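/- Conventions. A partition is a weakly decreasing sequence $\lambda=(\lambda_1\ge\lambda_2\ge\cdots)$ of nonnegative integers, finitely many nonzero, with $|\lambda|=\sum_j\lambda_j$; sums are component-wise, $r^m$ is the partition with $m$ parts equal to $r$, and $(r^m,\kappa)$ consists of $m$ rows $r$ followed by the rows of $\kappa$; $\square=(1)$. A partition for $\mathrm{Gr}(k,n)$ has $\lambda_1\le n-k$ and $\lambda_{k+1}=0$. A Schubert problem in $\mathrm{Gr}(k,n)$ is a list $\boldsymbol\lambda=(\lambda^1,\dots,\lambda^s)$ of partitions for $\mathrm{Gr}(k,n)$ (zero partitions are allowed) with $\sum_i|\lambda^i|=k(n-k)$. An instance of it in an $n$-dimensional complex vector space is a tuple $\mathcal F=(F^1_\bullet,\dots,F^s_\bullet)$ of complete flags, and its solution set $\Omega_{\boldsymbol\lambda}\mathcal F$ is the set of $k$-dimensional subspaces $H$ with $\dim(H\cap F^i_{n-k+j-\lambda^i_j})\ge j$ for all $i$ and $1\le j\le k$. A statement holds for general instances if it holds on a nonempty (hence dense) Zariski open subset of the product of the flag varieties. Let $\boldsymbol\lambda,\boldsymbol\mu,\boldsymbol\nu$ be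 Schubert problems in $\mathrm{Gr}(k+a,n+b)$, $\mathrm{Gr}(k,n)$, $\mathrm{Gr}(a,b)$. Then $\boldsymbol\lambda$ is fibered over $\boldsymbol\mu$ with fiber $\boldsymbol\nu$ if there are a nonempty Zariski open set $U$ of instances of $\boldsymbol\lambda$ in $\mathbb C^{n+b}$ and a construction that assigns to each $\mathcal F\in U$ an $n$-dimensional subspace $V\subset\mathbb C^{n+b}$, an instance $\mathcal E$ of $\boldsymbol\mu$ in $\mathrm{Gr}(k,V)$, and for each $h\in\Omega_{\boldsymbol\mu}\mathcal E$ an instance $\mathcal G(h)$ of $\boldsymbol\nu$ in $\mathrm{Gr}(a,\mathbb C^{n+b}/V)$, such that 1. $H\cap V\in\Omega_{\boldsymbol\mu}\mathcal E$ for every $H\in\Omega_{\boldsymbol\lambda}\mathcal F$; 2. if $H\in\Omega_{\boldsymbol\lambda}\mathcal F$ and $h=H\cap V$, then $H/h$, regarded as a subspace of $\mathbb C^{n+b}/V$, lies in $\Omega_{\boldsymbol\nu}\mathcal G(h)$; 3. $H\mapsto(H\cap V,\,H/(H\cap V))$ is a bijection from $\Omega_{\boldsymbol\lambda}\mathcal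 F$ to $\{(h,K): h\in\Omega_{\boldsymbol\mu}\mathcal E,\ K\in\Omega_{\boldsymbol\nu}\mathcal G(h)\}$; 4. for every given $n$-dimensional subspace $V$, all general instances $\mathcal E$ of $\boldsymbol\mu$ in $\mathrm{Gr}(k,V)$ arise in this way from some $\mathcal F\in U$; and for general $\mathcal E$ and every $h\in\Omega_{\boldsymbol\mu}\mathcal E$, all general instances of $\boldsymbol\nu$ in $\mathrm{Gr}(a,\mathbb C^{n+b}/V)$ arise as $\mathcal G(h)$ from some $\mathcal F\in U$ that induces $V$ and $\mathcal E$. Theorem. Let $a,b$ be integers with $a\ge1$ and $b\ge a+2$, let $s\ge4$, let $\kappa,\rho,\sigma$ be partitions with at most $a-1$ nonzero parts, and suppose that $$\boldsymbol\nu=\bigl((b-a-1,\kappa),\,(b-a-2,\rho),\,2^{a-1}+\sigma,\,\nu^4,\nu^5,\dots,\nu^s\bigr)$$ is a Schubert problem in $\mathrm{Gr}(a,b)$. Then $$\boldsymbol\lambda=\bigl(((b-a-1)^2,\kappa),\,((b-a-1)^2,\rho),\,(3^a,2)+\sigma,\,1^{a+1}+\nu^4,\,\nu^5,\dots,\nu^s\bigr)$$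 is a Schubert problem in $\mathrm{Gr}(2+a,4+b)$, and it is fibered over the Schubert problem $\square^4=(\square,\square,\square,\square)$ in $\mathrm{Gr}(2,4)$ with fiber $\boldsymbol\nu$. -/

import Mathlib

noncomputable section

namespace SchubertFib

open Module

/-! ### Partitions

A partition is a sequence `p : ℕ → ℕ`; the entry `p i` is the part with (one-based) number `i + 1`. -/

/-- `p` is a partition with at most `m` nonzero parts. -/
def IsPartition (m : ℕ) (p : ℕ → ℕ) : Prop :=
  Antitone p ∧ p m = 0

/-- `p` is a partition for `Gr(k, n)`: at most `k` nonzero parts, each at most `n - k`. -/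
def IsPartitionFor (k n : ℕ) (p : ℕ → ℕ) : Prop :=
  IsPartition k p ∧ p 0 ≤ n - k

/-- The partition `r^m` with `m` parts equal to `r`. The component-wise sum of partitions is the
sum of functions. -/
def rect (r m : ℕ) : ℕ → ℕ := fun i => if i < m then r else 0

/-- The partition `(r^m, p)`: `m` rows of length `r` followed by the rows of `p`. -/
def rowsThen (r m : ℕ) (p : ℕ → ℕ) : ℕ → ℕ := fun i => if i < m then r else p (i - m)

/-- The partition `□ = (1)`. -/
def box : ℕ → ℕ := rect 1 1

/-- A Schubert problem in `Gr(k, n)`: a family of partitions for `Gr(k, n)` whose sizes add up to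
`k (n - k)`. -/
def IsSchubertProblem {ι : Type} [Fintype ι] (k n : ℕ) (lam : ι → ℕ → ℕ) : Prop :=
  (∀ i, IsPartitionFor k n (lam i)) ∧
    ∑ i, ∑ j ∈ Finset.range k, lam i j = k * (n - k)

/-! ### Flags and Schubert varieties -/

/-- A complete flag in `X`. Only the subspaces `sub j` with `j ≤ dim X` carry information: by
monotonicity `sub j = X` for `j ≥ dim X`. -/
@[ext]
structure CompleteFlag (X : Type) [AddCommGroup X] [Module ℂ X] where
  sub : ℕ → Submodule ℂ X
  mono : Monotone sub
  finrank_sub : ∀ j, j ≤ finrank ℂ X → finrank ℂ (sub j) = j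

section

variable {X : Type} [AddCommGroup X] [Module ℂ X]

/-- The complete flag spanned by the initial segments of an ordered basis. -/
def CompleteFlag.ofBasis (B : Basis (Fin (finrank ℂ X)) ℂ X) : CompleteFlag X where
  sub j := Submodule.span ℂ (B '' {i | (i : ℕ) < j})
  mono := fun _ _ h => Submodule.span_mono (Set.image_mono fun _ hi => lt_of_lt_of_le hi h)
  finrank_sub j hj := by
    have hli : LinearIndependent ℂ (fun i : {i : Fin (finrank ℂ X) // (i : ℕ) < j} => B i) :=
      B.linearIndependent.comp _ Subtype.val_injective
    have h := finrank_span_eq_card hli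
    have hr : Set.range (fun i : {i : Fin (finrank ℂ X) // (i : ℕ) < j} => B i)
        = B '' {i | (i : ℕ) < j} := by
      rw [Set.image_eq_range]; rfl
    rw [hr] at h
    rw [h, Fintype.card_subtype]
    have := Fin.card_filter_val_lt (n := finrank ℂ X) (m := j)
    rw [this]
    exact min_eq_right hj

/-- The Schubert variety `Ω_p F` in `Gr(k, X)`, with `n = dim X`: the `k`-planes `H` with
`dim (H ∩ F_{n - k + j - p_j}) ≥ j` for `j = 1, …, k`. -/
def SchubertVariety (k : ℕ) (p : ℕ → ℕ) (F : CompleteFlag X) : Set (Submodule ℂ X) :=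
  {H | finrank ℂ H = k ∧
    ∀ j < k, j + 1 ≤ finrank ℂ ↥(H ⊓ F.sub (finrank ℂ X - k + (j + 1) - p j))}

/-- The solutions of the instance of the Schubert problem `lam` in `Gr(k, X)` given by the
flags `F`. -/
def Solutions {ι : Type} (k : ℕ) (lam : ι → ℕ → ℕ) (F : ι → CompleteFlag X) :
    Set (Submodule ℂ X) :=
  {H | finrank ℂ H = k ∧ ∀ i, H ∈ SchubertVariety k (lam i) (F i)}

/-- Zariski open subsets of the product over `ι` of copies of the flag variety of `X`. The flag
variety carries the quotient topology from the variety of ordered bases of `X`, which is open in an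
affine space of square matrices (the coordinates with respect to a reference basis `e`). So a set
of tuples of flags is open iff the tuples of ordered bases which define its members form the locus
where not all polynomials of some set `S` vanish. -/
def IsZariskiOpen {ι : Type} (U : Set (ι → CompleteFlag X)) : Prop :=
  ∃ (e : Basis (Fin (finrank ℂ X)) ℂ X)
    (S : Set (MvPolynomial (ι × Fin (finrank ℂ X) × Fin (finrank ℂ X)) ℂ)),
    ∀ B : ι → Basis (Fin (finrank ℂ X)) ℂ X,
      (fun i => CompleteFlag.ofBasis (B i)) ∈ U ↔
        ∃ p ∈ S, MvPolynomial.eval (fun t => e.repr (B t.1 t.2.1) t.2.2) p ≠ 0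

/-- `P` holds for general tuples of flags: on a nonempty Zariski open set. (The product of flag
varieties is irreducible, so that nonempty open sets are dense.) -/
def ForGeneral {ι : Type} (P : (ι → CompleteFlag X) → Prop) : Prop :=
  ∃ U : Set (ι → CompleteFlag X), IsZariskiOpen U ∧ U.Nonempty ∧ ∀ F ∈ U, P F

end

/-! ### Fibrations of Schubert problems -/

/-- What a fibration assigns to a tuple of flags in `X`: a subspace `V`, flags `E` in `V`, and for
each subspace `h` of `V` (only the solutions `h` of the instance `E` matter) flags `G h` in
`X / V`. -/
structure FiberData (X : Type) [AddCommGroup X] [Module ℂ X] (κ τ : Type) where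
  V : Submodule ℂ X
  E : κ → CompleteFlag V
  G : Submodule ℂ V → τ → CompleteFlag (X ⧸ V)

/-- `H ∩ V`, as a subspace of `V`. -/
def inter {X : Type} [AddCommGroup X] [Module ℂ X] (V H : Submodule ℂ X) : Submodule ℂ V :=
  H.comap V.subtype

/-- `H / (H ∩ V)`, as a subspace of `X / V`: the image of `H`. -/
def quot {X : Type} [AddCommGroup X] [Module ℂ X] (V H : Submodule ℂ X) : Submodule ℂ (X ⧸ V) :=
  H.map V.mkQ

/-- `lam` is fibered over `mu` with fiber `nu`, where `lam`, `mu`, `nu` are Schubert problems in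
`Gr(k + a, n + b)`, `Gr(k, n)`, `Gr(a, b)`. Here `U` is the set of general instances of `lam`, and
`D` is the construction of `V`, `E`, `G` from a general instance. -/
def IsFiberedOver {ι κ τ : Type} [Fintype ι] [Fintype κ] [Fintype τ] (k n a b : ℕ)
    (lam : ι → ℕ → ℕ) (mu : κ → ℕ → ℕ) (nu : τ → ℕ → ℕ) : Prop :=
  IsSchubertProblem (k + a) (n + b) lam ∧ IsSchubertProblem k n mu ∧ IsSchubertProblem a b nu ∧
  ∃ (U : Set (ι → CompleteFlag (Fin (n + b) → ℂ)))
    (D : (ι → CompleteFlag (Fin (n + b) → ℂ)) → FiberData (Fin (n + b) → ℂ) κ τ),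
    IsZariskiOpen U ∧ U.Nonempty ∧
    (∀ F ∈ U,
      -- the instance of `mu` in `Gr(k, V)`
      finrank ℂ (D F).V = n ∧
      (∀ H ∈ Solutions (k + a) lam F, inter (D F).V H ∈ Solutions k mu (D F).E) ∧
      -- the instances of `nu` in `Gr(a, ℂ^(n+b) / V)`
      (∀ h ∈ Solutions k mu (D F).E, ∀ H ∈ Solutions (k + a) lam F, inter (D F).V H = h →
        quot (D F).V H ∈ Solutions a nu ((D F).G h)) ∧
      -- the bijection
      Set.BijOn (fun H => (inter (D F).V H, quot (D F).V H)) (Solutions (k + a) lam F)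
        {q | q.1 ∈ Solutions k mu (D F).E ∧ q.2 ∈ Solutions a nu ((D F).G q.1)}) ∧
    (∀ V : Submodule ℂ (Fin (n + b) → ℂ), finrank ℂ V = n →
      -- all general instances of `mu` in `Gr(k, V)` arise
      ForGeneral (fun E : κ → CompleteFlag V => ∃ F ∈ U, ∃ G, D F = ⟨V, E, G⟩) ∧
      -- for general `E` and every solution `h`, all general instances of `nu` arise
      ForGeneral (fun E : κ → CompleteFlag V => ∀ h ∈ Solutions k mu E,
        ForGeneral (fun G' : τ → CompleteFlag ((Fin (n + b) → ℂ) ⧸ V) =>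
          ∃ F ∈ U, ∃ G, D F = ⟨V, E, G⟩ ∧ G h = G')))

end SchubertFib

end

/-! Put q = b - 1, so that X has dimension 5 + q, and let F¹, F², F³, F⁴ be the first four flags.
The corners of the partitions say that a solution H, of dimension a + 2, has dim(H ∩ F¹_5) ≥ 2,
dim(H ∩ F²_5) ≥ 2, dim(H ∩ F³_q) ≥ a, dim(H ∩ F³_{q+2}) ≥ a + 1 and dim(H ∩ F⁴_{q+3}) ≥ a + 1. Let V
be the sum of F¹_5 ∩ F³_{q+2} and F²_5 ∩ F³_{q+2}; it has dimension 4. Dimension counts inside H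
show that h = H ∩ V is a plane which meets the four planes cut out on V by F¹_5, F²_5, F³_q,
F⁴_{q+3} (`QuadFacts.inter_mem`). This is the classical problem of the common transversals of four
lines in space.

Given h, the hyperplane T = F⁴_{q+3} + h contains H. As H is the direct sum of H ∩ F¹_5 and H ∩
F³_q, and likewise with F², it lies in the intersection C of F¹_5 ∩ T + F³_q ∩ T with F²_5 ∩ T +
F³_q ∩ T (`QuadFacts.le_instC`). Here C has codimension 3, C ∩ V = h, and the image of C in X / V is
a hyperplane. From h ≤ H ≤ C one gets dim(H ∩ F_n) = dim(K ∩ image of C ∩ F_n) + dim(h ∩ F_n) for K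
= H / h, so the conditions on H are conditions on K (`TransFacts.mem_solutions_iff`). Except for F³,
the images of the C ∩ F_n are completed to a flag of X / V by inserting the line F_1, which is not
in C + V; F³ supplies the remaining members itself. The moment of insertion is a choice: after step
5 for F¹, at once for the others, and this is why the equal parts b - a - 1 of the first two
partitions give b - a - 1 and b - a - 2 in the fiber. Conversely the fiber conditions force K into
the image of C (`TransFacts.le_map_C`), and H is recovered as the part of C over K.

For the open set, V is parametrised by two copies of ℂ², and the transversals become eigenvectors of
a 2 × 2 matrix depending polynomially on bases of the flags. The genericity needed at each
transversal is the nonvanishing of a polynomial in an eigenvalue; its norm is a polynomial in the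
bases alone (`exists_norm`), so the conditions at all eigenvalues define a Zariski open set.

That all general data arise is shown by a construction. Bases of V and lifted bases of X / V are
shuffled into bases of X, the lifts in the second and fourth flags being twisted by linear forms so
that C has the right image for both transversals. The instance lies in the open set
(`LiftData.rootCond`) and induces the prescribed data (`LiftData.exists_instData_eq`); in particular
the open set is not empty. -/

noncomputable section

namespace SchubertFib

open Module

/-! ### Zariski open sets of tuples of flags, given by polynomial functions of bases. -/

variable {X : Type} [AddCommGroup X] [Module ℂ X]

/-- The `k`-th vector of an ordered basis, and `0` for `k` out of range. -/
def bv (B : Basis (Fin (finrank ℂ X)) ℂ X) (k : ℕ) : X :=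
  if h : k < finrank ℂ X then B ⟨k, h⟩ else 0

theorem bv_of_lt (B : Basis (Fin (finrank ℂ X)) ℂ X) {k : ℕ} (h : k < finrank ℂ X) :
    bv B k = B ⟨k, h⟩ := dif_pos h

/-- The polynomial functions of a tuple of ordered bases. -/
def polyFun {ι : Type} (e : Basis (Fin (finrank ℂ X)) ℂ X) :
    Subalgebra ℂ ((ι → Basis (Fin (finrank ℂ X)) ℂ X) → ℂ) where
  carrier := {f | ∃ p : MvPolynomial (ι × Fin (finrank ℂ X) × Fin (finrank ℂ X)) ℂ,
    ∀ B, f B = MvPolynomial.eval (fun t => e.repr (B t.1 t.2.1) t.2.2) p}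
  mul_mem' := by
    rintro f g ⟨p, hp⟩ ⟨q, hq⟩
    exact ⟨p * q, fun B => by simp [hp, hq]⟩
  add_mem' := by
    rintro f g ⟨p, hp⟩ ⟨q, hq⟩
    exact ⟨p + q, fun B => by simp [hp, hq]⟩
  algebraMap_mem' r := ⟨MvPolynomial.C r, fun B => by simp⟩

theorem polyFun_coord {ι : Type} (e : Basis (Fin (finrank ℂ X)) ℂ X) (i : ι)
    (k j : Fin (finrank ℂ X)) :
    (fun B : ι → Basis (Fin (finrank ℂ X)) ℂ X => e.repr (B i k) j) ∈ polyFun (ι := ι) e :=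
  ⟨MvPolynomial.X (i, k, j), fun B => by simp⟩

/-- Membership in the locus of tuples of bases where a polynomial function does not vanish. -/
def IsBasicOpen {ι : Type} (e : Basis (Fin (finrank ℂ X)) ℂ X)
    (W : Set (ι → Basis (Fin (finrank ℂ X)) ℂ X)) : Prop :=
  ∃ f ∈ polyFun (ι := ι) e, ∀ B, B ∈ W ↔ f B ≠ 0

theorem IsBasicOpen.of_mem {ι : Type} {e : Basis (Fin (finrank ℂ X)) ℂ X}
    {f : (ι → Basis (Fin (finrank ℂ X)) ℂ X) → ℂ} (hf : f ∈ polyFun (ι := ι) e) :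
    IsBasicOpen e {B | f B ≠ 0} := ⟨f, hf, fun _ => Iff.rfl⟩

theorem IsBasicOpen.inter {ι : Type} {e : Basis (Fin (finrank ℂ X)) ℂ X}
    {W W' : Set (ι → Basis (Fin (finrank ℂ X)) ℂ X)}
    (h : IsBasicOpen e W) (h' : IsBasicOpen e W') : IsBasicOpen e (W ∩ W') := by
  obtain ⟨f, hf, hW⟩ := h
  obtain ⟨g, hg, hW'⟩ := h'
  refine ⟨f * g, mul_mem hf hg, fun B => ?_⟩
  simp [hW, hW']

theorem IsBasicOpen.iInter {ι κ : Type} [Fintype κ] {e : Basis (Fin (finrank ℂ X)) ℂ X}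
    {W : κ → Set (ι → Basis (Fin (finrank ℂ X)) ℂ X)}
    (h : ∀ k, IsBasicOpen e (W k)) : IsBasicOpen e (⋂ k, W k) := by
  choose f hf hW using h
  refine ⟨∏ k, f k, prod_mem fun k _ => hf k, fun B => ?_⟩
  simp [hW, Finset.prod_ne_zero_iff]

theorem ofBasis_map_sub (B : Basis (Fin (finrank ℂ X)) ℂ X) (Φ : X ≃ₗ[ℂ] X) (j : ℕ) :
    (CompleteFlag.ofBasis (B.map Φ)).sub j =
      ((CompleteFlag.ofBasis B).sub j).map (Φ : X →ₗ[ℂ] X) := by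
  simp only [CompleteFlag.ofBasis, Submodule.map_span]
  congr 1
  ext v
  simp

/-- The flags of the tuples of bases in a basic open set form a Zariski open set. -/
theorem isZariskiOpen_image {ι : Type} {e : Basis (Fin (finrank ℂ X)) ℂ X}
    {W : Set (ι → Basis (Fin (finrank ℂ X)) ℂ X)} (hW : IsBasicOpen e W) :
    IsZariskiOpen {F : ι → CompleteFlag X | ∃ B ∈ W, F = fun i => CompleteFlag.ofBasis (B i)} := by
  obtain ⟨f, ⟨p, hp⟩, hf⟩ := hW
  -- The polynomial B ↦ p(B g), for a fixed tuple g of matrices.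
  let act (g : ι → Matrix (Fin (finrank ℂ X)) (Fin (finrank ℂ X)) ℂ) :
      MvPolynomial (ι × Fin (finrank ℂ X) × Fin (finrank ℂ X)) ℂ :=
    MvPolynomial.bind₁ (fun t => ∑ k, MvPolynomial.C (g t.1 k t.2.1) *
      MvPolynomial.X (t.1, k, t.2.2)) p
  have hact : ∀ g (B B' : ι → Basis (Fin (finrank ℂ X)) ℂ X),
      (∀ i j, B' i j = ∑ k, g i k j • B i k) →
      MvPolynomial.eval (fun t => e.repr (B t.1 t.2.1) t.2.2) (act g) = f B' := by
    intro g B B' h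
    rw [hp]
    simp only [act]
    rw [MvPolynomial.eval, MvPolynomial.eval₂Hom_bind₁]
    congr 2
    funext t
    simp [h, map_sum, Finsupp.finsetSum_apply]
  -- A flag tuple of the image can also come from bases outside W. The bases that define it form the
  -- union of the translates of W by matrices which preserve all flags (the triangular ones), so all
  -- these translates of p are used.
  refine ⟨e, {r | ∃ g, r = act g ∧ ∀ B : ι → Basis (Fin (finrank ℂ X)) ℂ X,
    ∃ B' : ι → Basis (Fin (finrank ℂ X)) ℂ X, (∀ i j, B' i j = ∑ k, g i k j • B i k) ∧
      ∀ i, CompleteFlag.ofBasis (B' i) = CompleteFlag.ofBasis (B i)}, fun B => ⟨?_, ?_⟩⟩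
  · rintro ⟨B', hB', hF⟩
    -- Take for g the matrix from B to B'. It preserves the flag of B; carrying B to B₂ by an
    -- automorphism shows that it preserves the flag of every B₂.
    refine ⟨_, ⟨fun i k j => (B i).repr (B' i j) k, rfl, fun B₂ => ?_⟩, ?_⟩
    · refine ⟨fun i => (B' i).map ((B i).equiv (B₂ i) (Equiv.refl _)), fun i j => ?_, fun i => ?_⟩
      · rw [Basis.map_apply]
        conv_lhs => rw [← (B i).sum_repr (B' i j), map_sum]
        simp
      · ext1
        funext j
        rw [ofBasis_map_sub, ← congrFun hF i, ← ofBasis_map_sub]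
        congr 2
        ext k
        simp
    · rw [hact _ B B' fun i j => ((B i).sum_repr (B' i j)).symm]
      exact (hf _).1 hB'
  · rintro ⟨_, ⟨g, rfl, hg⟩, hne⟩
    obtain ⟨B', hB', hF⟩ := hg B
    rw [hact g B B' hB'] at hne
    exact ⟨B', (hf _).2 hne, funext fun i => (hF i).symm⟩

/-! ### Vector-valued functions with coordinates in an algebra of functions -/

section coordinates

variable {Ω : Type} (e : Basis (Fin (finrank ℂ X)) ℂ X) (S : Subalgebra ℂ (Ω → ℂ))

/-- The function `u` has coordinates in `S`. -/
def HasCoordsIn (u : Ω → X) : Prop := ∀ j, (fun ω => e.repr (u ω) j) ∈ S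

variable {e S}

theorem HasCoordsIn.smul {f : Ω → ℂ} {v : Ω → X} (hf : f ∈ S) (hv : HasCoordsIn e S v) :
    HasCoordsIn e S (fun ω => f ω • v ω) := fun j => by
  have := mul_mem hf (hv j)
  simpa [Pi.mul_def] using this

theorem HasCoordsIn.sub {u v : Ω → X} (hu : HasCoordsIn e S u) (hv : HasCoordsIn e S v) :
    HasCoordsIn e S (fun ω => u ω - v ω) := fun j => by
  have := sub_mem (hu j) (hv j)
  simpa [Pi.sub_def] using this

theorem HasCoordsIn.zero : HasCoordsIn e S (fun _ => 0) := fun j => by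
  have := zero_mem S
  simpa [Pi.zero_def] using this

theorem HasCoordsIn.sum {κ : Type} (s : Finset κ) {u : κ → Ω → X}
    (hu : ∀ k ∈ s, HasCoordsIn e S (u k)) : HasCoordsIn e S (fun ω => ∑ k ∈ s, u k ω) := fun j => by
  have : (fun ω => e.repr (∑ k ∈ s, u k ω) j) = ∑ k ∈ s, fun ω => e.repr (u k ω) j := by
    funext ω
    simp [Finset.sum_apply, map_sum, Finsupp.finsetSum_apply]
  rw [this]
  exact sum_mem fun k hk => hu k hk j

theorem det_mem {m : ℕ} {M : Fin m → Fin m → Ω → ℂ} (hM : ∀ i j, M i j ∈ S) :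
    (fun ω => Matrix.det (Matrix.of fun i j => M i j ω)) ∈ S := by
  have : (fun ω => Matrix.det (Matrix.of fun i j => M i j ω)) =
      ∑ σ : Equiv.Perm (Fin m), ((Equiv.Perm.sign σ : ℤ) : ℂ) • ∏ i, M (σ i) i := by
    funext ω
    simp [Matrix.det_apply', Finset.sum_apply, Finset.prod_apply]
  rw [this]
  exact sum_mem fun σ _ => S.smul_mem (prod_mem fun i _ => hM _ _) _

theorem HasCoordsIn.det {v : Fin (finrank ℂ X) → Ω → X} (hv : ∀ k, HasCoordsIn e S (v k)) :
    (fun ω => e.det fun k => v k ω) ∈ S := by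
  have : (fun ω => e.det fun k => v k ω) =
      fun ω => Matrix.det (Matrix.of fun i j => e.repr (v j ω) i) := by
    funext ω
    rw [Basis.det_apply]
    congr 1
  rw [this]
  exact det_mem fun i j => hv j i

theorem HasCoordsIn.det_update {v : Fin (finrank ℂ X) → Ω → X} {u : Ω → X}
    (hv : ∀ k, HasCoordsIn e S (v k)) (hu : HasCoordsIn e S u) (j : Fin (finrank ℂ X)) :
    (fun ω => e.det (Function.update (fun k => v k ω) j (u ω))) ∈ S := by
  have : (fun ω => e.det (Function.update (fun k => v k ω) j (u ω))) =
      fun ω => e.det fun k => Function.update v j u k ω := by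
    funext ω
    congr 1
    funext k
    by_cases h : k = j
    · subst h; simp
    · simp [h]
  rw [this]
  refine HasCoordsIn.det fun k => ?_
  by_cases h : k = j
  · subst h; simpa using hu
  · simpa [h] using hv k

end coordinates

end SchubertFib

end

noncomputable section

namespace SchubertFib

open Module

/-! ### Functions of a root of a quadratic polynomial with coefficients in an algebra -/

section quadratic

variable {Ω : Type} (S : Subalgebra ℂ (Ω → ℂ)) {t d : Ω → ℂ}

/-- The functions of `ω` and of a root `β` of `β ^ 2 - t ω * β + d ω` which are linear in `β`
with coefficients in `S`. -/
def rootFun (ht : t ∈ S) (hd : d ∈ S) :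
    Subalgebra ℂ ({z : Ω × ℂ // z.2 ^ 2 = t z.1 * z.2 - d z.1} → ℂ) where
  carrier := {f | ∃ c₀ ∈ S, ∃ c₁ ∈ S, ∀ z, f z = c₀ z.1.1 + c₁ z.1.1 * z.1.2}
  mul_mem' := by
    rintro f g ⟨a, ha, b, hb, h⟩ ⟨a', ha', b', hb', h'⟩
    -- The square of the root is reduced by means of its equation.
    refine ⟨a * a' - b * b' * d, sub_mem (mul_mem ha ha') (mul_mem (mul_mem hb hb') hd),
      a * b' + b * a' + b * b' * t, add_mem (add_mem (mul_mem ha hb') (mul_mem hb ha'))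
        (mul_mem (mul_mem hb hb') ht), fun z => ?_⟩
    simp only [Pi.mul_apply, h, h', Pi.sub_apply, Pi.add_apply]
    linear_combination (b z.1.1 * b' z.1.1) * z.2
  add_mem' := by
    rintro f g ⟨a, ha, b, hb, h⟩ ⟨a', ha', b', hb', h'⟩
    refine ⟨a + a', add_mem ha ha', b + b', add_mem hb hb', fun z => ?_⟩
    simp only [h, h', Pi.add_apply]
    ring
  algebraMap_mem' r := ⟨algebraMap ℂ _ r, S.algebraMap_mem r, 0, zero_mem S, fun z => by simp⟩

variable {S}

theorem comp_mem_rootFun (ht : t ∈ S) (hd : d ∈ S) {f : Ω → ℂ} (hf : f ∈ S) :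
    (fun z => f z.1.1) ∈ rootFun S ht hd :=
  ⟨f, hf, 0, zero_mem S, fun z => by simp⟩

theorem root_mem_rootFun (ht : t ∈ S) (hd : d ∈ S) : (fun z => z.1.2) ∈ rootFun S ht hd :=
  ⟨0, zero_mem S, 1, one_mem S, fun z => by simp⟩

/-- The norm of a function of a root is in `S`, and it vanishes iff the function vanishes at one of
the roots. -/
theorem exists_norm (ht : t ∈ S) (hd : d ∈ S)
    {f : {z : Ω × ℂ // z.2 ^ 2 = t z.1 * z.2 - d z.1} → ℂ} (hf : f ∈ rootFun S ht hd) :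
    ∃ g ∈ S, ∀ ω, g ω ≠ 0 ↔ ∀ β (h : β ^ 2 = t ω * β - d ω), f ⟨(ω, β), h⟩ ≠ 0 := by
  obtain ⟨c₀, h₀, c₁, h₁, hf⟩ := hf
  -- This is (c₀ + c₁ β)(c₀ + c₁ (t - β)), as the two roots have sum t and product d.
  refine ⟨c₀ * c₀ + c₀ * c₁ * t + c₁ * c₁ * d, add_mem (add_mem (mul_mem h₀ h₀)
    (mul_mem (mul_mem h₀ h₁) ht)) (mul_mem (mul_mem h₁ h₁) hd), fun ω => ⟨?_, fun h => ?_⟩⟩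
  · intro hg β hβ h0
    rw [hf] at h0
    apply hg
    simp only [Pi.mul_apply, Pi.add_apply] at h0 ⊢
    linear_combination (c₀ ω + c₁ ω * (t ω - β)) * h0 + c₁ ω * c₁ ω * hβ
  · obtain ⟨β, hβ⟩ : ∃ β : ℂ, β ^ 2 = t ω * β - d ω := by
      obtain ⟨s, hs⟩ := IsAlgClosed.exists_pow_nat_eq (t ω ^ 2 - 4 * d ω) (n := 2) (by norm_num)
      exact ⟨(t ω + s) / 2, by linear_combination hs / 4⟩
    -- The conjugate root, possibly equal to β.
    have hβ' : (t ω - β) ^ 2 = t ω * (t ω - β) - d ω := by linear_combination hβ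
    have e₁ := h β hβ
    have e₂ := h (t ω - β) hβ'
    rw [hf] at e₁ e₂
    have := mul_ne_zero e₁ e₂
    simp only [Pi.mul_apply, Pi.add_apply] at this ⊢
    convert this using 1
    linear_combination (c₁ ω * c₁ ω) * hβ

end quadratic

end SchubertFib

end

noncomputable section

namespace SchubertFib

open Module

/-! ### Four subspaces and their transversals -/

/-- The determinant of two vectors of `ℂ²`. -/
def det₂ (r : Fin 2 → ℂ) : (Fin 2 → ℂ) →ₗ[ℂ] ℂ :=
  r 0 • LinearMap.proj 1 - r 1 • LinearMap.proj 0

theorem det₂_apply (r s : Fin 2 → ℂ) : det₂ r s = r 0 * s 1 - r 1 * s 0 := by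
  simp [det₂]

theorem det₂_eq_zero_iff {r : Fin 2 → ℂ} (hr : r ≠ 0) (s : Fin 2 → ℂ) :
    det₂ r s = 0 ↔ ∃ c : ℂ, s = c • r := by
  rw [det₂_apply]
  constructor
  · intro h
    by_cases h0 : r 0 = 0
    · have h1 : r 1 ≠ 0 := fun h1 => hr (by ext i; fin_cases i <;> simp [h0, h1])
      have hs : s 0 = 0 := by
        rw [h0] at h
        have : r 1 * s 0 = 0 := by linear_combination -h
        exact (mul_eq_zero.1 this).resolve_left h1
      refine ⟨s 1 / r 1, ?_⟩
      ext i
      fin_cases i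
      · simp [h0, hs]
      · simp [h1]
    · refine ⟨s 0 / r 0, ?_⟩
      ext i
      fin_cases i
      · simp [h0]
      · simp only [Pi.smul_apply, smul_eq_mul, Fin.mk_one]
        field_simp
        linear_combination h
  · rintro ⟨c, rfl⟩
    simp only [Pi.smul_apply, smul_eq_mul]
    ring

/-- Subspaces `F₁`, `F₂` complementary to `F₃`, with (multiples of) the projections along `F₃`,
a subspace `F₄` of codimension two, the kernel of `ξ`, and a plane `g` complementary to `F₃` in a
larger subspace, in general position. -/
structure Pencil (Y : Type) [AddCommGroup Y] [Module ℂ Y] where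
  F₁ : Submodule ℂ Y
  F₂ : Submodule ℂ Y
  F₃ : Submodule ℂ Y
  F₄ : Submodule ℂ Y
  g : (Fin 2 → ℂ) →ₗ[ℂ] Y
  π₁ : Y →ₗ[ℂ] Y
  π₂ : Y →ₗ[ℂ] Y
  ξ : Y →ₗ[ℂ] (Fin 2 → ℂ)
  δ : ℂ
  δ_ne : δ ≠ 0
  π₁_mem : ∀ u, π₁ u ∈ F₁
  π₂_mem : ∀ u, π₂ u ∈ F₂
  sub_π₁_mem : ∀ u, δ • u - π₁ u ∈ F₃
  sub_π₂_mem : ∀ u, δ • u - π₂ u ∈ F₃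
  disj₁ : F₁ ⊓ F₃ = ⊥
  disj₂ : F₂ ⊓ F₃ = ⊥
  ξ_eq_zero : ∀ u, ξ u = 0 ↔ u ∈ F₄
  g_mem : ∀ a, g a ∈ F₃ → a = 0
  P_inj : ∀ a, ξ (π₁ (g a)) = 0 → a = 0
  Q_inj : ∀ a, ξ (π₂ (g a)) = 0 → a = 0
  PQ_inj : ∀ a, ξ (π₁ (g a)) = ξ (π₂ (g a)) → a = 0

namespace Pencil

variable {Y : Type} [AddCommGroup Y] [Module ℂ Y] (L : Pencil Y)

/-- Coordinates on `V`: every vector is x a + y b for unique a and b. The four planes become b = 0,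
a = 0, a + b = 0 and P a + Q b = 0, so the common transversals are governed by the matrix pencil of
P and Q. -/
def x : (Fin 2 → ℂ) →ₗ[ℂ] Y := L.π₁ ∘ₗ L.g
def y : (Fin 2 → ℂ) →ₗ[ℂ] Y := L.π₂ ∘ₗ L.g
def P : (Fin 2 → ℂ) →ₗ[ℂ] (Fin 2 → ℂ) := L.ξ ∘ₗ L.x
def Q : (Fin 2 → ℂ) →ₗ[ℂ] (Fin 2 → ℂ) := L.ξ ∘ₗ L.y
/-- The subspace `F₃` together with the plane `g`. -/
def F₃' : Submodule ℂ Y := L.F₃ ⊔ LinearMap.range L.g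
/-- The four-dimensional subspace. -/
def V : Submodule ℂ Y := (L.F₁ ⊓ L.F₃') ⊔ (L.F₂ ⊓ L.F₃')

theorem x_mem (a) : L.x a ∈ L.F₁ := L.π₁_mem _
theorem y_mem (a) : L.y a ∈ L.F₂ := L.π₂_mem _

theorem ξ_x (a) : L.ξ (L.x a) = L.P a := rfl
theorem ξ_y (a) : L.ξ (L.y a) = L.Q a := rfl

theorem P_eq_zero {a} (h : L.P a = 0) : a = 0 := L.P_inj a h
theorem Q_eq_zero {a} (h : L.Q a = 0) : a = 0 := L.Q_inj a h
theorem P_eq_Q {a} (h : L.P a = L.Q a) : a = 0 := L.PQ_inj a h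

theorem P_surj : Function.Surjective L.P :=
  LinearMap.injective_iff_surjective.1 ((injective_iff_map_eq_zero _).2 fun _ => L.P_eq_zero)

theorem PQ_surj : Function.Surjective (L.P - L.Q) :=
  LinearMap.injective_iff_surjective.1 ((injective_iff_map_eq_zero _).2 fun _ h =>
    L.P_eq_Q (sub_eq_zero.1 h))

theorem π₁_of_mem {u} (hu : u ∈ L.F₁) : L.π₁ u = L.δ • u := by
  have : L.δ • u - L.π₁ u ∈ L.F₁ ⊓ L.F₃ :=
    ⟨sub_mem (L.F₁.smul_mem _ hu) (L.π₁_mem u), L.sub_π₁_mem u⟩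
  rw [L.disj₁, Submodule.mem_bot, sub_eq_zero] at this
  exact this.symm

theorem π₂_of_mem {u} (hu : u ∈ L.F₂) : L.π₂ u = L.δ • u := by
  have : L.δ • u - L.π₂ u ∈ L.F₂ ⊓ L.F₃ :=
    ⟨sub_mem (L.F₂.smul_mem _ hu) (L.π₂_mem u), L.sub_π₂_mem u⟩
  rw [L.disj₂, Submodule.mem_bot, sub_eq_zero] at this
  exact this.symm

theorem π₁_of_mem₃ {u} (hu : u ∈ L.F₃) : L.π₁ u = 0 := by
  have : L.π₁ u ∈ L.F₁ ⊓ L.F₃ := by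
    refine ⟨L.π₁_mem u, ?_⟩
    have := sub_mem (L.F₃.smul_mem L.δ hu) (L.sub_π₁_mem u)
    simpa using this
  simpa [L.disj₁] using this

theorem π₂_of_mem₃ {u} (hu : u ∈ L.F₃) : L.π₂ u = 0 := by
  have : L.π₂ u ∈ L.F₂ ⊓ L.F₃ := by
    refine ⟨L.π₂_mem u, ?_⟩
    have := sub_mem (L.F₃.smul_mem L.δ hu) (L.sub_π₂_mem u)
    simpa using this
  simpa [L.disj₂] using this

theorem π₁_x (a) : L.π₁ (L.x a) = L.δ • L.x a := L.π₁_of_mem (L.x_mem a)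
theorem π₂_y (a) : L.π₂ (L.y a) = L.δ • L.y a := L.π₂_of_mem (L.y_mem a)

/-- Modulo `F₃` both x a and y a agree with δ g a, and π₁ kills `F₃`. -/
theorem π₁_y (a) : L.π₁ (L.y a) = L.δ • L.x a := by
  have := L.π₁_of_mem₃ (L.sub_π₂_mem (L.g a))
  rw [map_sub, map_smul, sub_eq_zero] at this
  exact this.symm

theorem π₂_x (a) : L.π₂ (L.x a) = L.δ • L.y a := by
  have := L.π₂_of_mem₃ (L.sub_π₁_mem (L.g a))
  rw [map_sub, map_smul, sub_eq_zero] at this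
  exact this.symm

theorem x_mem₃' (a) : L.x a ∈ L.F₃' := by
  have h : L.x a = L.δ • L.g a - (L.δ • L.g a - L.x a) := by abel
  rw [h]
  exact sub_mem (Submodule.mem_sup_right (Submodule.smul_mem _ _ ⟨a, rfl⟩))
    (Submodule.mem_sup_left (L.sub_π₁_mem _))

theorem y_mem₃' (a) : L.y a ∈ L.F₃' := by
  have h : L.y a = L.δ • L.g a - (L.δ • L.g a - L.y a) := by abel
  rw [h]
  exact sub_mem (Submodule.mem_sup_right (Submodule.smul_mem _ _ ⟨a, rfl⟩))
    (Submodule.mem_sup_left (L.sub_π₂_mem _))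

theorem mem₁ (u : Y) : u ∈ L.F₁ ⊓ L.F₃' ↔ ∃ a, u = L.x a := by
  constructor
  · rintro ⟨h₁, h₃⟩
    obtain ⟨f, hf, _, ⟨a, rfl⟩, rfl⟩ := Submodule.mem_sup.1 h₃
    have h := L.π₁_of_mem h₁
    rw [map_add, L.π₁_of_mem₃ hf, zero_add] at h
    refine ⟨L.δ⁻¹ • a, ?_⟩
    rw [map_smul, x, LinearMap.comp_apply, h, inv_smul_smul₀ L.δ_ne]
  · rintro ⟨a, rfl⟩
    exact ⟨L.x_mem a, L.x_mem₃' a⟩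

theorem mem₂ (u : Y) : u ∈ L.F₂ ⊓ L.F₃' ↔ ∃ a, u = L.y a := by
  constructor
  · rintro ⟨h₁, h₃⟩
    obtain ⟨f, hf, _, ⟨a, rfl⟩, rfl⟩ := Submodule.mem_sup.1 h₃
    have h := L.π₂_of_mem h₁
    rw [map_add, L.π₂_of_mem₃ hf, zero_add] at h
    refine ⟨L.δ⁻¹ • a, ?_⟩
    rw [map_smul, y, LinearMap.comp_apply, h, inv_smul_smul₀ L.δ_ne]
  · rintro ⟨a, rfl⟩
    exact ⟨L.y_mem a, L.y_mem₃' a⟩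

theorem V_eq : L.V = LinearMap.range (L.x.coprod L.y) := by
  ext u
  rw [V, Submodule.mem_sup]
  constructor
  · rintro ⟨v, hv, w, hw, rfl⟩
    obtain ⟨a, rfl⟩ := (L.mem₁ v).1 hv
    obtain ⟨b, rfl⟩ := (L.mem₂ w).1 hw
    exact ⟨(a, b), by simp⟩
  · rintro ⟨⟨a, b⟩, rfl⟩
    exact ⟨L.x a, (L.mem₁ _).2 ⟨a, rfl⟩, L.y b, (L.mem₂ _).2 ⟨b, rfl⟩, by simp⟩

theorem mem_V (u : Y) : u ∈ L.V ↔ ∃ a b, u = L.x a + L.y b := by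
  rw [V_eq, LinearMap.mem_range, Prod.exists]
  simp [eq_comm]

theorem x_mem_V (a) : L.x a ∈ L.V := (L.mem_V _).2 ⟨a, 0, by simp⟩
theorem y_mem_V (a) : L.y a ∈ L.V := (L.mem_V _).2 ⟨0, a, by simp⟩

theorem x_sub_y_mem (a) : L.x a - L.y a ∈ L.F₃ := by
  have := sub_mem (L.sub_π₂_mem (L.g a)) (L.sub_π₁_mem (L.g a))
  simpa [x, y] using this

/-- Modulo `F₃` the vector is δ g (a + b), and the plane of g meets `F₃` only in zero. -/
theorem x_add_y_mem_iff {a b} : L.x a + L.y b ∈ L.F₃ ↔ a + b = 0 := by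
  constructor
  · intro h
    have h1 := add_mem h (add_mem (L.sub_π₁_mem (L.g a)) (L.sub_π₂_mem (L.g b)))
    have h2 : L.x a + L.y b + (L.δ • L.g a - L.π₁ (L.g a) + (L.δ • L.g b - L.π₂ (L.g b))) =
        L.δ • L.g (a + b) := by
      simp only [x, y, LinearMap.comp_apply, map_add, smul_add]
      abel
    rw [h2, Submodule.smul_mem_iff _ L.δ_ne] at h1
    exact L.g_mem _ h1
  · intro h
    rw [eq_neg_of_add_eq_zero_right h, map_neg, ← sub_eq_add_neg]
    exact L.x_sub_y_mem a

/-- Membership in `F₃` gives b = -a; applying ξ then gives P a = Q a, which is excluded for a ≠ 0.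
-/
theorem x_add_y_eq_zero {a b} (h : L.x a + L.y b = 0) : a = 0 ∧ b = 0 := by
  have h1 : a + b = 0 := L.x_add_y_mem_iff.1 (h ▸ zero_mem _)
  have h2 : b = -a := eq_neg_of_add_eq_zero_right h1
  subst h2
  have h3 := congrArg L.ξ h
  rw [map_neg, map_add, map_neg, map_zero, ← sub_eq_add_neg, sub_eq_zero] at h3
  have h4 := L.P_eq_Q h3
  simp [h4]

theorem x_eq_zero {a} (h : L.x a = 0) : a = 0 :=
  (L.x_add_y_eq_zero (a := a) (b := 0) (by simpa using h)).1

theorem y_eq_zero {a} (h : L.y a = 0) : a = 0 :=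
  (L.x_add_y_eq_zero (a := 0) (b := a) (by simpa using h)).2

theorem coprod_inj : Function.Injective (L.x.coprod L.y) := by
  rw [injective_iff_map_eq_zero]
  rintro ⟨a, b⟩ h
  obtain ⟨rfl, rfl⟩ := L.x_add_y_eq_zero (a := a) (b := b) (by simpa using h)
  rfl

theorem finrank_V : finrank ℂ L.V = 4 := by
  rw [V_eq, LinearMap.finrank_range_of_inj L.coprod_inj]
  simp

theorem V_inf₁ : L.V ⊓ L.F₁ = LinearMap.range L.x := by
  ext u
  constructor
  · rintro ⟨h, h₁⟩
    have h3 : u ∈ L.F₃' := by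
      obtain ⟨a, b, rfl⟩ := (L.mem_V u).1 h
      exact add_mem (L.x_mem₃' a) (L.y_mem₃' b)
    obtain ⟨a, rfl⟩ := (L.mem₁ u).1 ⟨h₁, h3⟩
    exact ⟨a, rfl⟩
  · rintro ⟨a, rfl⟩
    exact ⟨L.x_mem_V a, L.x_mem a⟩

theorem V_inf₂ : L.V ⊓ L.F₂ = LinearMap.range L.y := by
  ext u
  constructor
  · rintro ⟨h, h₁⟩
    have h3 : u ∈ L.F₃' := by
      obtain ⟨a, b, rfl⟩ := (L.mem_V u).1 h
      exact add_mem (L.x_mem₃' a) (L.y_mem₃' b)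
    obtain ⟨a, rfl⟩ := (L.mem₂ u).1 ⟨h₁, h3⟩
    exact ⟨a, rfl⟩
  · rintro ⟨a, rfl⟩
    exact ⟨L.y_mem_V a, L.y_mem a⟩

theorem V_inf₃ : L.V ⊓ L.F₃ = LinearMap.range (L.x - L.y) := by
  ext u
  constructor
  · rintro ⟨h, h₃⟩
    obtain ⟨a, b, rfl⟩ := (L.mem_V u).1 h
    have := eq_neg_of_add_eq_zero_right (L.x_add_y_mem_iff.1 h₃)
    subst this
    exact ⟨a, by simp [sub_eq_add_neg]⟩
  · rintro ⟨a, rfl⟩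
    exact ⟨sub_mem (L.x_mem_V a) (L.y_mem_V a), L.x_sub_y_mem a⟩

theorem finrank_V_inf₁ : finrank ℂ ↥(L.V ⊓ L.F₁) = 2 := by
  rw [V_inf₁, LinearMap.finrank_range_of_inj ((injective_iff_map_eq_zero _).2
    fun _ => L.x_eq_zero)]
  simp

theorem finrank_V_inf₂ : finrank ℂ ↥(L.V ⊓ L.F₂) = 2 := by
  rw [V_inf₂, LinearMap.finrank_range_of_inj ((injective_iff_map_eq_zero _).2
    fun _ => L.y_eq_zero)]
  simp

theorem finrank_V_inf₃ : finrank ℂ ↥(L.V ⊓ L.F₃) = 2 := by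
  rw [V_inf₃, LinearMap.finrank_range_of_inj ((injective_iff_map_eq_zero _).2 fun a h =>
    (L.x_add_y_eq_zero (a := a) (b := -a) (by simpa [sub_eq_add_neg] using h)).1)]
  simp

theorem V_inf₄ : L.V ⊓ L.F₄ =
    (LinearMap.ker (L.ξ ∘ₗ L.x.coprod L.y)).map (L.x.coprod L.y) := by
  ext u
  rw [V_eq]
  constructor
  · rintro ⟨⟨z, rfl⟩, h⟩
    exact ⟨z, (L.ξ_eq_zero _).2 h, rfl⟩
  · rintro ⟨z, hz, rfl⟩
    exact ⟨⟨z, rfl⟩, (L.ξ_eq_zero _).1 hz⟩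

/-- Rank-nullity: ξ maps `V` onto ℂ², already on the vectors x a, because P is surjective. -/
theorem finrank_V_inf₄ : finrank ℂ ↥(L.V ⊓ L.F₄) = 2 := by
  rw [V_inf₄, ← LinearEquiv.finrank_eq (Submodule.equivMapOfInjective _ L.coprod_inj _)]
  · have h := LinearMap.finrank_range_add_finrank_ker (L.ξ ∘ₗ L.x.coprod L.y)
    rw [LinearMap.range_eq_top.2] at h
    · simp at h
      omega
    · intro s
      obtain ⟨a, rfl⟩ := L.P_surj s
      exact ⟨(a, 0), by simp [ξ_x]⟩

theorem inf₃₄ : L.V ⊓ L.F₃ ⊓ L.F₄ = ⊥ := by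
  rw [V_inf₃, eq_bot_iff]
  rintro _ ⟨⟨a, rfl⟩, h⟩
  have h' := (L.ξ_eq_zero _).2 h
  rw [LinearMap.sub_apply, map_sub, sub_eq_zero] at h'
  simp [L.P_eq_Q h']

/-- The span of a vector of `F₁` and the corresponding vector of `F₂`. -/
def transversal (a : Fin 2 → ℂ) : Submodule ℂ Y := Submodule.span ℂ {L.x a, L.y a}

theorem mem_transversal {a : Fin 2 → ℂ} {u : Y} :
    u ∈ L.transversal a ↔ ∃ s t : ℂ, s • L.x a + t • L.y a = u :=
  Submodule.mem_span_pair

theorem transversal_le (a) : L.transversal a ≤ L.V := by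
  rw [transversal, Submodule.span_le]
  rintro _ (rfl | rfl)
  · exact L.x_mem_V a
  · exact L.y_mem_V a

theorem finrank_transversal {a} (ha : a ≠ 0) : finrank ℂ (L.transversal a) = 2 := by
  have hli : LinearIndependent ℂ ![L.x a, L.y a] := by
    rw [LinearIndependent.pair_iff]
    intro s t h
    rw [← map_smul, ← map_smul] at h
    obtain ⟨h1, h2⟩ := L.x_add_y_eq_zero h
    exact ⟨(smul_eq_zero.1 h1).resolve_right ha, (smul_eq_zero.1 h2).resolve_right ha⟩
  have := finrank_span_eq_card hli
  rw [Matrix.range_cons_cons_empty] at this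
  exact this.trans (by simp)

/-- The planes in `V` which meet all four subspaces. -/
theorem exists_eq_transversal [FiniteDimensional ℂ Y] {h : Submodule ℂ Y} (hV : h ≤ L.V)
    (hh : finrank ℂ h = 2)
    (h₁ : h ⊓ L.F₁ ≠ ⊥) (h₂ : h ⊓ L.F₂ ≠ ⊥) (h₃ : h ⊓ L.F₃ ≠ ⊥) (h₄ : h ⊓ L.F₄ ≠ ⊥) :
    ∃ (a : Fin 2 → ℂ) (α : ℂ), a ≠ 0 ∧ L.P a = α • L.Q a ∧ h = L.transversal a := by
  obtain ⟨u, ⟨huh, hu⟩, hu0⟩ := (Submodule.ne_bot_iff _).1 h₁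
  obtain ⟨a, rfl⟩ : u ∈ LinearMap.range L.x := by rw [← V_inf₁]; exact ⟨hV huh, hu⟩
  obtain ⟨v, ⟨hvh, hv⟩, hv0⟩ := (Submodule.ne_bot_iff _).1 h₂
  obtain ⟨b, rfl⟩ : v ∈ LinearMap.range L.y := by rw [← V_inf₂]; exact ⟨hV hvh, hv⟩
  have ha : a ≠ 0 := by rintro rfl; simp at hu0
  have hb : b ≠ 0 := by rintro rfl; simp at hv0
  -- The vectors found in the first two planes are independent, hence a basis of h.
  have hspan : h = Submodule.span ℂ {L.x a, L.y b} := by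
    symm
    apply Submodule.eq_of_le_of_finrank_eq
    · rw [Submodule.span_le]
      rintro _ (rfl | rfl) <;> assumption
    · have hli : LinearIndependent ℂ ![L.x a, L.y b] := by
        rw [LinearIndependent.pair_iff]
        intro s t h
        rw [← map_smul, ← map_smul] at h
        obtain ⟨h1, h2⟩ := L.x_add_y_eq_zero h
        exact ⟨(smul_eq_zero.1 h1).resolve_right ha, (smul_eq_zero.1 h2).resolve_right hb⟩
      have := finrank_span_eq_card hli
      rw [Matrix.range_cons_cons_empty] at this
      exact (this.trans (by simp)).trans hh.symm
  -- Meeting the third plane forces s a + t b = 0, so b is a nonzero multiple of a.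
  obtain ⟨w, ⟨hwh, hw⟩, hw0⟩ := (Submodule.ne_bot_iff _).1 h₃
  rw [hspan] at hwh
  obtain ⟨s, t, rfl⟩ := Submodule.mem_span_pair.1 hwh
  rw [← map_smul, ← map_smul, SetLike.mem_coe, x_add_y_mem_iff] at hw
  have ht : t ≠ 0 := by
    rintro rfl
    rw [zero_smul, add_zero, smul_eq_zero] at hw
    exact hw0 (by simp [hw.resolve_right ha])
  have hba : b = (-(t⁻¹ * s)) • a := by
    have : t • b = -(s • a) := eq_neg_of_add_eq_zero_right hw
    rw [neg_smul, mul_smul, ← smul_neg, ← this, inv_smul_smul₀ ht]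
  have hc : (-(t⁻¹ * s)) ≠ 0 := by
    intro h0
    rw [h0, zero_smul] at hba
    exact hb hba
  have htr : h = L.transversal a := by
    rw [hspan, transversal, hba, map_smul, Submodule.span_insert, Submodule.span_insert,
      Submodule.span_singleton_smul_eq (IsUnit.mk0 _ hc)]
  -- Meeting the fourth plane forces s P a + t Q a = 0, the eigenvector equation; s = 0 is
  -- impossible because Q is injective.
  obtain ⟨w, ⟨hwh, hw⟩, hw0⟩ := (Submodule.ne_bot_iff _).1 h₄
  rw [htr] at hwh
  obtain ⟨s, t, rfl⟩ := L.mem_transversal.1 hwh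
  have hw' := (L.ξ_eq_zero _).2 hw
  rw [map_add, map_smul, map_smul, ξ_x, ξ_y] at hw'
  have hs : s ≠ 0 := by
    rintro rfl
    rw [zero_smul, zero_add, smul_eq_zero] at hw'
    rcases hw' with rfl | hw'
    · simp at hw0
    · exact ha (L.Q_eq_zero hw')
  refine ⟨a, -(s⁻¹ * t), ha, ?_, htr⟩
  rw [neg_smul, mul_smul, ← smul_neg, ← eq_neg_of_add_eq_zero_left hw', inv_smul_smul₀ hs]

section eigen

variable {a : Fin 2 → ℂ} {α : ℂ}

theorem transversal_inf₃ : L.transversal a ⊓ L.F₃ = Submodule.span ℂ {L.x a - L.y a} := by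
  apply le_antisymm
  · rintro u ⟨hu, h1⟩
    obtain ⟨s, t, rfl⟩ := L.mem_transversal.1 hu
    rw [← map_smul, ← map_smul] at h1
    have h := eq_neg_of_add_eq_zero_right (L.x_add_y_mem_iff.1 h1)
    have h2 : s • L.x a + t • L.y a = s • (L.x a - L.y a) := by
      rw [← map_smul _ t, h, map_neg, map_smul, smul_sub, sub_eq_add_neg]
    rw [h2]
    exact Submodule.smul_mem _ _ (Submodule.mem_span_singleton_self _)
  · rw [Submodule.span_singleton_le_iff_mem]
    exact ⟨L.mem_transversal.2 ⟨1, -1, by simp [sub_eq_add_neg]⟩, L.x_sub_y_mem a⟩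

theorem transversal_inf₄ (ha : a ≠ 0) (hα : L.P a = α • L.Q a) :
    L.transversal a ⊓ L.F₄ = Submodule.span ℂ {L.x a - α • L.y a} := by
  apply le_antisymm
  · rintro u ⟨hu, h1⟩
    obtain ⟨s, t, rfl⟩ := L.mem_transversal.1 hu
    have h2 := (L.ξ_eq_zero _).2 h1
    rw [map_add, map_smul, map_smul, ξ_x, ξ_y, hα, smul_smul, ← add_smul, smul_eq_zero] at h2
    have h3 := h2.resolve_right fun h => ha (L.Q_eq_zero h)
    have h4 : s • L.x a + t • L.y a = s • (L.x a - α • L.y a) := by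
      rw [eq_neg_of_add_eq_zero_right h3, smul_sub, smul_smul, neg_smul, sub_eq_add_neg]
    rw [h4]
    exact Submodule.smul_mem _ _ (Submodule.mem_span_singleton_self _)
  · rw [Submodule.span_singleton_le_iff_mem]
    refine ⟨L.mem_transversal.2 ⟨1, -α, by simp [sub_eq_add_neg]⟩, (L.ξ_eq_zero _).1 ?_⟩
    rw [map_sub, map_smul, ξ_x, ξ_y, hα, sub_self]

/-- The linear form defining the hyperplane spanned by `F₄` and the transversal of `a`. -/
def η (a : Fin 2 → ℂ) : Y →ₗ[ℂ] ℂ := det₂ (L.Q a) ∘ₗ L.ξ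

theorem η_apply (u) : L.η a u = det₂ (L.Q a) (L.ξ u) := rfl

/-- The span of `F₄` and the transversal of `a`. -/
def T (a : Fin 2 → ℂ) : Submodule ℂ Y := L.F₄ ⊔ L.transversal a

/-- The space which contains the solutions which meet `V` in the transversal of `a`. -/
def C (a : Fin 2 → ℂ) : Submodule ℂ Y :=
  ((L.F₁ ⊓ L.T a) ⊔ (L.F₃ ⊓ L.T a)) ⊓ ((L.F₂ ⊓ L.T a) ⊔ (L.F₃ ⊓ L.T a))

theorem Q_ne_zero (ha : a ≠ 0) : L.Q a ≠ 0 := fun h => ha (L.Q_eq_zero h)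

/-- Modulo the kernel `F₄` of ξ, the transversal contributes just the line of Q a, since P a is
proportional to it. -/
theorem mem_T (ha : a ≠ 0) (hα : L.P a = α • L.Q a) (u : Y) : u ∈ L.T a ↔ L.η a u = 0 := by
  rw [η_apply, det₂_eq_zero_iff (L.Q_ne_zero ha), T, Submodule.mem_sup]
  constructor
  · rintro ⟨v, hv, w, hw, rfl⟩
    obtain ⟨s, t, rfl⟩ := L.mem_transversal.1 hw
    refine ⟨s * α + t, ?_⟩
    rw [map_add, (L.ξ_eq_zero v).2 hv, map_add, map_smul, map_smul, ξ_x, ξ_y, hα, zero_add,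
      smul_smul, add_smul]
  · rintro ⟨c, hc⟩
    refine ⟨u - c • L.y a, (L.ξ_eq_zero _).1 ?_, c • L.y a, L.mem_transversal.2 ⟨0, c, by simp⟩,
      by simp⟩
    rw [map_sub, map_smul, ξ_y, hc, sub_self]

/-- The decomposition of δ u along `F₁` and `F₃` is unique, so the condition is that u and its
component π₁ u both lie in T. -/
theorem mem_sup₁ (ha : a ≠ 0) (hα : L.P a = α • L.Q a) (u : Y) :
    u ∈ (L.F₁ ⊓ L.T a) ⊔ (L.F₃ ⊓ L.T a) ↔ L.η a u = 0 ∧ L.η a (L.π₁ u) = 0 := by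
  rw [Submodule.mem_sup]
  constructor
  · rintro ⟨v, ⟨hv, hvT⟩, w, ⟨hw, hwT⟩, rfl⟩
    replace hvT := (mem_T L ha hα _).1 hvT
    replace hwT := (mem_T L ha hα _).1 hwT
    rw [map_add, hvT, hwT, map_add, L.π₁_of_mem hv, L.π₁_of_mem₃ hw, add_zero, add_zero, map_smul (L.η a), hvT]
    simp
  · rintro ⟨h, h'⟩
    refine ⟨L.δ⁻¹ • L.π₁ u, ⟨L.F₁.smul_mem _ (L.π₁_mem u), ?_⟩,
      L.δ⁻¹ • (L.δ • u - L.π₁ u), ⟨L.F₃.smul_mem _ (L.sub_π₁_mem u), ?_⟩, ?_⟩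
    · rw [SetLike.mem_coe, mem_T L ha hα, map_smul, h', smul_zero]
    · rw [SetLike.mem_coe, mem_T L ha hα, map_smul, map_sub, map_smul, h, h']
      simp
    · rw [smul_sub, inv_smul_smul₀ L.δ_ne]
      abel

theorem mem_sup₂ (ha : a ≠ 0) (hα : L.P a = α • L.Q a) (u : Y) :
    u ∈ (L.F₂ ⊓ L.T a) ⊔ (L.F₃ ⊓ L.T a) ↔ L.η a u = 0 ∧ L.η a (L.π₂ u) = 0 := by
  rw [Submodule.mem_sup]
  constructor
  · rintro ⟨v, ⟨hv, hvT⟩, w, ⟨hw, hwT⟩, rfl⟩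
    replace hvT := (mem_T L ha hα _).1 hvT
    replace hwT := (mem_T L ha hα _).1 hwT
    rw [map_add, hvT, hwT, map_add, L.π₂_of_mem hv, L.π₂_of_mem₃ hw, add_zero, add_zero, map_smul (L.η a), hvT]
    simp
  · rintro ⟨h, h'⟩
    refine ⟨L.δ⁻¹ • L.π₂ u, ⟨L.F₂.smul_mem _ (L.π₂_mem u), ?_⟩,
      L.δ⁻¹ • (L.δ • u - L.π₂ u), ⟨L.F₃.smul_mem _ (L.sub_π₂_mem u), ?_⟩, ?_⟩
    · rw [SetLike.mem_coe, mem_T L ha hα, map_smul, h', smul_zero]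
    · rw [SetLike.mem_coe, mem_T L ha hα, map_smul, map_sub, map_smul, h, h']
      simp
    · rw [smul_sub, inv_smul_smul₀ L.δ_ne]
      abel

theorem mem_C (ha : a ≠ 0) (hα : L.P a = α • L.Q a) (u : Y) :
    u ∈ L.C a ↔ L.η a u = 0 ∧ L.η a (L.π₁ u) = 0 ∧ L.η a (L.π₂ u) = 0 := by
  rw [C, Submodule.mem_inf, mem_sup₁ L ha hα, mem_sup₂ L ha hα]
  tauto

theorem α_ne_zero (ha : a ≠ 0) (hα : L.P a = α • L.Q a) : α ≠ 0 := by
  rintro rfl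
  exact ha (L.P_eq_zero (by rw [hα, zero_smul]))

theorem α_ne_one (ha : a ≠ 0) (hα : L.P a = α • L.Q a) : α ≠ 1 := by
  rintro rfl
  exact ha (L.P_eq_Q (by rw [hα, one_smul]))

theorem η_x (hα : L.P a = α • L.Q a) : L.η a (L.x a) = 0 := by
  rw [η_apply, ξ_x, hα, det₂_apply]
  simp
  ring

theorem η_y : L.η a (L.y a) = 0 := by
  rw [η_apply, ξ_y, det₂_apply]
  ring

theorem transversal_le_C (ha : a ≠ 0) (hα : L.P a = α • L.Q a) : L.transversal a ≤ L.C a := by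
  intro u hu
  obtain ⟨s, t, rfl⟩ := L.mem_transversal.1 hu
  rw [mem_C L ha hα]
  simp only [map_add, map_smul, π₁_x, π₁_y, π₂_x, π₂_y, η_x L hα, η_y]
  simp

/-- Let u = x v + y w. The equation for π₁ u makes P (v + w) a multiple of Q a, so v + w is a
multiple of a since α ≠ 0. The equation for u then makes (P - Q) v a multiple of Q a, so v is a
multiple of a since α ≠ 1. -/
theorem C_inf_V (ha : a ≠ 0) (hα : L.P a = α • L.Q a) : L.C a ⊓ L.V = L.transversal a := by
  refine le_antisymm ?_ (le_inf (L.transversal_le_C ha hα) (L.transversal_le a))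
  rintro u ⟨hC, hV⟩
  obtain ⟨v, w, rfl⟩ := (L.mem_V u).1 hV
  rw [SetLike.mem_coe, mem_C L ha hα] at hC
  obtain ⟨h0, h1, -⟩ := hC
  rw [map_add, π₁_x, π₁_y, ← smul_add, ← map_add, map_smul, smul_eq_zero] at h1
  have h1 := h1.resolve_left L.δ_ne
  rw [η_apply, ξ_x, det₂_eq_zero_iff (L.Q_ne_zero ha)] at h1
  obtain ⟨c, hc⟩ := h1
  have hα0 := L.α_ne_zero ha hα
  have hα1 := L.α_ne_one ha hα
  have hvw : v + w = (c / α) • a := by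
    rw [← sub_eq_zero]
    apply L.P_eq_zero
    rw [map_sub, hc, map_smul, hα, smul_smul, div_mul_cancel₀ _ hα0, sub_self]
  have hw : w = (c / α) • a - v := by rw [← hvw]; abel
  rw [η_apply, det₂_eq_zero_iff (L.Q_ne_zero ha)] at h0
  obtain ⟨c', hc'⟩ := h0
  have hv : v = ((c' - c / α) / (α - 1)) • a := by
    rw [← sub_eq_zero]
    apply L.P_eq_Q
    rw [map_add, ξ_x, ξ_y, hw, map_sub, map_smul] at hc'
    rw [map_sub, map_sub, map_smul, map_smul, hα, ← sub_eq_zero]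
    have : L.P v - L.Q v = (c' - c / α) • L.Q a := by
      rw [sub_smul, ← hc']
      abel
    have h3 : L.P v - ((c' - c / α) / (α - 1)) • α • L.Q a -
        (L.Q v - ((c' - c / α) / (α - 1)) • L.Q a) =
        (L.P v - L.Q v) - (((c' - c / α) / (α - 1)) * (α - 1)) • L.Q a := by
      module
    rw [h3, this, div_mul_cancel₀ _ (sub_ne_zero.2 hα1), sub_self]
  rw [hw, hv, ← sub_smul, map_smul, map_smul]
  exact L.mem_transversal.2 ⟨_, _, rfl⟩

/-- The span of `C` and `V` is a hyperplane (or everything) with a simple equation. -/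
theorem mem_C_sup_V (ha : a ≠ 0) (hα : L.P a = α • L.Q a) {c₁ c₂ : ℂ} (hc₂ : c₂ ≠ 0)
    (hc : ∀ v, c₁ * L.η a (L.x v) = c₂ * L.η a (L.y v)) (u : Y) :
    u ∈ L.C a ⊔ L.V ↔ c₁ * L.η a (L.π₁ u) - c₂ * L.η a (L.π₂ u) = 0 := by
  -- On `V` the projections are δ x (v + w) and δ y (v + w), so the hypothesis on the coefficients
  -- says that the form vanishes on `V`.
  have key : ∀ v w, c₁ * L.η a (L.π₁ (L.x v + L.y w)) - c₂ * L.η a (L.π₂ (L.x v + L.y w)) = 0 := by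
    intro v w
    have := hc (v + w)
    simp only [map_add, π₁_x, π₁_y, π₂_x, π₂_y, map_smul, smul_eq_mul] at this ⊢
    linear_combination L.δ * this
  constructor
  · intro h
    obtain ⟨z, hz, w, hw, rfl⟩ := Submodule.mem_sup.1 h
    rw [mem_C L ha hα] at hz
    obtain ⟨v, w, rfl⟩ := (L.mem_V w).1 hw
    have := key v w
    rw [map_add L.π₁, map_add L.π₂, map_add (L.η a), map_add (L.η a), hz.2.1, hz.2.2]
    linear_combination this
  · intro h
    -- A vector x v + y (c - v) of `V` is chosen with the same ξ and the same ξ ∘ π₁ as u.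
    -- Subtracting it gives the first two equations of C.
    obtain ⟨c, hcc⟩ := L.P_surj (L.δ⁻¹ • L.ξ (L.π₁ u))
    obtain ⟨v, hv⟩ := L.PQ_surj (L.ξ u - L.Q c)
    rw [LinearMap.sub_apply] at hv
    refine Submodule.mem_sup.2 ⟨u - (L.x v + L.y (c - v)), ?_, L.x v + L.y (c - v),
      (L.mem_V _).2 ⟨_, _, rfl⟩, by abel⟩
    have e1 : L.η a (L.π₁ (u - (L.x v + L.y (c - v)))) = 0 := by
      have : L.ξ (L.π₁ (u - (L.x v + L.y (c - v)))) = 0 := by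
        rw [map_sub, map_add, π₁_x, π₁_y, ← smul_add, ← map_add, add_sub_cancel, map_sub,
          map_smul, ξ_x, hcc, smul_inv_smul₀ L.δ_ne, sub_self]
      rw [η_apply, this, map_zero]
    rw [mem_C L ha hα]
    refine ⟨?_, e1, ?_⟩
    · have : L.ξ (u - (L.x v + L.y (c - v))) = 0 := by
        rw [map_sub, map_add, ξ_x, ξ_y, map_sub]
        have : L.ξ u - (L.P v + (L.Q c - L.Q v)) = (L.ξ u - L.Q c) - (L.P v - L.Q v) := by abel
        rw [this, hv, sub_self]
      rw [η_apply, this, map_zero]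
    -- The third equation follows from the assumed relation because c₂ ≠ 0.
    · have h2 := key v (c - v)
      have h3 : c₂ * L.η a (L.π₂ (u - (L.x v + L.y (c - v)))) = 0 := by
        rw [map_sub L.π₁, map_sub (L.η a)] at e1
        rw [map_sub L.π₂, map_sub (L.η a)]
        linear_combination c₁ * e1 - h + h2
      exact (mul_eq_zero.1 h3).resolve_left hc₂

theorem finrank_le_finrank_inf_ker_add [FiniteDimensional ℂ Y] (S : Submodule ℂ Y)
    (f : Y →ₗ[ℂ] ℂ) :
    finrank ℂ S ≤ finrank ℂ ↥(S ⊓ LinearMap.ker f) + 1 := by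
  have h := LinearMap.finrank_range_add_finrank_ker (f ∘ₗ S.subtype)
  have h1 : finrank ℂ (LinearMap.range (f ∘ₗ S.subtype)) ≤ 1 := by
    simpa using Submodule.finrank_le (LinearMap.range (f ∘ₗ S.subtype))
  have h2 : finrank ℂ (LinearMap.ker (f ∘ₗ S.subtype)) = finrank ℂ ↥(S ⊓ LinearMap.ker f) := by
    rw [← Submodule.finrank_map_subtype_eq S (LinearMap.ker (f ∘ₗ S.subtype)),
      LinearMap.ker_comp, Submodule.map_comap_subtype]
  omega

/-- C meets `V` in dimension 2, so C + `V` has dimension dim C + 2; a single vector outside bounds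
it by dim Y - 1. -/
theorem finrank_C_le [FiniteDimensional ℂ Y] (ha : a ≠ 0) (hα : L.P a = α • L.Q a)
    {u : Y} (hu : u ∉ L.C a ⊔ L.V) : finrank ℂ (L.C a) + 3 ≤ finrank ℂ Y := by
  have h1 := Submodule.finrank_sup_add_finrank_inf_eq (L.C a) L.V
  rw [L.C_inf_V ha hα, L.finrank_V, L.finrank_transversal ha] at h1
  have h2 : finrank ℂ ↥(L.C a ⊔ L.V) < finrank ℂ Y := by
    apply Submodule.finrank_lt
    rintro h
    exact hu (h ▸ Submodule.mem_top)
  omega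

theorem C_eq (ha : a ≠ 0) (hα : L.P a = α • L.Q a) : L.C a = LinearMap.ker (L.η a) ⊓
    LinearMap.ker (L.η a ∘ₗ L.π₁) ⊓ LinearMap.ker (L.η a ∘ₗ L.π₂) := by
  ext u
  rw [mem_C L ha hα]
  simp [and_assoc]

/-- C is cut out by three linear equations. -/
theorem finrank_le_inf_C [FiniteDimensional ℂ Y] (ha : a ≠ 0) (hα : L.P a = α • L.Q a)
    (S : Submodule ℂ Y) : finrank ℂ S ≤ finrank ℂ ↥(S ⊓ L.C a) + 3 := by
  rw [C_eq L ha hα, ← inf_assoc, ← inf_assoc]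
  have h1 := finrank_le_finrank_inf_ker_add S (L.η a)
  have h2 := finrank_le_finrank_inf_ker_add (S ⊓ LinearMap.ker (L.η a)) (L.η a ∘ₗ L.π₁)
  have h3 := finrank_le_finrank_inf_ker_add (S ⊓ LinearMap.ker (L.η a) ⊓
    LinearMap.ker (L.η a ∘ₗ L.π₁)) (L.η a ∘ₗ L.π₂)
  omega

end eigen

end Pencil

end SchubertFib

end

noncomputable section

namespace SchubertFib

open Module

/-! ### Polynomial equations for the pencil of a quadruple of bases -/

section raw

variable {X : Type} [AddCommGroup X] [Module ℂ X]

/-- The coordinate with respect to the family `v`, multiplied by the determinant of `v`. -/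
def cr (e : Basis (Fin (finrank ℂ X)) ℂ X) (v : Fin (finrank ℂ X) → X)
    (j : Fin (finrank ℂ X)) : X →ₗ[ℂ] ℂ :=
  e.det.toMultilinearMap.toLinearMap v j

theorem cr_apply (e : Basis (Fin (finrank ℂ X)) ℂ X) (v : Fin (finrank ℂ X) → X) (j u) :
    cr e v j u = e.det (Function.update v j u) := rfl

theorem cr_basis (e B : Basis (Fin (finrank ℂ X)) ℂ X) (j u) :
    cr e B j u = e.det B * B.repr u j := by
  have h := Basis.det_smul_mk_coord_eq_det_update (e := e) B.linearIndependent
    (by rw [B.span_eq]) j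
  rw [cr, ← h]
  have hB : Basis.mk B.linearIndependent (by rw [B.span_eq]) = B := Basis.eq_of_apply_eq fun i => by
    simp
  rw [hB]
  simp

/-- Cramer's rule without denominators: this keeps all coefficients polynomial in v. -/
theorem det_smul_eq_sum (e : Basis (Fin (finrank ℂ X)) ℂ X) {v : Fin (finrank ℂ X) → X}
    (hv : e.det v ≠ 0) (u : X) : e.det v • u = ∑ j, cr e v j u • v j := by
  obtain ⟨hli, hsp⟩ := (Basis.is_basis_iff_det e).2 (isUnit_iff_ne_zero.2 hv)
  let B := Basis.mk hli hsp.ge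
  have hB : (B : Fin (finrank ℂ X) → X) = v := Basis.coe_mk _ _
  rw [← hB]
  simp only [cr_basis, mul_smul, ← Finset.smul_sum, B.sum_repr]

/-- The `k`-th coordinate with respect to the basis `B`, multiplied by the determinant of `B`. -/
def crd (e B : Basis (Fin (finrank ℂ X)) ℂ X) (k : ℕ) : X →ₗ[ℂ] ℂ :=
  if h : k < finrank ℂ X then cr e B ⟨k, h⟩ else 0

theorem crd_eq_zero_iff (e B : Basis (Fin (finrank ℂ X)) ℂ X) {k : ℕ} (h : k < finrank ℂ X)
    (u : X) : crd e B k u = 0 ↔ B.repr u ⟨k, h⟩ = 0 := by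
  rw [crd, dif_pos h, cr_basis, mul_eq_zero]
  simp [(e.isUnit_det B).ne_zero]

theorem mem_ofBasis_iff (e B : Basis (Fin (finrank ℂ X)) ℂ X) (m : ℕ) (u : X) :
    u ∈ (CompleteFlag.ofBasis B).sub m ↔ ∀ k, m ≤ k → k < finrank ℂ X → crd e B k u = 0 := by
  change u ∈ Submodule.span ℂ (B '' {i | (i : ℕ) < m}) ↔ _
  rw [Basis.mem_span_image]
  constructor
  · intro h k hk hkn
    rw [crd_eq_zero_iff e B hkn]
    by_contra hne
    have := h (Finsupp.mem_support_iff.2 hne)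
    simp at this
    omega
  · intro h k hk
    by_contra hkm
    exact (Finsupp.mem_support_iff.1 hk)
      ((crd_eq_zero_iff e B k.2 u).1 (h k (by simpa using hkm) k.2))

theorem bv_mem (B : Basis (Fin (finrank ℂ X)) ℂ X) {k m : ℕ} (h : k < m) :
    bv B k ∈ (CompleteFlag.ofBasis B).sub m := by
  unfold bv
  split_ifs with hk
  · exact Submodule.subset_span ⟨⟨k, hk⟩, h, rfl⟩
  · exact zero_mem _

theorem sub_succ (B : Basis (Fin (finrank ℂ X)) ℂ X) (k : ℕ) :
    (CompleteFlag.ofBasis B).sub (k + 1) =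
      (CompleteFlag.ofBasis B).sub k ⊔ Submodule.span ℂ {bv B k} := by
  apply le_antisymm
  · refine Submodule.span_le.2 ?_
    rintro _ ⟨i, hi, rfl⟩
    rcases Nat.lt_succ_iff_lt_or_eq.1 hi with h | h
    · exact Submodule.mem_sup_left (Submodule.subset_span ⟨i, h, rfl⟩)
    · refine Submodule.mem_sup_right ?_
      have : bv B k = B i := by subst h; exact bv_of_lt B i.2
      rw [this]
      exact Submodule.mem_span_singleton_self _
  · rw [sup_le_iff, Submodule.span_singleton_le_iff_mem]
    exact ⟨(CompleteFlag.ofBasis B).mono (Nat.le_succ k), bv_mem B (Nat.lt_succ_self k)⟩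

/-- The first `p` vectors of `B` followed by the first vectors of `B'`. -/
def frame (p : ℕ) (B B' : Basis (Fin (finrank ℂ X)) ℂ X) : Fin (finrank ℂ X) → X :=
  fun j => if (j : ℕ) < p then bv B j else bv B' (j - p)

/-- A multiple of the projection to the span of the first `p` vectors of `B` along the span of the
first vectors of `B'`. -/
def pr (e : Basis (Fin (finrank ℂ X)) ℂ X) (p : ℕ) (B B' : Basis (Fin (finrank ℂ X)) ℂ X) :
    X →ₗ[ℂ] X :=
  ∑ j : Fin (finrank ℂ X), if (j : ℕ) < p then
    (cr e (frame p B B') j).smulRight (frame p B B' j) else 0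

theorem pr_apply (e : Basis (Fin (finrank ℂ X)) ℂ X) (p : ℕ)
    (B B' : Basis (Fin (finrank ℂ X)) ℂ X) (u : X) :
    pr e p B B' u = ∑ j : Fin (finrank ℂ X), if (j : ℕ) < p then
      cr e (frame p B B') j u • frame p B B' j else 0 := by
  rw [pr, LinearMap.sum_apply]
  refine Finset.sum_congr rfl fun j _ => ?_
  split_ifs <;> simp

theorem pr_mem (e : Basis (Fin (finrank ℂ X)) ℂ X) (p : ℕ)
    (B B' : Basis (Fin (finrank ℂ X)) ℂ X) (u : X) :
    pr e p B B' u ∈ (CompleteFlag.ofBasis B).sub p := by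
  rw [pr_apply]
  refine sum_mem fun j _ => ?_
  split_ifs with h
  · refine Submodule.smul_mem _ _ ?_
    rw [frame, if_pos h]
    exact bv_mem B h
  · exact zero_mem _

/-- The terms of Cramer's expansion not taken up by `pr` are those with a vector of B'. -/
theorem sub_pr_mem {e : Basis (Fin (finrank ℂ X)) ℂ X} {p q : ℕ} (hpq : p + q = finrank ℂ X)
    {B B' : Basis (Fin (finrank ℂ X)) ℂ X} (h : e.det (frame p B B') ≠ 0) (u : X) :
    e.det (frame p B B') • u - pr e p B B' u ∈ (CompleteFlag.ofBasis B').sub q := by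
  rw [det_smul_eq_sum e h, pr_apply, ← Finset.sum_sub_distrib]
  refine sum_mem fun j _ => ?_
  split_ifs with hj
  · rw [sub_self]
    exact zero_mem _
  · rw [sub_zero]
    refine Submodule.smul_mem _ _ ?_
    rw [frame, if_neg hj]
    exact bv_mem B' (by have := j.2; omega)

theorem inf_eq_bot_of_det {e : Basis (Fin (finrank ℂ X)) ℂ X} {p q : ℕ}
    (hpq : p + q = finrank ℂ X) [FiniteDimensional ℂ X]
    {B B' : Basis (Fin (finrank ℂ X)) ℂ X} (h : e.det (frame p B B') ≠ 0) :
    (CompleteFlag.ofBasis B).sub p ⊓ (CompleteFlag.ofBasis B').sub q = ⊥ := by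
  have htop : (CompleteFlag.ofBasis B).sub p ⊔ (CompleteFlag.ofBasis B').sub q = ⊤ := by
    rw [eq_top_iff]
    intro u _
    have h1 := add_mem (Submodule.mem_sup_right (sub_pr_mem hpq h u))
      (Submodule.mem_sup_left (T := (CompleteFlag.ofBasis B').sub q) (pr_mem e p B B' u))
    rw [sub_add_cancel] at h1
    exact (Submodule.smul_mem_iff _ h).1 h1
  have h2 := Submodule.finrank_sup_add_finrank_inf_eq ((CompleteFlag.ofBasis B).sub p)
    ((CompleteFlag.ofBasis B').sub q)
  rw [htop, finrank_top, CompleteFlag.finrank_sub _ _ (by omega),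
    CompleteFlag.finrank_sub _ _ (by omega)] at h2
  exact Submodule.finrank_eq_zero.1 (by omega)

theorem det_frame_ne_zero {e : Basis (Fin (finrank ℂ X)) ℂ X} {p q : ℕ}
    (hpq : p + q = finrank ℂ X) [FiniteDimensional ℂ X]
    {B B' : Basis (Fin (finrank ℂ X)) ℂ X}
    (h : (CompleteFlag.ofBasis B).sub p ⊓ (CompleteFlag.ofBasis B').sub q = ⊥) :
    e.det (frame p B B') ≠ 0 := by
  have h2 := Submodule.finrank_sup_add_finrank_inf_eq ((CompleteFlag.ofBasis B).sub p)
    ((CompleteFlag.ofBasis B').sub q)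
  rw [h, finrank_bot, CompleteFlag.finrank_sub _ _ (by omega),
    CompleteFlag.finrank_sub _ _ (by omega), add_zero, hpq] at h2
  have htop := Submodule.eq_top_of_finrank_eq h2
  have hsp : ⊤ ≤ Submodule.span ℂ (Set.range (frame p B B')) := by
    rw [← htop, sup_le_iff]
    constructor
    · refine Submodule.span_le.2 ?_
      rintro _ ⟨i, hi, rfl⟩
      refine Submodule.subset_span ⟨i, ?_⟩
      rw [frame, if_pos (show (i : ℕ) < p from hi), bv_of_lt B i.2]
    · refine Submodule.span_le.2 ?_
      rintro _ ⟨i, hi, rfl⟩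
      have hi' : (i : ℕ) < q := hi
      refine Submodule.subset_span ⟨⟨p + i, by omega⟩, ?_⟩
      rw [frame, if_neg (by simp)]
      simp [bv_of_lt B' i.2]
  have hli := linearIndependent_of_top_le_span_of_card_eq_finrank hsp (by simp)
  exact ((Basis.is_basis_iff_det e).1 ⟨hli, top_le_iff.1 hsp⟩).ne_zero

variable (e : Basis (Fin (finrank ℂ X)) ℂ X) (p q : ℕ)
  (b : Fin 4 → Basis (Fin (finrank ℂ X)) ℂ X)

/-- Each projection is also multiplied by the determinant belonging to the other, so that both are
scaled by the same factor `D₁` `D₂`. -/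
def D₁ : ℂ := e.det (frame p (b 0) (b 2))
def D₂ : ℂ := e.det (frame p (b 1) (b 2))
def pi₁ : X →ₗ[ℂ] X := D₂ e p b • pr e p (b 0) (b 2)
def pi₂ : X →ₗ[ℂ] X := D₁ e p b • pr e p (b 1) (b 2)
/-- The last two coordinates with respect to the last basis. -/
def xi : X →ₗ[ℂ] (Fin 2 → ℂ) := LinearMap.pi fun l => crd e (b 3) (finrank ℂ X - 2 + l)
def gv : (Fin 2 → ℂ) →ₗ[ℂ] X := Fintype.linearCombination ℂ fun k : Fin 2 => bv (b 2) (q + k)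
def matP : Matrix (Fin 2) (Fin 2) ℂ :=
  Matrix.of fun l k => xi e b (pi₁ e p b (bv (b 2) (q + (k : ℕ)))) l
def matQ : Matrix (Fin 2) (Fin 2) ℂ :=
  Matrix.of fun l k => xi e b (pi₂ e p b (bv (b 2) (q + (k : ℕ)))) l
-- The polynomial substitute for Q⁻¹ P; its eigenvalues are β = α det Q, where P a = α Q a.
def matA : Matrix (Fin 2) (Fin 2) ℂ := (matQ e p q b).adjugate * matP e p q b

theorem matP_mulVec (a : Fin 2 → ℂ) : (matP e p q b).mulVec a = xi e b (pi₁ e p b (gv q b a)) := by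
  ext l
  simp [Matrix.mulVec, dotProduct, matP, gv, Fintype.linearCombination_apply, mul_comm]

theorem matQ_mulVec (a : Fin 2 → ℂ) : (matQ e p q b).mulVec a = xi e b (pi₂ e p b (gv q b a)) := by
  ext l
  simp [Matrix.mulVec, dotProduct, matQ, gv, Fintype.linearCombination_apply, mul_comm]

/-- The conditions under which the bases `b` define a pencil. -/
structure IsGeneral : Prop where
  D₁_ne : D₁ e p b ≠ 0
  D₂_ne : D₂ e p b ≠ 0
  P_ne : (matP e p q b).det ≠ 0
  Q_ne : (matQ e p q b).det ≠ 0
  PQ_ne : (matP e p q b - matQ e p q b).det ≠ 0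
  -- This makes the explicit eigenvector `eigvec` nonzero for every eigenvalue.
  A_ne : matA e p q b 0 1 ≠ 0

theorem eq_zero_of_mulVec_eq_zero {M : Matrix (Fin 2) (Fin 2) ℂ} (hM : M.det ≠ 0)
    {a : Fin 2 → ℂ} (h : M.mulVec a = 0) : a = 0 := by
  by_contra ha
  exact hM (Matrix.exists_mulVec_eq_zero_iff.1 ⟨a, ha, h⟩)

theorem ofBasis_sub_finrank_sub_two (h2 : 2 ≤ finrank ℂ X) (u : X) :
    xi e b u = 0 ↔ u ∈ (CompleteFlag.ofBasis (b 3)).sub (finrank ℂ X - 2) := by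
  rw [mem_ofBasis_iff e]
  constructor
  · intro h k hk hkn
    have h0 := congrFun h 0
    have h1 := congrFun h 1
    simp only [xi, LinearMap.pi_apply] at h0 h1
    obtain rfl | rfl : k = finrank ℂ X - 2 + ((0 : Fin 2) : ℕ) ∨
        k = finrank ℂ X - 2 + ((1 : Fin 2) : ℕ) := by
      simp
      omega
    · exact h0
    · exact h1
  · intro h
    ext l
    simp only [xi, LinearMap.pi_apply]
    exact h _ (by omega) (by omega)

variable {e p q b}

/-- The pencil of a quadruple of bases. -/
def IsGeneral.pencil [FiniteDimensional ℂ X] (H : IsGeneral e p q b) (hpq : p + q = finrank ℂ X)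
    (hp : 2 ≤ p) : Pencil X where
  F₁ := (CompleteFlag.ofBasis (b 0)).sub p
  F₂ := (CompleteFlag.ofBasis (b 1)).sub p
  F₃ := (CompleteFlag.ofBasis (b 2)).sub q
  F₄ := (CompleteFlag.ofBasis (b 3)).sub (finrank ℂ X - 2)
  g := gv q b
  π₁ := pi₁ e p b
  π₂ := pi₂ e p b
  ξ := xi e b
  δ := D₁ e p b * D₂ e p b
  δ_ne := mul_ne_zero H.D₁_ne H.D₂_ne
  π₁_mem u := Submodule.smul_mem _ _ (pr_mem _ _ _ _ _)
  π₂_mem u := Submodule.smul_mem _ _ (pr_mem _ _ _ _ _)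
  sub_π₁_mem u := by
    have := Submodule.smul_mem _ (D₂ e p b) (sub_pr_mem hpq H.D₁_ne u)
    rwa [smul_sub, smul_smul, mul_comm] at this
  sub_π₂_mem u := by
    have := Submodule.smul_mem _ (D₁ e p b) (sub_pr_mem hpq H.D₂_ne u)
    rwa [smul_sub, smul_smul] at this
  disj₁ := inf_eq_bot_of_det hpq H.D₁_ne
  disj₂ := inf_eq_bot_of_det hpq H.D₂_ne
  ξ_eq_zero u := ofBasis_sub_finrank_sub_two e b (by omega) u
  g_mem a h := by
    rw [mem_ofBasis_iff e] at h
    have key : ∀ k : Fin 2, a k = 0 := by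
      intro k
      have hk : q + (k : ℕ) < finrank ℂ X := by omega
      have h1 := (crd_eq_zero_iff e (b 2) hk _).1 (h (q + k) (by omega) hk)
      rw [gv, Fintype.linearCombination_apply, map_sum, Finsupp.finsetSum_apply] at h1
      rw [Fin.sum_univ_two] at h1
      rw [bv_of_lt _ (show q + ((0 : Fin 2) : ℕ) < finrank ℂ X by simp; omega),
        bv_of_lt _ (show q + ((1 : Fin 2) : ℕ) < finrank ℂ X by simp; omega)] at h1
      fin_cases k <;> simpa [Finsupp.single_apply] using h1
    ext k
    exact key k
  P_inj a h := eq_zero_of_mulVec_eq_zero H.P_ne (by rw [matP_mulVec]; exact h)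
  Q_inj a h := eq_zero_of_mulVec_eq_zero H.Q_ne (by rw [matQ_mulVec]; exact h)
  PQ_inj a h := eq_zero_of_mulVec_eq_zero H.PQ_ne (by
    rw [Matrix.sub_mulVec, matP_mulVec, matQ_mulVec, sub_eq_zero]
    exact h)

end raw

end SchubertFib

end

noncomputable section

namespace SchubertFib

open Module

/-! ### Polynomial dependence of the pencil on the bases. -/

section coords

variable {X : Type} [AddCommGroup X] [Module ℂ X] {e : Basis (Fin (finrank ℂ X)) ℂ X}
  {Ω : Type} {S : Subalgebra ℂ (Ω → ℂ)}

theorem HasCoordsIn.cr {v : Ω → Fin (finrank ℂ X) → X} {u : Ω → X}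
    (hv : ∀ k, HasCoordsIn e S (fun ω => v ω k)) (hu : HasCoordsIn e S u) (j) :
    (fun ω => cr e (v ω) j (u ω)) ∈ S :=
  HasCoordsIn.det_update (v := fun k ω => v ω k) hv hu j

variable {p q : ℕ}

theorem HasCoordsIn.frame {B B' : Ω → Basis (Fin (finrank ℂ X)) ℂ X}
    (hB : ∀ k, HasCoordsIn e S (fun ω => bv (B ω) k))
    (hB' : ∀ k, HasCoordsIn e S (fun ω => bv (B' ω) k)) (j) :
    HasCoordsIn e S (fun ω => frame p (B ω) (B' ω) j) := by
  by_cases h : (j : ℕ) < p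
  · simpa [SchubertFib.frame, h] using hB j
  · simpa [SchubertFib.frame, h] using hB' (j - p)

theorem HasCoordsIn.crd {B : Ω → Basis (Fin (finrank ℂ X)) ℂ X}
    (hB : ∀ k, HasCoordsIn e S (fun ω => bv (B ω) k)) {u : Ω → X} (hu : HasCoordsIn e S u)
    (k : ℕ) : (fun ω => crd e (B ω) k (u ω)) ∈ S := by
  by_cases h : k < finrank ℂ X
  · simp only [SchubertFib.crd, h, dite_true]
    refine HasCoordsIn.cr (v := fun ω => B ω) (fun k => ?_) hu _
    simpa [bv_of_lt] using hB k
  · simp only [SchubertFib.crd, h, dite_false]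
    exact zero_mem S

theorem HasCoordsIn.pr {B B' : Ω → Basis (Fin (finrank ℂ X)) ℂ X}
    (hB : ∀ k, HasCoordsIn e S (fun ω => bv (B ω) k))
    (hB' : ∀ k, HasCoordsIn e S (fun ω => bv (B' ω) k)) {u : Ω → X} (hu : HasCoordsIn e S u) :
    HasCoordsIn e S (fun ω => pr e p (B ω) (B' ω) (u ω)) := by
  simp only [pr_apply]
  refine HasCoordsIn.sum _ fun j _ => ?_
  by_cases h : (j : ℕ) < p
  · simp only [h, if_true]
    exact HasCoordsIn.smul (HasCoordsIn.cr (fun k => HasCoordsIn.frame hB hB' k) hu _)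
      (HasCoordsIn.frame hB hB' j)
  · simp only [h, if_false]
    exact HasCoordsIn.zero

variable {b : Ω → Fin 4 → Basis (Fin (finrank ℂ X)) ℂ X}

theorem D₁_mem (hb : ∀ i k, HasCoordsIn e S (fun ω => bv (b ω i) k)) :
    (fun ω => D₁ e p (b ω)) ∈ S :=
  HasCoordsIn.det (v := fun j ω => frame p (b ω 0) (b ω 2) j) fun j =>
    HasCoordsIn.frame (hb 0) (hb 2) j

theorem D₂_mem (hb : ∀ i k, HasCoordsIn e S (fun ω => bv (b ω i) k)) :
    (fun ω => D₂ e p (b ω)) ∈ S :=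
  HasCoordsIn.det (v := fun j ω => frame p (b ω 1) (b ω 2) j) fun j =>
    HasCoordsIn.frame (hb 1) (hb 2) j

theorem HasCoordsIn.pi₁ (hb : ∀ i k, HasCoordsIn e S (fun ω => bv (b ω i) k)) {u : Ω → X}
    (hu : HasCoordsIn e S u) : HasCoordsIn e S (fun ω => pi₁ e p (b ω) (u ω)) :=
  HasCoordsIn.smul (D₂_mem hb) (HasCoordsIn.pr (hb 0) (hb 2) hu)

theorem HasCoordsIn.pi₂ (hb : ∀ i k, HasCoordsIn e S (fun ω => bv (b ω i) k)) {u : Ω → X}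
    (hu : HasCoordsIn e S u) : HasCoordsIn e S (fun ω => pi₂ e p (b ω) (u ω)) :=
  HasCoordsIn.smul (D₁_mem hb) (HasCoordsIn.pr (hb 1) (hb 2) hu)

theorem xi_mem (hb : ∀ i k, HasCoordsIn e S (fun ω => bv (b ω i) k)) {u : Ω → X}
    (hu : HasCoordsIn e S u) (l) : (fun ω => xi e (b ω) (u ω) l) ∈ S :=
  HasCoordsIn.crd (hb 3) hu _

theorem matP_mem (hb : ∀ i k, HasCoordsIn e S (fun ω => bv (b ω i) k)) (l k) :
    (fun ω => matP e p q (b ω) l k) ∈ S :=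
  xi_mem hb (HasCoordsIn.pi₁ hb (hb 2 _)) l

theorem matQ_mem (hb : ∀ i k, HasCoordsIn e S (fun ω => bv (b ω i) k)) (l k) :
    (fun ω => matQ e p q (b ω) l k) ∈ S :=
  xi_mem hb (HasCoordsIn.pi₂ hb (hb 2 _)) l

theorem mem_of_eq_add {f g h : Ω → ℂ} (hg : g ∈ S) (hh : h ∈ S) (H : ∀ ω, f ω = g ω + h ω) :
    f ∈ S := by
  rw [show f = g + h from funext H]
  exact add_mem hg hh

theorem mem_of_eq_sub {f g h : Ω → ℂ} (hg : g ∈ S) (hh : h ∈ S) (H : ∀ ω, f ω = g ω - h ω) :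
    f ∈ S := by
  rw [show f = g - h from funext H]
  exact sub_mem hg hh

theorem det_two_mem {M : Ω → Matrix (Fin 2) (Fin 2) ℂ} (hM : ∀ i j, (fun ω => M ω i j) ∈ S) :
    (fun ω => (M ω).det) ∈ S :=
  det_mem (M := fun i j ω => M ω i j) hM

theorem adjugate_mem {M : Ω → Matrix (Fin 2) (Fin 2) ℂ} (hM : ∀ i j, (fun ω => M ω i j) ∈ S)
    (i j) : (fun ω => (M ω).adjugate i j) ∈ S := by
  simp only [Matrix.adjugate_fin_two]
  fin_cases i <;> fin_cases j <;> simp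
  · exact hM 1 1
  · exact neg_mem (hM 0 1)
  · exact neg_mem (hM 1 0)
  · exact hM 0 0

theorem matA_mem (hb : ∀ i k, HasCoordsIn e S (fun ω => bv (b ω i) k)) (l k) :
    (fun ω => matA e p q (b ω) l k) ∈ S := by
  have hQ := fun i => adjugate_mem (M := fun ω => matQ e p q (b ω))
    (fun i j => matQ_mem hb i j) l i
  have hP := fun i => matP_mem (p := p) (q := q) hb i k
  refine mem_of_eq_add (mul_mem (hQ 0) (hP 0)) (mul_mem (hQ 1) (hP 1)) fun ω => ?_
  simp only [matA, Matrix.mul_apply, Fin.sum_univ_two, Pi.mul_apply]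

theorem trace_mem (hb : ∀ i k, HasCoordsIn e S (fun ω => bv (b ω i) k)) :
    (fun ω => (matA e p q (b ω)).trace) ∈ S :=
  mem_of_eq_add (matA_mem hb 0 0) (matA_mem hb 1 1) fun _ => Matrix.trace_fin_two _

theorem det_matA_mem (hb : ∀ i k, HasCoordsIn e S (fun ω => bv (b ω i) k)) :
    (fun ω => (matA e p q (b ω)).det) ∈ S :=
  det_two_mem fun i j => matA_mem hb i j

variable {ι : Type}

theorem hasCoordsIn_polyFun (i : ι) (k : ℕ) :
    HasCoordsIn e (polyFun (ι := ι) e) (fun B => bv (B i) k) := by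
  intro j
  by_cases h : k < finrank ℂ X
  · simp only [bv_of_lt _ h]
    exact polyFun_coord e i _ j
  · have := zero_mem (polyFun (ι := ι) e)
    simpa [bv, h, Pi.zero_def] using this

theorem isGeneral_iff {b : Fin 4 → Basis (Fin (finrank ℂ X)) ℂ X} : IsGeneral e p q b ↔
    D₁ e p b ≠ 0 ∧ D₂ e p b ≠ 0 ∧ (matP e p q b).det ≠ 0 ∧ (matQ e p q b).det ≠ 0 ∧
      (matP e p q b - matQ e p q b).det ≠ 0 ∧ matA e p q b 0 1 ≠ 0 :=
  ⟨fun ⟨h1, h2, h3, h4, h5, h6⟩ => ⟨h1, h2, h3, h4, h5, h6⟩,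
    fun ⟨h1, h2, h3, h4, h5, h6⟩ => ⟨h1, h2, h3, h4, h5, h6⟩⟩

theorem IsBasicOpen.and {P Q : (ι → Basis (Fin (finrank ℂ X)) ℂ X) → Prop}
    (hP : IsBasicOpen e {B | P B}) (hQ : IsBasicOpen e {B | Q B}) :
    IsBasicOpen e {B | P B ∧ Q B} := hP.inter hQ

theorem IsBasicOpen.congr {P Q : (ι → Basis (Fin (finrank ℂ X)) ℂ X) → Prop}
    (hP : IsBasicOpen e {B | P B}) (h : ∀ B, Q B ↔ P B) : IsBasicOpen e {B | Q B} := by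
  obtain ⟨f, hf, hW⟩ := hP
  exact ⟨f, hf, fun B => (h B).trans (hW B)⟩

theorem isBasicOpen_isGeneral {p q : ℕ}
    {b : (ι → Basis (Fin (finrank ℂ X)) ℂ X) → Fin 4 → Basis (Fin (finrank ℂ X)) ℂ X}
    (hb : ∀ i k, HasCoordsIn e (polyFun (ι := ι) e) (fun B => bv (b B i) k)) :
    IsBasicOpen e {B | IsGeneral e p q (b B)} := by
  have hP : ∀ i j, (fun B => matP e p q (b B) i j) ∈ polyFun (ι := ι) e :=
    fun i j => matP_mem hb i j
  have hQ : ∀ i j, (fun B => matQ e p q (b B) i j) ∈ polyFun (ι := ι) e :=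
    fun i j => matQ_mem hb i j
  have h1 := IsBasicOpen.of_mem (D₁_mem (p := p) hb)
  have h2 := IsBasicOpen.of_mem (D₂_mem (p := p) hb)
  have h3 := IsBasicOpen.of_mem (det_two_mem hP)
  have h4 := IsBasicOpen.of_mem (det_two_mem hQ)
  have h5 := IsBasicOpen.of_mem (det_two_mem (M := fun B => matP e p q (b B) - matQ e p q (b B))
    fun i j => mem_of_eq_sub (hP i j) (hQ i j) fun _ => rfl)
  have h6 := IsBasicOpen.of_mem (matA_mem (p := p) (q := q) hb 0 1)
  exact (h1.and (h2.and (h3.and (h4.and (h5.and h6))))).congr fun B => isGeneral_iff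

end coords

/-! ### Transversals as eigenvectors. -/

section eigen

variable {X : Type} [AddCommGroup X] [Module ℂ X] (e : Basis (Fin (finrank ℂ X)) ℂ X)
  (p q : ℕ) (b : Fin 4 → Basis (Fin (finrank ℂ X)) ℂ X)

/-- `β` is an eigenvalue of the matrix of the quadruple `b`. -/
def IsRoot (β : ℂ) : Prop := β ^ 2 = (matA e p q b).trace * β - (matA e p q b).det

/-- The eigenvector for the eigenvalue `β`. -/
def eigvec (β : ℂ) : Fin 2 → ℂ := ![matA e p q b 0 1, β - matA e p q b 0 0]

variable {e p q b}

theorem IsGeneral.eigvec_ne (H : IsGeneral e p q b) (β : ℂ) : eigvec e p q b β ≠ 0 := by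
  intro h
  exact H.A_ne (congrFun h 0)

theorem matA_mulVec_eigvec {β : ℂ} (hβ : IsRoot e p q b β) :
    (matA e p q b).mulVec (eigvec e p q b β) = β • eigvec e p q b β := by
  rw [IsRoot, Matrix.trace_fin_two, Matrix.det_fin_two] at hβ
  ext i
  fin_cases i
  · simp [Matrix.mulVec, dotProduct, Fin.sum_univ_two, eigvec]
    ring
  -- The first coordinate holds identically; the second is the characteristic equation.
  · simp [Matrix.mulVec, dotProduct, Fin.sum_univ_two, eigvec]
    linear_combination -hβ

theorem matQ_mulVec_matA (a : Fin 2 → ℂ) :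
    (matQ e p q b).mulVec ((matA e p q b).mulVec a) =
      (matQ e p q b).det • (matP e p q b).mulVec a := by
  rw [Matrix.mulVec_mulVec, matA, ← mul_assoc, Matrix.mul_adjugate, Matrix.smul_mul, one_mul,
    Matrix.smul_mulVec]

theorem det₂_mulVec (M : Matrix (Fin 2) (Fin 2) ℂ) (r s : Fin 2 → ℂ) :
    det₂ (M.mulVec r) (M.mulVec s) = M.det * det₂ r s := by
  simp only [det₂_apply, Matrix.mulVec, dotProduct, Fin.sum_univ_two, Matrix.det_fin_two]
  ring

variable [FiniteDimensional ℂ X] (H : IsGeneral e p q b) (hpq : p + q = finrank ℂ X) (hp : 2 ≤ p)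

theorem IsGeneral.pencil_P (a) : (H.pencil hpq hp).P a = (matP e p q b).mulVec a :=
  (matP_mulVec e p q b a).symm

theorem IsGeneral.pencil_Q (a) : (H.pencil hpq hp).Q a = (matQ e p q b).mulVec a :=
  (matQ_mulVec e p q b a).symm

theorem IsGeneral.pencil_F₃' :
    (H.pencil hpq hp).F₃' = (CompleteFlag.ofBasis (b 2)).sub (q + 2) := by
  change (CompleteFlag.ofBasis (b 2)).sub q ⊔ LinearMap.range (gv q b) = _
  rw [sub_succ, sub_succ, gv, Fintype.range_linearCombination, sup_assoc]
  congr 1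
  rw [← Submodule.span_union]
  congr 1
  ext u
  simp [Fin.exists_fin_two, eq_comm, or_comm]

theorem IsGeneral.eigen (H : IsGeneral e p q b) {β : ℂ} (hβ : IsRoot e p q b β) :
    (H.pencil hpq hp).P (eigvec e p q b β) =
      (β / (matQ e p q b).det) • (H.pencil hpq hp).Q (eigvec e p q b β) := by
  rw [H.pencil_P hpq hp, H.pencil_Q hpq hp]
  have h := matQ_mulVec_matA (e := e) (p := p) (q := q) (b := b) (eigvec e p q b β)
  rw [matA_mulVec_eigvec hβ, Matrix.mulVec_smul] at h
  rw [div_eq_inv_mul, mul_smul, h, inv_smul_smul₀ H.Q_ne]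

/-- The root is α det Q. Since the entry 0 1 of the matrix is nonzero, the first row of the
eigenvector equation determines a from its nonzero entry a 0, up to the stated scalar. -/
theorem IsGeneral.exists_root (H : IsGeneral e p q b) {a : Fin 2 → ℂ} {α : ℂ} (ha : a ≠ 0)
    (hα : (H.pencil hpq hp).P a = α • (H.pencil hpq hp).Q a) :
    ∃ β, IsRoot e p q b β ∧ ∃ c : ℂ, c ≠ 0 ∧ a = c • eigvec e p q b β := by
  rw [H.pencil_P hpq hp, H.pencil_Q hpq hp] at hα
  have hA : (matA e p q b).mulVec a = (α * (matQ e p q b).det) • a := by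
    rw [matA, ← Matrix.mulVec_mulVec, hα, Matrix.mulVec_smul, Matrix.mulVec_mulVec,
      Matrix.adjugate_mul, Matrix.smul_mulVec, Matrix.one_mulVec, smul_smul]
  set β := α * (matQ e p q b).det
  have h0 := congrFun hA 0
  have h1 := congrFun hA 1
  simp only [Matrix.mulVec, dotProduct, Fin.sum_univ_two, Pi.smul_apply, smul_eq_mul] at h0 h1
  have hA01 := H.A_ne
  have ha0 : a 0 ≠ 0 := by
    intro h00
    rw [h00] at h0
    have : a 1 = 0 := by
      have : matA e p q b 0 1 * a 1 = 0 := by linear_combination h0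
      exact (mul_eq_zero.1 this).resolve_left hA01
    exact ha (by ext i; fin_cases i <;> simp [h00, this])
  refine ⟨β, ?_, a 0 / matA e p q b 0 1, div_ne_zero ha0 hA01, ?_⟩
  · rw [IsRoot, Matrix.trace_fin_two, Matrix.det_fin_two]
    apply mul_left_cancel₀ ha0
    linear_combination (β - matA e p q b 1 1) * (-h0) - matA e p q b 0 1 * h1
  · ext i
    fin_cases i
    · simp [eigvec, hA01]
    · simp only [eigvec, Fin.mk_one, Pi.smul_apply, Matrix.cons_val_one, smul_eq_mul,
        Matrix.cons_val_fin_one]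
      field_simp
      linear_combination h0

/-- From β Q a = det Q • P a one gets β det(Q a, P v) = det Q det(P a, P v) = det Q det P det(a, v)
= det P det(Q a, Q v). This provides the coefficients β and det P for the equation of C + V in
`Pencil.mem_C_sup_V`. -/
theorem IsGeneral.form_x_eq (H : IsGeneral e p q b) {β : ℂ} (hβ : IsRoot e p q b β) (v) :
    β * (H.pencil hpq hp).η (eigvec e p q b β) ((H.pencil hpq hp).x v) =
      (matP e p q b).det * (H.pencil hpq hp).η (eigvec e p q b β) ((H.pencil hpq hp).y v) := by
  rw [Pencil.η_apply, Pencil.η_apply, Pencil.ξ_x, Pencil.ξ_y]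
  have h := H.eigen hpq hp hβ
  rw [H.pencil_P hpq hp, H.pencil_Q hpq hp] at h
  rw [H.pencil_P hpq hp, H.pencil_Q hpq hp, H.pencil_Q hpq hp, det₂_mulVec]
  have h' : β • (matQ e p q b).mulVec (eigvec e p q b β) =
      (matQ e p q b).det • (matP e p q b).mulVec (eigvec e p q b β) := by
    rw [h, smul_smul, mul_div_cancel₀ _ H.Q_ne]
  have h2 := det₂_mulVec (matP e p q b) (eigvec e p q b β) v
  have h3 : β * det₂ ((matQ e p q b).mulVec (eigvec e p q b β)) ((matP e p q b).mulVec v) =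
      (matQ e p q b).det *
        det₂ ((matP e p q b).mulVec (eigvec e p q b β)) ((matP e p q b).mulVec v) := by
    have e0 := congrFun h' 0
    have e1 := congrFun h' 1
    simp only [Pi.smul_apply, smul_eq_mul] at e0 e1
    simp only [det₂_apply]
    linear_combination e0 * (matP e p q b).mulVec v 1 - e1 * (matP e p q b).mulVec v 0
  rw [h3, h2]
  ring

end eigen

end SchubertFib

end

noncomputable section

namespace SchubertFib

open Module

/-! ### Open conditions imposed at every root. -/

section items

variable {X : Type} [AddCommGroup X] [Module ℂ X] (e : Basis (Fin (finrank ℂ X)) ℂ X)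
  (p q : ℕ) (b : Fin 4 → Basis (Fin (finrank ℂ X)) ℂ X) (β : ℂ)

/-- The vector in the first subspace of the transversal for `β`. -/
def eigX : X := pi₁ e p b (gv q b (eigvec e p q b β))
/-- The vector in the second subspace of the transversal for `β`. -/
def eigY : X := pi₂ e p b (gv q b (eigvec e p q b β))
-- The form `Pencil.η` written for bases, so that it is visibly polynomial in the bases and β.
def eta : X →ₗ[ℂ] ℂ := det₂ (xi e b (eigY e p q b β)) ∘ₗ xi e b
/-- The equations of the space of solutions belonging to the transversal for `β`. -/
def etas : Fin 3 → X →ₗ[ℂ] ℂ :=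
  ![eta e p q b β, eta e p q b β ∘ₗ pi₁ e p b, eta e p q b β ∘ₗ pi₂ e p b]
-- The equation of C + V; the coefficients are those of `IsGeneral.form_x_eq`.
def omega : X →ₗ[ℂ] ℂ :=
  β • (eta e p q b β ∘ₗ pi₁ e p b) - (matP e p q b).det • (eta e p q b β ∘ₗ pi₂ e p b)

/-- The flags are in general position with respect to the transversal for `β`. -/
structure EdgeCond : Prop where
  fst_fst : crd e (b 0) (p - 1) (eigX e p q b β) ≠ 0
  snd_snd : crd e (b 1) (p - 1) (eigY e p q b β) ≠ 0
  fst : crd e (b 0) (finrank ℂ X - 1) (eigY e p q b β) ≠ 0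
  snd : crd e (b 1) (finrank ℂ X - 1) (eigX e p q b β) ≠ 0
  trd : crd e (b 2) (q - 1) (eigX e p q b β - eigY e p q b β) ≠ 0
  fth : crd e (b 3) (finrank ℂ X - 3)
    ((matQ e p q b).det • eigX e p q b β - β • eigY e p q b β) ≠ 0

theorem edgeCond_iff {e : Basis (Fin (finrank ℂ X)) ℂ X}
    {p q : ℕ} {b : Fin 4 → Basis (Fin (finrank ℂ X)) ℂ X} {β : ℂ} : EdgeCond e p q b β ↔
    crd e (b 0) (p - 1) (eigX e p q b β) ≠ 0 ∧
    crd e (b 1) (p - 1) (eigY e p q b β) ≠ 0 ∧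
    crd e (b 0) (finrank ℂ X - 1) (eigY e p q b β) ≠ 0 ∧
    crd e (b 1) (finrank ℂ X - 1) (eigX e p q b β) ≠ 0 ∧
    crd e (b 2) (q - 1) (eigX e p q b β - eigY e p q b β) ≠ 0 ∧
    crd e (b 3) (finrank ℂ X - 3)
      ((matQ e p q b).det • eigX e p q b β - β • eigY e p q b β) ≠ 0 :=
  ⟨fun ⟨h1, h2, h3, h4, h5, h6⟩ => ⟨h1, h2, h3, h4, h5, h6⟩,
    fun ⟨h1, h2, h3, h4, h5, h6⟩ => ⟨h1, h2, h3, h4, h5, h6⟩⟩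

end items

section mem

variable {X : Type} [AddCommGroup X] [Module ℂ X] {e : Basis (Fin (finrank ℂ X)) ℂ X}
  {Ω : Type} {S : Subalgebra ℂ (Ω → ℂ)} {p q : ℕ}
  {b : Ω → Fin 4 → Basis (Fin (finrank ℂ X)) ℂ X} {β : Ω → ℂ}

theorem det₂_mem {r s : Ω → Fin 2 → ℂ} (hr : ∀ i, (fun ω => r ω i) ∈ S)
    (hs : ∀ i, (fun ω => s ω i) ∈ S) : (fun ω => det₂ (r ω) (s ω)) ∈ S :=
  mem_of_eq_sub (mul_mem (hr 0) (hs 1)) (mul_mem (hr 1) (hs 0)) fun _ => det₂_apply _ _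

theorem HasCoordsIn.gv (hb : ∀ i k, HasCoordsIn e S (fun ω => bv (b ω i) k)) {a : Ω → Fin 2 → ℂ}
    (ha : ∀ i, (fun ω => a ω i) ∈ S) : HasCoordsIn e S (fun ω => gv q (b ω) (a ω)) := by
  simp only [SchubertFib.gv, Fintype.linearCombination_apply]
  exact HasCoordsIn.sum _ fun k _ => HasCoordsIn.smul (ha k) (hb _ _)

theorem eigvec_mem (hb : ∀ i k, HasCoordsIn e S (fun ω => bv (b ω i) k)) (hβ : β ∈ S) (i) :
    (fun ω => eigvec e p q (b ω) (β ω) i) ∈ S := by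
  fin_cases i
  · exact matA_mem hb 0 1
  · exact mem_of_eq_sub hβ (matA_mem (p := p) (q := q) hb 0 0) fun _ => rfl

theorem HasCoordsIn.eigX (hb : ∀ i k, HasCoordsIn e S (fun ω => bv (b ω i) k)) (hβ : β ∈ S) :
    HasCoordsIn e S (fun ω => eigX e p q (b ω) (β ω)) :=
  HasCoordsIn.pi₁ hb (HasCoordsIn.gv hb fun i => eigvec_mem hb hβ i)

theorem HasCoordsIn.eigY (hb : ∀ i k, HasCoordsIn e S (fun ω => bv (b ω i) k)) (hβ : β ∈ S) :
    HasCoordsIn e S (fun ω => eigY e p q (b ω) (β ω)) :=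
  HasCoordsIn.pi₂ hb (HasCoordsIn.gv hb fun i => eigvec_mem hb hβ i)

theorem eta_mem (hb : ∀ i k, HasCoordsIn e S (fun ω => bv (b ω i) k)) (hβ : β ∈ S) {u : Ω → X}
    (hu : HasCoordsIn e S u) : (fun ω => eta e p q (b ω) (β ω) (u ω)) ∈ S :=
  det₂_mem (fun i => xi_mem hb (HasCoordsIn.eigY hb hβ) i) (fun i => xi_mem hb hu i)

theorem etas_mem (hb : ∀ i k, HasCoordsIn e S (fun ω => bv (b ω i) k)) (hβ : β ∈ S) {u : Ω → X}
    (hu : HasCoordsIn e S u) (i) : (fun ω => etas e p q (b ω) (β ω) i (u ω)) ∈ S := by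
  fin_cases i
  · exact eta_mem hb hβ hu
  · exact eta_mem hb hβ (HasCoordsIn.pi₁ hb hu)
  · exact eta_mem hb hβ (HasCoordsIn.pi₂ hb hu)

theorem omega_mem (hb : ∀ i k, HasCoordsIn e S (fun ω => bv (b ω i) k)) (hβ : β ∈ S) {u : Ω → X}
    (hu : HasCoordsIn e S u) : (fun ω => omega e p q (b ω) (β ω) (u ω)) ∈ S :=
  mem_of_eq_sub (mul_mem hβ (eta_mem (p := p) (q := q) hb hβ (HasCoordsIn.pi₁ (p := p) hb hu)))
    (mul_mem (det_two_mem fun i j => matP_mem (p := p) (q := q) hb i j)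
      (eta_mem (p := p) (q := q) hb hβ (HasCoordsIn.pi₂ (p := p) hb hu))) fun _ => rfl

end mem

section rootOpen

variable {X : Type} [AddCommGroup X] [Module ℂ X] {e : Basis (Fin (finrank ℂ X)) ℂ X}
  {ι : Type} {p q : ℕ}
  {b : (ι → Basis (Fin (finrank ℂ X)) ℂ X) → Fin 4 → Basis (Fin (finrank ℂ X)) ℂ X}

/-- The algebra of functions of a tuple of bases and of a root. -/
def rootPoly (hb : ∀ i k, HasCoordsIn e (polyFun (ι := ι) e) (fun B => bv (b B i) k)) (p q : ℕ) :=
  rootFun (polyFun (ι := ι) e) (trace_mem (p := p) (q := q) hb) (det_matA_mem (p := p) (q := q) hb)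

/-- The root is not a function of the bases, but the product of the values at the two roots is a
polynomial in the bases, and it is nonzero exactly when no value vanishes. -/
theorem isBasicOpen_forall_root
    (hb : ∀ i k, HasCoordsIn e (polyFun (ι := ι) e) (fun B => bv (b B i) k))
    {g : (ι → Basis (Fin (finrank ℂ X)) ℂ X) → ℂ → ℂ}
    (hg : (fun z => g z.1.1 z.1.2) ∈ rootPoly hb p q) :
    IsBasicOpen e {B | ∀ β, IsRoot e p q (b B) β → g B β ≠ 0} := by
  obtain ⟨f, hf, h⟩ := exists_norm _ _ hg
  exact ⟨f, hf, fun B => (h B).symm⟩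

theorem HasCoordsIn.rootPoly
    (hb : ∀ i k, HasCoordsIn e (polyFun (ι := ι) e) (fun B => bv (b B i) k))
    {u : (ι → Basis (Fin (finrank ℂ X)) ℂ X) → X} (hu : HasCoordsIn e (polyFun (ι := ι) e) u) :
    HasCoordsIn e (rootPoly hb p q) (fun z => u z.1.1) :=
  fun j => comp_mem_rootFun _ _ (hu j)

theorem IsBasicOpen.forall_and {P Q : (ι → Basis (Fin (finrank ℂ X)) ℂ X) → ℂ → Prop}
    (hP : IsBasicOpen e {B | ∀ β, IsRoot e p q (b B) β → P B β})
    (hQ : IsBasicOpen e {B | ∀ β, IsRoot e p q (b B) β → Q B β}) :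
    IsBasicOpen e {B | ∀ β, IsRoot e p q (b B) β → P B β ∧ Q B β} :=
  (hP.and hQ).congr fun _ => ⟨fun h => ⟨fun β hβ => (h β hβ).1, fun β hβ => (h β hβ).2⟩,
    fun h β hβ => ⟨h.1 β hβ, h.2 β hβ⟩⟩

theorem IsBasicOpen.forall_root_congr {P Q : (ι → Basis (Fin (finrank ℂ X)) ℂ X) → ℂ → Prop}
    (hP : IsBasicOpen e {B | ∀ β, IsRoot e p q (b B) β → P B β}) (h : ∀ B β, Q B β ↔ P B β) :
    IsBasicOpen e {B | ∀ β, IsRoot e p q (b B) β → Q B β} :=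
  hP.congr fun _ => forall_congr' fun _ => imp_congr Iff.rfl (h _ _)

theorem root_mem_rootPoly
    (hb : ∀ i k, HasCoordsIn e (polyFun (ι := ι) e) (fun B => bv (b B i) k)) :
    (fun z => z.1.2) ∈ rootPoly hb p q := root_mem_rootFun _ _

theorem isBasicOpen_edgeCond
    (hb : ∀ i k, HasCoordsIn e (polyFun (ι := ι) e) (fun B => bv (b B i) k)) :
    IsBasicOpen e {B | ∀ β, IsRoot e p q (b B) β → EdgeCond e p q (b B) β} := by
  have hb' := fun i k => HasCoordsIn.rootPoly (p := p) (q := q) hb (hb i k)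
  have hβ := root_mem_rootPoly (p := p) (q := q) hb
  have hX := HasCoordsIn.eigX (p := p) (q := q) hb' hβ
  have hY := HasCoordsIn.eigY (p := p) (q := q) hb' hβ
  have hQ := det_two_mem fun i j => matQ_mem (p := p) (q := q) hb' i j
  have h1 := isBasicOpen_forall_root (g := fun B β => crd e (b B 0) (finrank ℂ X - 1)
    (eigY e p q (b B) β)) hb (HasCoordsIn.crd (hb' 0) hY _)
  have h2 := isBasicOpen_forall_root (g := fun B β => crd e (b B 1) (finrank ℂ X - 1)
    (eigX e p q (b B) β)) hb (HasCoordsIn.crd (hb' 1) hX _)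
  have h3 := isBasicOpen_forall_root (g := fun B β => crd e (b B 2) (q - 1)
    (eigX e p q (b B) β - eigY e p q (b B) β)) hb (HasCoordsIn.crd (hb' 2) (hX.sub hY) _)
  have h4 := isBasicOpen_forall_root (g := fun B β => crd e (b B 3) (finrank ℂ X - 3)
    ((matQ e p q (b B)).det • eigX e p q (b B) β - β • eigY e p q (b B) β)) hb
    (HasCoordsIn.crd (hb' 3) ((HasCoordsIn.smul hQ hX).sub (HasCoordsIn.smul hβ hY)) _)
  have h5 := isBasicOpen_forall_root (g := fun B β => crd e (b B 0) (p - 1)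
    (eigX e p q (b B) β)) hb (HasCoordsIn.crd (hb' 0) hX _)
  have h6 := isBasicOpen_forall_root (g := fun B β => crd e (b B 1) (p - 1)
    (eigY e p q (b B) β)) hb (HasCoordsIn.crd (hb' 1) hY _)
  exact (h5.forall_and (h6.forall_and (h1.forall_and (h2.forall_and (h3.forall_and
    h4))))).forall_root_congr fun B β => edgeCond_iff

theorem IsBasicOpen.forall_imp {κ : Type} [Fintype κ] {c : κ → Prop}
    {P : κ → (ι → Basis (Fin (finrank ℂ X)) ℂ X) → ℂ → Prop}
    (h : ∀ k, c k → IsBasicOpen e {B | ∀ β, IsRoot e p q (b B) β → P k B β}) :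
    IsBasicOpen e {B | ∀ β, IsRoot e p q (b B) β → ∀ k, c k → P k B β} := by
  have h' : ∀ k, IsBasicOpen e {B | c k → ∀ β, IsRoot e p q (b B) β → P k B β} := by
    intro k
    by_cases hk : c k
    · exact (h k hk).congr fun B => by simp [hk]
    · exact ⟨1, one_mem _, fun B => by simp [hk]⟩
  obtain ⟨f, hf, hW⟩ := IsBasicOpen.iInter h'
  refine ⟨f, hf, fun B => ?_⟩
  rw [← hW B]
  simp only [Set.mem_ofPred_eq, Set.mem_iInter]
  exact ⟨fun h k hk β hβ => h β hβ k hk, fun h β hβ k hk => h k hk β hβ⟩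

end rootOpen

/-! ### The open set of instances -/

section instances

variable {X : Type} [AddCommGroup X] [Module ℂ X] (e : Basis (Fin (finrank ℂ X)) ℂ X)
  (p q : ℕ) {t : ℕ} (B : Fin (4 + t) → Basis (Fin (finrank ℂ X)) ℂ X) (β : ℂ)

/-- The first four bases. -/
def quad : Fin 4 → Basis (Fin (finrank ℂ X)) ℂ X := fun k => B (Fin.castAdd t k)

/-- The flags are in general position with respect to the transversal for `β` and the space of
solutions belonging to it. -/
structure RootCond : Prop where
  edge : EdgeCond e p q (quad B) β
  line : ∀ i, i ≠ Fin.castAdd t 2 → omega e p q (quad B) β (bv (B i) 0) ≠ 0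
  -- Ensures that C + V is not everything. The member of index q + 2 of the third flag lies in C +
  -- V, so its next basis vector is the first candidate.
  line₃ : omega e p q (quad B) β (bv (quad B 2) (q + 2)) ≠ 0
  -- The three equations of C are independent on the member of dimension 6. The indices 0, 3, 5 are
  -- those for which this can be checked in the instance constructed later: one lifted vector and
  -- two vectors of V.
  six : ∀ k : Fin 4, (k : ℕ) < 2 → Matrix.det (Matrix.of fun i j : Fin 3 =>
    etas e p q (quad B) β i (bv (quad B k) (![0, 3, 5] j))) ≠ 0
  -- On the q-dimensional member of the third flag, where both projections vanish, only one equation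
  -- of C is left; on the fourth flag, up to codimension 2, the other two are.
  one : etas e p q (quad B) β 0 (bv (quad B 2) 0) ≠ 0
  two : Matrix.det (Matrix.of fun i j : Fin 2 =>
    etas e p q (quad B) β i.succ (bv (quad B 3) j)) ≠ 0
  three : ∀ i : Fin t, Matrix.det (Matrix.of fun k j : Fin 3 =>
    etas e p q (quad B) β k (bv (B (Fin.natAdd 4 i)) j)) ≠ 0
  last : ∀ i : Fin t, Matrix.det (Matrix.of fun k j : Fin 2 =>
    crd e (B (Fin.natAdd 4 i)) (finrank ℂ X - 2 + k)
      (![eigX e p q (quad B) β, eigY e p q (quad B) β] j)) ≠ 0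

theorem isBasicOpen_rootCond : IsBasicOpen e {B : Fin (4 + t) → Basis (Fin (finrank ℂ X)) ℂ X |
    IsGeneral e p q (quad B) ∧ ∀ β, IsRoot e p q (quad B) β → RootCond e p q B β} := by
  have hB : ∀ i k, HasCoordsIn e (polyFun (ι := Fin (4 + t)) e) (fun B => bv (B i) k) :=
    fun i k => hasCoordsIn_polyFun _ _
  have hb : ∀ i k, HasCoordsIn e (polyFun (ι := Fin (4 + t)) e) (fun B => bv (quad B i) k) :=
    fun i k => hasCoordsIn_polyFun _ _
  have hb' := fun i k => HasCoordsIn.rootPoly (p := p) (q := q) hb (hb i k)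
  have hB' := fun i k => HasCoordsIn.rootPoly (p := p) (q := q) hb (hB i k)
  have hβ := root_mem_rootPoly (p := p) (q := q) hb
  have hX := HasCoordsIn.eigX (p := p) (q := q) hb' hβ
  have hY := HasCoordsIn.eigY (p := p) (q := q) hb' hβ
  have h1 := isBasicOpen_edgeCond (p := p) (q := q) hb
  have h2 : IsBasicOpen e {B : Fin (4 + t) → Basis (Fin (finrank ℂ X)) ℂ X |
      ∀ β, IsRoot e p q (quad B) β → ∀ i, i ≠ Fin.castAdd t 2 →
        omega e p q (quad B) β (bv (B i) 0) ≠ 0} :=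
    IsBasicOpen.forall_imp fun i _ => isBasicOpen_forall_root
      (g := fun B β => omega e p q (quad B) β (bv (B i) 0)) hb (omega_mem hb' hβ (hB' i 0))
  have h3 := isBasicOpen_forall_root (g := fun B β => omega e p q (quad B) β
    (bv (quad B 2) (q + 2))) hb (omega_mem hb' hβ (hb' 2 (q + 2)))
  have h4 : IsBasicOpen e {B : Fin (4 + t) → Basis (Fin (finrank ℂ X)) ℂ X |
      ∀ β, IsRoot e p q (quad B) β → ∀ k : Fin 4, (k : ℕ) < 2 →
        Matrix.det (Matrix.of fun i j : Fin 3 =>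
          etas e p q (quad B) β i (bv (quad B k) (![0, 3, 5] j))) ≠ 0} :=
    IsBasicOpen.forall_imp fun k _ => isBasicOpen_forall_root
      (g := fun B β => Matrix.det (Matrix.of fun i j : Fin 3 =>
          etas e p q (quad B) β i (bv (quad B k) (![0, 3, 5] j)))) hb
      (det_mem fun i j => etas_mem hb' hβ (hb' k _) i)
  have h5 := isBasicOpen_forall_root (g := fun B β => etas e p q (quad B) β 0
    (bv (quad B 2) 0)) hb (etas_mem hb' hβ (hb' 2 _) 0)
  have h6 := isBasicOpen_forall_root (g := fun B β => Matrix.det (Matrix.of fun i j : Fin 2 =>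
    etas e p q (quad B) β i.succ (bv (quad B 3) j))) hb
      (det_mem fun i j => etas_mem hb' hβ (hb' 3 _) i.succ)
  have h7 : IsBasicOpen e {B : Fin (4 + t) → Basis (Fin (finrank ℂ X)) ℂ X |
      ∀ β, IsRoot e p q (quad B) β → ∀ k : Fin t, True →
        Matrix.det (Matrix.of fun i j : Fin 3 =>
          etas e p q (quad B) β i (bv (B (Fin.natAdd 4 k)) j)) ≠ 0} :=
    IsBasicOpen.forall_imp fun k _ => isBasicOpen_forall_root
      (g := fun B β => Matrix.det (Matrix.of fun i j : Fin 3 =>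
          etas e p q (quad B) β i (bv (B (Fin.natAdd 4 k)) j))) hb
      (det_mem fun i j => etas_mem hb' hβ (hB' _ _) i)
  have h8 : IsBasicOpen e {B : Fin (4 + t) → Basis (Fin (finrank ℂ X)) ℂ X |
      ∀ β, IsRoot e p q (quad B) β → ∀ i : Fin t, True →
        Matrix.det (Matrix.of fun k j : Fin 2 =>
          crd e (B (Fin.natAdd 4 i)) (finrank ℂ X - 2 + k)
            (![eigX e p q (quad B) β, eigY e p q (quad B) β] j)) ≠ 0} := by
    refine IsBasicOpen.forall_imp fun i _ => isBasicOpen_forall_root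
      (g := fun B β => Matrix.det (Matrix.of fun k j : Fin 2 =>
          crd e (B (Fin.natAdd 4 i)) (finrank ℂ X - 2 + k)
            (![eigX e p q (quad B) β, eigY e p q (quad B) β] j))) hb
      (det_mem fun k j => ?_)
    fin_cases j
    · exact HasCoordsIn.crd (hB' (Fin.natAdd 4 i)) hX _
    · exact HasCoordsIn.crd (hB' (Fin.natAdd 4 i)) hY _
  refine (isBasicOpen_isGeneral hb).and ?_
  refine (h1.forall_and (h2.forall_and (h3.forall_and (h4.forall_and (h5.forall_and (h6.forall_and
    (h7.forall_and h8))))))).forall_root_congr fun B β => ?_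
  exact ⟨fun ⟨h1, h2, h3, h4, h5, h6, h7, h8⟩ =>
      ⟨h1, h2, h3, h4, h5, h6, fun i _ => h7 i, fun i _ => h8 i⟩,
    fun ⟨h1, h2, h3, h4, h5, h6, h7, h8⟩ =>
      ⟨h1, h2, h3, h4, h5, h6, fun i => h7 i trivial, fun i => h8 i trivial⟩⟩

/-- General quadruples of bases of a four-dimensional space. -/
structure IsGeneralQuad (b : Fin 4 → Basis (Fin (finrank ℂ X)) ℂ X) : Prop where
  general : IsGeneral e 2 2 b
  -- The two transversals are distinct, so that together they give a basis of the space.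
  disc : (matA e 2 2 b).trace ^ 2 - 4 * (matA e 2 2 b).det ≠ 0
  edge : ∀ β, IsRoot e 2 2 b β → EdgeCond e 2 2 b β

theorem isBasicOpen_isGeneralQuad :
    IsBasicOpen e {b : Fin 4 → Basis (Fin (finrank ℂ X)) ℂ X | IsGeneralQuad e b} := by
  have hb : ∀ i k, HasCoordsIn e (polyFun (ι := Fin 4) e)
      (fun b : Fin 4 → Basis (Fin (finrank ℂ X)) ℂ X => bv (id b i) k) :=
    fun i k => hasCoordsIn_polyFun _ _
  have h1 := isBasicOpen_isGeneral (p := 2) (q := 2) hb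
  have h2 := IsBasicOpen.of_mem (mem_of_eq_sub
    (f := fun b => (matA e 2 2 (id b)).trace ^ 2 - 4 * (matA e 2 2 (id b)).det)
    (pow_mem (trace_mem (p := 2) (q := 2) hb) 2)
    ((polyFun (ι := Fin 4) e).smul_mem (det_matA_mem (p := 2) (q := 2) hb) 4) fun _ => rfl)
  have h3 := isBasicOpen_edgeCond (p := 2) (q := 2) hb
  exact (h1.and (h2.and h3)).congr fun b => ⟨fun ⟨h1, h2, h3⟩ => ⟨h1, h2, h3⟩,
    fun ⟨h1, h2, h3⟩ => ⟨h1, h2, h3⟩⟩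

end instances

end SchubertFib

end

noncomputable section

namespace SchubertFib

open Module

/-! ### Dimensions -/

section dims

variable {Y : Type} [AddCommGroup Y] [Module ℂ Y] {Z : Type} [AddCommGroup Z] [Module ℂ Z]

theorem finrank_map_add_finrank_inf_ker [FiniteDimensional ℂ Y] (f : Y →ₗ[ℂ] Z)
    (A : Submodule ℂ Y) :
    finrank ℂ (A.map f) + finrank ℂ ↥(A ⊓ LinearMap.ker f) = finrank ℂ A := by
  have h := LinearMap.finrank_range_add_finrank_ker (f ∘ₗ A.subtype)
  have h2 : finrank ℂ (LinearMap.ker (f ∘ₗ A.subtype)) = finrank ℂ ↥(A ⊓ LinearMap.ker f) := by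
    rw [← Submodule.finrank_map_subtype_eq A (LinearMap.ker (f ∘ₗ A.subtype)),
      LinearMap.ker_comp, Submodule.map_comap_subtype]
  have h3 : LinearMap.range (f ∘ₗ A.subtype) = A.map f := by
    rw [LinearMap.range_comp, Submodule.range_subtype]
  rw [h2, h3] at h
  exact h

theorem finrank_map_mkQ_add [FiniteDimensional ℂ Y] (V A : Submodule ℂ Y) :
    finrank ℂ (A.map V.mkQ) + finrank ℂ ↥(A ⊓ V) = finrank ℂ A := by
  have := finrank_map_add_finrank_inf_ker V.mkQ A
  rwa [Submodule.ker_mkQ] at this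

theorem finrank_add_le_inf_add [FiniteDimensional ℂ Y] {A B W : Submodule ℂ Y} (hA : A ≤ W)
    (hB : B ≤ W) : finrank ℂ A + finrank ℂ B ≤ finrank ℂ ↥(A ⊓ B) + finrank ℂ W := by
  have h := Submodule.finrank_sup_add_finrank_inf_eq A B
  have h2 := Submodule.finrank_mono (sup_le hA hB)
  omega

theorem finrank_map_add_le [FiniteDimensional ℂ Y] (f : Y →ₗ[ℂ] Z) {A B : Submodule ℂ Y}
    (h : A ≤ B) : finrank ℂ (B.map f) + finrank ℂ A ≤ finrank ℂ (A.map f) + finrank ℂ B := by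
  have h1 := finrank_map_add_finrank_inf_ker f A
  have h2 := finrank_map_add_finrank_inf_ker f B
  have h3 := Submodule.finrank_mono (inf_le_inf_right (LinearMap.ker f) h)
  omega

theorem finrank_sup_add_le [FiniteDimensional ℂ Y] (L : Submodule ℂ Y) {A B : Submodule ℂ Y}
    (h : A ≤ B) : finrank ℂ ↥(B ⊔ L) + finrank ℂ A ≤ finrank ℂ ↥(A ⊔ L) + finrank ℂ B := by
  have h1 := Submodule.finrank_sup_add_finrank_inf_eq (A ⊔ L) B
  have h2 : A ⊔ L ⊔ B = B ⊔ L := by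
    rw [sup_right_comm, sup_eq_right.2 h]
  have h3 := Submodule.finrank_mono (le_inf (le_sup_left (b := L)) h)
  rw [h2] at h1
  omega

theorem CompleteFlag.sub_eq_top [FiniteDimensional ℂ Y] (F : CompleteFlag Y) {j : ℕ}
    (hj : finrank ℂ Y ≤ j) : F.sub j = ⊤ := by
  have h : F.sub (finrank ℂ Y) = ⊤ := Submodule.eq_top_of_finrank_eq (F.finrank_sub _ le_rfl)
  exact top_le_iff.1 (h ▸ F.mono hj)

theorem CompleteFlag.sub_zero [FiniteDimensional ℂ Y] (F : CompleteFlag Y) : F.sub 0 = ⊥ :=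
  Submodule.finrank_eq_zero.1 (F.finrank_sub 0 (Nat.zero_le _))

theorem CompleteFlag.finrank_sub_eq [FiniteDimensional ℂ Y] (F : CompleteFlag Y) (j : ℕ) :
    finrank ℂ (F.sub j) = min j (finrank ℂ Y) := by
  rcases le_total j (finrank ℂ Y) with h | h
  · rw [F.finrank_sub j h, min_eq_left h]
  · rw [F.sub_eq_top h, finrank_top, min_eq_right h]

theorem CompleteFlag.finrank_inf_le [FiniteDimensional ℂ Y] (F : CompleteFlag Y)
    (A : Submodule ℂ Y) {m n : ℕ} (h : m ≤ n) :
    finrank ℂ ↥(A ⊓ F.sub n) + m ≤ finrank ℂ ↥(A ⊓ F.sub m) + n := by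
  have h1 := finrank_add_le_inf_add (A := A ⊓ F.sub n) (B := F.sub m) inf_le_right (F.mono h)
  rw [inf_assoc, inf_eq_right.2 (F.mono h), F.finrank_sub_eq, F.finrank_sub_eq] at h1
  omega

end dims

/-! ### The complete flag of a chain of subspaces -/

section chains

variable {Y : Type} [AddCommGroup Y] [Module ℂ Y]

theorem chain_le [FiniteDimensional ℂ Y] {S : ℕ → Submodule ℂ Y} (hS : Monotone S) {m n : ℕ}
    (h : finrank ℂ (S m) ≤ finrank ℂ (S n)) : S m ≤ S n := by
  rcases le_total m n with hmn | hmn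
  · exact hS hmn
  · exact (Submodule.eq_of_le_of_finrank_le (hS hmn) h).ge

theorem chain_eq [FiniteDimensional ℂ Y] {S : ℕ → Submodule ℂ Y} (hS : Monotone S) {m n : ℕ}
    (h : finrank ℂ (S m) = finrank ℂ (S n)) : S m = S n :=
  le_antisymm (chain_le hS h.le) (chain_le hS h.ge)

open Classical in
/-- The complete flag with subspaces in the chain `S` (if there is one). -/
def flagOfChain [FiniteDimensional ℂ Y] (S : ℕ → Submodule ℂ Y) : CompleteFlag Y :=
  if h : ∃ G : CompleteFlag Y, ∀ j, ∃ n, G.sub j = S n then h.choose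
  else CompleteFlag.ofBasis (finBasis ℂ Y)

/-- Members of a chain are determined by their dimension, so at most one complete flag has its
members in the chain. -/
theorem flagOfChain_eq [FiniteDimensional ℂ Y] {S : ℕ → Submodule ℂ Y} (hS : Monotone S)
    (G : CompleteFlag Y) (hG : ∀ j ≤ finrank ℂ Y, ∃ n, G.sub j = S n) : flagOfChain S = G := by
  have h : ∃ G : CompleteFlag Y, ∀ j, ∃ n, G.sub j = S n := by
    refine ⟨G, fun j => ?_⟩
    rcases le_total j (finrank ℂ Y) with hj | hj
    · exact hG j hj
    · rw [G.sub_eq_top hj, ← G.sub_eq_top le_rfl]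
      exact hG _ le_rfl
  rw [flagOfChain, dif_pos h]
  ext1
  funext j
  rcases le_total j (finrank ℂ Y) with hj | hj
  · obtain ⟨m, hm⟩ := h.choose_spec j
    obtain ⟨n, hn⟩ := hG j hj
    rw [hm, hn]
    apply chain_eq hS
    rw [← hm, ← hn, CompleteFlag.finrank_sub _ _ hj, CompleteFlag.finrank_sub _ _ hj]
  · rw [G.sub_eq_top hj, CompleteFlag.sub_eq_top _ hj]

/-- A chain from zero to the whole space whose dimension grows by at most one at each step takes
every dimension, so a complete flag can be picked from it. -/
theorem flagOfChain_sub [FiniteDimensional ℂ Y] {S : ℕ → Submodule ℂ Y} (hS : Monotone S)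
    (h0 : S 0 = ⊥) {N : ℕ} (hN : S N = ⊤)
    (hstep : ∀ n, finrank ℂ (S (n + 1)) ≤ finrank ℂ (S n) + 1) (n : ℕ) :
    (flagOfChain S).sub (finrank ℂ (S n)) = S n := by
  have hex : ∀ j ≤ finrank ℂ Y, ∃ n, finrank ℂ (S n) = j := by
    intro j
    induction j with
    | zero => exact fun _ => ⟨0, by rw [h0, finrank_bot]⟩
    | succ j ih =>
      intro hj
      have hex : ∃ n, j + 1 ≤ finrank ℂ (S n) := ⟨N, by rw [hN, finrank_top]; exact hj⟩
      classical
      refine ⟨Nat.find hex, le_antisymm ?_ (Nat.find_spec hex)⟩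
      cases hk : Nat.find hex with
      | zero => rw [h0, finrank_bot]; omega
      | succ k =>
        have := Nat.find_min hex (m := k) (by omega)
        have := hstep k
        omega
  choose! f hf using hex
  let G : CompleteFlag Y :=
    { sub := fun j => S (f (min j (finrank ℂ Y)))
      mono := fun i j hij => chain_le hS (by
        rw [hf _ (min_le_right _ _), hf _ (min_le_right _ _)]
        omega)
      finrank_sub := fun j hj => by rw [min_eq_left hj, hf j hj] }
  rw [flagOfChain_eq hS G fun j _ => ⟨_, rfl⟩]
  apply chain_eq hS
  have := Submodule.finrank_le (S n)
  rw [min_eq_left this, hf _ this]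

end chains

/-! ### The construction -/

section construction

variable {X : Type} [AddCommGroup X] [Module ℂ X]

/-- The traces of the subspaces of a flag in `V`. -/
def chainE (V : Submodule ℂ X) (F : CompleteFlag X) (n : ℕ) : Submodule ℂ V := inter V (F.sub n)

theorem chainE_mono (V : Submodule ℂ X) (F : CompleteFlag X) : Monotone (chainE V F) :=
  fun _ _ h => Submodule.comap_mono (F.mono h)

theorem map_inter (V A : Submodule ℂ X) : (inter V A).map V.subtype = V ⊓ A :=
  Submodule.map_comap_subtype _ _

theorem finrank_inter (V A : Submodule ℂ X) : finrank ℂ (inter V A) = finrank ℂ ↥(V ⊓ A) := by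
  rw [← map_inter, Submodule.finrank_map_subtype_eq]

theorem inter_inf (V A : Submodule ℂ X) (h : Submodule ℂ V) :
    finrank ℂ ↥(h ⊓ inter V A) = finrank ℂ ↥(h.map V.subtype ⊓ A) := by
  rw [← Submodule.finrank_map_subtype_eq, Submodule.map_inf _ V.injective_subtype, map_inter,
    ← inf_assoc, inf_eq_left.2 (Submodule.map_subtype_le V h)]

theorem flagOfChain_chainE_sub [FiniteDimensional ℂ X] (V : Submodule ℂ X) (F : CompleteFlag X)
    (n : ℕ) : (flagOfChain (chainE V F)).sub (finrank ℂ ↥(V ⊓ F.sub n)) = inter V (F.sub n) := by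
  have := flagOfChain_sub (chainE_mono V F) (N := finrank ℂ X)
    (by rw [chainE, F.sub_zero, inter, Submodule.comap_bot, Submodule.ker_subtype])
    (by rw [chainE, F.sub_eq_top le_rfl, inter, Submodule.comap_top]) (fun k => by
      rw [chainE, chainE, finrank_inter, finrank_inter]
      have := F.finrank_inf_le V (Nat.le_add_right k 1)
      omega) n
  rwa [chainE, finrank_inter] at this

/-- The chain in `X / V` induced by `F` via `C`, with the line of `F` inserted after step `c`. -/
def chainQ (V C : Submodule ℂ X) (c : ℕ) (F : CompleteFlag X) (n : ℕ) : Submodule ℂ (X ⧸ V) :=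
  if n ≤ c then (C ⊓ F.sub n).map V.mkQ else (C ⊓ F.sub (n - 1) ⊔ F.sub 1).map V.mkQ

/-- The chain in `X / V` induced by `F` via `C` up to step `c`, and directly afterwards. -/
def chainR (V C : Submodule ℂ X) (c : ℕ) (F : CompleteFlag X) (n : ℕ) : Submodule ℂ (X ⧸ V) :=
  if n ≤ c then (C ⊓ F.sub n).map V.mkQ else (F.sub n).map V.mkQ

theorem chainQ_mono (V C : Submodule ℂ X) (c : ℕ) (F : CompleteFlag X) :
    Monotone (chainQ V C c F) := by
  intro m n h
  unfold chainQ
  split_ifs with h1 h2 h2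
  · exact Submodule.map_mono (inf_le_inf_left _ (F.mono h))
  · exact Submodule.map_mono (le_sup_of_le_left (inf_le_inf_left _ (F.mono (by omega))))
  · omega
  · exact Submodule.map_mono (sup_le_sup_right (inf_le_inf_left _ (F.mono (by omega))) _)

theorem chainR_mono (V C : Submodule ℂ X) (c : ℕ) (F : CompleteFlag X) :
    Monotone (chainR V C c F) := by
  intro m n h
  unfold chainR
  split_ifs with h1 h2 h2
  · exact Submodule.map_mono (inf_le_inf_left _ (F.mono h))
  · exact Submodule.map_mono (inf_le_right.trans (F.mono h))
  · omega
  · exact Submodule.map_mono (F.mono h)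

variable [FiniteDimensional ℂ X] {V C : Submodule ℂ X} {F : CompleteFlag X}

theorem sup_eq_top_of_line {u : X} (hC : finrank ℂ ↥(C ⊔ V) + 1 = finrank ℂ X)
    (hu : u ∉ C ⊔ V) {A : Submodule ℂ X} (huA : u ∈ A) : (C ⊔ A).map V.mkQ = ⊤ := by
  have h : C ⊔ V ⊔ A = ⊤ := by
    apply Submodule.eq_top_of_finrank_eq
    have : C ⊔ V < C ⊔ V ⊔ A := by
      refine lt_of_le_of_ne le_sup_left fun h => hu ?_
      rw [h]
      exact Submodule.mem_sup_right huA
    have := Submodule.finrank_lt_finrank_of_lt this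
    have := Submodule.finrank_le (C ⊔ V ⊔ A)
    omega
  have h2 := congrArg (Submodule.map V.mkQ) h
  rw [Submodule.map_top, Submodule.range_mkQ, sup_right_comm, Submodule.map_sup,
    Submodule.mkQ_map_self, sup_bot_eq] at h2
  exact h2

/-- The steps are at most one because C ∩ F_n grows by at most one and the only other step adds a
line. The chain reaches X / V because C + V is a hyperplane not containing that line. -/
theorem flagOfChain_chainQ_sub (hC : finrank ℂ ↥(C ⊔ V) + 1 = finrank ℂ X)
    (hl : ¬ F.sub 1 ≤ C ⊔ V) (c n : ℕ) :
    (flagOfChain (chainQ V C c F)).sub (finrank ℂ (chainQ V C c F n)) = chainQ V C c F n := by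
  obtain ⟨u, hu, huC⟩ := SetLike.not_le_iff_exists.1 hl
  refine flagOfChain_sub (chainQ_mono V C c F) ?_ (N := finrank ℂ X + 1 + c) ?_ (fun k => ?_) n
  · rw [chainQ, if_pos (Nat.zero_le _), F.sub_zero, inf_bot_eq, Submodule.map_bot]
  · by_cases h : finrank ℂ X = 0
    · have : Subsingleton X := finrank_zero_iff.1 h
      exact absurd (Subsingleton.elim u 0 ▸ zero_mem _) huC
    · rw [chainQ, if_neg (by omega), F.sub_eq_top (by omega), inf_top_eq]
      exact sup_eq_top_of_line hC huC hu
  · have hstep := fun k => F.finrank_inf_le C (Nat.le_add_right k 1)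
    rcases lt_trichotomy k c with h3 | h3 | h3
    · rw [chainQ, chainQ, if_pos (by omega), if_pos h3.le]
      have := finrank_map_add_le V.mkQ (inf_le_inf_left C (F.mono (Nat.le_add_right k 1)))
      have := hstep k
      omega
    · subst h3
      rw [chainQ, chainQ, if_neg (by omega), if_pos le_rfl, Nat.add_sub_cancel,
        Submodule.map_sup]
      have h4 := Submodule.finrank_add_le_finrank_add_finrank ((C ⊓ F.sub k).map V.mkQ)
        ((F.sub 1).map V.mkQ)
      have h5 := Submodule.finrank_map_le V.mkQ (F.sub 1)
      rw [F.finrank_sub_eq] at h5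
      omega
    · obtain ⟨k, rfl⟩ : ∃ j, k = j + 1 := ⟨k - 1, by omega⟩
      rw [chainQ, chainQ, if_neg (by omega), if_neg (by omega), show k + 1 + 1 - 1 = k + 1 from rfl,
        show k + 1 - 1 = k from rfl]
      have h4 := finrank_map_add_le V.mkQ (sup_le_sup_right (inf_le_inf_left C
        (F.mono (Nat.le_add_right k 1))) (F.sub 1))
      have h5 := finrank_sup_add_le (F.sub 1) (inf_le_inf_left C (F.mono (Nat.le_add_right k 1)))
      have := hstep k
      omega

/-- By hypothesis both descriptions of the chain agree at step c, so passing from one to the other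
causes no jump. -/
theorem flagOfChain_chainR_sub {c : ℕ} (hc : (F.sub c).map V.mkQ = (C ⊓ F.sub c).map V.mkQ)
    (n : ℕ) :
    (flagOfChain (chainR V C c F)).sub (finrank ℂ (chainR V C c F n)) = chainR V C c F n := by
  refine flagOfChain_sub (chainR_mono V C c F) ?_ (N := finrank ℂ X + 1 + c) ?_ (fun k => ?_) n
  · rw [chainR, if_pos (Nat.zero_le _), F.sub_zero, inf_bot_eq, Submodule.map_bot]
  · rw [chainR, if_neg (by omega), F.sub_eq_top (by omega), Submodule.map_top,
      Submodule.range_mkQ]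
  · have hstep := F.finrank_inf_le C (Nat.le_add_right k 1)
    have hstep' := F.finrank_inf_le ⊤ (Nat.le_add_right k 1)
    rw [top_inf_eq, top_inf_eq] at hstep'
    have hm := finrank_map_add_le V.mkQ (F.mono (Nat.le_add_right k 1))
    rcases lt_trichotomy k c with h3 | h3 | h3
    · rw [chainR, chainR, if_pos (by omega), if_pos h3.le]
      have := finrank_map_add_le V.mkQ (inf_le_inf_left C (F.mono (Nat.le_add_right k 1)))
      omega
    · subst h3
      rw [chainR, chainR, if_neg (by omega), if_pos le_rfl, ← hc]
      omega
    · rw [chainR, chainR, if_neg (by omega), if_neg (by omega)]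
      omega

/-- Dimensions of intersections of a space `H` between `C ∩ V` and `C`, and of its image. -/
theorem finrank_inf_eq {h H A : Submodule ℂ X} (hCV : C ⊓ V = h) (hh : h ≤ H) (hH : H ≤ C) :
    finrank ℂ ↥(H ⊓ A) = finrank ℂ ↥(H.map V.mkQ ⊓ (C ⊓ A).map V.mkQ) + finrank ℂ ↥(h ⊓ A) := by
  have h1 := finrank_map_mkQ_add V (H ⊓ A)
  have h2 : H ⊓ A ⊓ V = h ⊓ A := by
    rw [inf_right_comm]
    congr 1
    apply le_antisymm
    · rw [← hCV]
      exact inf_le_inf_right V hH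
    · exact le_inf hh (hCV ▸ inf_le_right)
  have h3 : (H ⊓ A).map V.mkQ = H.map V.mkQ ⊓ (C ⊓ A).map V.mkQ := by
    apply le_antisymm
    · exact le_inf (Submodule.map_mono inf_le_left) (Submodule.map_mono (inf_le_inf_right A hH))
    · rintro _ ⟨⟨u, hu, rfl⟩, ⟨w, ⟨hwC, hwA⟩, hw⟩⟩
      refine ⟨w, ⟨?_, hwA⟩, hw⟩
      have h4 : w - u ∈ h := by
        rw [← hCV]
        exact ⟨sub_mem hwC (hH hu), (Submodule.Quotient.eq V).1 hw⟩
      have := add_mem (hh h4) hu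
      rwa [sub_add_cancel] at this
  rw [h2, h3] at h1
  exact h1.symm

end construction

end SchubertFib

end

noncomputable section

namespace SchubertFib

open Module

section construction

variable {X : Type} [AddCommGroup X] [Module ℂ X] {t : ℕ}

/-- The four-dimensional space of an instance. -/
def instV (q : ℕ) (F : Fin (4 + t) → CompleteFlag X) : Submodule ℂ X :=
  ((F (Fin.castAdd t 0)).sub 5 ⊓ (F (Fin.castAdd t 2)).sub (q + 2)) ⊔
    ((F (Fin.castAdd t 1)).sub 5 ⊓ (F (Fin.castAdd t 2)).sub (q + 2))

/-- The hyperplane belonging to a transversal `h`. -/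
def instT (q : ℕ) (F : Fin (4 + t) → CompleteFlag X) (h : Submodule ℂ X) : Submodule ℂ X :=
  (F (Fin.castAdd t 3)).sub (q + 3) ⊔ h

/-- The space which contains the solutions belonging to a transversal `h`. -/
def instC (q : ℕ) (F : Fin (4 + t) → CompleteFlag X) (h : Submodule ℂ X) : Submodule ℂ X :=
  (((F (Fin.castAdd t 0)).sub 5 ⊓ instT q F h) ⊔ ((F (Fin.castAdd t 2)).sub q ⊓ instT q F h)) ⊓
    (((F (Fin.castAdd t 1)).sub 5 ⊓ instT q F h) ⊔ ((F (Fin.castAdd t 2)).sub q ⊓ instT q F h))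

/-- The chains in the quotient by `V`. -/
def chainG (q : ℕ) (V C : Submodule ℂ X) (F : Fin (4 + t) → CompleteFlag X) (i : Fin (4 + t)) :
    ℕ → Submodule ℂ (X ⧸ V) :=
  -- The different insertion points produce the different partitions of the fiber. In the first flag
  -- the line comes after step 5, so the image of C ∩ F_5 is itself the member of dimension 2; in
  -- the second the line comes first, so that image is cut out by the member of dimension 3. The
  -- third flag needs no line, since beyond step q + 2 its own members are used.
  if i = Fin.castAdd t 0 then chainQ V C 5 (F i)
  else if i = Fin.castAdd t 2 then chainR V C (q + 2) (F i) else chainQ V C 0 (F i)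

variable [FiniteDimensional ℂ X]

def instE (V : Submodule ℂ X) (F : Fin (4 + t) → CompleteFlag X) (k : Fin 4) : CompleteFlag V :=
  flagOfChain (chainE V (F (Fin.castAdd t k)))

def instG (q : ℕ) (V C : Submodule ℂ X) (F : Fin (4 + t) → CompleteFlag X) (i : Fin (4 + t)) :
    CompleteFlag (X ⧸ V) :=
  flagOfChain (chainG q V C F i)

/-- The data of the fibration. -/
def instData (q : ℕ) (F : Fin (4 + t) → CompleteFlag X) :
    FiberData X (Fin 4) (Fin (4 + t)) where
  V := instV q F
  E := instE (instV q F) F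
  G h := instG q (instV q F) (instC q F (h.map (instV q F).subtype)) F

/-- Properties of the four-dimensional space of a general instance. -/
structure QuadFacts (q : ℕ) (F : Fin (4 + t) → CompleteFlag X) (V : Submodule ℂ X) : Prop where
  two_le : 2 ≤ q
  finrank_X : finrank ℂ X = 5 + q
  finrank_V : finrank ℂ V = 4
  le₃ : V ≤ (F (Fin.castAdd t 2)).sub (q + 2)
  le_sup : V ≤ (V ⊓ (F (Fin.castAdd t 0)).sub 5) ⊔ (V ⊓ (F (Fin.castAdd t 1)).sub 5)
  le_sup₃ : V ≤ (V ⊓ (F (Fin.castAdd t 0)).sub 5) ⊔ (V ⊓ (F (Fin.castAdd t 2)).sub q)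
  inf_le₁ : (F (Fin.castAdd t 0)).sub 5 ⊓ (F (Fin.castAdd t 2)).sub (q + 2) ≤ V
  inf_le₂ : (F (Fin.castAdd t 1)).sub 5 ⊓ (F (Fin.castAdd t 2)).sub (q + 2) ≤ V
  disj₁ : (F (Fin.castAdd t 0)).sub 5 ⊓ (F (Fin.castAdd t 2)).sub q = ⊥
  disj₂ : (F (Fin.castAdd t 1)).sub 5 ⊓ (F (Fin.castAdd t 2)).sub q = ⊥
  disj₃₄ : V ⊓ (F (Fin.castAdd t 2)).sub q ⊓ (F (Fin.castAdd t 3)).sub (q + 3) = ⊥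
  inf₁ : finrank ℂ ↥(V ⊓ (F (Fin.castAdd t 0)).sub 5) = 2
  inf₂ : finrank ℂ ↥(V ⊓ (F (Fin.castAdd t 1)).sub 5) = 2
  inf₃ : finrank ℂ ↥(V ⊓ (F (Fin.castAdd t 2)).sub q) = 2
  inf₄ : finrank ℂ ↥(V ⊓ (F (Fin.castAdd t 3)).sub (q + 3)) = 2

/-- Properties of the space belonging to a transversal of a general instance. -/
structure TransFacts (q : ℕ) (F : Fin (4 + t) → CompleteFlag X) (V h C : Submodule ℂ X) :
    Prop where
  inf_V : C ⊓ V = h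
  finrank_h : finrank ℂ h = 2
  finrank_C : finrank ℂ C = q + 2
  line : ∀ i, i ≠ Fin.castAdd t 2 → ¬ (F i).sub 1 ≤ C ⊔ V
  five : ∀ k : Fin 4, (k : ℕ) < 2 → finrank ℂ ↥(C ⊓ (F (Fin.castAdd t k)).sub 5) = 3
  first : ∀ k : Fin 4, (k : ℕ) < 2 → ∀ n, 6 ≤ n → n ≤ q + 5 →
    finrank ℂ ↥(C ⊓ (F (Fin.castAdd t k)).sub n) + 3 = n
  h_first : ∀ k : Fin 4, (k : ℕ) < 2 → ∀ n, 5 ≤ n → n ≤ q + 4 →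
    finrank ℂ ↥(h ⊓ (F (Fin.castAdd t k)).sub n) = 1
  third : ∀ n, 1 ≤ n → n ≤ q → finrank ℂ ↥(C ⊓ (F (Fin.castAdd t 2)).sub n) + 1 = n
  h_third : h ⊓ (F (Fin.castAdd t 2)).sub (q - 1) = ⊥
  h_third' : finrank ℂ ↥(h ⊓ (F (Fin.castAdd t 2)).sub q) = 1
  third_eq : (F (Fin.castAdd t 2)).sub (q + 2) ≤ (C ⊓ (F (Fin.castAdd t 2)).sub (q + 2)) ⊔ V
  fourth : ∀ n, 2 ≤ n → n ≤ q + 3 → finrank ℂ ↥(C ⊓ (F (Fin.castAdd t 3)).sub n) + 2 = n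
  h_fourth : h ⊓ (F (Fin.castAdd t 3)).sub (q + 2) = ⊥
  h_fourth' : finrank ℂ ↥(h ⊓ (F (Fin.castAdd t 3)).sub (q + 3)) = 1
  other : ∀ i : Fin t, ∀ n, 3 ≤ n → n ≤ q + 5 →
    finrank ℂ ↥(C ⊓ (F (Fin.natAdd 4 i)).sub n) + 3 = n
  h_other : ∀ i : Fin t, h ⊓ (F (Fin.natAdd 4 i)).sub (q + 3) = ⊥

end construction

/-! ### General position of an instance, derived from the open conditions. -/

section facts

variable {X : Type} [AddCommGroup X] [Module ℂ X] [FiniteDimensional ℂ X]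

/-- The forms are independent on A, so their common zeros in A, which contain C ∩ A, have
codimension m. -/
theorem finrank_inf_add_le_of_det {m : ℕ} {C A : Submodule ℂ X} (φ : Fin m → X →ₗ[ℂ] ℂ)
    (v : Fin m → X) (hC : ∀ i, ∀ u ∈ C, φ i u = 0) (hv : ∀ j, v j ∈ A)
    (hdet : (Matrix.of fun i j => φ i (v j)).det ≠ 0) :
    finrank ℂ ↥(C ⊓ A) + m ≤ finrank ℂ A := by
  have h1 := finrank_map_add_finrank_inf_ker (LinearMap.pi φ) A
  have h2 : A.map (LinearMap.pi φ) = ⊤ := by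
    rw [eq_top_iff]
    intro c _
    obtain ⟨d, hd⟩ := (Matrix.mulVec_surjective_iff_isUnit.2
      ((Matrix.isUnit_iff_isUnit_det _).2 (isUnit_iff_ne_zero.2 hdet))) c
    refine ⟨∑ j, d j • v j, sum_mem fun j _ => A.smul_mem _ (hv j), ?_⟩
    rw [← hd]
    ext i
    simp [Matrix.mulVec, dotProduct, mul_comm]
  rw [h2, finrank_top, finrank_fin_fun] at h1
  have h3 : finrank ℂ ↥(C ⊓ A) ≤ finrank ℂ ↥(A ⊓ LinearMap.ker (LinearMap.pi φ)) := by
    refine Submodule.finrank_mono (le_inf inf_le_right fun u hu => ?_)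
    rw [LinearMap.mem_ker]
    ext i
    exact hC i u hu.1
  omega

variable {e : Basis (Fin (finrank ℂ X)) ℂ X} {q t : ℕ}
  {B : Fin (4 + t) → Basis (Fin (finrank ℂ X)) ℂ X}

theorem instV_eq (hG : IsGeneral e 5 q (quad B)) (hN : 5 + q = finrank ℂ X) :
    instV q (fun i => CompleteFlag.ofBasis (B i)) = (hG.pencil hN (by norm_num)).V := by
  rw [Pencil.V, IsGeneral.pencil_F₃']
  rfl

theorem quadFacts (hG : IsGeneral e 5 q (quad B)) (hN : 5 + q = finrank ℂ X) (hq2 : 2 ≤ q) :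
    QuadFacts q (fun i => CompleteFlag.ofBasis (B i))
      (instV q fun i => CompleteFlag.ofBasis (B i)) := by
  have hV := instV_eq hG hN
  have hF₃' := hG.pencil_F₃' hN (by norm_num)
  set L := hG.pencil hN (by norm_num) with hL
  have hq : finrank ℂ X - 2 = q + 3 := by omega
  have h₁ : (CompleteFlag.ofBasis (B (Fin.castAdd t 0))).sub 5 = L.F₁ := rfl
  have h₂ : (CompleteFlag.ofBasis (B (Fin.castAdd t 1))).sub 5 = L.F₂ := rfl
  have h₃ : (CompleteFlag.ofBasis (B (Fin.castAdd t 2))).sub q = L.F₃ := rfl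
  have h₃' : (CompleteFlag.ofBasis (B (Fin.castAdd t 2))).sub (q + 2) = L.F₃' := hF₃'.symm
  have h₄ : (CompleteFlag.ofBasis (B (Fin.castAdd t 3))).sub (q + 3) = L.F₄ := by
    rw [← hq]; rfl
  rw [hV]
  constructor
  · exact hq2
  · exact hN.symm
  · exact L.finrank_V
  · exact h₃' ▸ sup_le inf_le_right inf_le_right
  · change L.V ≤ (L.V ⊓ L.F₁) ⊔ (L.V ⊓ L.F₂)
    rw [L.V_inf₁, L.V_inf₂, L.V_eq, LinearMap.range_coprod]
  · change L.V ≤ (L.V ⊓ L.F₁) ⊔ (L.V ⊓ L.F₃)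
    rw [L.V_inf₁, L.V_inf₃]
    intro u hu
    obtain ⟨v, w, rfl⟩ := (L.mem_V u).1 hu
    refine Submodule.mem_sup.2 ⟨_, ⟨v + w, rfl⟩, _, ⟨-w, rfl⟩, ?_⟩
    simp only [map_add, map_neg, LinearMap.sub_apply]
    abel
  · exact h₃'.symm ▸ le_sup_left
  · exact h₃'.symm ▸ le_sup_right
  · exact L.disj₁
  · exact L.disj₂
  · have := L.inf₃₄
    rwa [← h₄] at this
  · exact L.finrank_V_inf₁
  · exact L.finrank_V_inf₂
  · exact L.finrank_V_inf₃
  · have := L.finrank_V_inf₄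
    rwa [← h₄] at this

end facts

end SchubertFib

end

noncomputable section

namespace SchubertFib

open Module

section facts

theorem notMem_of_crd {X : Type} [AddCommGroup X] [Module ℂ X]
    {e B : Basis (Fin (finrank ℂ X)) ℂ X} {k m : ℕ} {u : X}
    (h : crd e B k u ≠ 0) (hk : k < finrank ℂ X) (hm : m ≤ k) :
    u ∉ (CompleteFlag.ofBasis B).sub m := fun hu =>
  h ((mem_ofBasis_iff e B m u).1 hu k hm hk)

theorem inf_eq_bot_of_notMem {X : Type} [AddCommGroup X] [Module ℂ X]
    {h A A' : Submodule ℂ X} {u : X} (hA : A ≤ A')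
    (hu : h ⊓ A' = Submodule.span ℂ {u}) (huA : u ∉ A) : h ⊓ A = ⊥ := by
  rw [eq_bot_iff]
  rintro w ⟨hw, hwA⟩
  have h1 : w ∈ h ⊓ A' := ⟨hw, hA hwA⟩
  rw [hu] at h1
  obtain ⟨c, rfl⟩ := Submodule.mem_span_singleton.1 h1
  by_cases hc : c = 0
  · rw [hc, zero_smul]; exact zero_mem _
  · exact absurd ((A.smul_mem_iff hc).1 hwA) huA

variable {X : Type} [AddCommGroup X] [Module ℂ X] [FiniteDimensional ℂ X]

theorem finrank_inf_eq_one {h A : Submodule ℂ X} (hh : finrank ℂ h = 2) {u v : X} (hu : u ∈ h)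
    (huA : u ∈ A) (hu0 : u ≠ 0) (hv : v ∈ h) (hvA : v ∉ A) : finrank ℂ ↥(h ⊓ A) = 1 := by
  have h1 : finrank ℂ ↥(h ⊓ A) < finrank ℂ h := by
    apply Submodule.finrank_lt_finrank_of_lt
    refine lt_of_le_of_ne inf_le_left fun h => ?_
    rw [← h] at hv
    exact hvA hv.2
  have h2 : 0 < finrank ℂ ↥(h ⊓ A) := by
    rw [pos_iff_ne_zero, Ne, Submodule.finrank_eq_zero]
    intro h3
    exact hu0 ((Submodule.mem_bot ℂ).1 (h3 ▸ ⟨hu, huA⟩))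
  omega

variable {e : Basis (Fin (finrank ℂ X)) ℂ X} {q t : ℕ}
  {B : Fin (4 + t) → Basis (Fin (finrank ℂ X)) ℂ X}

theorem instC_eq (hG : IsGeneral e 5 q (quad B)) (hN : 5 + q = finrank ℂ X) (a : Fin 2 → ℂ) :
    instC q (fun i => CompleteFlag.ofBasis (B i)) ((hG.pencil hN (by norm_num)).transversal a) =
      (hG.pencil hN (by norm_num)).C a := by
  have hq : finrank ℂ X - 2 = q + 3 := by omega
  have h₄ : (CompleteFlag.ofBasis (B (Fin.castAdd t 3))).sub (q + 3) =
      (hG.pencil hN (by norm_num)).F₄ := by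
    rw [← hq]; rfl
  rw [instC, instT, h₄]
  rfl

/-- Upper bounds for dim(C ∩ F_n) come from the nonzero determinants in `RootCond`. Lower bounds
come from counting the equations of C that do not hold automatically on F_n. The intersections with
the transversal are controlled by `EdgeCond` and by the condition `last`. -/
theorem transFacts (hG : IsGeneral e 5 q (quad B)) (hN : 5 + q = finrank ℂ X) (hq2 : 2 ≤ q)
    {β : ℂ} (hβ : IsRoot e 5 q (quad B) β) (hR : RootCond e 5 q B β) :
    TransFacts q (fun i => CompleteFlag.ofBasis (B i)) (hG.pencil hN (by norm_num)).V
      ((hG.pencil hN (by norm_num)).transversal (eigvec e 5 q (quad B) β))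
      ((hG.pencil hN (by norm_num)).C (eigvec e 5 q (quad B) β)) := by
  have ha := hG.eigvec_ne β
  have hα := hG.eigen hN (by norm_num) hβ
  have hform := hG.form_x_eq hN (by norm_num) hβ
  have hF₃' := hG.pencil_F₃' hN (by norm_num)
  set L := hG.pencil hN (by norm_num) with hL
  set a := eigvec e 5 q (quad B) β with ha'
  have hq : finrank ℂ X - 2 = q + 3 := by omega
  have h₁ : (CompleteFlag.ofBasis (B (Fin.castAdd t 0))).sub 5 = L.F₁ := rfl
  have h₂ : (CompleteFlag.ofBasis (B (Fin.castAdd t 1))).sub 5 = L.F₂ := rfl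
  have h₃ : (CompleteFlag.ofBasis (B (Fin.castAdd t 2))).sub q = L.F₃ := rfl
  have h₃' : (CompleteFlag.ofBasis (B (Fin.castAdd t 2))).sub (q + 2) = L.F₃' := hF₃'.symm
  have h₄ : (CompleteFlag.ofBasis (B (Fin.castAdd t 3))).sub (q + 3) = L.F₄ := by
    rw [← hq]; rfl
  have hx : L.x a = eigX e 5 q (quad B) β := rfl
  have hy : L.y a = eigY e 5 q (quad B) β := rfl
  have hsup : ∀ u, u ∈ L.C a ⊔ L.V ↔ omega e 5 q (quad B) β u = 0 := fun u =>
    L.mem_C_sup_V ha hα hG.P_ne hform u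
  have hetas : ∀ i, ∀ u ∈ L.C a, etas e 5 q (quad B) β i u = 0 := by
    intro i u hu
    obtain ⟨h0, h1, h2⟩ := (L.mem_C ha hα u).1 hu
    fin_cases i
    · exact h0
    · exact h1
    · exact h2
  have hC : finrank ℂ (L.C a) = q + 2 := by
    have h1 := L.finrank_C_le ha hα (u := bv (quad B 2) (q + 2))
      (fun h => hR.line₃ ((hsup _).1 h))
    have h2 := L.finrank_le_inf_C ha hα ⊤
    rw [top_inf_eq, finrank_top] at h2
    omega
  have hh := L.finrank_transversal ha
  have hfr : ∀ i n, n ≤ q + 5 → finrank ℂ ((CompleteFlag.ofBasis (B i)).sub n) = n :=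
    fun i n hn => CompleteFlag.finrank_sub _ _ (by omega)
  have hxh : L.x a ∈ L.transversal a := L.mem_transversal.2 ⟨1, 0, by simp⟩
  have hyh : L.y a ∈ L.transversal a := L.mem_transversal.2 ⟨0, 1, by simp⟩
  have hx0 : L.x a ≠ 0 := fun h => ha (L.x_eq_zero h)
  have hy0 : L.y a ≠ 0 := fun h => ha (L.y_eq_zero h)
  have hfirst : ∀ k : Fin 4, (k : ℕ) < 2 → ∀ n, 6 ≤ n → n ≤ q + 5 →
      finrank ℂ ↥(L.C a ⊓ (CompleteFlag.ofBasis (B (Fin.castAdd t k))).sub n) + 3 = n := by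
    intro k hk n hn hn'
    have h1 := finrank_inf_add_le_of_det (C := L.C a)
      (A := (CompleteFlag.ofBasis (B (Fin.castAdd t k))).sub n) _ _ hetas (fun j => ?_)
      (hR.six k hk)
    · have h2 := L.finrank_le_inf_C ha hα ((CompleteFlag.ofBasis (B (Fin.castAdd t k))).sub n)
      rw [inf_comm] at h2
      rw [hfr _ _ hn'] at h1 h2
      omega
    · refine bv_mem _ ?_
      fin_cases j <;> simp <;> omega
  -- On the 5-dimensional member of the first or second flag its own projection is a scalar, so two
  -- equations remain and the dimension is at least 3. The value in dimension 6 shows that it is no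
  -- larger.
  have hfive : ∀ (k : Fin 4) (φ : X →ₗ[ℂ] ℂ), (k : ℕ) < 2 →
      (∀ u ∈ (CompleteFlag.ofBasis (B (Fin.castAdd t k))).sub 5, L.η a u = 0 → φ u = 0 →
        u ∈ L.C a) →
      finrank ℂ ↥(L.C a ⊓ (CompleteFlag.ofBasis (B (Fin.castAdd t k))).sub 5) = 3 := by
    intro k φ hk hφ
    have h1 := Pencil.finrank_le_finrank_inf_ker_add
      ((CompleteFlag.ofBasis (B (Fin.castAdd t k))).sub 5) (L.η a)
    have h2 := Pencil.finrank_le_finrank_inf_ker_add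
      ((CompleteFlag.ofBasis (B (Fin.castAdd t k))).sub 5 ⊓ LinearMap.ker (L.η a)) φ
    have h3 : (CompleteFlag.ofBasis (B (Fin.castAdd t k))).sub 5 ⊓ LinearMap.ker (L.η a) ⊓
        LinearMap.ker φ ≤ L.C a ⊓ (CompleteFlag.ofBasis (B (Fin.castAdd t k))).sub 5 :=
      fun u hu => ⟨hφ u hu.1.1 hu.1.2 hu.2, hu.1.1⟩
    have h4 := Submodule.finrank_mono h3
    have h5 := hfirst k hk 6 le_rfl (by omega)
    have h6 := Submodule.finrank_mono (inf_le_inf_left (L.C a)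
      ((CompleteFlag.ofBasis (B (Fin.castAdd t k))).mono (show 5 ≤ 6 by norm_num)))
    rw [hfr _ _ (by omega)] at h1
    omega
  -- The modular law, valid because V is contained in `F₃'`.
  have htop : (L.C a ⊔ L.V) ⊓ L.F₃' = (L.C a ⊓ L.F₃') ⊔ L.V := by
    rw [sup_comm, sup_inf_assoc_of_le _ (show L.V ≤ L.F₃' from sup_le inf_le_right inf_le_right),
      sup_comm]
  refine ⟨L.C_inf_V ha hα, hh, hC, ?_, ?_, hfirst, ?_, ?_, ?_, ?_, ?_, ?_, ?_, ?_, ?_, ?_⟩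
  · intro i hi h
    exact hR.line i hi ((hsup _).1 (h (bv_mem _ Nat.zero_lt_one)))
  · intro k hk
    obtain rfl | rfl : k = 0 ∨ k = 1 := by omega
    · refine hfive 0 (L.η a ∘ₗ L.π₂) hk fun u hu h1 h2 => (L.mem_C ha hα u).2 ⟨h1, ?_, h2⟩
      rw [L.π₁_of_mem hu, map_smul, h1, smul_zero]
    · refine hfive 1 (L.η a ∘ₗ L.π₁) hk fun u hu h1 h2 => (L.mem_C ha hα u).2 ⟨h1, h2, ?_⟩
      rw [L.π₂_of_mem hu, map_smul, h1, smul_zero]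
  · intro k hk n hn hn'
    obtain rfl | rfl : k = 0 ∨ k = 1 := by omega
    · exact finrank_inf_eq_one hh hxh (CompleteFlag.mono _ hn (h₁ ▸ L.x_mem a)) hx0 hyh
        (notMem_of_crd hR.edge.fst (by omega) (by omega))
    · exact finrank_inf_eq_one hh hyh (CompleteFlag.mono _ hn (h₂ ▸ L.y_mem a)) hy0 hxh
        (notMem_of_crd hR.edge.snd (by omega) (by omega))
  · intro n hn hn'
    have h1 := finrank_inf_add_le_of_det (C := L.C a) (m := 1)
      (A := (CompleteFlag.ofBasis (B (Fin.castAdd t 2))).sub n)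
      ![etas e 5 q (quad B) β 0] ![bv (quad B 2) 0] (by
        intro i
        fin_cases i
        exact hetas 0) (by
        intro j
        fin_cases j
        exact bv_mem _ (by omega)) (by
        rw [Matrix.det_fin_one]
        exact hR.one)
    have h2 := Pencil.finrank_le_finrank_inf_ker_add
      ((CompleteFlag.ofBasis (B (Fin.castAdd t 2))).sub n) (L.η a)
    have h3 : (CompleteFlag.ofBasis (B (Fin.castAdd t 2))).sub n ⊓ LinearMap.ker (L.η a) ≤
        L.C a ⊓ (CompleteFlag.ofBasis (B (Fin.castAdd t 2))).sub n := by
      rintro u ⟨hu, hu'⟩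
      have hu3 : u ∈ L.F₃ := h₃ ▸ CompleteFlag.mono _ hn' hu
      exact ⟨(L.mem_C ha hα u).2 ⟨hu', by rw [L.π₁_of_mem₃ hu3, map_zero],
        by rw [L.π₂_of_mem₃ hu3, map_zero]⟩, hu⟩
    have h4 := Submodule.finrank_mono h3
    rw [hfr _ _ (by omega)] at h1 h2
    omega
  · exact inf_eq_bot_of_notMem (CompleteFlag.mono _ (Nat.sub_le q 1))
      (L.transversal_inf₃) (notMem_of_crd hR.edge.trd (by omega) le_rfl)
  · change finrank ℂ ↥(L.transversal a ⊓ L.F₃) = 1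
    rw [L.transversal_inf₃, finrank_span_singleton]
    intro h
    rw [sub_eq_add_neg, ← map_neg] at h
    exact ha (L.x_add_y_eq_zero h).1
  -- It suffices that `F₃'` lies in C + V, whose equation is `omega`. That form vanishes on `F₃`
  -- because both projections do, and on the plane of g by `form_x_eq`.
  · rw [h₃', ← htop]
    refine le_inf (fun u hu => ?_) le_rfl
    rw [hsup]
    obtain ⟨w, hw, _, ⟨v, rfl⟩, rfl⟩ := Submodule.mem_sup.1 hu
    have h1 := hform v
    have h2 : omega e 5 q (quad B) β w = β * L.η a (L.π₁ w) -
      (matP e 5 q (quad B)).det * L.η a (L.π₂ w) := rfl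
    have h3 : omega e 5 q (quad B) β (L.g v) = β * L.η a (L.x v) -
      (matP e 5 q (quad B)).det * L.η a (L.y v) := rfl
    rw [map_add, h2, h3, L.π₁_of_mem₃ hw, L.π₂_of_mem₃ hw, map_zero, h1]
    ring
  · intro n hn hn'
    have h1 := finrank_inf_add_le_of_det (C := L.C a)
      (A := (CompleteFlag.ofBasis (B (Fin.castAdd t 3))).sub n)
      (fun i : Fin 2 => etas e 5 q (quad B) β i.succ) (fun j : Fin 2 => bv (quad B 3) j)
      (fun i => hetas _) (fun j => bv_mem _ (by omega)) hR.two
    have h2 := Pencil.finrank_le_finrank_inf_ker_add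
      ((CompleteFlag.ofBasis (B (Fin.castAdd t 3))).sub n) (L.η a ∘ₗ L.π₁)
    have h3 := Pencil.finrank_le_finrank_inf_ker_add
      ((CompleteFlag.ofBasis (B (Fin.castAdd t 3))).sub n ⊓ LinearMap.ker (L.η a ∘ₗ L.π₁))
      (L.η a ∘ₗ L.π₂)
    have h4 : (CompleteFlag.ofBasis (B (Fin.castAdd t 3))).sub n ⊓
        LinearMap.ker (L.η a ∘ₗ L.π₁) ⊓ LinearMap.ker (L.η a ∘ₗ L.π₂) ≤
        L.C a ⊓ (CompleteFlag.ofBasis (B (Fin.castAdd t 3))).sub n := by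
      rintro u ⟨⟨hu, hu1⟩, hu2⟩
      have hu4 : u ∈ L.F₄ := h₄ ▸ CompleteFlag.mono _ hn' hu
      exact ⟨(L.mem_C ha hα u).2 ⟨by rw [L.η_apply, (L.ξ_eq_zero u).2 hu4, map_zero], hu1, hu2⟩,
        hu⟩
    have h5 := Submodule.finrank_mono h4
    rw [hfr _ _ (by omega)] at h1 h2
    omega
  · refine inf_eq_bot_of_notMem (A' := L.F₄) (h₄ ▸ CompleteFlag.mono _ (Nat.le_succ _))
      (L.transversal_inf₄ ha hα) fun h => ?_
    have h2 := Submodule.smul_mem _ (matQ e 5 q (quad B)).det h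
    rw [smul_sub, smul_smul, mul_div_cancel₀ _ hG.Q_ne] at h2
    exact notMem_of_crd hR.edge.fth (by omega) (by omega) h2
  · rw [h₄, L.transversal_inf₄ ha hα, finrank_span_singleton]
    intro h
    rw [sub_eq_add_neg, ← map_smul, ← map_neg] at h
    exact ha (L.x_add_y_eq_zero h).1
  · intro i n hn hn'
    have h1 := finrank_inf_add_le_of_det (C := L.C a)
      (A := (CompleteFlag.ofBasis (B (Fin.natAdd 4 i))).sub n) _
      (fun j : Fin 3 => bv (B (Fin.natAdd 4 i)) j) hetas (fun j => bv_mem _ (by omega))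
      (hR.three i)
    have h2 := L.finrank_le_inf_C ha hα ((CompleteFlag.ofBasis (B (Fin.natAdd 4 i))).sub n)
    rw [inf_comm] at h2
    rw [hfr _ _ hn'] at h1 h2
    omega
  · intro i
    rw [eq_bot_iff]
    rintro u ⟨hu, hu'⟩
    obtain ⟨s, r, rfl⟩ := L.mem_transversal.1 hu
    have h1 : ![s, r] = 0 := by
      refine eq_zero_of_mulVec_eq_zero (hR.last i) ?_
      ext k
      have h2 := (mem_ofBasis_iff e _ _ _).1 hu' (finrank ℂ X - 2 + k) (by omega) (by omega)
      rw [map_add, map_smul, map_smul, hx, hy] at h2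
      simp only [Matrix.mulVec, dotProduct, Fin.sum_univ_two, Matrix.of_apply,
        Matrix.cons_val_zero, Matrix.cons_val_one, Pi.zero_apply]
      simp only [smul_eq_mul] at h2
      linear_combination h2
    have hs : s = 0 := congrFun h1 0
    have hr : r = 0 := congrFun h1 1
    rw [hs, hr, zero_smul, zero_smul, add_zero]
    exact zero_mem _

end facts

end SchubertFib

end

noncomputable section

namespace SchubertFib

open Module

/-! ### Schubert conditions in terms of dimension functions -/

section arith

variable {a b : ℕ} {d k : ℕ → ℕ}

/-- Here and below d and k stand for the dimensions of H ∩ F_n and K ∩ G_m. Row j of the big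
partition, counted from 0, matches row j - 1 of the fiber for 1 ≤ j ≤ a, with the shift n = m + 3;
row 1 is exactly the corner n = 5, m = 2. Row 0 follows from row 1 because d grows by at most one,
and the last row is empty. -/
theorem conditions_iff_first {κ : ℕ → ℕ} (hab : a + 2 ≤ b)
    (hd1 : ∀ n, d (n + 1) ≤ d n + 1) (h5 : d 5 = k 2 + 1)
    (hm : ∀ m, 3 ≤ m → m ≤ b → d (m + 3) = k m + 1) (hX : d (5 + (b - 1)) = 2 + a) (ha : 0 < a)
    (hκ0 : ∀ j, a - 1 ≤ j → κ j = 0) (hκ : ∀ j, κ j ≤ b - a - 1) :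
    (∀ j < 2 + a, j + 1 ≤ d (5 + (b - 1) - (2 + a) + (j + 1) - rowsThen (b - a - 1) 2 κ j)) ↔
      ∀ j < a, j + 1 ≤ k (b - a + (j + 1) - rowsThen (b - a - 1) 1 κ j) := by
  unfold rowsThen
  constructor
  · intro h j hj
    have h1 := h (j + 1) (by omega)
    have hκj := hκ (j - 1)
    rcases Nat.eq_zero_or_pos j with rfl | hj0
    · rw [if_pos (by omega), show 5 + (b - 1) - (2 + a) + (0 + 1 + 1) - (b - a - 1) = 5 by omega] at h1
      rw [if_pos (by omega), show b - a + (0 + 1) - (b - a - 1) = 2 by omega]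
      omega
    · rw [if_neg (by omega), show j + 1 - 2 = j - 1 by omega,
        show 5 + (b - 1) - (2 + a) + (j + 1 + 1) - κ (j - 1) =
          (b - a + (j + 1) - κ (j - 1)) + 3 by omega, hm _ (by omega) (by omega)] at h1
      rw [if_neg (by omega)]
      omega
  · intro h j hj
    have h0 := h 0 ha
    rw [if_pos (by omega), show b - a + (0 + 1) - (b - a - 1) = 2 by omega] at h0
    have h4 : d 5 ≤ d 4 + 1 := hd1 4
    obtain rfl | rfl | hj2 | rfl : j = 0 ∨ j = 1 ∨ (2 ≤ j ∧ j ≤ a) ∨ j = a + 1 := by omega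
    · rw [if_pos (by omega), show 5 + (b - 1) - (2 + a) + (0 + 1) - (b - a - 1) = 4 by omega]
      omega
    · rw [if_pos (by omega), show 5 + (b - 1) - (2 + a) + (1 + 1) - (b - a - 1) = 5 by omega]
      omega
    · have h1 := h (j - 1) (by omega)
      have hκj := hκ (j - 2)
      rw [if_neg (show ¬ j - 1 < 1 by omega), show j - 1 - 1 = j - 2 by omega] at h1
      rw [if_neg (by omega), show 5 + (b - 1) - (2 + a) + (j + 1) - κ (j - 2) =
          (b - a + (j - 1 + 1) - κ (j - 2)) + 3 by omega, hm _ (by omega) (by omega)]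
      omega
    · rw [if_neg (by omega), hκ0 _ (by omega),
        show 5 + (b - 1) - (2 + a) + (a + 1 + 1) - 0 = 5 + (b - 1) by omega]
      omega

/-- The corner n = 5 now corresponds to m = 3, which shortens the first part of the fiber partition
by one. -/
theorem conditions_iff_second {κ : ℕ → ℕ} (hab : a + 2 ≤ b)
    (hd1 : ∀ n, d (n + 1) ≤ d n + 1) (h5 : d 5 = k 3 + 1)
    (hm : ∀ m, 3 ≤ m → m ≤ b → d (m + 3) = k m + 1) (hX : d (5 + (b - 1)) = 2 + a) (ha : 0 < a)
    (hκ0 : ∀ j, a - 1 ≤ j → κ j = 0) (hκ : ∀ j, κ j ≤ b - a - 2) :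
    (∀ j < 2 + a, j + 1 ≤ d (5 + (b - 1) - (2 + a) + (j + 1) - rowsThen (b - a - 1) 2 κ j)) ↔
      ∀ j < a, j + 1 ≤ k (b - a + (j + 1) - rowsThen (b - a - 2) 1 κ j) := by
  unfold rowsThen
  constructor
  · intro h j hj
    have h1 := h (j + 1) (by omega)
    have hκj := hκ (j - 1)
    rcases Nat.eq_zero_or_pos j with rfl | hj0
    · rw [if_pos (by omega), show 5 + (b - 1) - (2 + a) + (0 + 1 + 1) - (b - a - 1) = 5 by omega] at h1
      rw [if_pos (by omega), show b - a + (0 + 1) - (b - a - 2) = 3 by omega]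
      omega
    · rw [if_neg (by omega), show j + 1 - 2 = j - 1 by omega,
        show 5 + (b - 1) - (2 + a) + (j + 1 + 1) - κ (j - 1) =
          (b - a + (j + 1) - κ (j - 1)) + 3 by omega, hm _ (by omega) (by omega)] at h1
      rw [if_neg (by omega)]
      omega
  · intro h j hj
    have h0 := h 0 ha
    rw [if_pos (by omega), show b - a + (0 + 1) - (b - a - 2) = 3 by omega] at h0
    have h4 : d 5 ≤ d 4 + 1 := hd1 4
    obtain rfl | rfl | hj2 | rfl : j = 0 ∨ j = 1 ∨ (2 ≤ j ∧ j ≤ a) ∨ j = a + 1 := by omega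
    · rw [if_pos (by omega), show 5 + (b - 1) - (2 + a) + (0 + 1) - (b - a - 1) = 4 by omega]
      omega
    · rw [if_pos (by omega), show 5 + (b - 1) - (2 + a) + (1 + 1) - (b - a - 1) = 5 by omega]
      omega
    · have h1 := h (j - 1) (by omega)
      have hκj := hκ (j - 2)
      rw [if_neg (show ¬ j - 1 < 1 by omega), show j - 1 - 1 = j - 2 by omega] at h1
      rw [if_neg (by omega), show 5 + (b - 1) - (2 + a) + (j + 1) - κ (j - 2) =
          (b - a + (j - 1 + 1) - κ (j - 2)) + 3 by omega, hm _ (by omega) (by omega)]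
      omega
    · rw [if_neg (by omega), hκ0 _ (by omega),
        show 5 + (b - 1) - (2 + a) + (a + 1 + 1) - 0 = 5 + (b - 1) by omega]
      omega

/-- The rows below a - 1 match with the shift n = m + 1. Rows a - 1 and a of the big partition both
say that k (b - 3) ≥ a - 1, while the last row of the fiber is empty. -/
theorem conditions_iff_third {σ : ℕ → ℕ} (hab : a + 2 ≤ b) (hk : Monotone k)
    (hm : ∀ m, m ≤ b - 3 → d (m + 1) = k m) (h1 : d (b - 1) = k (b - 3) + 1)
    (h2 : d (b + 1) = k (b - 3) + 2) (hX : d (5 + (b - 1)) = 2 + a) (hK : k b = a) (ha : 0 < a)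
    (hσ : ∀ j, j < a - 1 → 2 + σ j ≤ b - a) (hσ0 : ∀ j, a - 1 ≤ j → σ j = 0) :
    (∀ j < 2 + a, j + 1 ≤ d (5 + (b - 1) - (2 + a) + (j + 1) -
        (rowsThen 3 a (rect 2 1) + σ) j)) ↔
      ∀ j < a, j + 1 ≤ k (b - a + (j + 1) - (rect 2 (a - 1) + σ) j) := by
  simp only [rowsThen, rect, Pi.add_apply]
  constructor
  · intro h j hj
    have h3 := h j (by omega)
    rw [if_pos hj] at h3
    rcases Nat.lt_or_ge j (a - 1) with hj1 | hj1
    · have := hσ j hj1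
      rw [if_pos hj1]
      rw [show 5 + (b - 1) - (2 + a) + (j + 1) - (3 + σ j) = (b - a + (j + 1) - (2 + σ j)) + 1
        by omega, hm _ (by omega)] at h3
      exact h3
    · rw [if_neg (by omega), hσ0 j hj1, show b - a + (j + 1) - (0 + 0) = b by omega]
      omega
  · intro h j hj
    -- For a ≥ 2 this is contained in row a - 2 of the fiber; for a = 1 there is nothing to prove.
    have hk3 : a - 1 ≤ k (b - 3) := by
      rcases Nat.lt_or_ge a 2 with ha2 | ha2
      · omega
      · have h3 := h (a - 2) (by omega)
        rw [if_pos (by omega)] at h3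
        have h4 := hk (show b - a + (a - 2 + 1) - (2 + σ (a - 2)) ≤ b - 3 by omega)
        omega
    rcases Nat.lt_or_ge j (a - 1) with hj1 | hj1
    · have h3 := h j (by omega)
      have := hσ j hj1
      rw [if_pos hj1] at h3
      rw [if_pos (by omega), show 5 + (b - 1) - (2 + a) + (j + 1) - (3 + σ j) =
        (b - a + (j + 1) - (2 + σ j)) + 1 by omega, hm _ (by omega)]
      exact h3
    · rw [hσ0 j hj1]
      obtain rfl | rfl | rfl : j = a - 1 ∨ j = a ∨ j = a + 1 := by omega
      · rw [if_pos (by omega), show 5 + (b - 1) - (2 + a) + (a - 1 + 1) - (3 + 0) = b - 1 by omega]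
        omega
      · rw [if_neg (by omega), if_pos (by omega),
          show 5 + (b - 1) - (2 + j) + (j + 1) - (2 + 0) = b + 1 by omega]
        omega
      · rw [if_neg (by omega), if_neg (by omega),
          show 5 + (b - 1) - (2 + a) + (a + 1 + 1) - (0 + 0) = 5 + (b - 1) by omega]
        omega

/-- The added column 1^(a+1) absorbs the shift n = m + 1, and the two extra rows hold automatically.
-/
theorem conditions_iff_fourth {ν : ℕ → ℕ} (hab : a + 2 ≤ b)
    (hm : ∀ m, 1 ≤ m → m ≤ b → d (m + 1) = k m) (h2 : d (b + 2) = k b + 1)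
    (hX : d (5 + (b - 1)) = 2 + a) (hK : k b = a)
    (hν : ∀ j, ν j ≤ b - a) (hν0 : ∀ j, a ≤ j → ν j = 0) :
    (∀ j < 2 + a, j + 1 ≤ d (5 + (b - 1) - (2 + a) + (j + 1) - (rect 1 (a + 1) + ν) j)) ↔
      ∀ j < a, j + 1 ≤ k (b - a + (j + 1) - ν j) := by
  simp only [rect, Pi.add_apply]
  have key : ∀ j < a, d (5 + (b - 1) - (2 + a) + (j + 1) - ((if j < a + 1 then 1 else 0) + ν j)) =
      k (b - a + (j + 1) - ν j) := by
    intro j hj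
    have := hν j
    rw [if_pos (by omega), ← hm _ (by omega) (by omega)]
    congr 1
    omega
  constructor
  · intro h j hj
    rw [← key j hj]
    exact h j (by omega)
  · intro h j hj
    rcases Nat.lt_or_ge j a with hj1 | hj1
    · rw [key j hj1]
      exact h j hj1
    · rw [hν0 j hj1]
      obtain rfl | rfl : j = a ∨ j = a + 1 := by omega
      · rw [if_pos (by omega), show 5 + (b - 1) - (2 + j) + (j + 1) - (1 + 0) = b + 2 by omega]
        omega
      · rw [if_neg (by omega),
          show 5 + (b - 1) - (2 + a) + (a + 1 + 1) - (0 + 0) = 5 + (b - 1) by omega]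
        omega

/-- With the partition unchanged, the shift n = m + 2 only accounts for the larger codimension of H;
the two extra rows are zero and impose nothing. -/
theorem conditions_iff_other {ν : ℕ → ℕ} (hab : a + 2 ≤ b) (hd1 : ∀ n, d (n + 1) ≤ d n + 1)
    (hm : ∀ m, 1 ≤ m → m ≤ b → d (m + 2) = k m)
    (hX : d (5 + (b - 1)) = 2 + a)
    (hν : ∀ j, ν j ≤ b - a) (hν0 : ∀ j, a ≤ j → ν j = 0) :
    (∀ j < 2 + a, j + 1 ≤ d (5 + (b - 1) - (2 + a) + (j + 1) - ν j)) ↔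
      ∀ j < a, j + 1 ≤ k (b - a + (j + 1) - ν j) := by
  have key : ∀ j < a, d (5 + (b - 1) - (2 + a) + (j + 1) - ν j) =
      k (b - a + (j + 1) - ν j) := by
    intro j hj
    have := hν j
    rw [← hm _ (by omega) (by omega)]
    congr 1
    omega
  constructor
  · intro h j hj
    rw [← key j hj]
    exact h j (by omega)
  · intro h j hj
    rcases Nat.lt_or_ge j a with hj1 | hj1
    · rw [key j hj1]
      exact h j hj1
    · rw [hν0 j hj1]
      obtain rfl | rfl : j = a ∨ j = a + 1 := by omega
      · have h3 := hd1 (b + 3)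
        rw [show b + 3 + 1 = 5 + (b - 1) by omega] at h3
        rw [show 5 + (b - 1) - (2 + j) + (j + 1) - 0 = b + 3 by omega]
        omega
      · rw [show 5 + (b - 1) - (2 + a) + (a + 1 + 1) - 0 = 5 + (b - 1) by omega]
        omega

end arith

end SchubertFib

end

noncomputable section

namespace SchubertFib

open Module

/-! ### Traces on the image of C of the flags in the quotient. -/

section relations

variable {X : Type} [AddCommGroup X] [Module ℂ X] [FiniteDimensional ℂ X]

theorem sup_line {A D l : Submodule ℂ X} (hA : A ≤ D) (hl : finrank ℂ l ≤ 1) (hlD : ¬ l ≤ D) :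
    (A ⊔ l) ⊓ D = A ∧ finrank ℂ ↥(A ⊔ l) = finrank ℂ A + 1 := by
  have h0 : finrank ℂ ↥(l ⊓ D) < finrank ℂ l := by
    apply Submodule.finrank_lt_finrank_of_lt
    exact lt_of_le_of_ne inf_le_left fun h => hlD (h ▸ inf_le_right)
  have h1 : l ⊓ D = ⊥ := Submodule.finrank_eq_zero.1 (by omega)
  constructor
  · rw [sup_inf_assoc_of_le _ hA, h1, sup_bot_eq]
  · have h2 := Submodule.finrank_sup_add_finrank_inf_eq A l
    have h3 : A ⊓ l = ⊥ := by
      rw [eq_bot_iff, ← h1, inf_comm]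
      exact inf_le_inf_left _ hA
    rw [h3, finrank_bot] at h2
    omega

variable {t q : ℕ} {F : Fin (4 + t) → CompleteFlag X} {V h C : Submodule ℂ X}

theorem TransFacts.hyperplane (hQ : QuadFacts q F V) (hT : TransFacts q F V h C) :
    finrank ℂ ↥(C ⊔ V) + 1 = finrank ℂ X := by
  have h1 := Submodule.finrank_sup_add_finrank_inf_eq C V
  rw [hT.inf_V, hT.finrank_h, hT.finrank_C, hQ.finrank_V] at h1
  rw [hQ.finrank_X]
  omega

theorem TransFacts.finrank_map (hT : TransFacts q F V h C) (A : Submodule ℂ X) :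
    finrank ℂ ((C ⊓ A).map V.mkQ) + finrank ℂ ↥(h ⊓ A) = finrank ℂ ↥(C ⊓ A) := by
  have := finrank_map_mkQ_add V (C ⊓ A)
  rwa [inf_right_comm, hT.inf_V] at this

theorem le_sup_of_map_le {X : Type} [AddCommGroup X] [Module ℂ X] {V C A : Submodule ℂ X} (hA : A.map V.mkQ ≤ C.map V.mkQ) :
    A ≤ C ⊔ V := by
  rw [Submodule.map_le_iff_le_comap, Submodule.comap_map_mkQ, sup_comm] at hA
  exact hA

/-- Once the line is inserted, each member has dimension one more than the image of C ∩ F_n. As the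
line is not in the image of C, intersecting with that image removes it again. For subspaces K of the
image of C the inserted line is therefore invisible. -/
theorem TransFacts.chainQ_rel (hQ : QuadFacts q F V) (hT : TransFacts q F V h C) {i : Fin (4 + t)}
    (hi : i ≠ Fin.castAdd t 2) {c n : ℕ} (hc : c ≤ n) :
    (flagOfChain (chainQ V C c (F i))).sub (finrank ℂ ((C ⊓ (F i).sub n).map V.mkQ) + 1) ⊓
      C.map V.mkQ = (C ⊓ (F i).sub n).map V.mkQ := by
  have h1 := flagOfChain_chainQ_sub (hT.hyperplane hQ) (hT.line i hi) c (n + 1)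
  have h2 : chainQ V C c (F i) (n + 1) = (C ⊓ (F i).sub n).map V.mkQ ⊔ ((F i).sub 1).map V.mkQ := by
    rw [chainQ, if_neg (by omega), Nat.add_sub_cancel, Submodule.map_sup]
  have h3 := sup_line (A := (C ⊓ (F i).sub n).map V.mkQ) (D := C.map V.mkQ)
    (l := ((F i).sub 1).map V.mkQ) (Submodule.map_mono inf_le_left) (by
      have := Submodule.finrank_map_le V.mkQ ((F i).sub 1)
      rw [(F i).finrank_sub_eq] at this
      omega) (fun h => hT.line i hi (le_sup_of_map_le h))
  rw [h2, h3.2] at h1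
  rw [h1, h3.1]

theorem TransFacts.chainQ_rel_of_le (hQ : QuadFacts q F V) (hT : TransFacts q F V h C)
    {i : Fin (4 + t)} (hi : i ≠ Fin.castAdd t 2) {c n : ℕ} (hc : n ≤ c) :
    (flagOfChain (chainQ V C c (F i))).sub (finrank ℂ ((C ⊓ (F i).sub n).map V.mkQ)) =
      (C ⊓ (F i).sub n).map V.mkQ := by
  have h1 := flagOfChain_chainQ_sub (hT.hyperplane hQ) (hT.line i hi) c n
  rwa [chainQ, if_pos hc] at h1

theorem TransFacts.chainR_rel (hT : TransFacts q F V h C) {n : ℕ} (hc : n ≤ q + 2) :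
    (flagOfChain (chainR V C (q + 2) (F (Fin.castAdd t 2)))).sub
      (finrank ℂ ((C ⊓ (F (Fin.castAdd t 2)).sub n).map V.mkQ)) =
      (C ⊓ (F (Fin.castAdd t 2)).sub n).map V.mkQ := by
  have h1 := flagOfChain_chainR_sub (V := V) (C := C) (F := F (Fin.castAdd t 2)) (c := q + 2) (by
    apply le_antisymm
    · have := Submodule.map_mono (f := V.mkQ) hT.third_eq
      rwa [Submodule.map_sup, Submodule.mkQ_map_self, sup_bot_eq] at this
    · exact Submodule.map_mono inf_le_right) n
  rwa [chainR, if_pos hc] at h1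

theorem finrank_inf_congr {X : Type} [AddCommGroup X] [Module ℂ X] {K D A A' : Submodule ℂ X} (hK : K ≤ D) (hA : A ⊓ D = A') :
    finrank ℂ ↥(K ⊓ A) = finrank ℂ ↥(K ⊓ A') := by
  rw [← hA, inf_comm A, ← inf_assoc, inf_eq_left.2 hK]

theorem instG_one (q V C) (F : Fin (4 + t) → CompleteFlag X) :
    instG q V C F (Fin.castAdd t 0) = flagOfChain (chainQ V C 5 (F (Fin.castAdd t 0))) := by
  rw [instG, chainG, if_pos rfl]

theorem instG_three (q V C) (F : Fin (4 + t) → CompleteFlag X) :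
    instG q V C F (Fin.castAdd t 2) = flagOfChain (chainR V C (q + 2) (F (Fin.castAdd t 2))) := by
  rw [instG, chainG, if_neg (by simp [Fin.ext_iff]), if_pos rfl]

theorem instG_other (q V C) (F : Fin (4 + t) → CompleteFlag X) {i : Fin (4 + t)}
    (h0 : i ≠ Fin.castAdd t 0) (h2 : i ≠ Fin.castAdd t 2) :
    instG q V C F i = flagOfChain (chainQ V C 0 (F i)) := by
  rw [instG, chainG, if_neg h0, if_neg h2]

theorem natAdd_ne_castAdd (i : Fin t) (k : Fin 4) : Fin.natAdd 4 i ≠ Fin.castAdd t k := by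
  simp only [ne_eq, Fin.ext_iff, Fin.val_natAdd, Fin.val_castAdd]
  omega

/-! ### Relations between the flags in `X` and in `X / V` -/

theorem TransFacts.first_five (hQ : QuadFacts q F V) (hT : TransFacts q F V h C) :
    (instG q V C F (Fin.castAdd t 0)).sub 2 = (C ⊓ (F (Fin.castAdd t 0)).sub 5).map V.mkQ := by
  have h1 := hT.chainQ_rel_of_le hQ (i := Fin.castAdd t 0) (by simp [Fin.ext_iff]) (le_refl 5)
  have h2 := hT.finrank_map ((F (Fin.castAdd t 0)).sub 5)
  rw [hT.five 0 (by simp), hT.h_first 0 (by simp) 5 le_rfl (by have := hQ.two_le; omega)] at h2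
  rw [show finrank ℂ ((C ⊓ (F (Fin.castAdd t 0)).sub 5).map V.mkQ) = 2 by omega] at h1
  rw [instG_one, h1]

theorem TransFacts.finrank_map_first (hT : TransFacts q F V h C) (k : Fin 4) (hk : (k : ℕ) < 2)
    {m : ℕ} (hm : 3 ≤ m) (hm' : m ≤ q + 1) :
    finrank ℂ ((C ⊓ (F (Fin.castAdd t k)).sub (m + 3)).map V.mkQ) + 1 = m := by
  have h2 := hT.finrank_map ((F (Fin.castAdd t k)).sub (m + 3))
  have h3 := hT.first k hk (m + 3) (by omega) (by omega)
  rw [hT.h_first k hk _ (by omega) (by omega)] at h2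
  omega

theorem TransFacts.first_rel (hQ : QuadFacts q F V) (hT : TransFacts q F V h C) {m : ℕ}
    (hm : 3 ≤ m) (hm' : m ≤ q + 1) :
    (instG q V C F (Fin.castAdd t 0)).sub m ⊓ C.map V.mkQ =
      (C ⊓ (F (Fin.castAdd t 0)).sub (m + 3)).map V.mkQ := by
  have h1 := hT.chainQ_rel hQ (i := Fin.castAdd t 0) (by simp [Fin.ext_iff]) (c := 5)
    (n := m + 3) (by omega)
  rw [hT.finrank_map_first 0 (by simp) hm hm'] at h1
  rw [instG_one, h1]

theorem TransFacts.second_rel (hQ : QuadFacts q F V) (hT : TransFacts q F V h C) {m : ℕ}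
    (hm : 3 ≤ m) (hm' : m ≤ q + 1) :
    (instG q V C F (Fin.castAdd t 1)).sub m ⊓ C.map V.mkQ =
      (C ⊓ (F (Fin.castAdd t 1)).sub (m + 3)).map V.mkQ := by
  have h1 := hT.chainQ_rel hQ (i := Fin.castAdd t 1) (by simp [Fin.ext_iff]) (c := 0)
    (n := m + 3) (by omega)
  rw [hT.finrank_map_first 1 (by simp) hm hm'] at h1
  rw [instG_other _ _ _ _ (by simp [Fin.ext_iff]) (by simp [Fin.ext_iff]), h1]

/-- The image of C ∩ F_5 has dimension 3 - 1 = 2, and the line was inserted before it, hence the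
index 3. -/
theorem TransFacts.second_five (hQ : QuadFacts q F V) (hT : TransFacts q F V h C) :
    (instG q V C F (Fin.castAdd t 1)).sub 3 ⊓ C.map V.mkQ =
      (C ⊓ (F (Fin.castAdd t 1)).sub 5).map V.mkQ := by
  have h1 := hT.chainQ_rel hQ (i := Fin.castAdd t 1) (by simp [Fin.ext_iff]) (Nat.zero_le 5)
  have h2 := hT.finrank_map ((F (Fin.castAdd t 1)).sub 5)
  rw [hT.five 1 (by simp), hT.h_first 1 (by simp) 5 le_rfl (by have := hQ.two_le; omega)] at h2
  rw [show finrank ℂ ((C ⊓ (F (Fin.castAdd t 1)).sub 5).map V.mkQ) = 2 by omega] at h1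
  rw [instG_other _ _ _ _ (by simp [Fin.ext_iff]) (by simp [Fin.ext_iff]), h1]

theorem TransFacts.third_rel (hT : TransFacts q F V h C) {m : ℕ}
    (hm : m + 2 ≤ q) :
    (instG q V C F (Fin.castAdd t 2)).sub m = (C ⊓ (F (Fin.castAdd t 2)).sub (m + 1)).map V.mkQ := by
  have h1 := hT.chainR_rel (n := m + 1) (by omega)
  have h2 := hT.finrank_map ((F (Fin.castAdd t 2)).sub (m + 1))
  have h3 := hT.third (m + 1) (by omega) (by omega)
  have h4 : h ⊓ (F (Fin.castAdd t 2)).sub (m + 1) = ⊥ := by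
    rw [eq_bot_iff, ← hT.h_third]
    exact inf_le_inf_left _ ((F _).mono (by omega))
  rw [h4, finrank_bot] at h2
  rw [show finrank ℂ ((C ⊓ (F (Fin.castAdd t 2)).sub (m + 1)).map V.mkQ) = m by omega] at h1
  rw [instG_three, h1]

theorem TransFacts.third_rel_last (hT : TransFacts q F V h C)
    (hq : 2 ≤ q) :
    (instG q V C F (Fin.castAdd t 2)).sub (q - 2) =
      (C ⊓ (F (Fin.castAdd t 2)).sub q).map V.mkQ := by
  have h1 := hT.chainR_rel (n := q) (by omega)
  have h2 := hT.finrank_map ((F (Fin.castAdd t 2)).sub q)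
  have h3 := hT.third q (by omega) le_rfl
  rw [hT.h_third'] at h2
  rw [show finrank ℂ ((C ⊓ (F (Fin.castAdd t 2)).sub q).map V.mkQ) = q - 2 by omega] at h1
  rw [instG_three, h1]

/-- Together with the previous lemma: the images for n = q and n = q + 2 coincide. For n = q + 2 one
has V ≤ F_n ≤ C + V, so the image has dimension q + 2 - 4. -/
theorem TransFacts.third_rel_last' (hQ : QuadFacts q F V) (hT : TransFacts q F V h C)
    (hq : 2 ≤ q) :
    (instG q V C F (Fin.castAdd t 2)).sub (q - 2) =
      (C ⊓ (F (Fin.castAdd t 2)).sub (q + 2)).map V.mkQ := by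
  have h1 := hT.chainR_rel (n := q + 2) (by omega)
  have h2 : (C ⊓ (F (Fin.castAdd t 2)).sub (q + 2)).map V.mkQ =
      ((F (Fin.castAdd t 2)).sub (q + 2)).map V.mkQ := by
    apply le_antisymm (Submodule.map_mono inf_le_right)
    have := Submodule.map_mono (f := V.mkQ) hT.third_eq
    rwa [Submodule.map_sup, Submodule.mkQ_map_self, sup_bot_eq] at this
  have h3 := finrank_map_mkQ_add V ((F (Fin.castAdd t 2)).sub (q + 2))
  rw [inf_eq_right.2 hQ.le₃, hQ.finrank_V, (F _).finrank_sub_eq, hQ.finrank_X] at h3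
  rw [show finrank ℂ ((C ⊓ (F (Fin.castAdd t 2)).sub (q + 2)).map V.mkQ) = q - 2 by
    rw [h2]; omega] at h1
  rw [instG_three, h1]

theorem TransFacts.fourth_rel (hQ : QuadFacts q F V) (hT : TransFacts q F V h C) {m : ℕ}
    (hm : 1 ≤ m) (hm' : m ≤ q + 1) :
    (instG q V C F (Fin.castAdd t 3)).sub m ⊓ C.map V.mkQ =
      (C ⊓ (F (Fin.castAdd t 3)).sub (m + 1)).map V.mkQ := by
  have h1 := hT.chainQ_rel hQ (i := Fin.castAdd t 3) (by simp [Fin.ext_iff]) (c := 0)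
    (n := m + 1) (by omega)
  have h2 := hT.finrank_map ((F (Fin.castAdd t 3)).sub (m + 1))
  have h3 := hT.fourth (m + 1) (by omega) (by omega)
  have h4 : h ⊓ (F (Fin.castAdd t 3)).sub (m + 1) = ⊥ := by
    rw [eq_bot_iff, ← hT.h_fourth]
    exact inf_le_inf_left _ ((F _).mono (by omega))
  rw [h4, finrank_bot] at h2
  rw [show finrank ℂ ((C ⊓ (F (Fin.castAdd t 3)).sub (m + 1)).map V.mkQ) + 1 = m by omega] at h1
  rw [instG_other _ _ _ _ (by simp [Fin.ext_iff]) (by simp [Fin.ext_iff]), h1]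

theorem TransFacts.finrank_map_C (hT : TransFacts q F V h C) : finrank ℂ (C.map V.mkQ) = q := by
  have h1 := finrank_map_mkQ_add V C
  rw [hT.inf_V, hT.finrank_C, hT.finrank_h] at h1
  omega

/-- C ∩ F_{q+3} has dimension q + 1 and meets h in a line, so its image already has the dimension q
of the image of C. -/
theorem TransFacts.fourth_last (hT : TransFacts q F V h C) :
    (C ⊓ (F (Fin.castAdd t 3)).sub (q + 3)).map V.mkQ = C.map V.mkQ := by
  apply Submodule.eq_of_le_of_finrank_le (Submodule.map_mono inf_le_left)
  have h2 := hT.finrank_map ((F (Fin.castAdd t 3)).sub (q + 3))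
  have h3 := hT.fourth (q + 3) (by omega) le_rfl
  rw [hT.h_fourth'] at h2
  rw [hT.finrank_map_C]
  omega

theorem TransFacts.other_rel (hQ : QuadFacts q F V) (hT : TransFacts q F V h C) (i : Fin t) {m : ℕ}
    (hm : 1 ≤ m) (hm' : m ≤ q + 1) :
    (instG q V C F (Fin.natAdd 4 i)).sub m ⊓ C.map V.mkQ =
      (C ⊓ (F (Fin.natAdd 4 i)).sub (m + 2)).map V.mkQ := by
  have h1 := hT.chainQ_rel hQ (natAdd_ne_castAdd i 2) (c := 0) (n := m + 2) (by omega)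
  have h2 := hT.finrank_map ((F (Fin.natAdd 4 i)).sub (m + 2))
  have h3 := hT.other i (m + 2) (by omega) (by omega)
  have h4 : h ⊓ (F (Fin.natAdd 4 i)).sub (m + 2) = ⊥ := by
    rw [eq_bot_iff, ← hT.h_other i]
    exact inf_le_inf_left _ ((F _).mono (by omega))
  rw [h4, finrank_bot] at h2
  rw [show finrank ℂ ((C ⊓ (F (Fin.natAdd 4 i)).sub (m + 2)).map V.mkQ) + 1 = m by omega] at h1
  rw [instG_other _ _ _ _ (natAdd_ne_castAdd i 0) (natAdd_ne_castAdd i 2), h1]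

/-! ### Solutions with given trace on `V` -/

/-- The partitions of the big Schubert problem. -/
def bigProblem (a b : ℕ) (κ ρ σ ν₄ : ℕ → ℕ) {t : ℕ} (ν' : Fin t → ℕ → ℕ) : Fin (4 + t) → ℕ → ℕ :=
  Fin.append ![rowsThen (b - a - 1) 2 κ, rowsThen (b - a - 1) 2 ρ,
    rowsThen 3 a (rect 2 1) + σ, rect 1 (a + 1) + ν₄] ν'

/-- The partitions of the Schubert problem of the fiber. -/
def fiberProblem (a b : ℕ) (κ ρ σ ν₄ : ℕ → ℕ) {t : ℕ} (ν' : Fin t → ℕ → ℕ) :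
    Fin (4 + t) → ℕ → ℕ :=
  Fin.append ![rowsThen (b - a - 1) 1 κ, rowsThen (b - a - 2) 1 ρ, rect 2 (a - 1) + σ, ν₄] ν'

/-- The numerical hypotheses on the partitions. -/
structure NumFacts (a b : ℕ) (κ ρ σ ν₄ : ℕ → ℕ) {t : ℕ} (ν' : Fin t → ℕ → ℕ) : Prop where
  ha : 0 < a
  hab : a + 2 ≤ b
  κ_le : ∀ j, κ j ≤ b - a - 1
  κ_zero : ∀ j, a - 1 ≤ j → κ j = 0
  ρ_le : ∀ j, ρ j ≤ b - a - 2
  ρ_zero : ∀ j, a - 1 ≤ j → ρ j = 0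
  σ_le : ∀ j, j < a - 1 → 2 + σ j ≤ b - a
  σ_zero : ∀ j, a - 1 ≤ j → σ j = 0
  ν₄_le : ∀ j, ν₄ j ≤ b - a
  ν₄_zero : ∀ j, a ≤ j → ν₄ j = 0
  ν'_le : ∀ i j, ν' i j ≤ b - a
  ν'_zero : ∀ i j, a ≤ j → ν' i j = 0

/-- For h ≤ H ≤ C, the dimension of H ∩ F_n splits into a part in the image of C ∩ F_n and the known
dimension of h ∩ F_n. Since the image K of H lies in that of C, the image of C ∩ F_n may be replaced
by a member of the flag in the quotient. What is left is the arithmetic of each partition. -/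
theorem TransFacts.mem_solutions_iff (hQ : QuadFacts q F V) (hT : TransFacts q F V h C)
    {a : ℕ} {κ ρ σ ν₄ : ℕ → ℕ} {ν' : Fin t → ℕ → ℕ}
    (hN : NumFacts a (q + 1) κ ρ σ ν₄ ν') {H : Submodule ℂ X} (hh : h ≤ H) (hH : H ≤ C)
    (hHa : finrank ℂ H = 2 + a) :
    H ∈ Solutions (2 + a) (bigProblem a (q + 1) κ ρ σ ν₄ ν') F ↔
      H.map V.mkQ ∈ Solutions a (fiberProblem a (q + 1) κ ρ σ ν₄ ν') (instG q V C F) := by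
  have hq2 : 2 ≤ q := by have := hN.ha; have := hN.hab; omega
  have hHV : H ⊓ V = h := by
    refine le_antisymm ?_ (le_inf hh ?_)
    · rw [← hT.inf_V]; exact inf_le_inf_right V hH
    · rw [← hT.inf_V]; exact inf_le_right
  have hK : finrank ℂ (H.map V.mkQ) = a := by
    have := finrank_map_mkQ_add V H
    rw [hHV, hT.finrank_h] at this
    omega
  have hKC : H.map V.mkQ ≤ C.map V.mkQ := Submodule.map_mono hH
  have hquot : finrank ℂ (X ⧸ V) = q + 1 := by
    have := Submodule.finrank_quotient_add_finrank V
    rw [hQ.finrank_V, hQ.finrank_X] at this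
    omega
  have hd : ∀ A, finrank ℂ ↥(H ⊓ A) =
      finrank ℂ ↥(H.map V.mkQ ⊓ (C ⊓ A).map V.mkQ) + finrank ℂ ↥(h ⊓ A) :=
    fun A => finrank_inf_eq hT.inf_V hh hH
  have hd1 : ∀ i n, finrank ℂ ↥(H ⊓ (F i).sub (n + 1)) ≤ finrank ℂ ↥(H ⊓ (F i).sub n) + 1 := by
    intro i n
    have := (F i).finrank_inf_le H (Nat.le_add_right n 1)
    omega
  have hX : ∀ i, finrank ℂ ↥(H ⊓ (F i).sub (5 + (q + 1 - 1))) = 2 + a := by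
    intro i
    rw [(F i).sub_eq_top (by rw [hQ.finrank_X]; omega), inf_top_eq, hHa]
  have hKb : ∀ i, finrank ℂ ↥(H.map V.mkQ ⊓ (instG q V C F i).sub (q + 1)) = a := by
    intro i
    rw [CompleteFlag.sub_eq_top _ hquot.le, inf_top_eq, hK]
  have hbase : ∀ i : Fin (4 + t), (∀ j < 2 + a, j + 1 ≤ finrank ℂ ↥(H ⊓ (F i).sub
      (5 + (q + 1 - 1) - (2 + a) + (j + 1) - bigProblem a (q + 1) κ ρ σ ν₄ ν' i j))) ↔
      ∀ j < a, j + 1 ≤ finrank ℂ ↥(H.map V.mkQ ⊓ (instG q V C F i).sub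
        (q + 1 - a + (j + 1) - fiberProblem a (q + 1) κ ρ σ ν₄ ν' i j)) := by
    intro i
    refine Fin.addCases (fun k => ?_) (fun i => ?_) i
    · rw [bigProblem, fiberProblem, Fin.append_left, Fin.append_left]
      obtain rfl | rfl | rfl | rfl : k = 0 ∨ k = 1 ∨ k = 2 ∨ k = 3 := by omega
      · refine conditions_iff_first (d := fun n => finrank ℂ ↥(H ⊓ (F (Fin.castAdd t 0)).sub n))
          (k := fun m => finrank ℂ ↥(H.map V.mkQ ⊓ (instG q V C F (Fin.castAdd t 0)).sub m))
          hN.hab (hd1 _) ?_ (fun m hm hm' => ?_) (hX _) hN.ha hN.κ_zero hN.κ_le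
        · rw [hd, hT.h_first 0 (by simp) _ le_rfl (by omega), hT.first_five hQ]
        · rw [hd, hT.h_first 0 (by simp) _ (by omega) (by omega),
            finrank_inf_congr hKC (hT.first_rel hQ hm hm')]
      · refine conditions_iff_second (d := fun n => finrank ℂ ↥(H ⊓ (F (Fin.castAdd t 1)).sub n))
          (k := fun m => finrank ℂ ↥(H.map V.mkQ ⊓ (instG q V C F (Fin.castAdd t 1)).sub m))
          hN.hab (hd1 _) ?_ (fun m hm hm' => ?_) (hX _) hN.ha hN.ρ_zero hN.ρ_le
        · rw [hd, hT.h_first 1 (by simp) _ le_rfl (by omega),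
            finrank_inf_congr hKC (hT.second_five hQ)]
        · rw [hd, hT.h_first 1 (by simp) _ (by omega) (by omega),
            finrank_inf_congr hKC (hT.second_rel hQ hm hm')]
      · refine conditions_iff_third (d := fun n => finrank ℂ ↥(H ⊓ (F (Fin.castAdd t 2)).sub n))
          (k := fun m => finrank ℂ ↥(H.map V.mkQ ⊓ (instG q V C F (Fin.castAdd t 2)).sub m))
          hN.hab (fun m n hmn => Submodule.finrank_mono (inf_le_inf_left _
            ((instG q V C F (Fin.castAdd t 2)).mono hmn)))
          (fun m hm => ?_) ?_ ?_ (hX _) (hKb _) hN.ha hN.σ_le hN.σ_zero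
        · have h4 : h ⊓ (F (Fin.castAdd t 2)).sub (m + 1) = ⊥ := by
            rw [eq_bot_iff, ← hT.h_third]
            exact inf_le_inf_left _ ((F _).mono (by omega))
          rw [hd, h4, finrank_bot, hT.third_rel (by omega), add_zero]
        · rw [show q + 1 - 1 = q by omega, show q + 1 - 3 = q - 2 by omega, hd, hT.h_third',
            hT.third_rel_last hq2]
        · have h5 : h ≤ (F (Fin.castAdd t 2)).sub (q + 1 + 1) := by
            rw [← hT.inf_V]; exact inf_le_right.trans hQ.le₃
          rw [show q + 1 - 3 = q - 2 by omega, hd, inf_eq_left.2 h5, hT.finrank_h,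
            hT.third_rel_last' hQ hq2]
      · refine conditions_iff_fourth (d := fun n => finrank ℂ ↥(H ⊓ (F (Fin.castAdd t 3)).sub n))
          (k := fun m => finrank ℂ ↥(H.map V.mkQ ⊓ (instG q V C F (Fin.castAdd t 3)).sub m))
          hN.hab (fun m hm hm' => ?_) ?_ (hX _) (hKb _) hN.ν₄_le hN.ν₄_zero
        · have h4 : h ⊓ (F (Fin.castAdd t 3)).sub (m + 1) = ⊥ := by
            rw [eq_bot_iff, ← hT.h_fourth]
            exact inf_le_inf_left _ ((F _).mono (by omega))
          rw [hd, h4, finrank_bot, finrank_inf_congr hKC (hT.fourth_rel hQ hm hm'), add_zero]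
        · rw [hKb, hd, hT.h_fourth', hT.fourth_last, inf_eq_left.2 hKC, hK]
    · rw [bigProblem, fiberProblem, Fin.append_right, Fin.append_right]
      refine conditions_iff_other (d := fun n => finrank ℂ ↥(H ⊓ (F (Fin.natAdd 4 i)).sub n))
        (k := fun m => finrank ℂ ↥(H.map V.mkQ ⊓ (instG q V C F (Fin.natAdd 4 i)).sub m))
        hN.hab (hd1 _) (fun m hm hm' => ?_) (hX _) (hN.ν'_le i) (hN.ν'_zero i)
      have h4 : h ⊓ (F (Fin.natAdd 4 i)).sub (m + 2) = ⊥ := by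
        rw [eq_bot_iff, ← hT.h_other i]
        exact inf_le_inf_left _ ((F _).mono (by omega))
      rw [hd, h4, finrank_bot, finrank_inf_congr hKC (hT.other_rel hQ i hm hm'), add_zero]
  have hXq : finrank ℂ X = 5 + (q + 1 - 1) := hQ.finrank_X
  rw [Solutions, Solutions]
  simp only [SchubertVariety, Set.mem_ofPred_eq, hHa, hK, true_and]
  refine forall_congr' fun i => ?_
  rw [hXq, hquot]
  exact hbase i

end relations

end SchubertFib

end

noncomputable section

namespace SchubertFib

open Module

/-! ### The bijection for a good instance. -/

section forward

/-- Only the first row of □ is a condition; the second refers to the whole space. -/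
theorem mem_solutions_box {Y : Type} [AddCommGroup Y] [Module ℂ Y] [FiniteDimensional ℂ Y]
    (hY : finrank ℂ Y = 4) (E : Fin 4 → CompleteFlag Y) (h : Submodule ℂ Y) :
    h ∈ Solutions 2 (fun _ => box) E ↔
      finrank ℂ h = 2 ∧ ∀ k, 1 ≤ finrank ℂ ↥(h ⊓ (E k).sub 2) := by
  refine and_congr_right fun hh => forall_congr' fun k => ?_
  rw [SchubertVariety, Set.mem_ofPred_eq]
  simp only [hh, true_and]
  constructor
  · intro H
    have := H 0 (by norm_num)
    have h2 : 4 - 2 + (0 + 1) - box 0 = 2 := rfl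
    rwa [hY, h2] at this
  · intro H j hj
    rw [hY]
    obtain rfl | rfl : j = 0 ∨ j = 1 := by omega
    · exact H
    · rw [(E k).sub_eq_top (by simp [box, rect, hY]), inf_top_eq, hh]

variable {X : Type} [AddCommGroup X] [Module ℂ X] [FiniteDimensional ℂ X]
  {t q : ℕ} {F : Fin (4 + t) → CompleteFlag X} {V : Submodule ℂ X}

theorem QuadFacts.mem_solutions_box (hQ : QuadFacts q F V) (h : Submodule ℂ V) :
    h ∈ Solutions 2 (fun _ => box) (instE V F) ↔
      finrank ℂ h = 2 ∧ 1 ≤ finrank ℂ ↥(h.map V.subtype ⊓ (F (Fin.castAdd t 0)).sub 5) ∧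
      1 ≤ finrank ℂ ↥(h.map V.subtype ⊓ (F (Fin.castAdd t 1)).sub 5) ∧
      1 ≤ finrank ℂ ↥(h.map V.subtype ⊓ (F (Fin.castAdd t 2)).sub q) ∧
      1 ≤ finrank ℂ ↥(h.map V.subtype ⊓ (F (Fin.castAdd t 3)).sub (q + 3)) := by
  have key : ∀ (k : Fin 4) (n : ℕ), finrank ℂ ↥(V ⊓ (F (Fin.castAdd t k)).sub n) = 2 →
      finrank ℂ ↥(h ⊓ (instE V F k).sub 2) =
        finrank ℂ ↥(h.map V.subtype ⊓ (F (Fin.castAdd t k)).sub n) := by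
    intro k n hn
    have := flagOfChain_chainE_sub V (F (Fin.castAdd t k)) n
    rw [hn] at this
    rw [instE, this, inter_inf]
  rw [SchubertFib.mem_solutions_box hQ.finrank_V]
  refine and_congr_right fun _ => ?_
  rw [Fin.forall_fin_succ, Fin.forall_fin_succ, Fin.forall_fin_two]
  rw [key 0 5 hQ.inf₁]
  change _ ∧ 1 ≤ finrank ℂ ↥(h ⊓ (instE V F 1).sub 2) ∧ 1 ≤ finrank ℂ ↥(h ⊓ (instE V F 2).sub 2) ∧
    1 ≤ finrank ℂ ↥(h ⊓ (instE V F 3).sub 2) ↔ _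
  rw [key 1 5 hQ.inf₂, key 2 q hQ.inf₃, key 3 (q + 3) hQ.inf₄]

/-- An instance for which the construction works. -/
structure GoodInst (q : ℕ) (F : Fin (4 + t) → CompleteFlag X) : Prop where
  quad : QuadFacts q F (instV q F)
  trans : ∀ h ∈ Solutions 2 (fun _ => box) (instE (instV q F) F),
    TransFacts q F (instV q F) (h.map (instV q F).subtype)
      (instC q F (h.map (instV q F).subtype))

theorem goodInst_of_rootCond {e : Basis (Fin (finrank ℂ X)) ℂ X}
    {B : Fin (4 + t) → Basis (Fin (finrank ℂ X)) ℂ X}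
    (hG : IsGeneral e 5 q (SchubertFib.quad B)) (hN : 5 + q = finrank ℂ X) (hq2 : 2 ≤ q)
    (hR : ∀ β, IsRoot e 5 q (SchubertFib.quad B) β → RootCond e 5 q B β) :
    GoodInst q (fun i => CompleteFlag.ofBasis (B i)) := by
  refine ⟨quadFacts hG hN hq2, fun h hh => ?_⟩
  rw [(quadFacts hG hN hq2).mem_solutions_box] at hh
  have hV := instV_eq hG hN
  have hne : ∀ A : Submodule ℂ X, 1 ≤ finrank ℂ A → A ≠ ⊥ := by
    rintro A hA rfl
    simp at hA
  obtain ⟨h0, h1, h2, h3, h4⟩ := hh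
  have h4' := hne _ h4
  rw [show q + 3 = finrank ℂ X - 2 by omega] at h4'
  obtain ⟨a, α, ha, hα, heq⟩ := (hG.pencil hN (by norm_num)).exists_eq_transversal
    (h := h.map (instV q fun i => CompleteFlag.ofBasis (B i)).subtype)
    ((Submodule.map_subtype_le _ _).trans hV.le) (by rwa [Submodule.finrank_map_subtype_eq])
    (hne _ h1) (hne _ h2) (hne _ h3) h4'
  obtain ⟨β, hβ, c, hc, rfl⟩ := hG.exists_root hN (by norm_num) ha hα
  have h5 : (hG.pencil hN (by norm_num)).transversal (c • eigvec e 5 q (SchubertFib.quad B) β) =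
      (hG.pencil hN (by norm_num)).transversal (eigvec e 5 q (SchubertFib.quad B) β) := by
    apply Submodule.eq_of_le_of_finrank_eq
    · rw [Pencil.transversal, Submodule.span_le]
      rintro _ (rfl | rfl)
      · exact (Pencil.mem_transversal _).2 ⟨c, 0, by simp⟩
      · exact (Pencil.mem_transversal _).2 ⟨0, c, by simp⟩
    · rw [Pencil.finrank_transversal _ ha, Pencil.finrank_transversal _ (hG.eigvec_ne β)]
  rw [heq, h5, instC_eq hG hN, hV]
  exact transFacts hG hN hq2 hβ (hR β hβ)

variable {a : ℕ} {κ ρ σ ν₄ : ℕ → ℕ} {ν' : Fin t → ℕ → ℕ}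

/-- These are the corner conditions; κ, ρ, σ and ν⁴ do not enter, as σ and ν⁴ vanish in the rows
used. -/
theorem QuadFacts.inf_solution {X : Type} [AddCommGroup X] [Module ℂ X]
    {F : Fin (4 + t) → CompleteFlag X} {V : Submodule ℂ X} (hQ : QuadFacts q F V) (hN : NumFacts a (q + 1) κ ρ σ ν₄ ν')
    {H : Submodule ℂ X} (hH : H ∈ Solutions (2 + a) (bigProblem a (q + 1) κ ρ σ ν₄ ν') F) :
    finrank ℂ H = 2 + a ∧ 2 ≤ finrank ℂ ↥(H ⊓ (F (Fin.castAdd t 0)).sub 5) ∧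
      2 ≤ finrank ℂ ↥(H ⊓ (F (Fin.castAdd t 1)).sub 5) ∧
      a ≤ finrank ℂ ↥(H ⊓ (F (Fin.castAdd t 2)).sub q) ∧
      a + 1 ≤ finrank ℂ ↥(H ⊓ (F (Fin.castAdd t 2)).sub (q + 2)) ∧
      a + 1 ≤ finrank ℂ ↥(H ⊓ (F (Fin.castAdd t 3)).sub (q + 3)) := by
  have ha := hN.ha
  have hab := hN.hab
  have hX := hQ.finrank_X
  refine ⟨hH.1, ?_, ?_, ?_, ?_, ?_⟩
  · have h := (hH.2 (Fin.castAdd t 0)).2 1 (by omega)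
    rw [bigProblem, Fin.append_left] at h
    change _ ≤ finrank ℂ ↥(H ⊓ (F (Fin.castAdd t 0)).sub (finrank ℂ X - (2 + a) + (1 + 1) -
      rowsThen (q + 1 - a - 1) 2 κ 1)) at h
    rw [rowsThen, if_pos (by norm_num)] at h
    rwa [show finrank ℂ X - (2 + a) + (1 + 1) - (q + 1 - a - 1) = 5 by omega] at h
  · have h := (hH.2 (Fin.castAdd t 1)).2 1 (by omega)
    rw [bigProblem, Fin.append_left] at h
    change _ ≤ finrank ℂ ↥(H ⊓ (F (Fin.castAdd t 1)).sub (finrank ℂ X - (2 + a) + (1 + 1) -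
      rowsThen (q + 1 - a - 1) 2 ρ 1)) at h
    rw [rowsThen, if_pos (by norm_num)] at h
    rwa [show finrank ℂ X - (2 + a) + (1 + 1) - (q + 1 - a - 1) = 5 by omega] at h
  · have h := (hH.2 (Fin.castAdd t 2)).2 (a - 1) (by omega)
    rw [bigProblem, Fin.append_left] at h
    change _ ≤ finrank ℂ ↥(H ⊓ (F (Fin.castAdd t 2)).sub (finrank ℂ X - (2 + a) + (a - 1 + 1) -
      (rowsThen 3 a (rect 2 1) + σ) (a - 1))) at h
    rw [Pi.add_apply, hN.σ_zero _ le_rfl, rowsThen, if_pos (by omega)] at h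
    rw [show finrank ℂ X - (2 + a) + (a - 1 + 1) - (3 + 0) = q by omega] at h
    omega
  · have h := (hH.2 (Fin.castAdd t 2)).2 a (by omega)
    rw [bigProblem, Fin.append_left] at h
    change _ ≤ finrank ℂ ↥(H ⊓ (F (Fin.castAdd t 2)).sub (finrank ℂ X - (2 + a) + (a + 1) -
      (rowsThen 3 a (rect 2 1) + σ) a)) at h
    rw [Pi.add_apply, hN.σ_zero _ (by omega), rowsThen, if_neg (by omega), rect,
      if_pos (by omega)] at h
    rwa [show finrank ℂ X - (2 + a) + (a + 1) - (2 + 0) = q + 2 by omega] at h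
  · have h := (hH.2 (Fin.castAdd t 3)).2 a (by omega)
    rw [bigProblem, Fin.append_left] at h
    change _ ≤ finrank ℂ ↥(H ⊓ (F (Fin.castAdd t 3)).sub (finrank ℂ X - (2 + a) + (a + 1) -
      (rect 1 (a + 1) + ν₄) a)) at h
    rw [Pi.add_apply, hN.ν₄_zero _ le_rfl, rect, if_pos (by omega)] at h
    rwa [show finrank ℂ X - (2 + a) + (a + 1) - (1 + 0) = q + 3 by omega] at h

theorem finrank_add_le_of_inf_eq_bot {A B H : Submodule ℂ X} (hA : A ≤ H) (hB : B ≤ H)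
    (h : A ⊓ B = ⊥) : finrank ℂ A + finrank ℂ B ≤ finrank ℂ H := by
  have := finrank_add_le_inf_add hA hB
  rw [h, finrank_bot] at this
  omega

theorem eq_sup_of_finrank_le {A B H : Submodule ℂ X} (hA : A ≤ H) (hB : B ≤ H)
    (h : A ⊓ B = ⊥) (hd : finrank ℂ H ≤ finrank ℂ A + finrank ℂ B) : A ⊔ B = H := by
  apply Submodule.eq_of_le_of_finrank_le (sup_le hA hB)
  have := Submodule.finrank_sup_add_finrank_inf_eq A B
  rw [h, finrank_bot] at this
  omega

/-- Every count takes place inside H, of dimension a + 2, where two subspaces whose dimensions add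
up to more than a + 2 must meet. -/
theorem QuadFacts.inter_mem (hQ : QuadFacts q F V) (hN : NumFacts a (q + 1) κ ρ σ ν₄ ν')
    {H : Submodule ℂ X} (hH : H ∈ Solutions (2 + a) (bigProblem a (q + 1) κ ρ σ ν₄ ν') F) :
    inter V H ∈ Solutions 2 (fun _ => box) (instE V F) := by
  obtain ⟨hHa, h1, h2, h3, h3', h4⟩ := hQ.inf_solution hN hH
  rw [hQ.mem_solutions_box, map_inter, finrank_inter]
  -- Otherwise V would meet F⁴_{q+3} in dimension at least 4 + (a + 1) - (a + 2) = 3.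
  have hnV : ¬ V ≤ H := by
    intro hV
    have h5 := finrank_add_le_inf_add hV (inf_le_left : H ⊓ (F (Fin.castAdd t 3)).sub (q + 3) ≤ H)
    rw [← inf_assoc, inf_eq_left.2 hV, hQ.inf₄, hQ.finrank_V] at h5
    omega
  -- Otherwise H ∩ F¹_5 and H ∩ F²_5 lie in V, hence fill the two planes which span V, against the
  -- previous step.
  have hn₃ : ¬ H ≤ (F (Fin.castAdd t 2)).sub (q + 2) := by
    intro hH3
    apply hnV
    have key : ∀ A : Submodule ℂ X, A ⊓ (F (Fin.castAdd t 2)).sub (q + 2) ≤ V →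
        finrank ℂ ↥(V ⊓ A) = 2 → 2 ≤ finrank ℂ ↥(H ⊓ A) → V ⊓ A ≤ H := by
      intro A hA hVA hHA
      have h5 : H ⊓ A ≤ V ⊓ A := le_inf ((le_inf inf_le_right (inf_le_left.trans hH3)).trans hA)
        inf_le_right
      rw [← Submodule.eq_of_le_of_finrank_le h5 (by omega)]
      exact inf_le_left
    exact hQ.le_sup.trans (sup_le (key _ hQ.inf_le₁ hQ.inf₁ h1) (key _ hQ.inf_le₂ hQ.inf₂ h2))
  -- Inside H, a subspace of dimension 2 meets H ∩ F³_{q+2}, of dimension at least a + 1.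
  have hline : ∀ A : Submodule ℂ X, A ⊓ (F (Fin.castAdd t 2)).sub (q + 2) ≤ V →
      2 ≤ finrank ℂ ↥(H ⊓ A) → 1 ≤ finrank ℂ ↥(V ⊓ H ⊓ A) := by
    intro A hA hHA
    have h5 := finrank_add_le_inf_add (inf_le_left : H ⊓ A ≤ H)
      (inf_le_left : H ⊓ (F (Fin.castAdd t 2)).sub (q + 2) ≤ H)
    have h6 : H ⊓ A ⊓ (H ⊓ (F (Fin.castAdd t 2)).sub (q + 2)) ≤ V ⊓ H ⊓ A := fun u hu =>
      ⟨⟨hA ⟨hu.1.2, hu.2.2⟩, hu.1.1⟩, hu.1.2⟩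
    have h7 := Submodule.finrank_mono h6
    omega
  have s1 := hline _ hQ.inf_le₁ h1
  have s2 := hline _ hQ.inf_le₂ h2
  have hdisj : V ⊓ (F (Fin.castAdd t 0)).sub 5 ⊓ (V ⊓ (F (Fin.castAdd t 1)).sub 5) = ⊥ := by
    have h5 := Submodule.finrank_sup_add_finrank_inf_eq (V ⊓ (F (Fin.castAdd t 0)).sub 5)
      (V ⊓ (F (Fin.castAdd t 1)).sub 5)
    have h6 := Submodule.finrank_mono hQ.le_sup
    rw [hQ.inf₁, hQ.inf₂] at h5
    rw [hQ.finrank_V] at h6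
    exact Submodule.finrank_eq_zero.1 (by omega)
  have hh2 : 2 ≤ finrank ℂ ↥(V ⊓ H) := by
    have h5 := finrank_add_le_of_inf_eq_bot
      (inf_le_left : V ⊓ H ⊓ (F (Fin.castAdd t 0)).sub 5 ≤ V ⊓ H)
      (inf_le_left : V ⊓ H ⊓ (F (Fin.castAdd t 1)).sub 5 ≤ V ⊓ H) (by
        rw [eq_bot_iff, ← hdisj]
        exact fun u hu => ⟨⟨hu.1.1.1, hu.1.2⟩, ⟨hu.1.1.1, hu.2.2⟩⟩)
    omega
  -- If A missed F³_q, then H would be the sum of A and H ∩ F³_q and so lie in F³_{q+2}.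
  have hsup : ∀ A : Submodule ℂ X, A ≤ V → A ≤ H → 2 ≤ finrank ℂ A →
      A ⊓ (F (Fin.castAdd t 2)).sub q ≠ ⊥ := by
    intro A hAV hAH hA2 hA
    have h5 := eq_sup_of_finrank_le hAH (inf_le_left : H ⊓ (F (Fin.castAdd t 2)).sub q ≤ H) (by
      rw [eq_bot_iff, ← hA]
      exact inf_le_inf_left _ inf_le_right) (by omega)
    apply hn₃
    rw [← h5]
    exact sup_le (hAV.trans hQ.le₃) (inf_le_right.trans ((F _).mono (by omega)))
  have h44 := finrank_add_le_inf_add (inf_le_right : V ⊓ H ≤ H)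
    (inf_le_left : H ⊓ (F (Fin.castAdd t 3)).sub (q + 3) ≤ H)
  have h45 : V ⊓ H ⊓ (H ⊓ (F (Fin.castAdd t 3)).sub (q + 3)) =
      V ⊓ H ⊓ (F (Fin.castAdd t 3)).sub (q + 3) := by
    rw [← inf_assoc, inf_eq_left.2 (inf_le_right : V ⊓ H ≤ H)]
  rw [h45] at h44
  refine ⟨le_antisymm ?_ hh2, s1, s2, ?_, by omega⟩
  -- If V ∩ H had dimension 3, it would meet F⁴_{q+3} in dimension 2, and that intersection would in
  -- turn meet F³_q, although V ∩ F³_q ∩ F⁴_{q+3} = 0.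
  · by_contra h5
    refine hsup (V ⊓ H ⊓ (F (Fin.castAdd t 3)).sub (q + 3)) (inf_le_left.trans inf_le_left)
      (inf_le_left.trans inf_le_right) (by omega) ?_
    rw [eq_bot_iff, ← hQ.disj₃₄]
    exact fun u hu => ⟨⟨hu.1.1.1, hu.2⟩, hu.1.2⟩
  · rw [Nat.one_le_iff_ne_zero, Ne, Submodule.finrank_eq_zero]
    exact hsup _ inf_le_left inf_le_right hh2

theorem QuadFacts.le_instC (hQ : QuadFacts q F V) (hN : NumFacts a (q + 1) κ ρ σ ν₄ ν')
    {H : Submodule ℂ X} (hH : H ∈ Solutions (2 + a) (bigProblem a (q + 1) κ ρ σ ν₄ ν') F)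
    (hT : TransFacts q F V (V ⊓ H) (instC q F (V ⊓ H))) : H ≤ instC q F (V ⊓ H) := by
  obtain ⟨hHa, h1, h2, h3, h3', h4⟩ := hQ.inf_solution hN hH
  -- H is spanned by H ∩ F⁴_{q+3}, of dimension at least a + 1, and V ∩ H, which meet in a line.
  have hHT : H ≤ instT q F (V ⊓ H) := by
    have h5 := Submodule.finrank_sup_add_finrank_inf_eq (H ⊓ (F (Fin.castAdd t 3)).sub (q + 3))
      (V ⊓ H)
    have h6 : H ⊓ (F (Fin.castAdd t 3)).sub (q + 3) ⊓ (V ⊓ H) =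
        V ⊓ H ⊓ (F (Fin.castAdd t 3)).sub (q + 3) := by
      rw [inf_comm, ← inf_assoc, inf_eq_left.2 (inf_le_right : V ⊓ H ≤ H)]
    rw [h6, hT.h_fourth', hT.finrank_h] at h5
    have h7 := Submodule.eq_of_le_of_finrank_le (sup_le inf_le_left inf_le_right :
      H ⊓ (F (Fin.castAdd t 3)).sub (q + 3) ⊔ V ⊓ H ≤ H) (by omega)
    exact h7.ge.trans (sup_le_sup inf_le_right le_rfl)
  -- By dimension H is the direct sum of its intersections with A and A', both of which lie in T.
  have key : ∀ A A' : Submodule ℂ X, A ⊓ A' = ⊥ → 2 ≤ finrank ℂ ↥(H ⊓ A) →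
      a ≤ finrank ℂ ↥(H ⊓ A') →
      H ≤ (A ⊓ instT q F (V ⊓ H)) ⊔ (A' ⊓ instT q F (V ⊓ H)) := by
    intro A A' hAA hA hA'
    have h5 := eq_sup_of_finrank_le (inf_le_left : H ⊓ A ≤ H) (inf_le_left : H ⊓ A' ≤ H) (by
      rw [eq_bot_iff, ← hAA]
      exact inf_le_inf inf_le_right inf_le_right) (by omega)
    calc H = H ⊓ A ⊔ H ⊓ A' := h5.symm
      _ ≤ _ := sup_le_sup (le_inf inf_le_right (inf_le_left.trans hHT))
        (le_inf inf_le_right (inf_le_left.trans hHT))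
  exact le_inf (key _ _ hQ.disj₁ h1 h3) (key _ _ hQ.disj₂ h2 h3)

/-- The corner conditions of the first and third partitions of the fiber give K a subspace of
dimension 1 in the image of C ∩ F¹_5 and one of dimension a - 1 in that of C ∩ F³_q. These images
are independent, so K is spanned inside the image of C. -/
theorem TransFacts.le_map_C {h C : Submodule ℂ X} (hQ : QuadFacts q F V)
    (hT : TransFacts q F V h C) (hN : NumFacts a (q + 1) κ ρ σ ν₄ ν') {K : Submodule ℂ (X ⧸ V)}
    (hK : K ∈ Solutions a (fiberProblem a (q + 1) κ ρ σ ν₄ ν') (instG q V C F)) :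
    K ≤ C.map V.mkQ := by
  have ha := hN.ha
  have hab := hN.hab
  have hq2 := hQ.two_le
  have hquot : finrank ℂ (X ⧸ V) = q + 1 := by
    have := Submodule.finrank_quotient_add_finrank V
    rw [hQ.finrank_V, hQ.finrank_X] at this
    omega
  have h1 : 1 ≤ finrank ℂ ↥(K ⊓ (C ⊓ (F (Fin.castAdd t 0)).sub 5).map V.mkQ) := by
    have h := (hK.2 (Fin.castAdd t 0)).2 0 ha
    rw [fiberProblem, Fin.append_left] at h
    change _ ≤ finrank ℂ ↥(K ⊓ (instG q V C F (Fin.castAdd t 0)).sub (finrank ℂ (X ⧸ V) - a +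
      (0 + 1) - rowsThen (q + 1 - a - 1) 1 κ 0)) at h
    rw [rowsThen, if_pos (by norm_num)] at h
    rwa [show finrank ℂ (X ⧸ V) - a + (0 + 1) - (q + 1 - a - 1) = 2 by omega,
      hT.first_five hQ] at h
  have h2 : a - 1 ≤ finrank ℂ ↥(K ⊓ (C ⊓ (F (Fin.castAdd t 2)).sub q).map V.mkQ) := by
    rcases Nat.lt_or_ge a 2 with ha2 | ha2
    · omega
    · have h := (hK.2 (Fin.castAdd t 2)).2 (a - 2) (by omega)
      rw [fiberProblem, Fin.append_left] at h
      change _ ≤ finrank ℂ ↥(K ⊓ (instG q V C F (Fin.castAdd t 2)).sub (finrank ℂ (X ⧸ V) - a +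
        (a - 2 + 1) - (rect 2 (a - 1) + σ) (a - 2))) at h
      rw [Pi.add_apply, rect, if_pos (by omega)] at h
      rw [← hT.third_rel_last hq2]
      have h5 := Submodule.finrank_mono (inf_le_inf_left K
        ((instG q V C F (Fin.castAdd t 2)).mono (show finrank ℂ (X ⧸ V) - a +
        (a - 2 + 1) - (2 + σ (a - 2)) ≤ q - 2 by omega)))
      omega
  -- Two representatives differ by a vector of V, which splits into parts in F¹_5 and F³_q. Moving
  -- one part to each side gives a vector of F¹_5 ∩ F³_q = 0.
  have h3 : (C ⊓ (F (Fin.castAdd t 0)).sub 5).map V.mkQ ⊓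
      (C ⊓ (F (Fin.castAdd t 2)).sub q).map V.mkQ = ⊥ := by
    rw [eq_bot_iff]
    rintro _ ⟨⟨u, ⟨-, hu⟩, rfl⟩, ⟨w, ⟨-, hw⟩, hwu⟩⟩
    have h4 : w - u ∈ V := (Submodule.Quotient.eq V).1 hwu
    obtain ⟨v₁, hv₁, v₂, hv₂, hv⟩ := Submodule.mem_sup.1 (hQ.le_sup₃ h4)
    have h5 : u + v₁ = w - v₂ := by
      rw [← sub_eq_zero]
      have : u + v₁ - (w - v₂) = (v₁ + v₂) - (w - u) := by abel
      rw [this, hv, sub_self]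
    have h6 : u + v₁ ∈ (F (Fin.castAdd t 0)).sub 5 ⊓ (F (Fin.castAdd t 2)).sub q :=
      ⟨add_mem hu hv₁.2, h5 ▸ sub_mem hw hv₂.2⟩
    rw [hQ.disj₁, Submodule.mem_bot] at h6
    rw [Submodule.mem_bot, Submodule.mkQ_apply, Submodule.Quotient.mk_eq_zero,
      eq_neg_of_add_eq_zero_left h6]
    exact neg_mem hv₁.1
  have h5 := eq_sup_of_finrank_le (H := K) inf_le_left inf_le_left
    (A := K ⊓ (C ⊓ (F (Fin.castAdd t 0)).sub 5).map V.mkQ)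
    (B := K ⊓ (C ⊓ (F (Fin.castAdd t 2)).sub q).map V.mkQ) (by
      rw [eq_bot_iff, ← h3]
      exact inf_le_inf inf_le_right inf_le_right) (by rw [hK.1]; omega)
  rw [← h5]
  exact sup_le (inf_le_right.trans (Submodule.map_mono inf_le_left))
    (inf_le_right.trans (Submodule.map_mono inf_le_left))

/-- The solution is the part of C over K. It maps onto K because K lies in the image of C, and it
meets V in C ∩ V = h. -/
theorem TransFacts.exists_solution {h C : Submodule ℂ X} (hQ : QuadFacts q F V)
    (hT : TransFacts q F V h C) (hN : NumFacts a (q + 1) κ ρ σ ν₄ ν') {K : Submodule ℂ (X ⧸ V)}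
    (hK : K ∈ Solutions a (fiberProblem a (q + 1) κ ρ σ ν₄ ν') (instG q V C F)) :
    ∃ H ∈ Solutions (2 + a) (bigProblem a (q + 1) κ ρ σ ν₄ ν') F,
      V ⊓ H = h ∧ H.map V.mkQ = K := by
  have hKC := hT.le_map_C hQ hN hK
  have hmap : (C ⊓ K.comap V.mkQ).map V.mkQ = K := by
    apply le_antisymm
    · rintro _ ⟨u, hu, rfl⟩
      exact hu.2
    · intro k hk
      obtain ⟨c, hc, rfl⟩ := hKC hk
      exact ⟨c, ⟨hc, hk⟩, rfl⟩
  have hVK : V ≤ K.comap V.mkQ := by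
    intro v hv
    rw [Submodule.mem_comap, Submodule.mkQ_apply, (Submodule.Quotient.mk_eq_zero V).2 hv]
    exact zero_mem _
  have hCV : C ⊓ K.comap V.mkQ ⊓ V = h := by
    rw [inf_assoc, inf_eq_right.2 hVK, hT.inf_V]
  have hfin : finrank ℂ ↥(C ⊓ K.comap V.mkQ) = 2 + a := by
    have := finrank_map_mkQ_add V (C ⊓ K.comap V.mkQ)
    rw [hmap, hCV, hT.finrank_h, hK.1] at this
    omega
  refine ⟨C ⊓ K.comap V.mkQ, ?_, by rw [inf_comm, hCV], hmap⟩
  rw [hT.mem_solutions_iff hQ hN (hCV ▸ inf_le_left) inf_le_left hfin, hmap]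
  exact hK

theorem GoodInst.solution_facts (hF : GoodInst q F) (hN : NumFacts a (q + 1) κ ρ σ ν₄ ν')
    {H : Submodule ℂ X} (hH : H ∈ Solutions (2 + a) (bigProblem a (q + 1) κ ρ σ ν₄ ν') F) :
    inter (instData q F).V H ∈ Solutions 2 (fun _ => box) (instData q F).E ∧
      TransFacts q F (instV q F) (instV q F ⊓ H) (instC q F (instV q F ⊓ H)) ∧
      H ≤ instC q F (instV q F ⊓ H) := by
  have h1 := hF.quad.inter_mem hN hH
  have h2 := hF.trans _ h1
  rw [map_inter] at h2
  exact ⟨h1, h2, hF.quad.le_instC hN hH h2⟩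

theorem GoodInst.quot_mem (hF : GoodInst q F) (hN : NumFacts a (q + 1) κ ρ σ ν₄ ν')
    {H : Submodule ℂ X} (hH : H ∈ Solutions (2 + a) (bigProblem a (q + 1) κ ρ σ ν₄ ν') F) :
    quot (instData q F).V H ∈ Solutions a (fiberProblem a (q + 1) κ ρ σ ν₄ ν')
      ((instData q F).G (inter (instData q F).V H)) := by
  obtain ⟨h1, h2, h3⟩ := hF.solution_facts hN hH
  have := (h2.mem_solutions_iff hF.quad hN inf_le_right h3 hH.1).1 hH
  rw [← map_inter] at this
  exact this

/-- The modular law. It makes the map to pairs injective: C depends only on H ∩ V, and then the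
image of H determines H. -/
theorem eq_inf_comap {X : Type} [AddCommGroup X] [Module ℂ X] {V C H : Submodule ℂ X} (hC : C ⊓ V ≤ H) (hH : H ≤ C) :
    C ⊓ (H.map V.mkQ).comap V.mkQ = H := by
  rw [Submodule.comap_map_mkQ, sup_comm, inf_comm, sup_inf_assoc_of_le _ hH, inf_comm V C,
    sup_eq_left.2 hC]

theorem GoodInst.bijOn (hF : GoodInst q F) (hN : NumFacts a (q + 1) κ ρ σ ν₄ ν') :
    Set.BijOn (fun H => (inter (instData q F).V H, quot (instData q F).V H))
      (Solutions (2 + a) (bigProblem a (q + 1) κ ρ σ ν₄ ν') F)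
      {p | p.1 ∈ Solutions 2 (fun _ => box) (instData q F).E ∧
        p.2 ∈ Solutions a (fiberProblem a (q + 1) κ ρ σ ν₄ ν') ((instData q F).G p.1)} := by
  refine ⟨fun H hH => ⟨(hF.solution_facts hN hH).1, hF.quot_mem hN hH⟩, ?_, ?_⟩
  · intro H hH H' hH' heq
    obtain ⟨-, h2, h3⟩ := hF.solution_facts hN hH
    obtain ⟨-, h2', h3'⟩ := hF.solution_facts hN hH'
    have e1 : instV q F ⊓ H = instV q F ⊓ H' := by
      have := congrArg (fun p => p.1.map (instV q F).subtype) heq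
      simpa only [instData, map_inter] using this
    have e2 : H.map (instV q F).mkQ = H'.map (instV q F).mkQ := congrArg Prod.snd heq
    have e3 := eq_inf_comap (h2.inf_V.le.trans inf_le_right) h3
    have e4 := eq_inf_comap (h2'.inf_V.le.trans inf_le_right) h3'
    rw [← e3, ← e4, e1, e2]
  · rintro ⟨h, K⟩ ⟨hh, hK⟩
    obtain ⟨H, hH, hHV, hHK⟩ := (hF.trans h hh).exists_solution hF.quad hN hK
    refine ⟨H, hH, Prod.ext ?_ hHK⟩
    have : (inter (instV q F) H).map (instV q F).subtype = h.map (instV q F).subtype := by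
      rw [map_inter, hHV]
    exact Submodule.map_injective_of_injective (instV q F).injective_subtype this

end forward

end SchubertFib

end

noncomputable section

namespace SchubertFib

open Module

/-! ### Bases of `X` from bases of `V` and of `X / V` -/

section shuffle

/-- The positions `f i` and `g m` of the members of two sequences of lengths `n₁` and `n₂` in a
shuffle of the sequences. -/
structure IsShuffle (n₁ n₂ : ℕ) (f g : ℕ → ℕ) : Prop where
  lt₁ : ∀ i < n₁, f i < n₁ + n₂
  lt₂ : ∀ m < n₂, g m < n₁ + n₂
  inj₁ : ∀ i < n₁, ∀ j < n₁, f i = f j → i = j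
  inj₂ : ∀ m < n₂, ∀ k < n₂, g m = g k → m = k
  ne : ∀ i < n₁, ∀ m < n₂, f i ≠ g m

def IsShuffle.equiv {n₁ n₂ n : ℕ} {f g : ℕ → ℕ} (h : IsShuffle n₁ n₂ f g) (hn : n₁ + n₂ = n) :
    Fin n₁ ⊕ Fin n₂ ≃ Fin n :=
  Equiv.ofBijective (Sum.elim (fun i => ⟨f i, hn ▸ h.lt₁ i i.2⟩) fun m => ⟨g m, hn ▸ h.lt₂ m m.2⟩)
    ((Fintype.bijective_iff_injective_and_card _).2 ⟨by
      rintro (i | m) (j | k) hij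
      · exact congrArg _ (Fin.ext (h.inj₁ i i.2 j j.2 (congrArg Fin.val hij)))
      · exact absurd (congrArg Fin.val hij) (h.ne i i.2 k k.2)
      · exact absurd (congrArg Fin.val hij).symm (h.ne j j.2 m m.2)
      · exact congrArg _ (Fin.ext (h.inj₂ m m.2 k k.2 (congrArg Fin.val hij))), by simp [hn]⟩)

variable {X : Type} [AddCommGroup X] [Module ℂ X] {V : Submodule ℂ X}

/-- The decomposition of `X` by a section. -/
def splitEquiv {s : (X ⧸ V) →ₗ[ℂ] X} (hs : ∀ z, V.mkQ (s z) = z) : (V × (X ⧸ V)) ≃ₗ[ℂ] X where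
  toFun p := p.1 + s p.2
  map_add' p r := by simp only [Prod.fst_add, Prod.snd_add, Submodule.coe_add, map_add]; abel
  map_smul' c p := by simp
  invFun u := (⟨u - s (V.mkQ u), by
    rw [← Submodule.Quotient.mk_eq_zero V, ← Submodule.mkQ_apply, map_sub, hs, sub_self]⟩, V.mkQ u)
  left_inv p := by
    have h : V.mkQ (p.1 + s p.2) = p.2 := by
      rw [map_add, hs, Submodule.mkQ_apply, (Submodule.Quotient.mk_eq_zero V).2 p.1.2, zero_add]
    refine Prod.ext (Subtype.ext ?_) h
    simp only [h]
    abel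
  right_inv u := by simp

theorem exists_eq_add {s : (X ⧸ V) →ₗ[ℂ] X} (hs : ∀ z, V.mkQ (s z) = z) (u : X) :
    ∃ v : V, u = v + s (V.mkQ u) :=
  ⟨((splitEquiv hs).symm u).1, ((splitEquiv hs).apply_symm_apply u).symm⟩

variable [FiniteDimensional ℂ X] {f g : ℕ → ℕ}

theorem finrank_add_quotient (V : Submodule ℂ X) :
    finrank ℂ V + finrank ℂ (X ⧸ V) = finrank ℂ X := by
  rw [add_comm]
  exact Submodule.finrank_quotient_add_finrank V

/-- The basis obtained by shuffling a basis of `V` and a lifted basis of `X / V`. -/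
def shuffle (h : IsShuffle (finrank ℂ V) (finrank ℂ (X ⧸ V)) f g) {s : (X ⧸ V) →ₗ[ℂ] X}
    (hs : ∀ z, V.mkQ (s z) = z) (b : Basis (Fin (finrank ℂ V)) ℂ V)
    (w : Basis (Fin (finrank ℂ (X ⧸ V))) ℂ (X ⧸ V)) : Basis (Fin (finrank ℂ X)) ℂ X :=
  ((b.prod w).map (splitEquiv hs)).reindex (h.equiv (finrank_add_quotient V))

variable (h : IsShuffle (finrank ℂ V) (finrank ℂ (X ⧸ V)) f g) {s : (X ⧸ V) →ₗ[ℂ] X}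
  (hs : ∀ z, V.mkQ (s z) = z) (b : Basis (Fin (finrank ℂ V)) ℂ V)
  (w : Basis (Fin (finrank ℂ (X ⧸ V))) ℂ (X ⧸ V))

theorem bv_shuffle₁ {i : ℕ} (hi : i < finrank ℂ V) : bv (shuffle h hs b w) (f i) = bv b i := by
  have h1 : f i < finrank ℂ X := finrank_add_quotient V ▸ h.lt₁ i hi
  rw [bv_of_lt _ h1, bv_of_lt _ hi]
  have h2 : (⟨f i, h1⟩ : Fin (finrank ℂ X)) = h.equiv (finrank_add_quotient V) (Sum.inl ⟨i, hi⟩) := rfl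
  rw [h2, shuffle, Basis.reindex_apply, Equiv.symm_apply_apply, Basis.map_apply]
  simp [splitEquiv]

theorem bv_shuffle₂ {m : ℕ} (hm : m < finrank ℂ (X ⧸ V)) :
    bv (shuffle h hs b w) (g m) = s (bv w m) := by
  have h1 : g m < finrank ℂ X := finrank_add_quotient V ▸ h.lt₂ m hm
  rw [bv_of_lt _ h1, bv_of_lt _ hm]
  have h2 : (⟨g m, h1⟩ : Fin (finrank ℂ X)) = h.equiv (finrank_add_quotient V) (Sum.inr ⟨m, hm⟩) := rfl
  rw [h2, shuffle, Basis.reindex_apply, Equiv.symm_apply_apply, Basis.map_apply]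
  simp [splitEquiv]

theorem mem_ofBasis_iff_repr {Y : Type} [AddCommGroup Y] [Module ℂ Y]
    (b : Basis (Fin (finrank ℂ Y)) ℂ Y) (m : ℕ) (u : Y) :
    u ∈ (CompleteFlag.ofBasis b).sub m ↔ ∀ k : Fin (finrank ℂ Y), m ≤ k → b.repr u k = 0 := by
  rw [mem_ofBasis_iff b]
  exact ⟨fun H k hk => (crd_eq_zero_iff b b k.2 u).1 (H k hk k.2),
    fun H k hk hk' => (crd_eq_zero_iff b b hk' u).2 (H ⟨k, hk'⟩ hk)⟩

/-- The subspaces of the flag of a shuffled basis. -/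
theorem mem_shuffle {n p m : ℕ} (hp : ∀ i < finrank ℂ V, n ≤ f i ↔ p ≤ i)
    (hm : ∀ k < finrank ℂ (X ⧸ V), n ≤ g k ↔ m ≤ k) (v : V) (z : X ⧸ V) :
    (v : X) + s z ∈ (CompleteFlag.ofBasis (shuffle h hs b w)).sub n ↔
      v ∈ (CompleteFlag.ofBasis b).sub p ∧ z ∈ (CompleteFlag.ofBasis w).sub m := by
  rw [mem_ofBasis_iff_repr, mem_ofBasis_iff_repr, mem_ofBasis_iff_repr,
    ← (h.equiv (finrank_add_quotient V)).forall_congr_right, Sum.forall]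
  have h0 : (v : X) + s z = splitEquiv hs (v, z) := rfl
  have h1 : ∀ k, (shuffle h hs b w).repr (v + s z) (h.equiv (finrank_add_quotient V) k) =
      (b.prod w).repr (v, z) k := by
    intro k
    rw [h0, shuffle, Basis.repr_reindex_apply, Equiv.symm_apply_apply, Basis.map_repr]
    simp
  refine and_congr (forall_congr' fun i => ?_) (forall_congr' fun k => ?_)
  · rw [h1, Basis.prod_repr_inl]
    exact imp_congr (hp i i.2) Iff.rfl
  · rw [h1, Basis.prod_repr_inr]
    exact imp_congr (hm k k.2) Iff.rfl

theorem mem_shuffle_section {n p m : ℕ} (hp : ∀ i < finrank ℂ V, n ≤ f i ↔ p ≤ i)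
    (hm : ∀ k < finrank ℂ (X ⧸ V), n ≤ g k ↔ m ≤ k) (z : X ⧸ V) :
    s z ∈ (CompleteFlag.ofBasis (shuffle h hs b w)).sub n ↔
      z ∈ (CompleteFlag.ofBasis w).sub m := by
  have := mem_shuffle h hs b w hp hm 0 z
  rw [Submodule.coe_zero, zero_add] at this
  rw [this, and_iff_right (zero_mem _)]

theorem map_mkQ_shuffle {n p m : ℕ} (hp : ∀ i < finrank ℂ V, n ≤ f i ↔ p ≤ i)
    (hm : ∀ k < finrank ℂ (X ⧸ V), n ≤ g k ↔ m ≤ k) :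
    ((CompleteFlag.ofBasis (shuffle h hs b w)).sub n).map V.mkQ =
      (CompleteFlag.ofBasis w).sub m := by
  apply le_antisymm
  · rintro _ ⟨u, hu, rfl⟩
    obtain ⟨v, hv⟩ := exists_eq_add hs u
    rw [SetLike.mem_coe, hv] at hu
    exact ((mem_shuffle h hs b w hp hm v _).1 hu).2
  · intro z hz
    exact ⟨s z, (mem_shuffle_section h hs b w hp hm z).2 hz, hs z⟩

theorem exists_section (V : Submodule ℂ X) : ∃ s : (X ⧸ V) →ₗ[ℂ] X, ∀ z, V.mkQ (s z) = z := by
  obtain ⟨s, hs⟩ := V.mkQ.exists_rightInverse_of_surjective (Submodule.range_mkQ V)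
  exact ⟨s, fun z => LinearMap.congr_fun hs z⟩

end shuffle

end SchubertFib

end

noncomputable section

namespace SchubertFib

open Module

/-! ### Data for an instance with prescribed V and prescribed flags. -/

section frames

/-- The bases `b` define flags in a four-dimensional space whose planes are spanned by
`x, x'`, `y, y'`, `x - y, x' - y'`, `x - α y, x' - α' y'` for a basis `x, x', y, y'`. -/
structure QuadFrame {Y : Type} [AddCommGroup Y] [Module ℂ Y]
    (b : Fin 4 → Basis (Fin (finrank ℂ Y)) ℂ Y) (v : Basis (Fin 4) ℂ Y) (α α' : ℂ) : Prop where
  α_ne_zero : α ≠ 0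
  α_ne_one : α ≠ 1
  α'_ne_zero : α' ≠ 0
  α'_ne_one : α' ≠ 1
  α_ne : α ≠ α'
  mem₁ : ∀ u, u ∈ (CompleteFlag.ofBasis (b 0)).sub 2 ↔ v.coord 2 u = 0 ∧ v.coord 3 u = 0
  mem₂ : ∀ u, u ∈ (CompleteFlag.ofBasis (b 1)).sub 2 ↔ v.coord 0 u = 0 ∧ v.coord 1 u = 0
  mem₃ : ∀ u, u ∈ (CompleteFlag.ofBasis (b 2)).sub 2 ↔
    v.coord 0 u + v.coord 2 u = 0 ∧ v.coord 1 u + v.coord 3 u = 0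
  mem₄ : ∀ u, u ∈ (CompleteFlag.ofBasis (b 3)).sub 2 ↔
    α * v.coord 0 u + v.coord 2 u = 0 ∧ α' * v.coord 1 u + v.coord 3 u = 0
  last₁ : v.coord 0 (bv (b 2) 3) + v.coord 2 (bv (b 2) 3) ≠ 0
  last₂ : v.coord 1 (bv (b 2) 3) + v.coord 3 (bv (b 2) 3) ≠ 0

/-- The flags of the bases `b` are in general position with respect to the vectors `x`, `y`. -/
structure FrameEdge {Y : Type} [AddCommGroup Y] [Module ℂ Y]
    (b : Fin 4 → Basis (Fin (finrank ℂ Y)) ℂ Y) (x y : Y) (α : ℂ) : Prop where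
  fst_fst : x ∉ (CompleteFlag.ofBasis (b 0)).sub 1
  snd_snd : y ∉ (CompleteFlag.ofBasis (b 1)).sub 1
  fst : y ∉ (CompleteFlag.ofBasis (b 0)).sub 3
  snd : x ∉ (CompleteFlag.ofBasis (b 1)).sub 3
  trd : x - y ∉ (CompleteFlag.ofBasis (b 2)).sub 1
  fth : x - α • y ∉ (CompleteFlag.ofBasis (b 3)).sub 1

/-- Bases of a `(q + 1)`-dimensional space, adapted to two linear forms. -/
structure FiberFrame (q : ℕ) {t : ℕ} {Y : Type} [AddCommGroup Y] [Module ℂ Y]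
    (w : Fin (4 + t) → Basis (Fin (finrank ℂ Y)) ℂ Y) (φ θ : Y →ₗ[ℂ] ℂ) : Prop where
  φ_first : ∀ m < q + 1, φ (bv (w (Fin.castAdd t 0)) m) = 0 ↔ m ≠ 2
  φ_other : ∀ i, i ≠ Fin.castAdd t 0 → i ≠ Fin.castAdd t 2 → ∀ m < q + 1,
    φ (bv (w i) m) = 0 ↔ m ≠ 0
  φ_third : ∀ u ∈ (CompleteFlag.ofBasis (w (Fin.castAdd t 2))).sub (q - 2), φ u = 0
  φ_third_ne : φ (bv (w (Fin.castAdd t 2)) (q - 2)) ≠ 0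
  θ_first : θ (bv (w (Fin.castAdd t 0)) 2) ≠ 0
  θ_other : ∀ i, i ≠ Fin.castAdd t 0 → i ≠ Fin.castAdd t 2 → θ (bv (w i) 0) ≠ 0
  θ_third : ∀ u ∈ (CompleteFlag.ofBasis (w (Fin.castAdd t 2))).sub (q - 2), θ u = 0
  θ_third_ne : θ (bv (w (Fin.castAdd t 2)) (q - 2)) ≠ 0
  disj₁ : (CompleteFlag.ofBasis (w (Fin.castAdd t 0))).sub 3 ⊓
    (CompleteFlag.ofBasis (w (Fin.castAdd t 2))).sub (q - 2) = ⊥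
  disj₂ : (CompleteFlag.ofBasis (w (Fin.castAdd t 1))).sub 3 ⊓
    (CompleteFlag.ofBasis (w (Fin.castAdd t 2))).sub (q - 2) = ⊥

/-- The data from which an instance with given fibration data is constructed. -/
structure LiftData {X : Type} [AddCommGroup X] [Module ℂ X] (V : Submodule ℂ X) (t q : ℕ) where
  two_le : 2 ≤ q
  finrank_V : finrank ℂ V = 4
  finrank_quot : finrank ℂ (X ⧸ V) = q + 1
  s : (X ⧸ V) →ₗ[ℂ] X
  hs : ∀ z, V.mkQ (s z) = z
  b : Fin 4 → Basis (Fin (finrank ℂ V)) ℂ V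
  d : Basis (Fin (finrank ℂ V)) ℂ V
  v : Basis (Fin 4) ℂ V
  α : ℂ
  α' : ℂ
  frame : QuadFrame b v α α'
  edge : FrameEdge b (v 0) (v 2) α
  edge' : FrameEdge b (v 1) (v 3) α'
  mem_d : ∀ u, u ∈ (CompleteFlag.ofBasis d).sub 2 ↔
    v.coord 0 u = v.coord 1 u ∧ v.coord 2 u = v.coord 3 u
  w : Fin (4 + t) → Basis (Fin (finrank ℂ (X ⧸ V))) ℂ (X ⧸ V)
  φ : (X ⧸ V) →ₗ[ℂ] ℂ
  θ : (X ⧸ V) →ₗ[ℂ] ℂ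
  fiber : FiberFrame q w φ θ

namespace LiftData

variable {X : Type} [AddCommGroup X] [Module ℂ X] {V : Submodule ℂ X}
  {t q : ℕ} (D : LiftData V t q)

/-- The twisted lifts, used for the second and the fourth flag. The twist by φ confines the image of
C to ker φ for the transversal of v 0, v 2; the twist by θ confines it to ker θ for the transversal
of v 1, v 3. -/
def s₁ : (X ⧸ V) →ₗ[ℂ] X := D.s + D.φ.smulRight ((D.v 1 - D.v 3 : V) : X)
def s₃ : (X ⧸ V) →ₗ[ℂ] X := D.s - D.θ.smulRight ((D.v 2 : V) : X)

theorem s₁_apply (z) : D.s₁ z = D.s z + ((D.φ z • (D.v 1 - D.v 3) : V) : X) := rfl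
theorem s₃_apply (z) : D.s₃ z = D.s z - ((D.θ z • D.v 2 : V) : X) := rfl

theorem mkQ_coe (v : V) : V.mkQ (v : X) = 0 := (Submodule.Quotient.mk_eq_zero V).2 v.2

theorem hs₁ (z) : V.mkQ (D.s₁ z) = z := by
  rw [s₁_apply, map_add, D.hs, mkQ_coe, add_zero]

theorem hs₃ (z) : V.mkQ (D.s₃ z) = z := by
  rw [s₃_apply, map_sub, D.hs, mkQ_coe, sub_zero]

/-- Positions of the vectors of `V` and of the lifted vectors, in the five types of flags. -/
def fpos (q : ℕ) : Fin 5 → ℕ → ℕ :=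
  -- The positions are dictated by the dimensions of V ∩ F_n and the images of F_n. In every type
  -- but the third, position 0 holds a lifted vector on which φ does not vanish: number 2 in the
  -- first flag, whose line is inserted late, and number 0 in the others.
  ![fun i => if i < 3 then i + 3 else i + q + 1, fun i => if i < 3 then i + 3 else i + q + 1,
    fun i => if i = 0 then 0 else i + (q - 2), fun i => if i = 0 then 1 else i + q + 1,
    fun i => if i < 2 then i + 1 else i + q + 1]
def gpos (q : ℕ) : Fin 5 → ℕ → ℕ :=
  ![fun m => if m < 2 then m + 1 else if m = 2 then 0 else m + 3, fun m => if m < 3 then m else m + 3,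
    fun m => if m < q - 2 then m + 1 else m + 4, fun m => if m = 0 then 0 else m + 1,
    fun m => if m = 0 then 0 else m + 2]

theorem isShuffle_pos {q : ℕ} (hq : 2 ≤ q) (k : Fin 5) :
    IsShuffle 4 (q + 1) (fpos q k) (gpos q k) := by
  obtain rfl | rfl | rfl | rfl | rfl : k = 0 ∨ k = 1 ∨ k = 2 ∨ k = 3 ∨ k = 4 := by omega
  all_goals
    refine ⟨fun i hi => ?_, fun m hm => ?_, fun i hi j hj h => ?_, fun m hm k hk h => ?_,
      fun i hi m hm h => ?_⟩
  all_goals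
    first
    | simp only [fpos, gpos, Matrix.cons_val] at h
      split_ifs at h <;> omega
    | simp only [fpos, gpos, Matrix.cons_val]
      split_ifs <;> omega

/-- The subspace of index `n` of the flag is spanned by the first `p` vectors of `V` and the first
`m` lifted vectors. -/
def Splits (q : ℕ) (k : Fin 5) (n p m : ℕ) : Prop :=
  (∀ i < 4, n ≤ fpos q k i ↔ p ≤ i) ∧ ∀ i < q + 1, n ≤ gpos q k i ↔ m ≤ i

theorem splits₀ {q n p m : ℕ} (hq : 2 ≤ q) (h : n = p + m ∧ 3 ≤ m ∧ (p ≤ 3 ∧ m = 3 ∨ p = 3 ∧ m ≤ q + 1)) :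
    Splits q 0 n p m := by
  constructor <;> intro i hi <;> simp only [fpos, gpos, Matrix.cons_val_zero] <;> split_ifs <;> omega

theorem splits₁ {q n p m : ℕ} (hq : 2 ≤ q) (h : n = p + m ∧
    (p = 0 ∧ m ≤ 3 ∨ p ≤ 3 ∧ m = 3 ∨ p = 3 ∧ 3 ≤ m ∧ m ≤ q + 1 ∨ p = 4 ∧ m = q + 1)) :
    Splits q 1 n p m := by
  constructor <;> intro i hi <;>
    simp only [fpos, gpos, Matrix.cons_val_zero, Matrix.cons_val_one] <;> split_ifs <;> omega

theorem splits₂ {q n p m : ℕ} (hq : 2 ≤ q) (h : n = p + m ∧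
    (p = 0 ∧ m = 0 ∨ p = 1 ∧ m ≤ q - 2 ∨ 1 ≤ p ∧ p ≤ 4 ∧ m = q - 2 ∨
      p = 4 ∧ q - 2 ≤ m ∧ m ≤ q + 1)) :
    Splits q 2 n p m := by
  constructor <;> intro i hi <;>
    simp only [fpos, gpos, Matrix.cons_val] <;> split_ifs <;> omega

theorem splits₃ {q n p m : ℕ} (h : n = p + m ∧
    (p = 0 ∧ m ≤ 1 ∨ p = 1 ∧ 1 ≤ m ∧ m ≤ q + 1 ∨ 1 ≤ p ∧ p ≤ 4 ∧ m = q + 1)) :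
    Splits q 3 n p m := by
  constructor <;> intro i hi <;>
    simp only [fpos, gpos, Matrix.cons_val] <;> split_ifs <;> omega

theorem splits₄ {q n p m : ℕ} (h : n = p + m ∧
    (p = 0 ∧ m ≤ 1 ∨ p ≤ 2 ∧ m = 1 ∨ p = 2 ∧ 1 ≤ m ∧ m ≤ q + 1 ∨ 2 ≤ p ∧ p ≤ 4 ∧ m = q + 1)) :
    Splits q 4 n p m := by
  constructor <;> intro i hi <;>
    simp only [fpos, gpos, Matrix.cons_val] <;> split_ifs <;> omega

theorem isShuffle (D : LiftData V t q) (k : Fin 5) :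
    IsShuffle (finrank ℂ V) (finrank ℂ (X ⧸ V)) (fpos q k) (gpos q k) := by
  rw [D.finrank_V, D.finrank_quot]
  exact isShuffle_pos D.two_le k

theorem splits_left (D : LiftData V t q) {k : Fin 5} {n p m : ℕ} (h : Splits q k n p m) :
    ∀ i < finrank ℂ V, n ≤ fpos q k i ↔ p ≤ i := by
  rw [D.finrank_V]
  exact h.1

theorem splits_right (D : LiftData V t q) {k : Fin 5} {n p m : ℕ} (h : Splits q k n p m) :
    ∀ i < finrank ℂ (X ⧸ V), n ≤ gpos q k i ↔ m ≤ i := by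
  rw [D.finrank_quot]
  exact h.2

variable [FiniteDimensional ℂ X]

/-- The bases of the constructed instance. -/
def B : Fin (4 + t) → Basis (Fin (finrank ℂ X)) ℂ X :=
  Fin.append ![shuffle (D.isShuffle 0) D.hs (D.b 0) (D.w (Fin.castAdd t 0)),
      shuffle (D.isShuffle 1) D.hs₁ (D.b 1) (D.w (Fin.castAdd t 1)),
      shuffle (D.isShuffle 2) D.hs (D.b 2) (D.w (Fin.castAdd t 2)),
      shuffle (D.isShuffle 3) D.hs₃ (D.b 3) (D.w (Fin.castAdd t 3))]
    fun i => shuffle (D.isShuffle 4) D.hs D.d (D.w (Fin.natAdd 4 i))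

theorem B₀ : D.B (Fin.castAdd t 0) =
    shuffle (D.isShuffle 0) D.hs (D.b 0) (D.w (Fin.castAdd t 0)) := Fin.append_left _ _ _
theorem B₁ : D.B (Fin.castAdd t 1) =
    shuffle (D.isShuffle 1) D.hs₁ (D.b 1) (D.w (Fin.castAdd t 1)) := Fin.append_left _ _ _
theorem B₂ : D.B (Fin.castAdd t 2) =
    shuffle (D.isShuffle 2) D.hs (D.b 2) (D.w (Fin.castAdd t 2)) := Fin.append_left _ _ _
theorem B₃ : D.B (Fin.castAdd t 3) =
    shuffle (D.isShuffle 3) D.hs₃ (D.b 3) (D.w (Fin.castAdd t 3)) := Fin.append_left _ _ _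
theorem B₄ (i : Fin t) : D.B (Fin.natAdd 4 i) =
    shuffle (D.isShuffle 4) D.hs D.d (D.w (Fin.natAdd 4 i)) := Fin.append_right _ _ _


/-! ### The subspaces of the constructed flags -/

/-- The flags of the constructed instance. -/
def F (i : Fin (4 + t)) : CompleteFlag X := CompleteFlag.ofBasis (D.B i)

theorem mem_F₀ {n p m : ℕ} (h : Splits q 0 n p m) (u : V) (z : X ⧸ V) :
    (u : X) + D.s z ∈ (D.F (Fin.castAdd t 0)).sub n ↔ u ∈ (CompleteFlag.ofBasis (D.b 0)).sub p ∧
      z ∈ (CompleteFlag.ofBasis (D.w (Fin.castAdd t 0))).sub m := by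
  rw [F, B₀]
  exact mem_shuffle _ _ _ _ (D.splits_left h) (D.splits_right h) u z

theorem mem_F₁ {n p m : ℕ} (h : Splits q 1 n p m) (u : V) (z : X ⧸ V) :
    (u : X) + D.s z ∈ (D.F (Fin.castAdd t 1)).sub n ↔
      u - D.φ z • (D.v 1 - D.v 3) ∈ (CompleteFlag.ofBasis (D.b 1)).sub p ∧
      z ∈ (CompleteFlag.ofBasis (D.w (Fin.castAdd t 1))).sub m := by
  rw [F, B₁, ← mem_shuffle (D.isShuffle 1) D.hs₁ (D.b 1) (D.w (Fin.castAdd t 1)) (D.splits_left h) (D.splits_right h) _ z, s₁_apply]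
  apply iff_of_eq
  congr 1
  push_cast
  abel

theorem mem_F₂ {n p m : ℕ} (h : Splits q 2 n p m) (u : V) (z : X ⧸ V) :
    (u : X) + D.s z ∈ (D.F (Fin.castAdd t 2)).sub n ↔ u ∈ (CompleteFlag.ofBasis (D.b 2)).sub p ∧
      z ∈ (CompleteFlag.ofBasis (D.w (Fin.castAdd t 2))).sub m := by
  rw [F, B₂]
  exact mem_shuffle _ _ _ _ (D.splits_left h) (D.splits_right h) u z

theorem mem_F₃ {n p m : ℕ} (h : Splits q 3 n p m) (u : V) (z : X ⧸ V) :
    (u : X) + D.s z ∈ (D.F (Fin.castAdd t 3)).sub n ↔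
      u + D.θ z • D.v 2 ∈ (CompleteFlag.ofBasis (D.b 3)).sub p ∧
      z ∈ (CompleteFlag.ofBasis (D.w (Fin.castAdd t 3))).sub m := by
  rw [F, B₃, ← mem_shuffle (D.isShuffle 3) D.hs₃ (D.b 3) (D.w (Fin.castAdd t 3)) (D.splits_left h) (D.splits_right h) _ z, s₃_apply]
  apply iff_of_eq
  congr 1
  push_cast
  abel

theorem mem_F₄ (i : Fin t) {n p m : ℕ} (h : Splits q 4 n p m) (u : V) (z : X ⧸ V) :
    (u : X) + D.s z ∈ (D.F (Fin.natAdd 4 i)).sub n ↔ u ∈ (CompleteFlag.ofBasis D.d).sub p ∧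
      z ∈ (CompleteFlag.ofBasis (D.w (Fin.natAdd 4 i))).sub m := by
  rw [F, B₄]
  exact mem_shuffle _ _ _ _ (D.splits_left h) (D.splits_right h) u z

end LiftData

end frames

end SchubertFib

end

noncomputable section
set_option linter.unusedSectionVars false

namespace SchubertFib

open Module

/-! ### The pencil of the constructed instance. -/

section lifts

theorem crd_ne_zero {X : Type} [AddCommGroup X] [Module ℂ X] {e B : Basis (Fin (finrank ℂ X)) ℂ X}
    {k : ℕ} {u : X} (hu : u ∈ (CompleteFlag.ofBasis B).sub (k + 1))
    (hu' : u ∉ (CompleteFlag.ofBasis B).sub k) : crd e B k u ≠ 0 := by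
  intro h
  refine hu' ((mem_ofBasis_iff e B k u).2 fun m hm hmn => ?_)
  rcases Nat.eq_or_lt_of_le hm with rfl | hlt
  · exact h
  · exact (mem_ofBasis_iff e B (k + 1) u).1 hu m hlt hmn

theorem mem_ofBasis_of_le {X : Type} [AddCommGroup X] [Module ℂ X]
    (B : Basis (Fin (finrank ℂ X)) ℂ X) {k : ℕ} (hk : finrank ℂ X ≤ k) (u : X) :
    u ∈ (CompleteFlag.ofBasis B).sub k :=
  (mem_ofBasis_iff B B k u).2 fun m hm hmn => by omega

theorem det_ne_zero_of_forall {m : ℕ} {M : Matrix (Fin m) (Fin m) ℂ}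
    (h : ∀ c, M.mulVec c = 0 → c = 0) : M.det ≠ 0 := fun h0 => by
  obtain ⟨c, hc, hc'⟩ := Matrix.exists_mulVec_eq_zero_iff.2 h0
  exact hc (h c hc')

theorem bv_ne_zero {X : Type} [AddCommGroup X] [Module ℂ X] (B : Basis (Fin (finrank ℂ X)) ℂ X)
    {k : ℕ} (hk : k < finrank ℂ X) : bv B k ≠ 0 := by
  rw [bv_of_lt B hk]
  exact B.ne_zero _

theorem bv_notMem {X : Type} [AddCommGroup X] [Module ℂ X] (B : Basis (Fin (finrank ℂ X)) ℂ X)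
    {k m : ℕ} (hk : k < finrank ℂ X) (hm : m ≤ k) : bv B k ∉ (CompleteFlag.ofBasis B).sub m := by
  rw [mem_ofBasis_iff_repr, bv_of_lt B hk]
  intro h
  have := h ⟨k, hk⟩ hm
  simp at this

theorem eq_zero_of_smul_bv_add_mem {X : Type} [AddCommGroup X] [Module ℂ X]
    (B : Basis (Fin (finrank ℂ X)) ℂ X) {k m : ℕ} (hk : k < finrank ℂ X) (hm : m ≤ k)
    {c : ℂ} {u : X} (hu : u ∈ (CompleteFlag.ofBasis B).sub m)
    (h : c • bv B k + u ∈ (CompleteFlag.ofBasis B).sub m) : c = 0 := by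
  by_contra hc
  exact bv_notMem B hk hm ((Submodule.smul_mem_iff _ hc).1 ((Submodule.add_mem_iff_left _ hu).1 h))

/-- Vectors `u` which describe the pencil of the bases `b`: the `p`-planes of the first two flags
contain `u 0, u 1` and `u 2, u 3`, with `u 0 - u 2` and `u 1 - u 3` in the `q`-plane of the third
flag, and the last flag is given by the equations with coefficients `α`, `α'`. The functions `r`,
`r'` give the coordinates of the plane of the pencil. -/
structure IsFramed {X : Type} [AddCommGroup X] [Module ℂ X] (p q : ℕ)
    (b : Fin 4 → Basis (Fin (finrank ℂ X)) ℂ X) (u : Fin 4 → X) (α α' : ℂ)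
    (r r' : (Fin 2 → ℂ) → ℂ) : Prop where
  add_eq : p + q = finrank ℂ X
  two_le : 2 ≤ finrank ℂ X
  α_ne_zero : α ≠ 0
  α_ne_one : α ≠ 1
  α'_ne_zero : α' ≠ 0
  α'_ne_one : α' ≠ 1
  α_ne : α ≠ α'
  disj₁ : (CompleteFlag.ofBasis (b 0)).sub p ⊓ (CompleteFlag.ofBasis (b 2)).sub q = ⊥
  disj₂ : (CompleteFlag.ofBasis (b 1)).sub p ⊓ (CompleteFlag.ofBasis (b 2)).sub q = ⊥
  mem₁ : u 0 ∈ (CompleteFlag.ofBasis (b 0)).sub p ∧ u 1 ∈ (CompleteFlag.ofBasis (b 0)).sub p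
  mem₂ : u 2 ∈ (CompleteFlag.ofBasis (b 1)).sub p ∧ u 3 ∈ (CompleteFlag.ofBasis (b 1)).sub p
  mem₃ : u 0 - u 2 ∈ (CompleteFlag.ofBasis (b 2)).sub q ∧
    u 1 - u 3 ∈ (CompleteFlag.ofBasis (b 2)).sub q
  mem₄ : ∀ c₀ c₁ c₂ c₃ : ℂ, c₀ • u 0 + c₁ • u 1 + (c₂ • u 2 + c₃ • u 3) ∈
    (CompleteFlag.ofBasis (b 3)).sub (finrank ℂ X - 2) ↔ α * c₀ + c₂ = 0 ∧ α' * c₁ + c₃ = 0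
  gv_sub : ∀ a, gv q b a - (r a • u 0 + r' a • u 1) ∈ (CompleteFlag.ofBasis (b 2)).sub q
  inj : ∀ a, r a = 0 → r' a = 0 → a = 0
  last₁ : r ![0, 1] ≠ 0
  last₂ : r' ![0, 1] ≠ 0

namespace IsFramed

variable {X : Type} [AddCommGroup X] [Module ℂ X] [FiniteDimensional ℂ X] {p q : ℕ}
  {b : Fin 4 → Basis (Fin (finrank ℂ X)) ℂ X} {u : Fin 4 → X} {α α' : ℂ}
  {r r' : (Fin 2 → ℂ) → ℂ} (H : IsFramed p q b u α α' r r') (e : Basis (Fin (finrank ℂ X)) ℂ X)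

theorem D₁_ne (H : IsFramed p q b u α α' r r') : D₁ e p b ≠ 0 := det_frame_ne_zero H.add_eq H.disj₁
theorem D₂_ne (H : IsFramed p q b u α α' r r') : D₂ e p b ≠ 0 := det_frame_ne_zero H.add_eq H.disj₂

theorem δ_ne (H : IsFramed p q b u α α' r r') : D₂ e p b * D₁ e p b ≠ 0 :=
  mul_ne_zero (H.D₂_ne e) (H.D₁_ne e)

/-- Uniqueness of the decomposition along complementary subspaces. -/
theorem pr_eq {B B' : Basis (Fin (finrank ℂ X)) ℂ X} (hpq : p + q = finrank ℂ X)
    (hD : (CompleteFlag.ofBasis B).sub p ⊓ (CompleteFlag.ofBasis B').sub q = ⊥) {w w' : X}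
    (h1 : w' ∈ (CompleteFlag.ofBasis B).sub p) (h2 : w - w' ∈ (CompleteFlag.ofBasis B').sub q) :
    pr e p B B' w = e.det (frame p B B') • w' := by
  have h3 := pr_mem e p B B' w
  have h4 := sub_pr_mem hpq (det_frame_ne_zero (e := e) hpq hD) w
  have h5 : e.det (frame p B B') • w' - pr e p B B' w ∈ (⊥ : Submodule ℂ X) := by
    rw [← hD]
    refine ⟨sub_mem (Submodule.smul_mem _ _ h1) h3, ?_⟩
    have h6 := sub_mem h4 (Submodule.smul_mem _ (e.det (frame p B B')) h2)
    rwa [smul_sub, sub_sub_sub_cancel_left] at h6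
  exact (sub_eq_zero.1 ((Submodule.mem_bot ℂ).1 h5)).symm

theorem pi₁_gv (H : IsFramed p q b u α α' r r') (a) :
    pi₁ e p b (gv q b a) = (D₂ e p b * D₁ e p b) • (r a • u 0 + r' a • u 1) := by
  rw [pi₁, LinearMap.smul_apply, pr_eq e H.add_eq H.disj₁ (add_mem (Submodule.smul_mem _ _ H.mem₁.1)
    (Submodule.smul_mem _ _ H.mem₁.2)) (H.gv_sub a), mul_smul]
  rfl

theorem pi₂_gv (H : IsFramed p q b u α α' r r') (a) :
    pi₂ e p b (gv q b a) = (D₂ e p b * D₁ e p b) • (r a • u 2 + r' a • u 3) := by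
  have h := add_mem (H.gv_sub a) (add_mem (Submodule.smul_mem _ (r a) H.mem₃.1)
    (Submodule.smul_mem _ (r' a) H.mem₃.2))
  have h' : gv q b a - (r a • u 0 + r' a • u 1) + (r a • (u 0 - u 2) + r' a • (u 1 - u 3)) =
    gv q b a - (r a • u 2 + r' a • u 3) := by module
  rw [h'] at h
  rw [pi₂, LinearMap.smul_apply, pr_eq e H.add_eq H.disj₂ (add_mem (Submodule.smul_mem _ _ H.mem₂.1)
    (Submodule.smul_mem _ _ H.mem₂.2)) h, mul_comm, mul_smul]
  rfl

/-- Linear relations between `P a` and `Q a`. -/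
theorem smul_P_add_smul_Q (H : IsFramed p q b u α α' r r') (c d : ℂ) (a) :
    c • (matP e p q b).mulVec a + d • (matQ e p q b).mulVec a = 0 ↔
      (α * c + d) * r a = 0 ∧ (α' * c + d) * r' a = 0 := by
  have hδ := H.δ_ne e
  have h : c • pi₁ e p b (gv q b a) + d • pi₂ e p b (gv q b a) = (D₂ e p b * D₁ e p b) •
      ((c * r a) • u 0 + (c * r' a) • u 1 + ((d * r a) • u 2 + (d * r' a) • u 3)) := by
    rw [H.pi₁_gv, H.pi₂_gv]
    module
  rw [matP_mulVec, matQ_mulVec, ← LinearMap.map_smul (xi e b), ← LinearMap.map_smul (xi e b),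
    ← map_add, h, map_smul, smul_eq_zero, or_iff_right hδ,
    ofBasis_sub_finrank_sub_two e b H.two_le, H.mem₄]
  rw [add_mul, add_mul, mul_assoc, mul_assoc]

theorem det_smul_add_smul_ne (H : IsFramed p q b u α α' r r') {c d : ℂ} (h : α * c + d ≠ 0)
    (h' : α' * c + d ≠ 0) : (c • matP e p q b + d • matQ e p q b).det ≠ 0 := by
  refine det_ne_zero_of_forall fun a ha => ?_
  rw [Matrix.add_mulVec, Matrix.smul_mulVec, Matrix.smul_mulVec, H.smul_P_add_smul_Q] at ha
  exact H.inj a ((mul_eq_zero.1 ha.1).resolve_left h) ((mul_eq_zero.1 ha.2).resolve_left h')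

theorem isGeneral (H : IsFramed p q b u α α' r r') : IsGeneral e p q b := by
  have hQ : (matQ e p q b).det ≠ 0 := by
    have := H.det_smul_add_smul_ne e (c := 0) (d := 1) (by simp) (by simp)
    rwa [zero_smul, zero_add, one_smul] at this
  refine ⟨H.D₁_ne e, H.D₂_ne e, ?_, hQ, ?_, ?_⟩
  · have := H.det_smul_add_smul_ne e (c := 1) (d := 0) (by simpa using H.α_ne_zero)
      (by simpa using H.α'_ne_zero)
    rwa [zero_smul, add_zero, one_smul] at this
  · have := H.det_smul_add_smul_ne e (c := 1) (d := -1)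
      (by simpa [← sub_eq_add_neg, sub_eq_zero] using H.α_ne_one)
      (by simpa [← sub_eq_add_neg, sub_eq_zero] using H.α'_ne_one)
    rwa [neg_smul, one_smul, one_smul, ← sub_eq_add_neg] at this
  -- If that entry vanished, ![0, 1] would be an eigenvector. Both of its coordinates r and r' are
  -- nonzero, so both α det Q and α' det Q would equal its eigenvalue.
  · intro hA
    have h1 := matQ_mulVec_matA (e := e) (p := p) (q := q) (b := b) ![0, 1]
    have h2 : (matA e p q b).mulVec ![0, 1] = matA e p q b 1 1 • ![0, 1] := by
      ext i
      fin_cases i <;> simp [Matrix.mulVec, dotProduct, Fin.sum_univ_two, hA]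
    rw [h2, Matrix.mulVec_smul, ← sub_eq_zero, sub_eq_neg_add, ← neg_smul,
      H.smul_P_add_smul_Q] at h1
    have h5 := (mul_eq_zero.1 h1.1).resolve_right H.last₁
    have h6 := (mul_eq_zero.1 h1.2).resolve_right H.last₂
    have h7 : (α - α') * (matQ e p q b).det = 0 := by linear_combination h6 - h5
    exact (mul_ne_zero (sub_ne_zero.2 H.α_ne) hQ) h7

/-- The eigenvectors for the root `β` are multiples of `x` and `y`, where `β` is a multiple
of `ε`. -/
structure IsSideOf (e : Basis (Fin (finrank ℂ X)) ℂ X) (p q : ℕ)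
    (b : Fin 4 → Basis (Fin (finrank ℂ X)) ℂ X) (x y : X) (ε β : ℂ) : Prop where
  root : IsRoot e p q b β
  eq : β = ε * (matQ e p q b).det
  smul : ∃ c : ℂ, c ≠ 0 ∧ eigX e p q b β = c • x ∧ eigY e p q b β = c • y

/-- In the coordinates r, r' the pencil is diagonal with entries α, α'. As α ≠ α', an eigenvector
has exactly one nonzero coordinate, so only two transversals have to be examined. -/
theorem isSideOf (H : IsFramed p q b u α α' r r') {β : ℂ} (hβ : IsRoot e p q b β) :
    IsSideOf e p q b (u 0) (u 2) α β ∨ IsSideOf e p q b (u 1) (u 3) α' β := by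
  have hG := H.isGeneral e
  set a := eigvec e p q b β with ha
  have ha0 : a ≠ 0 := hG.eigvec_ne β
  have h1 := matQ_mulVec_matA (e := e) (p := p) (q := q) (b := b) a
  rw [ha, matA_mulVec_eigvec hβ, ← ha, Matrix.mulVec_smul, ← sub_eq_zero, sub_eq_neg_add,
    ← neg_smul, H.smul_P_add_smul_Q] at h1
  have hX : eigX e p q b β = _ := H.pi₁_gv e a
  have hY : eigY e p q b β = _ := H.pi₂_gv e a
  have hδ := H.δ_ne e
  by_cases h0 : r a = 0
  · have h0' : r' a ≠ 0 := fun h => ha0 (H.inj a h0 h)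
    right
    refine ⟨hβ, ?_, D₂ e p b * D₁ e p b * r' a, mul_ne_zero hδ h0', ?_, ?_⟩
    · linear_combination (mul_eq_zero.1 h1.2).resolve_right h0'
    · rw [hX, h0, zero_smul, zero_add, smul_smul]
    · rw [hY, h0, zero_smul, zero_add, smul_smul]
  · have h3 := (mul_eq_zero.1 h1.1).resolve_right h0
    have h0' : r' a = 0 := by
      refine (mul_eq_zero.1 h1.2).resolve_left fun h4 => ?_
      have h7 : (α - α') * (matQ e p q b).det = 0 := by linear_combination h4 - h3
      exact (mul_ne_zero (sub_ne_zero.2 H.α_ne) hG.Q_ne) h7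
    left
    refine ⟨hβ, ?_, D₂ e p b * D₁ e p b * r a, mul_ne_zero hδ h0, ?_, ?_⟩
    · linear_combination h3
    · rw [hX, h0', zero_smul, add_zero, smul_smul]
    · rw [hY, h0', zero_smul, add_zero, smul_smul]

theorem IsSideOf.edgeCond {x y : X} {ε β : ℂ} (S : IsSideOf e p q b x y ε β)
    (hp : 1 ≤ p) (hq : 1 ≤ q) (hN : 3 ≤ finrank ℂ X)
    (hQ : (matQ e p q b).det ≠ 0) (h1 : x ∈ (CompleteFlag.ofBasis (b 0)).sub p)
    (h1' : x ∉ (CompleteFlag.ofBasis (b 0)).sub (p - 1))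
    (h2 : y ∈ (CompleteFlag.ofBasis (b 1)).sub p)
    (h2' : y ∉ (CompleteFlag.ofBasis (b 1)).sub (p - 1))
    (h3 : y ∉ (CompleteFlag.ofBasis (b 0)).sub (finrank ℂ X - 1))
    (h4 : x ∉ (CompleteFlag.ofBasis (b 1)).sub (finrank ℂ X - 1))
    (h5 : x - y ∈ (CompleteFlag.ofBasis (b 2)).sub q)
    (h5' : x - y ∉ (CompleteFlag.ofBasis (b 2)).sub (q - 1))
    (h6 : x - ε • y ∈ (CompleteFlag.ofBasis (b 3)).sub (finrank ℂ X - 2))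
    (h6' : x - ε • y ∉ (CompleteFlag.ofBasis (b 3)).sub (finrank ℂ X - 3)) :
    EdgeCond e p q b β := by
  obtain ⟨c, hc, hX, hY⟩ := S.smul
  have key : ∀ {d : ℂ} (_ : d ≠ 0) {B : Basis (Fin (finrank ℂ X)) ℂ X} {k : ℕ} {w : X}
      (_ : w ∈ (CompleteFlag.ofBasis B).sub (k + 1)) (_ : w ∉ (CompleteFlag.ofBasis B).sub k),
      crd e B k (d • w) ≠ 0 := fun hd _ _ _ hw hw' =>
    crd_ne_zero (Submodule.smul_mem _ _ hw) fun h => hw' ((Submodule.smul_mem_iff _ hd).1 h)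
  refine ⟨?_, ?_, ?_, ?_, ?_, ?_⟩
  · rw [hX]
    exact key hc (by rwa [Nat.sub_add_cancel hp]) h1'
  · rw [hY]
    exact key hc (by rwa [Nat.sub_add_cancel hp]) h2'
  · rw [hY]
    exact key hc (mem_ofBasis_of_le _ (by omega) _) h3
  · rw [hX]
    exact key hc (mem_ofBasis_of_le _ (by omega) _) h4
  · rw [hX, hY, ← smul_sub]
    exact key hc (by rwa [Nat.sub_add_cancel hq]) h5'
  · have h7 : (matQ e p q b).det • eigX e p q b β - β • eigY e p q b β =
        ((matQ e p q b).det * c) • (x - ε • y) := by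
      rw [hX, hY, S.eq]
      module
    rw [h7]
    exact key (mul_ne_zero hQ hc) (by rwa [show finrank ℂ X - 3 + 1 = finrank ℂ X - 2 by omega]) h6'

end IsFramed

namespace LiftData

variable {X : Type} [AddCommGroup X] [Module ℂ X] {V : Submodule ℂ X}
  {t q : ℕ} (D : LiftData V t q) [FiniteDimensional ℂ X]

theorem finrank_X (D : LiftData V t q) : 5 + q = finrank ℂ X := by
  rw [← finrank_add_quotient V, D.finrank_V, D.finrank_quot]
  omega

theorem exists_eq (u : X) : ∃ (a : V) (z : X ⧸ V), u = a + D.s z :=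
  let ⟨a, ha⟩ := exists_eq_add D.hs u
  ⟨a, _, ha⟩

theorem add_eq_zero {a : V} {z : X ⧸ V} (h : (a : X) + D.s z = 0) : a = 0 ∧ z = 0 := by
  have h1 := congrArg V.mkQ h
  rw [map_add, mkQ_coe, D.hs, zero_add, map_zero] at h1
  subst h1
  rw [map_zero, add_zero] at h
  exact ⟨Subtype.ext h, rfl⟩

theorem add_inj {a a' : V} {z z' : X ⧸ V} (h : (a : X) + D.s z = a' + D.s z') :
    a = a' ∧ z = z' := by
  have := D.add_eq_zero (a := a - a') (z := z - z') (by
    rw [map_sub, Submodule.coe_sub, ← sub_eq_zero.2 h]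
    abel)
  exact ⟨sub_eq_zero.1 this.1, sub_eq_zero.1 this.2⟩

theorem mem_coe₀ {n p m : ℕ} (h : Splits q 0 n p m) (u : V) :
    (u : X) ∈ (D.F (Fin.castAdd t 0)).sub n ↔ u ∈ (CompleteFlag.ofBasis (D.b 0)).sub p := by
  simpa using D.mem_F₀ h u 0

theorem mem_coe₁ {n p m : ℕ} (h : Splits q 1 n p m) (u : V) :
    (u : X) ∈ (D.F (Fin.castAdd t 1)).sub n ↔ u ∈ (CompleteFlag.ofBasis (D.b 1)).sub p := by
  simpa using D.mem_F₁ h u 0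

theorem mem_coe₂ {n p m : ℕ} (h : Splits q 2 n p m) (u : V) :
    (u : X) ∈ (D.F (Fin.castAdd t 2)).sub n ↔ u ∈ (CompleteFlag.ofBasis (D.b 2)).sub p := by
  simpa using D.mem_F₂ h u 0

theorem mem_coe₃ {n p m : ℕ} (h : Splits q 3 n p m) (u : V) :
    (u : X) ∈ (D.F (Fin.castAdd t 3)).sub n ↔ u ∈ (CompleteFlag.ofBasis (D.b 3)).sub p := by
  simpa using D.mem_F₃ h u 0

theorem mem_coe₄ (i : Fin t) {n p m : ℕ} (h : Splits q 4 n p m) (u : V) :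
    (u : X) ∈ (D.F (Fin.natAdd 4 i)).sub n ↔ u ∈ (CompleteFlag.ofBasis D.d).sub p := by
  simpa using D.mem_F₄ i h u 0

theorem splits_five₀ (D : LiftData V t q) : Splits q 0 5 2 3 := splits₀ D.two_le (by omega)
theorem splits_five₁ (D : LiftData V t q) : Splits q 1 5 2 3 := splits₁ D.two_le (by omega)
theorem splits_q (D : LiftData V t q) : Splits q 2 q 2 (q - 2) :=
  splits₂ D.two_le (by have := D.two_le; omega)
theorem splits_q₃ : Splits q 3 (q + 3) 2 (q + 1) := splits₃ (by omega)
theorem splits_q₄ : Splits q 4 (q + 3) 2 (q + 1) := splits₄ (by omega)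

theorem eq_zero_of_coord {u : V} (h : ∀ i, D.v.coord i u = 0) : u = 0 :=
  D.v.forall_coord_eq_zero_iff.1 h

theorem coord_v (i j) : D.v.coord i (D.v j) = if j = i then 1 else 0 := by
  rw [Basis.coord_apply, Basis.repr_self, Finsupp.single_apply]

/-- The members of index 3 and q - 2 are independent in the quotient, and the first and third planes
are independent in V. -/
theorem inf₁₃ : (D.F (Fin.castAdd t 0)).sub 5 ⊓ (D.F (Fin.castAdd t 2)).sub q = ⊥ := by
  rw [eq_bot_iff]
  rintro u ⟨h1, h3⟩
  obtain ⟨a, z, rfl⟩ := D.exists_eq u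
  obtain ⟨ha1, hz1⟩ := (D.mem_F₀ D.splits_five₀ a z).1 h1
  obtain ⟨ha3, hz3⟩ := (D.mem_F₂ D.splits_q a z).1 h3
  have hz : z ∈ (⊥ : Submodule ℂ (X ⧸ V)) := D.fiber.disj₁ ▸ ⟨hz1, hz3⟩
  rw [Submodule.mem_bot] at hz
  obtain ⟨h2, h3⟩ := (D.frame.mem₁ a).1 ha1
  obtain ⟨h4, h5⟩ := (D.frame.mem₃ a).1 ha3
  rw [h2, add_zero] at h4
  rw [h3, add_zero] at h5
  rw [hz, D.eq_zero_of_coord (Fin.forall_fin_succ.2 ⟨h4, Fin.forall_fin_succ.2 ⟨h5,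
    Fin.forall_fin_two.2 ⟨h2, h3⟩⟩⟩)]
  simp

theorem inf₂₃ : (D.F (Fin.castAdd t 1)).sub 5 ⊓ (D.F (Fin.castAdd t 2)).sub q = ⊥ := by
  rw [eq_bot_iff]
  rintro u ⟨h1, h3⟩
  obtain ⟨a, z, rfl⟩ := D.exists_eq u
  obtain ⟨ha1, hz1⟩ := (D.mem_F₁ D.splits_five₁ a z).1 h1
  obtain ⟨ha3, hz3⟩ := (D.mem_F₂ D.splits_q a z).1 h3
  have hz : z ∈ (⊥ : Submodule ℂ (X ⧸ V)) := D.fiber.disj₂ ▸ ⟨hz1, hz3⟩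
  rw [Submodule.mem_bot] at hz
  rw [hz, map_zero, zero_smul, sub_zero] at ha1
  obtain ⟨h2, h3⟩ := (D.frame.mem₂ a).1 ha1
  obtain ⟨h4, h5⟩ := (D.frame.mem₃ a).1 ha3
  rw [h2, zero_add] at h4
  rw [h3, zero_add] at h5
  rw [hz, D.eq_zero_of_coord (Fin.forall_fin_succ.2 ⟨h2, Fin.forall_fin_succ.2 ⟨h3,
    Fin.forall_fin_two.2 ⟨h4, h5⟩⟩⟩)]
  simp

/-- The vector of the pencil belonging to `a`. -/
def γ (a : Fin 2 → ℂ) : V := a 0 • bv (D.b 2) 2 + a 1 • bv (D.b 2) 3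

theorem gv_eq (a : Fin 2 → ℂ) : gv q (quad D.B) a = (D.γ a : X) := by
  have h2 := D.two_le
  have e1 : bv (D.B (Fin.castAdd t 2)) q = bv (D.b 2) 2 := by
    rw [B₂, ← bv_shuffle₁ (D.isShuffle 2) D.hs (D.b 2) (D.w (Fin.castAdd t 2)) (i := 2)
      (by rw [D.finrank_V]; omega)]
    congr 1
    simp [fpos]
    omega
  have e2 : bv (D.B (Fin.castAdd t 2)) (q + 1) = bv (D.b 2) 3 := by
    rw [B₂, ← bv_shuffle₁ (D.isShuffle 2) D.hs (D.b 2) (D.w (Fin.castAdd t 2)) (i := 3)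
      (by rw [D.finrank_V]; omega)]
    congr 1
    simp [fpos]
    omega
  rw [gv, Fintype.linearCombination_apply, Fin.sum_univ_two]
  change a 0 • bv (D.B (Fin.castAdd t 2)) q + a 1 • bv (D.B (Fin.castAdd t 2)) (q + 1) = _
  rw [e1, e2]
  rfl

theorem γ_eq_zero {a : Fin 2 → ℂ} (h : D.γ a ∈ (CompleteFlag.ofBasis (D.b 2)).sub 2) : a = 0 := by
  have h3 : a 1 = 0 := eq_zero_of_smul_bv_add_mem (D.b 2) (k := 3) (m := 3)
    (by rw [D.finrank_V]; omega) le_rfl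
    (Submodule.smul_mem _ (a 0) (bv_mem (D.b 2) (show 2 < 3 by omega))) (by
      rw [add_comm]
      exact (CompleteFlag.ofBasis (D.b 2)).mono (show 2 ≤ 3 by omega) h)
  have h2 : a 0 = 0 := eq_zero_of_smul_bv_add_mem (D.b 2) (k := 2) (m := 2)
    (by rw [D.finrank_V]; omega) le_rfl (Submodule.zero_mem _) (by
      rw [γ, h3, zero_smul] at h
      exact h)
  ext i
  fin_cases i
  · exact h2
  · exact h3

def coordX (a : Fin 2 → ℂ) : ℂ := D.v.coord 0 (D.γ a) + D.v.coord 2 (D.γ a)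
def coordX' (a : Fin 2 → ℂ) : ℂ := D.v.coord 1 (D.γ a) + D.v.coord 3 (D.γ a)

theorem isFramed : IsFramed 5 q (quad D.B) (fun i => (D.v i : X)) D.α D.α' D.coordX D.coordX' := by
  have hN := D.finrank_X
  refine ⟨hN, by omega, D.frame.α_ne_zero, D.frame.α_ne_one, D.frame.α'_ne_zero, D.frame.α'_ne_one,
    D.frame.α_ne, D.inf₁₃, D.inf₂₃, ⟨?_, ?_⟩, ⟨?_, ?_⟩, ⟨?_, ?_⟩, fun c₀ c₁ c₂ c₃ => ?_,
    fun a => ?_, fun a h h' => D.γ_eq_zero ((D.frame.mem₃ _).2 ⟨h, h'⟩), ?_, ?_⟩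
  · refine (D.mem_coe₀ D.splits_five₀ _).2 ((D.frame.mem₁ _).2 ?_)
    simp [-Basis.coord_apply, coord_v]
  · refine (D.mem_coe₀ D.splits_five₀ _).2 ((D.frame.mem₁ _).2 ?_)
    simp [-Basis.coord_apply, coord_v]
  · refine (D.mem_coe₁ D.splits_five₁ _).2 ((D.frame.mem₂ _).2 ?_)
    simp [-Basis.coord_apply, coord_v]
  · refine (D.mem_coe₁ D.splits_five₁ _).2 ((D.frame.mem₂ _).2 ?_)
    simp [-Basis.coord_apply, coord_v]
  · refine (D.mem_coe₂ D.splits_q (D.v 0 - D.v 2)).2 ((D.frame.mem₃ _).2 ?_)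
    simp [-Basis.coord_apply, coord_v]
  · refine (D.mem_coe₂ D.splits_q (D.v 1 - D.v 3)).2 ((D.frame.mem₃ _).2 ?_)
    simp [-Basis.coord_apply, coord_v]
  · rw [show finrank ℂ X - 2 = q + 3 by omega]
    refine (D.mem_coe₃ splits_q₃ (c₀ • D.v 0 + c₁ • D.v 1 + (c₂ • D.v 2 + c₃ • D.v 3))).trans
      ((D.frame.mem₄ _).trans ?_)
    simp [-Basis.coord_apply, coord_v]
  · rw [gv_eq]
    refine (D.mem_coe₂ D.splits_q (D.γ a - (D.coordX a • D.v 0 + D.coordX' a • D.v 1))).2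
      ((D.frame.mem₃ _).2 ?_)
    simp [-Basis.coord_apply, coord_v, coordX, coordX']
  · simpa [coordX, γ] using D.frame.last₁
  · simpa [coordX', γ] using D.frame.last₂

theorem isGeneral (e : Basis (Fin (finrank ℂ X)) ℂ X) : IsGeneral e 5 q (quad D.B) := D.isFramed.isGeneral e

end LiftData

end lifts

end SchubertFib

end

noncomputable section
set_option linter.unusedSectionVars false

namespace SchubertFib

open Module

/-! ### The two transversals of the constructed instance. -/

section sides

namespace LiftData

variable {X : Type} [AddCommGroup X] [Module ℂ X] {V : Submodule ℂ X}
  {t q : ℕ} (D : LiftData V t q) [FiniteDimensional ℂ X]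

theorem eq_sum_coord (u : V) : u = D.v.coord 0 u • D.v 0 + D.v.coord 1 u • D.v 1 +
    D.v.coord 2 u • D.v 2 + D.v.coord 3 u • D.v 3 := by
  conv_lhs => rw [← D.v.sum_repr u, Fin.sum_univ_four]
  rfl

/-- V is spanned by its first two planes, which lie in the defining intersections; equality follows
because both spaces have dimension 4. -/
theorem instV_F : instV q D.F = V := by
  have h2 := D.two_le
  have hs : Splits q 2 (q + 2) 4 (q - 2) := splits₂ h2 (by omega)
  have h3 : ∀ u : V, (u : X) ∈ (D.F (Fin.castAdd t 2)).sub (q + 2) := fun u =>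
    (D.mem_coe₂ hs u).2 (mem_ofBasis_of_le _ D.finrank_V.le _)
  have hle : V ≤ instV q D.F := by
    intro u hu
    have h1 := D.eq_sum_coord ⟨u, hu⟩
    set c := fun i => D.v.coord i ⟨u, hu⟩
    have e1 : u = ((c 0 • D.v 0 + c 1 • D.v 1 : V) : X) + ((c 2 • D.v 2 + c 3 • D.v 3 : V) : X) := by
      have := congrArg (Subtype.val) h1
      simp only [Submodule.coe_add] at this ⊢
      rw [this]
      abel
    rw [e1]
    refine Submodule.add_mem_sup ⟨?_, h3 _⟩ ⟨?_, h3 _⟩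
    · rw [SetLike.mem_coe, D.mem_coe₀ D.splits_five₀, D.frame.mem₁]
      simp [-Basis.coord_apply, coord_v]
    · rw [SetLike.mem_coe, D.mem_coe₁ D.splits_five₁, D.frame.mem₂]
      simp [-Basis.coord_apply, coord_v]
  let e : Basis (Fin (finrank ℂ X)) ℂ X := finBasis ℂ X
  refine (Submodule.eq_of_le_of_finrank_eq hle ?_).symm
  rw [D.finrank_V]
  exact (quadFacts (D.isGeneral e) D.finrank_X h2).finrank_V.symm

/-- A common transversal, spanned by `x` and `y`, of the four planes defined by the flags `D.b`,
and the equation `ψ` of the space of solutions belonging to it. -/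
structure Side (x y : V) (ε : ℂ) (ψ : (X ⧸ V) →ₗ[ℂ] ℂ) : Prop where
  edge : FrameEdge D.b x y ε
  mem₁ : x ∈ (CompleteFlag.ofBasis (D.b 0)).sub 2
  mem₂ : y ∈ (CompleteFlag.ofBasis (D.b 1)).sub 2
  mem₃ : ∀ r s : ℂ, r • x + s • y ∈ (CompleteFlag.ofBasis (D.b 2)).sub 2 ↔ r + s = 0
  mem₄ : ∀ r s : ℂ, r • x + s • y ∈ (CompleteFlag.ofBasis (D.b 3)).sub 2 ↔ ε * r + s = 0
  mem_d : ∀ r s : ℂ, r • x + s • y ∈ (CompleteFlag.ofBasis D.d).sub 2 → r = 0 ∧ s = 0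
  ψ_first : ψ (bv (D.w (Fin.castAdd t 0)) 2) ≠ 0
  ψ_other : ∀ i, i ≠ Fin.castAdd t 0 → i ≠ Fin.castAdd t 2 → ψ (bv (D.w i) 0) ≠ 0
  ψ_third : ψ (bv (D.w (Fin.castAdd t 2)) (q - 2)) ≠ 0
  ψ_C : ∀ u ∈ instC q D.F (Submodule.span ℂ {(x : X), (y : X)}), ψ (V.mkQ u) = 0

/-- A linear form in the coordinates of the summands. -/
def form (c₀ c₁ c₂ c₃ : ℂ) (θ : (X ⧸ V) →ₗ[ℂ] ℂ) : X →ₗ[ℂ] ℂ :=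
  (LinearMap.coprod (c₀ • D.v.coord 0 + c₁ • D.v.coord 1 + c₂ • D.v.coord 2 + c₃ • D.v.coord 3) θ) ∘ₗ
    (splitEquiv D.hs).symm.toLinearMap

theorem form_apply (c₀ c₁ c₂ c₃ : ℂ) (θ : (X ⧸ V) →ₗ[ℂ] ℂ) (a : V) (z : X ⧸ V) :
    D.form c₀ c₁ c₂ c₃ θ (a + D.s z) = c₀ * D.v.coord 0 a + c₁ * D.v.coord 1 a +
      c₂ * D.v.coord 2 a + c₃ * D.v.coord 3 a + θ z := by
  have h : (a : X) + D.s z = splitEquiv D.hs (a, z) := rfl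
  rw [h, form, LinearMap.comp_apply, LinearEquiv.coe_coe, LinearEquiv.symm_apply_apply]
  simp [-Basis.coord_apply]

theorem form_coe (c₀ c₁ c₂ c₃ : ℂ) (θ : (X ⧸ V) →ₗ[ℂ] ℂ) (a : V) :
    D.form c₀ c₁ c₂ c₃ θ a = c₀ * D.v.coord 0 a + c₁ * D.v.coord 1 a +
      c₂ * D.v.coord 2 a + c₃ * D.v.coord 3 a := by
  simpa [-Basis.coord_apply] using D.form_apply c₀ c₁ c₂ c₃ θ a 0

theorem instT_le {x y : V} {τ : X →ₗ[ℂ] ℂ} (hx : τ x = 0) (hy : τ y = 0)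
    (h : ∀ (a : V) z, a + D.θ z • D.v 2 ∈ (CompleteFlag.ofBasis (D.b 3)).sub 2 →
      τ (a + D.s z) = 0) :
    ∀ u ∈ instT q D.F (Submodule.span ℂ {(x : X), (y : X)}), τ u = 0 := by
  suffices instT q D.F (Submodule.span ℂ {(x : X), (y : X)}) ≤ LinearMap.ker τ from
    fun u hu => this hu
  refine sup_le (fun u hu => ?_) (Submodule.span_le.2 ?_)
  · obtain ⟨a, z, rfl⟩ := D.exists_eq u
    exact h a z ((D.mem_F₃ splits_q₃ a z).1 hu).1
  · rintro u (rfl | rfl)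
    · exact hx
    · exact hy

/-- On T the V-coordinates satisfy α' c₁ + c₃ = 0. Write u in C as f1 + f3 = f2 + f4, the summands
in T and in the first, third, second and third flags. Then c₁ vanishes on f1, f3 and f4, while on f2
it equals φ of the quotient part because of the twist. Comparing c₁ on both sides gives φ = 0. -/
theorem side : D.Side (D.v 0) (D.v 2) D.α D.φ := by
  have hα := D.frame.α'_ne_zero
  have hα1 := D.frame.α'_ne_one
  refine ⟨D.edge, ?_, ?_, fun r s => ?_, fun r s => ?_, fun r s => ?_, ?_, fun i h h' => ?_, ?_, ?_⟩
  · rw [D.frame.mem₁]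
    simp [-Basis.coord_apply, coord_v]
  · rw [D.frame.mem₂]
    simp [-Basis.coord_apply, coord_v]
  · rw [D.frame.mem₃]
    simp [-Basis.coord_apply, coord_v]
  · rw [D.frame.mem₄]
    simp [-Basis.coord_apply, coord_v]
  · rw [D.mem_d]
    simp [-Basis.coord_apply, coord_v]
  · rw [Ne, D.fiber.φ_first 2 (by have := D.two_le; omega)]
    simp
  · rw [Ne, D.fiber.φ_other i h h' 0 (by omega)]
    simp
  · exact D.fiber.φ_third_ne
  · have hT := D.instT_le (x := D.v 0) (y := D.v 2) (τ := D.form 0 D.α' 0 1 0)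
      (by simp [-Basis.coord_apply, form_coe, coord_v])
      (by simp [-Basis.coord_apply, form_coe, coord_v]) (fun a z h => by
        have := ((D.frame.mem₄ _).1 h).2
        simp only [map_add, map_smul, coord_v, smul_eq_mul] at this
        simp only [Fin.isValue, Fin.reduceEq, if_false, mul_zero, add_zero] at this
        rw [form_apply]
        simp only [LinearMap.zero_apply]
        linear_combination this)
    have h3 : ∀ (a : V) z, (a : X) + D.s z ∈ (D.F (Fin.castAdd t 2)).sub q ⊓
        instT q D.F (Submodule.span ℂ {(D.v 0 : X), (D.v 2 : X)}) →
        D.v.coord 1 a = 0 ∧ D.v.coord 3 a = 0 ∧ D.φ z = 0 := by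
      rintro a z ⟨h, h'⟩
      have h1 := hT _ h'
      rw [form_apply, LinearMap.zero_apply] at h1
      obtain ⟨h4, h5⟩ := (D.mem_F₂ D.splits_q a z).1 h
      have h6 := ((D.frame.mem₃ _).1 h4).2
      have h7 : D.v.coord 1 a = 0 := by
        have : (D.α' - 1) * D.v.coord 1 a = 0 := by linear_combination h1 - h6
        exact (mul_eq_zero.1 this).resolve_left (sub_ne_zero.2 hα1)
      exact ⟨h7, by rwa [h7, zero_add] at h6, D.fiber.φ_third z h5⟩
    rintro u ⟨hu1, hu2⟩
    obtain ⟨f1, ⟨hf1, hf1'⟩, f3, hf3, he1⟩ := Submodule.mem_sup.1 hu1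
    obtain ⟨f2, ⟨hf2, hf2'⟩, f4, hf4, he2⟩ := Submodule.mem_sup.1 hu2
    obtain ⟨a1, z1, rfl⟩ := D.exists_eq f1
    obtain ⟨a2, z2, rfl⟩ := D.exists_eq f2
    obtain ⟨a3, z3, rfl⟩ := D.exists_eq f3
    obtain ⟨a4, z4, rfl⟩ := D.exists_eq f4
    obtain ⟨h31, -, -⟩ := h3 a3 z3 hf3
    obtain ⟨h41, h43, h4φ⟩ := h3 a4 z4 hf4
    have hu : V.mkQ u = z2 + z4 := by
      rw [← he2]
      simp only [map_add, mkQ_coe, D.hs, zero_add]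
    have hV := (D.add_inj (a := a1 + a3) (a' := a2 + a4) (z := z1 + z3) (z' := z2 + z4) (by
      rw [map_add, map_add, Submodule.coe_add, Submodule.coe_add]
      rw [← he2] at he1
      rw [add_add_add_comm, he1, add_add_add_comm])).1
    have h1 := hT _ hf1'
    rw [form_apply, LinearMap.zero_apply,
      ((D.frame.mem₁ _).1 ((D.mem_F₀ D.splits_five₀ _ _).1 hf1).1).2] at h1
    have h11 : D.v.coord 1 a1 = 0 := by
      have : D.α' * D.v.coord 1 a1 = 0 := by linear_combination h1
      exact (mul_eq_zero.1 this).resolve_left hα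
    have h2 := ((D.frame.mem₂ _).1 ((D.mem_F₁ D.splits_five₁ _ _).1 hf2).1).2
    simp only [map_sub, map_smul, coord_v, smul_eq_mul] at h2
    simp only [Fin.isValue, Fin.reduceEq, if_false, if_true, mul_one, sub_zero] at h2
    have h5 := congrArg (D.v.coord 1) hV
    rw [map_add, map_add, h11, h31, h41] at h5
    rw [hu, map_add, h4φ]
    linear_combination -h2 - h5

/-- Here T has the equation α c₀ + c₂ + θ = 0, because the fourth flag is twisted by θ. The
coordinate c₀ vanishes on the summands from the second and third flags, hence also on the one from
the first flag, where c₂ = 0; so θ vanishes on that summand. -/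
theorem side' : D.Side (D.v 1) (D.v 3) D.α' D.θ := by
  have hα := D.frame.α_ne_zero
  have hα1 := D.frame.α_ne_one
  refine ⟨D.edge', ?_, ?_, fun r s => ?_, fun r s => ?_, fun r s => ?_, D.fiber.θ_first,
    D.fiber.θ_other, D.fiber.θ_third_ne, ?_⟩
  · rw [D.frame.mem₁]
    simp [-Basis.coord_apply, coord_v]
  · rw [D.frame.mem₂]
    simp [-Basis.coord_apply, coord_v]
  · rw [D.frame.mem₃]
    simp [-Basis.coord_apply, coord_v]
  · rw [D.frame.mem₄]
    simp [-Basis.coord_apply, coord_v]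
  · rw [D.mem_d]
    simp [-Basis.coord_apply, coord_v, eq_comm]
  · have hT := D.instT_le (x := D.v 1) (y := D.v 3) (τ := D.form D.α 0 1 0 D.θ)
      (by simp [-Basis.coord_apply, form_coe, coord_v])
      (by simp [-Basis.coord_apply, form_coe, coord_v]) (fun a z h => by
        have := ((D.frame.mem₄ _).1 h).1
        simp only [map_add, map_smul, coord_v, smul_eq_mul] at this
        simp only [Fin.isValue, Fin.reduceEq, if_false, if_true, mul_zero, add_zero, mul_one] at this
        rw [form_apply]
        linear_combination this)
    have h3 : ∀ (a : V) z, (a : X) + D.s z ∈ (D.F (Fin.castAdd t 2)).sub q ⊓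
        instT q D.F (Submodule.span ℂ {(D.v 1 : X), (D.v 3 : X)}) →
        D.v.coord 0 a = 0 ∧ D.θ z = 0 := by
      rintro a z ⟨h, h'⟩
      have h1 := hT _ h'
      obtain ⟨h4, h5⟩ := (D.mem_F₂ D.splits_q a z).1 h
      rw [form_apply, D.fiber.θ_third z h5] at h1
      have h6 := ((D.frame.mem₃ _).1 h4).1
      have h7 : D.v.coord 0 a = 0 := by
        have : (D.α - 1) * D.v.coord 0 a = 0 := by linear_combination h1 - h6
        exact (mul_eq_zero.1 this).resolve_left (sub_ne_zero.2 hα1)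
      exact ⟨h7, D.fiber.θ_third z h5⟩
    rintro u ⟨hu1, hu2⟩
    obtain ⟨f1, ⟨hf1, hf1'⟩, f3, hf3, he1⟩ := Submodule.mem_sup.1 hu1
    obtain ⟨f2, ⟨hf2, hf2'⟩, f4, hf4, he2⟩ := Submodule.mem_sup.1 hu2
    obtain ⟨a1, z1, rfl⟩ := D.exists_eq f1
    obtain ⟨a2, z2, rfl⟩ := D.exists_eq f2
    obtain ⟨a3, z3, rfl⟩ := D.exists_eq f3
    obtain ⟨a4, z4, rfl⟩ := D.exists_eq f4
    obtain ⟨h30, h3θ⟩ := h3 a3 z3 hf3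
    obtain ⟨h40, -⟩ := h3 a4 z4 hf4
    have hu : V.mkQ u = z1 + z3 := by
      rw [← he1]
      simp only [map_add, mkQ_coe, D.hs, zero_add]
    have hV := (D.add_inj (a := a1 + a3) (a' := a2 + a4) (z := z1 + z3) (z' := z2 + z4) (by
      rw [map_add, map_add, Submodule.coe_add, Submodule.coe_add]
      rw [← he2] at he1
      rw [add_add_add_comm, he1, add_add_add_comm])).1
    have h1 := hT _ hf1'
    rw [form_apply, ((D.frame.mem₁ _).1 ((D.mem_F₀ D.splits_five₀ _ _).1 hf1).1).1] at h1
    have h2 := ((D.frame.mem₂ _).1 ((D.mem_F₁ D.splits_five₁ _ _).1 hf2).1).1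
    simp only [map_sub, map_smul, coord_v, smul_eq_mul] at h2
    simp only [Fin.isValue, Fin.reduceEq, if_false, mul_zero, sub_zero] at h2
    have h5 := congrArg (D.v.coord 0) hV
    rw [map_add, map_add, h2, h30, h40] at h5
    rw [hu, map_add, h3θ]
    linear_combination h1 - D.α * h5

/-- The untwisted lift differs from that of the fourth flag by a multiple of v 2, which is in the
transversal. -/
theorem s_mem_T (z : X ⧸ V) :
    D.s z ∈ instT q D.F (Submodule.span ℂ {(D.v 0 : X), (D.v 2 : X)}) := by
  have h := (D.mem_F₃ splits_q₃ (-(D.θ z • D.v 2)) z).2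
    ⟨by rw [neg_add_cancel]; exact zero_mem _, mem_ofBasis_of_le _ D.finrank_quot.le _⟩
  have h2 : ((D.θ z • D.v 2 : V) : X) ∈ Submodule.span ℂ {(D.v 0 : X), (D.v 2 : X)} :=
    Submodule.smul_mem _ _ (Submodule.subset_span (by simp))
  have := Submodule.add_mem_sup h h2
  rwa [Submodule.coe_neg, add_comm (-_) _, neg_add_cancel_right] at this

theorem exists_add_of_disj (D : LiftData V t q) {w w' : Basis (Fin (finrank ℂ (X ⧸ V))) ℂ (X ⧸ V)}
    (h : (CompleteFlag.ofBasis w).sub 3 ⊓ (CompleteFlag.ofBasis w').sub (q - 2) = ⊥) (z : X ⧸ V) :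
    ∃ z₁ ∈ (CompleteFlag.ofBasis w).sub 3, ∃ z₃ ∈ (CompleteFlag.ofBasis w').sub (q - 2),
      z₁ + z₃ = z := by
  have hq := D.two_le
  have h1 := Submodule.finrank_sup_add_finrank_inf_eq ((CompleteFlag.ofBasis w).sub 3)
    ((CompleteFlag.ofBasis w').sub (q - 2))
  have h2 := D.finrank_quot
  rw [h, finrank_bot, CompleteFlag.finrank_sub _ _ (by omega),
    CompleteFlag.finrank_sub _ _ (by omega)] at h1
  have h3 : (CompleteFlag.ofBasis w).sub 3 ⊔ (CompleteFlag.ofBasis w').sub (q - 2) = ⊤ :=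
    Submodule.eq_top_of_finrank_eq (by omega)
  exact Submodule.mem_sup.1 (h3 ▸ Submodule.mem_top)

/-- Split z along the third flag and along the first or second one. The form φ vanishes on the part
from the third flag, so the part from the second flag is also in ker φ, where the twisted and
untwisted lifts agree. -/
theorem s_mem_C {z : X ⧸ V} (hz : D.φ z = 0) :
    D.s z ∈ instC q D.F (Submodule.span ℂ {(D.v 0 : X), (D.v 2 : X)}) := by
  have key : ∀ z ∈ (CompleteFlag.ofBasis (D.w (Fin.castAdd t 2))).sub (q - 2),
      D.s z ∈ (D.F (Fin.castAdd t 2)).sub q := fun z hz => by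
    simpa using (D.mem_F₂ D.splits_q 0 z).2 ⟨zero_mem _, hz⟩
  constructor
  · obtain ⟨z1, h1, z3, h3, rfl⟩ := D.exists_add_of_disj D.fiber.disj₁ z
    rw [map_add]
    refine Submodule.add_mem_sup ⟨?_, D.s_mem_T _⟩ ⟨key _ h3, D.s_mem_T _⟩
    simpa using (D.mem_F₀ D.splits_five₀ 0 z1).2 ⟨zero_mem _, h1⟩
  · obtain ⟨z1, h1, z3, h3, rfl⟩ := D.exists_add_of_disj D.fiber.disj₂ z
    rw [map_add, D.fiber.φ_third _ h3, add_zero] at hz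
    rw [map_add]
    refine Submodule.add_mem_sup ⟨?_, D.s_mem_T _⟩ ⟨key _ h3, D.s_mem_T _⟩
    simpa using (D.mem_F₁ D.splits_five₁ 0 z1).2 ⟨by simp [hz], h1⟩

end LiftData

end sides

end SchubertFib

end

noncomputable section
set_option linter.unusedSectionVars false

namespace SchubertFib

open Module

/-! ### The open conditions for the constructed instance. -/

section roots

namespace LiftData

variable {X : Type} [AddCommGroup X] [Module ℂ X] {V : Submodule ℂ X}
  {t q : ℕ} (D : LiftData V t q) [FiniteDimensional ℂ X] (e : Basis (Fin (finrank ℂ X)) ℂ X)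

/-- The eigenvectors for the root `β` are multiples of `x` and `y`. -/
abbrev IsSideOf (x y : V) (ε β : ℂ) : Prop := IsFramed.IsSideOf e 5 q (quad D.B) (x : X) (y : X) ε β

theorem isSideOf {β : ℂ} (hβ : IsRoot e 5 q (quad D.B) β) :
    D.IsSideOf e (D.v 0) (D.v 2) D.α β ∨ D.IsSideOf e (D.v 1) (D.v 3) D.α' β :=
  D.isFramed.isSideOf e hβ

variable {D e} {x y : V} {ε β : ℂ} {ψ : (X ⧸ V) →ₗ[ℂ] ℂ}

theorem IsSideOf.transversal_eq (S : D.IsSideOf e x y ε β) :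
    ((D.isGeneral e).pencil D.finrank_X (by norm_num)).transversal (eigvec e 5 q (quad D.B) β) =
      Submodule.span ℂ {(x : X), (y : X)} := by
  obtain ⟨c, hc, hX, hY⟩ := S.smul
  ext u
  rw [Pencil.mem_transversal, Submodule.mem_span_pair]
  change (∃ r s : ℂ, r • eigX e 5 q (quad D.B) β + s • eigY e 5 q (quad D.B) β = u) ↔ _
  rw [hX, hY]
  constructor
  · rintro ⟨r, s, rfl⟩
    exact ⟨r * c, s * c, by simp [mul_smul]⟩
  · rintro ⟨r, s, rfl⟩
    exact ⟨r / c, s / c, by simp [smul_smul, hc]⟩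

theorem IsSideOf.C_eq (S : D.IsSideOf e x y ε β) :
    ((D.isGeneral e).pencil D.finrank_X (by norm_num)).C (eigvec e 5 q (quad D.B) β) =
      instC q D.F (Submodule.span ℂ {(x : X), (y : X)}) := by
  rw [← S.transversal_eq]
  exact (instC_eq (D.isGeneral e) D.finrank_X _).symm

theorem IsSideOf.C_inf_V (S : D.IsSideOf e x y ε β) :
    instC q D.F (Submodule.span ℂ {(x : X), (y : X)}) ⊓ V =
      Submodule.span ℂ {(x : X), (y : X)} := by
  have h := ((D.isGeneral e).pencil D.finrank_X (by norm_num)).C_inf_V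
    ((D.isGeneral e).eigvec_ne β) ((D.isGeneral e).eigen D.finrank_X (by norm_num) S.root)
  rw [S.C_eq, S.transversal_eq, ← instV_eq] at h
  have h2 : instV q (fun i => CompleteFlag.ofBasis (D.B i)) = V := D.instV_F
  rwa [h2] at h

theorem IsSideOf.mem_C (S : D.IsSideOf e x y ε β) {u : X}
    (h : ∀ i, etas e 5 q (quad D.B) β i u = 0) :
    u ∈ instC q D.F (Submodule.span ℂ {(x : X), (y : X)}) := by
  rw [← S.C_eq, Pencil.mem_C _ ((D.isGeneral e).eigvec_ne β)
    ((D.isGeneral e).eigen D.finrank_X (by norm_num) S.root)]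
  exact ⟨h 0, h 1, h 2⟩

theorem IsSideOf.exists_of_coe_mem_C (S : D.IsSideOf e x y ε β) {u : V}
    (h : (u : X) ∈ instC q D.F (Submodule.span ℂ {(x : X), (y : X)})) :
    ∃ r s : ℂ, u = r • x + s • y := by
  have h2 : (u : X) ∈ instC q D.F (Submodule.span ℂ {(x : X), (y : X)}) ⊓ V := ⟨h, u.2⟩
  rw [S.C_inf_V, Submodule.mem_span_pair] at h2
  obtain ⟨r, s, h3⟩ := h2
  exact ⟨r, s, Subtype.ext (by simp [h3])⟩

/-- The image of C + V is contained in ker ψ. -/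
theorem Side.omega_ne (H : D.Side x y ε ψ) (S : D.IsSideOf e x y ε β) {u : X}
    (hu : ψ (V.mkQ u) ≠ 0) : omega e 5 q (quad D.B) β u ≠ 0 := by
  intro h
  have hα := (D.isGeneral e).eigen D.finrank_X (by norm_num) S.root
  have hform := (D.isGeneral e).form_x_eq D.finrank_X (by norm_num) S.root
  have hsup : u ∈ ((D.isGeneral e).pencil D.finrank_X (by norm_num)).C
      (eigvec e 5 q (quad D.B) β) ⊔ ((D.isGeneral e).pencil D.finrank_X (by norm_num)).V ↔
      omega e 5 q (quad D.B) β u = 0 :=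
    Pencil.mem_C_sup_V _ ((D.isGeneral e).eigvec_ne β) hα (D.isGeneral e).P_ne hform u
  have h1 := hsup.2 h
  rw [S.C_eq, ← instV_eq] at h1
  obtain ⟨w, hw, v, hv, rfl⟩ := Submodule.mem_sup.1 h1
  have hv' : v ∈ V := by
    have h2 := D.instV_F
    rw [← h2]
    exact hv
  rw [map_add, map_add, H.ψ_C w hw, mkQ_coe ⟨v, hv'⟩] at hu
  simp at hu

theorem Side.edgeCond (H : D.Side x y ε ψ) (S : D.IsSideOf e x y ε β) :
    EdgeCond e 5 q (quad D.B) β := by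
  have hq := D.two_le
  have hN := D.finrank_X
  refine IsFramed.IsSideOf.edgeCond e S (by omega) (by omega) (by omega) (D.isGeneral e).Q_ne
    ((D.mem_coe₀ D.splits_five₀ _).2 H.mem₁) (fun h => H.edge.fst_fst ?_)
    ((D.mem_coe₁ D.splits_five₁ _).2 H.mem₂) (fun h => H.edge.snd_snd ?_)
    (fun h => H.edge.fst ?_) (fun h => H.edge.snd ?_)
    ((D.mem_coe₂ D.splits_q (x - y)).2 ?_) (fun h => H.edge.trd ?_) ?_ (fun h => H.edge.fth ?_)
  · exact (D.mem_coe₀ (splits₀ hq (n := 4) (p := 1) (m := 3) (by omega)) _).1 h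
  · exact (D.mem_coe₁ (splits₁ hq (n := 4) (p := 1) (m := 3) (by omega)) _).1 h
  · rw [show finrank ℂ X - 1 = q + 4 by omega] at h
    exact (D.mem_coe₀ (splits₀ hq (n := q + 4) (p := 3) (m := q + 1) (by omega)) _).1 h
  · rw [show finrank ℂ X - 1 = q + 4 by omega] at h
    exact (D.mem_coe₁ (splits₁ hq (n := q + 4) (p := 3) (m := q + 1) (by omega)) _).1 h
  · have := (H.mem₃ 1 (-1)).2 (by ring)
    rwa [one_smul, neg_one_smul, ← sub_eq_add_neg] at this
  · exact (D.mem_coe₂ (splits₂ hq (n := q - 1) (p := 1) (m := q - 2) (by omega)) (x - y)).1 h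
  · rw [show finrank ℂ X - 2 = q + 3 by omega]
    refine (D.mem_coe₃ splits_q₃ (x - ε • y)).2 ?_
    have := (H.mem₄ 1 (-ε)).2 (by ring)
    rwa [one_smul, neg_smul, ← sub_eq_add_neg] at this
  · rw [show finrank ℂ X - 3 = q + 2 by omega] at h
    exact (D.mem_coe₃ (splits₃ (n := q + 2) (p := 1) (m := q + 1) (by omega)) (x - ε • y)).1 h

theorem bv_B₀ {i : ℕ} (hi : i < 4) :
    bv (D.B (Fin.castAdd t 0)) (fpos q 0 i) = ((bv (D.b 0) i : V) : X) := by
  rw [B₀]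
  exact bv_shuffle₁ _ _ _ _ (D.finrank_V.symm ▸ hi)

theorem bv_B₁ {i : ℕ} (hi : i < 4) :
    bv (D.B (Fin.castAdd t 1)) (fpos q 1 i) = ((bv (D.b 1) i : V) : X) := by
  rw [B₁]
  exact bv_shuffle₁ _ _ _ _ (D.finrank_V.symm ▸ hi)

theorem bv_B₂ {i : ℕ} (hi : i < 4) :
    bv (D.B (Fin.castAdd t 2)) (fpos q 2 i) = ((bv (D.b 2) i : V) : X) := by
  rw [B₂]
  exact bv_shuffle₁ _ _ _ _ (D.finrank_V.symm ▸ hi)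

theorem bv_B₃ {i : ℕ} (hi : i < 4) :
    bv (D.B (Fin.castAdd t 3)) (fpos q 3 i) = ((bv (D.b 3) i : V) : X) := by
  rw [B₃]
  exact bv_shuffle₁ _ _ _ _ (D.finrank_V.symm ▸ hi)

theorem bv_B₄ (k : Fin t) {i : ℕ} (hi : i < 4) :
    bv (D.B (Fin.natAdd 4 k)) (fpos q 4 i) = ((bv D.d i : V) : X) := by
  rw [B₄]
  exact bv_shuffle₁ _ _ _ _ (D.finrank_V.symm ▸ hi)

theorem mkQ_bv_B₀ {m : ℕ} (hm : m < q + 1) :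
    V.mkQ (bv (D.B (Fin.castAdd t 0)) (gpos q 0 m)) = bv (D.w (Fin.castAdd t 0)) m := by
  rw [B₀, bv_shuffle₂ _ _ _ _ (D.finrank_quot.symm ▸ hm), D.hs]

theorem mkQ_bv_B₁ {m : ℕ} (hm : m < q + 1) :
    V.mkQ (bv (D.B (Fin.castAdd t 1)) (gpos q 1 m)) = bv (D.w (Fin.castAdd t 1)) m := by
  rw [B₁, bv_shuffle₂ _ _ _ _ (D.finrank_quot.symm ▸ hm), D.hs₁]

theorem mkQ_bv_B₂ {m : ℕ} (hm : m < q + 1) :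
    V.mkQ (bv (D.B (Fin.castAdd t 2)) (gpos q 2 m)) = bv (D.w (Fin.castAdd t 2)) m := by
  rw [B₂, bv_shuffle₂ _ _ _ _ (D.finrank_quot.symm ▸ hm), D.hs]

theorem mkQ_bv_B₃ {m : ℕ} (hm : m < q + 1) :
    V.mkQ (bv (D.B (Fin.castAdd t 3)) (gpos q 3 m)) = bv (D.w (Fin.castAdd t 3)) m := by
  rw [B₃, bv_shuffle₂ _ _ _ _ (D.finrank_quot.symm ▸ hm), D.hs₃]

theorem mkQ_bv_B₄ (k : Fin t) {m : ℕ} (hm : m < q + 1) :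
    V.mkQ (bv (D.B (Fin.natAdd 4 k)) (gpos q 4 m)) = bv (D.w (Fin.natAdd 4 k)) m := by
  rw [B₄, bv_shuffle₂ _ _ _ _ (D.finrank_quot.symm ▸ hm), D.hs]

theorem Side.ψ_line (H : D.Side x y ε ψ) (i) (hi : i ≠ Fin.castAdd t 2) :
    ψ (V.mkQ (bv (D.B i) 0)) ≠ 0 := by
  induction i using Fin.addCases with
  | left k =>
    have hk : k ≠ 2 := fun h => hi (by rw [h])
    obtain rfl | rfl | rfl : k = 0 ∨ k = 1 ∨ k = 3 := by omega
    · have := mkQ_bv_B₀ (D := D) (m := 2) (by have := D.two_le; omega)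
      change V.mkQ (bv _ 0) = _ at this
      rw [this]
      exact H.ψ_first
    · have := mkQ_bv_B₁ (D := D) (m := 0) (by omega)
      change V.mkQ (bv _ 0) = _ at this
      rw [this]
      exact H.ψ_other _ (by simp [Fin.ext_iff]) hi
    · have := mkQ_bv_B₃ (D := D) (m := 0) (by omega)
      change V.mkQ (bv _ 0) = _ at this
      rw [this]
      exact H.ψ_other _ (by simp [Fin.ext_iff]) hi
  | right k =>
    have := mkQ_bv_B₄ (D := D) k (m := 0) (by omega)
    change V.mkQ (bv _ 0) = _ at this
    rw [this]
    exact H.ψ_other _ (natAdd_ne_castAdd _ _) hi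

theorem Side.eq_zero_of_mem_C (H : D.Side x y ε ψ) {c : ℂ} {u : X} {v : V}
    (hu : ψ (V.mkQ u) ≠ 0)
    (h : c • u + v ∈ instC q D.F (Submodule.span ℂ {(x : X), (y : X)})) : c = 0 := by
  have := H.ψ_C _ h
  rw [map_add, mkQ_coe, map_smul, add_zero, map_smul, smul_eq_mul] at this
  exact (mul_eq_zero.1 this).resolve_right hu

theorem eq_zero_of_smul_bv {Y : Type} [AddCommGroup Y] [Module ℂ Y]
    (b : Basis (Fin (finrank ℂ Y)) ℂ Y) {j k : ℕ} (hjk : j < k) (hk : k < finrank ℂ Y) {c d : ℂ}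
    (h : c • bv b j + d • bv b k = 0) : c = 0 ∧ d = 0 := by
  have hd : d = 0 := eq_zero_of_smul_bv_add_mem b hk le_rfl
    (Submodule.smul_mem _ c (bv_mem b hjk)) (by rw [add_comm, h]; exact zero_mem _)
  rw [hd, zero_smul, add_zero, smul_eq_zero] at h
  exact ⟨h.resolve_right (bv_ne_zero b (hjk.trans hk)), hd⟩

/-- The only vectors of a transversal in the span of the first and third vectors of a basis are
zero. -/
theorem eq_zero_of_transversal {b : Basis (Fin (finrank ℂ V)) ℂ V} {x y : V}
    (h4 : finrank ℂ V = 4)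
    (hx2 : x ∈ (CompleteFlag.ofBasis b).sub 2) (hx1 : x ∉ (CompleteFlag.ofBasis b).sub 1)
    (hy : y ∉ (CompleteFlag.ofBasis b).sub 3) {c d r s : ℂ}
    (h : c • bv b 0 + d • bv b 2 = r • x + s • y) : c = 0 ∧ d = 0 := by
  have m0 : c • bv b 0 ∈ (CompleteFlag.ofBasis b).sub 1 :=
    Submodule.smul_mem _ _ (bv_mem b (by omega))
  have hm := (CompleteFlag.ofBasis b).mono
  have hs : s = 0 := by
    by_contra hs
    have h1 : c • bv b 0 + d • bv b 2 ∈ (CompleteFlag.ofBasis b).sub 3 :=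
      add_mem (hm (by omega) m0) (Submodule.smul_mem _ _ (bv_mem b (by omega)))
    rw [h, Submodule.add_mem_iff_right _ (Submodule.smul_mem _ _ (hm (by omega) hx2)),
      Submodule.smul_mem_iff _ hs] at h1
    exact hy h1
  rw [hs, zero_smul, add_zero] at h
  have hd : d = 0 := eq_zero_of_smul_bv_add_mem b (k := 2) (m := 2) (by omega) le_rfl
    (hm (by omega) m0) (by rw [add_comm, h]; exact Submodule.smul_mem _ _ hx2)
  rw [hd, zero_smul, add_zero] at h
  have hr : r = 0 := by
    by_contra hr
    rw [h, Submodule.smul_mem_iff _ hr] at m0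
    exact hx1 m0
  rw [hr, zero_smul, smul_eq_zero] at h
  exact ⟨h.resolve_right (bv_ne_zero b (by omega)), hd⟩

/-- The pattern of this and the following determinants: a null vector gives an element of C.
Applying ψ removes its lifted basis vector, which is not in ker ψ. The rest lies in C ∩ V, the
transversal, and the position of the transversal relative to the flags of V makes it zero. -/
theorem Side.det_six (H : D.Side x y ε ψ) (S : D.IsSideOf e x y ε β) (k : Fin 4)
    (hk : (k : ℕ) < 2) : Matrix.det (Matrix.of fun i j : Fin 3 =>
      etas e 5 q (quad D.B) β i (bv (quad D.B k) (![0, 3, 5] j))) ≠ 0 := by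
  have h4 := D.finrank_V
  refine det_ne_zero_of_forall fun c hc => ?_
  have h1 := S.mem_C (u := c 0 • bv (quad D.B k) 0 + (c 1 • bv (quad D.B k) 3 +
      c 2 • bv (quad D.B k) 5)) fun i => by
    have := congrFun hc i
    simp only [Matrix.mulVec, dotProduct, Fin.sum_univ_three, Matrix.of_apply, Pi.zero_apply] at this
    simp only [map_add, map_smul, smul_eq_mul]
    simp only [Matrix.cons_val] at this
    linear_combination this
  obtain rfl | rfl : k = 0 ∨ k = 1 := by omega
  · have e1 : bv (quad D.B 0) 3 = ((bv (D.b 0) 0 : V) : X) := bv_B₀ (i := 0) (by omega)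
    have e2 : bv (quad D.B 0) 5 = ((bv (D.b 0) 2 : V) : X) := bv_B₀ (i := 2) (by omega)
    rw [e1, e2, ← Submodule.coe_smul, ← Submodule.coe_smul, ← Submodule.coe_add] at h1
    have h2 := H.eq_zero_of_mem_C (H.ψ_line (Fin.castAdd t 0) (by simp [Fin.ext_iff])) h1
    rw [h2, zero_smul, zero_add] at h1
    obtain ⟨r, s, h3⟩ := S.exists_of_coe_mem_C h1
    obtain ⟨h5, h6⟩ := eq_zero_of_transversal h4 H.mem₁ H.edge.fst_fst H.edge.fst h3
    exact funext (Fin.forall_fin_succ.2 ⟨h2, Fin.forall_fin_two.2 ⟨h5, h6⟩⟩)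
  · have e1 : bv (quad D.B 1) 3 = ((bv (D.b 1) 0 : V) : X) := bv_B₁ (i := 0) (by omega)
    have e2 : bv (quad D.B 1) 5 = ((bv (D.b 1) 2 : V) : X) := bv_B₁ (i := 2) (by omega)
    rw [e1, e2, ← Submodule.coe_smul, ← Submodule.coe_smul, ← Submodule.coe_add] at h1
    have h2 := H.eq_zero_of_mem_C (H.ψ_line (Fin.castAdd t 1) (by simp [Fin.ext_iff])) h1
    rw [h2, zero_smul, zero_add] at h1
    obtain ⟨r, s, h3⟩ := S.exists_of_coe_mem_C h1
    rw [add_comm (r • x)] at h3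
    obtain ⟨h5, h6⟩ := eq_zero_of_transversal h4 H.mem₂ H.edge.snd_snd H.edge.snd h3
    exact funext (Fin.forall_fin_succ.2 ⟨h2, Fin.forall_fin_two.2 ⟨h5, h6⟩⟩)

/-- The two projections vanish on the third flag up to index q, so the vanishing of η would place
the first basis vector in C ∩ V; this contradicts the position of x - y. -/
theorem Side.eta_ne (H : D.Side x y ε ψ) (S : D.IsSideOf e x y ε β) :
    etas e 5 q (quad D.B) β 0 (bv (quad D.B 2) 0) ≠ 0 := by
  have h4 := D.finrank_V
  have e1 : bv (quad D.B 2) 0 = ((bv (D.b 2) 0 : V) : X) := bv_B₂ (i := 0) (by omega)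
  have hm := bv_mem (D.b 2) (show 0 < 1 by omega)
  have hm2 := (CompleteFlag.ofBasis (D.b 2)).mono (show 1 ≤ 2 by omega) hm
  have hq : ((bv (D.b 2) 0 : V) : X) - 0 ∈ (CompleteFlag.ofBasis (quad D.B 2)).sub q := by
    rw [sub_zero]
    exact (D.mem_coe₂ D.splits_q _).2 hm2
  intro h
  rw [e1] at h
  have h1 := S.mem_C (u := (bv (D.b 2) 0 : V)) fun i => by
    fin_cases i
    · exact h
    · change eta e 5 q (quad D.B) β (pi₁ e 5 (quad D.B) _) = 0
      rw [pi₁, LinearMap.smul_apply, IsFramed.pr_eq e (B := quad D.B 0) (B' := quad D.B 2) D.finrank_X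
        D.inf₁₃ (zero_mem _) hq]
      simp
    · change eta e 5 q (quad D.B) β (pi₂ e 5 (quad D.B) _) = 0
      rw [pi₂, LinearMap.smul_apply, IsFramed.pr_eq e (B := quad D.B 1) (B' := quad D.B 2) D.finrank_X
        D.inf₂₃ (zero_mem _) hq]
      simp
  obtain ⟨r, s, h3⟩ := S.exists_of_coe_mem_C h1
  rw [h3, H.mem₃] at hm2
  have hs : s = -r := by linear_combination hm2
  rw [hs, neg_smul, ← sub_eq_add_neg, ← smul_sub] at h3
  by_cases hr : r = 0
  · rw [hr, zero_smul] at h3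
    exact bv_ne_zero (D.b 2) (by omega) h3
  · rw [h3, Submodule.smul_mem_iff _ hr] at hm
    exact H.edge.trd hm

theorem Side.det_two (H : D.Side x y ε ψ) (S : D.IsSideOf e x y ε β) :
    Matrix.det (Matrix.of fun i j : Fin 2 =>
      etas e 5 q (quad D.B) β i.succ (bv (quad D.B 3) j)) ≠ 0 := by
  have h4 := D.finrank_V
  have hN := D.finrank_X
  refine det_ne_zero_of_forall fun c hc => ?_
  have h1 := S.mem_C (u := c 0 • bv (quad D.B 3) 0 + c 1 • bv (quad D.B 3) 1) (by
    refine Fin.cases ?_ fun i => ?_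
    · change det₂ _ (xi e (quad D.B) _) = 0
      rw [(ofBasis_sub_finrank_sub_two e (quad D.B) (by omega)
        (c 0 • bv (quad D.B 3) 0 + c 1 • bv (quad D.B 3) 1)).2 (add_mem
        (Submodule.smul_mem _ _ (bv_mem _ (by omega)))
        (Submodule.smul_mem _ _ (bv_mem _ (by omega)))), map_zero]
    · have := congrFun hc i
      simp only [Matrix.mulVec, dotProduct, Fin.sum_univ_two, Matrix.of_apply, Pi.zero_apply] at this
      simp only [map_add, map_smul, smul_eq_mul]
      simp only [Fin.val_zero, Fin.val_one] at this
      linear_combination this)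
  have e1 : bv (quad D.B 3) 1 = ((bv (D.b 3) 0 : V) : X) := bv_B₃ (i := 0) (by omega)
  rw [e1, ← Submodule.coe_smul] at h1
  have h2 := H.eq_zero_of_mem_C (H.ψ_line (Fin.castAdd t 3) (by simp [Fin.ext_iff])) h1
  rw [h2, zero_smul, zero_add] at h1
  obtain ⟨r, s, h3⟩ := S.exists_of_coe_mem_C h1
  have hm : c 1 • bv (D.b 3) 0 ∈ (CompleteFlag.ofBasis (D.b 3)).sub 1 :=
    Submodule.smul_mem _ _ (bv_mem (D.b 3) (show 0 < 1 by omega))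
  have hm2 := (CompleteFlag.ofBasis (D.b 3)).mono (show 1 ≤ 2 by omega) hm
  rw [h3, H.mem₄] at hm2
  have hs : s = -(r * ε) := by linear_combination hm2
  rw [hs, neg_smul, ← sub_eq_add_neg, mul_smul, ← smul_sub] at h3
  have hr : r = 0 := by
    by_contra hr
    rw [h3, Submodule.smul_mem_iff _ hr] at hm
    exact H.edge.fth hm
  rw [hr, zero_smul, smul_eq_zero] at h3
  exact funext (Fin.forall_fin_two.2 ⟨h2, h3.resolve_right (bv_ne_zero _ (by omega))⟩)

theorem Side.det_three (H : D.Side x y ε ψ) (S : D.IsSideOf e x y ε β) (i : Fin t) :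
    Matrix.det (Matrix.of fun k j : Fin 3 =>
      etas e 5 q (quad D.B) β k (bv (D.B (Fin.natAdd 4 i)) j)) ≠ 0 := by
  have h4 := D.finrank_V
  refine det_ne_zero_of_forall fun c hc => ?_
  have h1 := S.mem_C (u := c 0 • bv (D.B (Fin.natAdd 4 i)) 0 + (c 1 • bv (D.B (Fin.natAdd 4 i)) 1 +
      c 2 • bv (D.B (Fin.natAdd 4 i)) 2)) fun k => by
    have := congrFun hc k
    simp only [Matrix.mulVec, dotProduct, Fin.sum_univ_three, Matrix.of_apply, Pi.zero_apply] at this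
    simp only [map_add, map_smul, smul_eq_mul]
    simp only [Fin.val_zero, Fin.val_one, Fin.val_two] at this
    linear_combination this
  have e1 : bv (D.B (Fin.natAdd 4 i)) 1 = ((bv D.d 0 : V) : X) := bv_B₄ i (i := 0) (by omega)
  have e2 : bv (D.B (Fin.natAdd 4 i)) 2 = ((bv D.d 1 : V) : X) := bv_B₄ i (i := 1) (by omega)
  rw [e1, e2, ← Submodule.coe_smul, ← Submodule.coe_smul, ← Submodule.coe_add] at h1
  have h2 := H.eq_zero_of_mem_C (H.ψ_line (Fin.natAdd 4 i) (natAdd_ne_castAdd _ _)) h1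
  rw [h2, zero_smul, zero_add] at h1
  obtain ⟨r, s, h3⟩ := S.exists_of_coe_mem_C h1
  have hm : c 1 • bv D.d 0 + c 2 • bv D.d 1 ∈ (CompleteFlag.ofBasis D.d).sub 2 :=
    add_mem (Submodule.smul_mem _ _ (bv_mem _ (by omega)))
      (Submodule.smul_mem _ _ (bv_mem _ (by omega)))
  rw [h3] at hm
  obtain ⟨rfl, rfl⟩ := H.mem_d r s hm
  rw [zero_smul, zero_smul, zero_add] at h3
  obtain ⟨h5, h6⟩ := eq_zero_of_smul_bv D.d (by omega) (by omega) h3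
  exact funext (Fin.forall_fin_succ.2 ⟨h2, Fin.forall_fin_two.2 ⟨h5, h6⟩⟩)

/-- This is the purpose of the diagonal plane of `D.d`: it meets both transversals only in zero. -/
theorem Side.det_last (H : D.Side x y ε ψ) (S : D.IsSideOf e x y ε β) (i : Fin t) :
    Matrix.det (Matrix.of fun k j : Fin 2 =>
      crd e (D.B (Fin.natAdd 4 i)) (finrank ℂ X - 2 + k)
        (![eigX e 5 q (quad D.B) β, eigY e 5 q (quad D.B) β] j)) ≠ 0 := by
  have hN := D.finrank_X
  obtain ⟨c, hc, hX, hY⟩ := S.smul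
  refine det_ne_zero_of_forall fun d hd => ?_
  have h1 : (((d 0 * c) • x + (d 1 * c) • y : V) : X) ∈ (D.F (Fin.natAdd 4 i)).sub (q + 3) := by
    rw [F, mem_ofBasis_iff e]
    intro k hk hkN
    obtain ⟨j, rfl⟩ : ∃ j : Fin 2, k = finrank ℂ X - 2 + j :=
      ⟨⟨k - (q + 3), by omega⟩, by simp only; omega⟩
    have := congrFun hd j
    simp only [Matrix.mulVec, dotProduct, Fin.sum_univ_two, Matrix.of_apply, Pi.zero_apply] at this
    simp only [Matrix.cons_val] at this
    rw [hX, hY] at this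
    push_cast at this ⊢
    simp only [map_add, map_smul, smul_eq_mul] at this ⊢
    linear_combination this
  rw [D.mem_coe₄ i splits_q₄] at h1
  obtain ⟨h2, h3⟩ := H.mem_d _ _ h1
  exact funext (Fin.forall_fin_two.2 ⟨(mul_eq_zero.1 h2).resolve_right hc,
    (mul_eq_zero.1 h3).resolve_right hc⟩)

theorem Side.rootCond (H : D.Side x y ε ψ) (S : D.IsSideOf e x y ε β) :
    RootCond e 5 q D.B β := by
  have hq := D.two_le
  refine ⟨H.edgeCond S, fun i hi => H.omega_ne S (H.ψ_line i hi), H.omega_ne S ?_, H.det_six S,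
    H.eta_ne S, H.det_two S, H.det_three S, H.det_last S⟩
  have := mkQ_bv_B₂ (D := D) (m := q - 2) (by omega)
  rw [show gpos q 2 (q - 2) = q + 2 by simp [gpos]; omega] at this
  change ψ (V.mkQ (bv (D.B (Fin.castAdd t 2)) (q + 2))) ≠ 0
  rw [this]
  exact H.ψ_third

variable (D e) in
theorem rootCond (hβ : IsRoot e 5 q (quad D.B) β) : RootCond e 5 q D.B β :=
  (D.isSideOf e hβ).elim D.side.rootCond D.side'.rootCond

end LiftData

end roots

end SchubertFib

end

noncomputable section
set_option linter.unusedSectionVars false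

namespace SchubertFib

open Module

/-! ### The constructed instance induces the prescribed flags. -/

section fibration

theorem inf_ker_sup_span {Y : Type} [AddCommGroup Y] [Module ℂ Y] {A : Submodule ℂ Y}
    {φ : Y →ₗ[ℂ] ℂ} {u : Y} (hu : u ∈ A) (hφ : φ u ≠ 0) :
    A ⊓ LinearMap.ker φ ⊔ Submodule.span ℂ {u} = A := by
  refine le_antisymm (sup_le inf_le_left (by simpa using hu)) fun w hw => ?_
  refine Submodule.mem_sup.2 ⟨w - (φ w / φ u) • u, ⟨sub_mem hw (A.smul_mem _ hu), ?_⟩,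
    (φ w / φ u) • u, Submodule.smul_mem _ _ (Submodule.mem_span_singleton_self u),
    sub_add_cancel _ _⟩
  simp [hφ]

theorem sub_one_eq {Y : Type} [AddCommGroup Y] [Module ℂ Y]
    (b : Basis (Fin (finrank ℂ Y)) ℂ Y) :
    (CompleteFlag.ofBasis b).sub 1 = Submodule.span ℂ {bv b 0} := by
  have h : (CompleteFlag.ofBasis b).sub 0 = ⊥ := by
    simp [CompleteFlag.ofBasis]
  rw [show 1 = 0 + 1 from rfl, sub_succ, h, bot_sup_eq]

namespace LiftData

variable {X : Type} [AddCommGroup X] [Module ℂ X] {V : Submodule ℂ X}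
  {t q : ℕ} (D : LiftData V t q) [FiniteDimensional ℂ X]

theorem instE_eq (k : Fin 4) : instE V D.F k = CompleteFlag.ofBasis (D.b k) := by
  have hq := D.two_le
  refine flagOfChain_eq (chainE_mono _ _) _ fun j hj => ?_
  rw [D.finrank_V] at hj
  rcases Nat.lt_or_ge 3 j with h | h
  · refine ⟨finrank ℂ X, ?_⟩
    rw [chainE, CompleteFlag.sub_eq_top _ le_rfl,
      CompleteFlag.sub_eq_top _ (by rw [D.finrank_V]; omega), inter, Submodule.comap_top]
  obtain rfl | rfl | rfl | rfl : k = 0 ∨ k = 1 ∨ k = 2 ∨ k = 3 := by omega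
  · refine ⟨j + 3, ?_⟩
    ext u
    exact (D.mem_coe₀ (splits₀ (p := j) (m := 3) hq (by omega)) u).symm
  · refine ⟨j + 3, ?_⟩
    ext u
    exact (D.mem_coe₁ (splits₁ (p := j) (m := 3) hq (by omega)) u).symm
  · rcases Nat.eq_zero_or_pos j with h0 | h0
    · refine ⟨0, ?_⟩
      ext u
      exact (D.mem_coe₂ (splits₂ (p := j) (m := 0) hq (by omega)) u).symm
    · refine ⟨j + (q - 2), ?_⟩
      ext u
      exact (D.mem_coe₂ (splits₂ (p := j) (m := q - 2) hq (by omega)) u).symm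
  · rcases Nat.eq_zero_or_pos j with h0 | h0
    · refine ⟨0, ?_⟩
      ext u
      exact (D.mem_coe₃ (splits₃ (p := j) (m := 0) (by omega)) u).symm
    · refine ⟨j + (q + 1), ?_⟩
      ext u
      exact (D.mem_coe₃ (splits₃ (p := j) (m := q + 1) (by omega)) u).symm

/-- The space of solutions belonging to the first transversal. -/
def C : Submodule ℂ X := instC q D.F (Submodule.span ℂ {(D.v 0 : X), (D.v 2 : X)})

theorem v₂_mem_C : (D.v 2 : X) ∈ D.C := by
  have h0 : (D.v 0 : X) ∈ instT q D.F (Submodule.span ℂ {(D.v 0 : X), (D.v 2 : X)}) :=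
    Submodule.mem_sup_right (Submodule.subset_span (by simp))
  have h2 : (D.v 2 : X) ∈ instT q D.F (Submodule.span ℂ {(D.v 0 : X), (D.v 2 : X)}) :=
    Submodule.mem_sup_right (Submodule.subset_span (by simp))
  constructor
  · refine Submodule.mem_sup.2 ⟨D.v 0, ⟨(D.mem_coe₀ D.splits_five₀ _).2 D.side.mem₁, h0⟩,
      ((D.v 2 - D.v 0 : V) : X), ⟨(D.mem_coe₂ D.splits_q _).2 ?_, sub_mem h2 h0⟩, by simp⟩
    have := (D.side.mem₃ (-1) 1).2 (by ring)
    rwa [one_smul, neg_one_smul, neg_add_eq_sub] at this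
  · exact Submodule.mem_sup_left ⟨(D.mem_coe₁ D.splits_five₁ _).2 D.side.mem₂, h2⟩

theorem map_C_le : D.C.map V.mkQ ≤ LinearMap.ker D.φ := by
  rintro _ ⟨u, hu, rfl⟩
  exact D.side.ψ_C u hu

/-- C contains v 2 and all lifts of ker φ, so a lift may be corrected by a multiple of v 2 in order
to land in A. This freedom is needed for the fourth flag, whose lift is twisted along v 2. -/
theorem map_C_inf {A : Submodule ℂ X} {W : Submodule ℂ (X ⧸ V)} (h1 : A.map V.mkQ ≤ W)
    (h2 : ∀ z ∈ W, D.φ z = 0 → ∃ c : ℂ, ((c • D.v 2 : V) : X) + D.s z ∈ A) :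
    (D.C ⊓ A).map V.mkQ = W ⊓ LinearMap.ker D.φ := by
  apply le_antisymm
  · exact le_inf ((Submodule.map_mono inf_le_right).trans h1)
      ((Submodule.map_mono inf_le_left).trans D.map_C_le)
  · rintro z ⟨hz, hφ⟩
    obtain ⟨c, hc⟩ := h2 z hz hφ
    refine ⟨_, ⟨add_mem (D.C.smul_mem c D.v₂_mem_C) (D.s_mem_C hφ), hc⟩, ?_⟩
    rw [map_add, ← Submodule.coe_smul, mkQ_coe, D.hs, zero_add]

theorem map_F₀ {n p m : ℕ} (h : Splits q 0 n p m) : ((D.F (Fin.castAdd t 0)).sub n).map V.mkQ =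
    (CompleteFlag.ofBasis (D.w (Fin.castAdd t 0))).sub m := by
  rw [F, B₀]
  exact map_mkQ_shuffle _ _ _ _ (D.splits_left h) (D.splits_right h)

theorem map_F₁ {n p m : ℕ} (h : Splits q 1 n p m) : ((D.F (Fin.castAdd t 1)).sub n).map V.mkQ =
    (CompleteFlag.ofBasis (D.w (Fin.castAdd t 1))).sub m := by
  rw [F, B₁]
  exact map_mkQ_shuffle _ D.hs₁ _ _ (D.splits_left h) (D.splits_right h)

theorem map_F₂ {n p m : ℕ} (h : Splits q 2 n p m) : ((D.F (Fin.castAdd t 2)).sub n).map V.mkQ =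
    (CompleteFlag.ofBasis (D.w (Fin.castAdd t 2))).sub m := by
  rw [F, B₂]
  exact map_mkQ_shuffle _ _ _ _ (D.splits_left h) (D.splits_right h)

theorem map_F₃ {n p m : ℕ} (h : Splits q 3 n p m) : ((D.F (Fin.castAdd t 3)).sub n).map V.mkQ =
    (CompleteFlag.ofBasis (D.w (Fin.castAdd t 3))).sub m := by
  rw [F, B₃]
  exact map_mkQ_shuffle _ D.hs₃ _ _ (D.splits_left h) (D.splits_right h)

theorem map_F₄ (i : Fin t) {n p m : ℕ} (h : Splits q 4 n p m) :
    ((D.F (Fin.natAdd 4 i)).sub n).map V.mkQ =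
      (CompleteFlag.ofBasis (D.w (Fin.natAdd 4 i))).sub m := by
  rw [F, B₄]
  exact map_mkQ_shuffle _ _ _ _ (D.splits_left h) (D.splits_right h)

theorem map_C_inf₀ {n p m : ℕ} (h : Splits q 0 n p m) :
    (D.C ⊓ (D.F (Fin.castAdd t 0)).sub n).map V.mkQ =
      (CompleteFlag.ofBasis (D.w (Fin.castAdd t 0))).sub m ⊓ LinearMap.ker D.φ :=
  D.map_C_inf (D.map_F₀ h).le fun z hz _ => ⟨0, (D.mem_F₀ h _ z).2 ⟨by simp, hz⟩⟩

theorem map_C_inf₁ {n p m : ℕ} (h : Splits q 1 n p m) :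
    (D.C ⊓ (D.F (Fin.castAdd t 1)).sub n).map V.mkQ =
      (CompleteFlag.ofBasis (D.w (Fin.castAdd t 1))).sub m ⊓ LinearMap.ker D.φ :=
  D.map_C_inf (D.map_F₁ h).le fun z hz hφ => ⟨0, (D.mem_F₁ h _ z).2 ⟨by simp [hφ], hz⟩⟩

theorem map_C_inf₂ {n p m : ℕ} (h : Splits q 2 n p m) :
    (D.C ⊓ (D.F (Fin.castAdd t 2)).sub n).map V.mkQ =
      (CompleteFlag.ofBasis (D.w (Fin.castAdd t 2))).sub m ⊓ LinearMap.ker D.φ :=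
  D.map_C_inf (D.map_F₂ h).le fun z hz _ => ⟨0, (D.mem_F₂ h _ z).2 ⟨by simp, hz⟩⟩

theorem map_C_inf₃ {n p m : ℕ} (h : Splits q 3 n p m) :
    (D.C ⊓ (D.F (Fin.castAdd t 3)).sub n).map V.mkQ =
      (CompleteFlag.ofBasis (D.w (Fin.castAdd t 3))).sub m ⊓ LinearMap.ker D.φ :=
  D.map_C_inf (D.map_F₃ h).le fun z hz _ => ⟨-D.θ z, (D.mem_F₃ h _ z).2 ⟨by simp, hz⟩⟩

theorem map_C_inf₄ (i : Fin t) {n p m : ℕ} (h : Splits q 4 n p m) :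
    (D.C ⊓ (D.F (Fin.natAdd 4 i)).sub n).map V.mkQ =
      (CompleteFlag.ofBasis (D.w (Fin.natAdd 4 i))).sub m ⊓ LinearMap.ker D.φ :=
  D.map_C_inf (D.map_F₄ i h).le fun z hz _ => ⟨0, (D.mem_F₄ i h _ z).2 ⟨by simp, hz⟩⟩

theorem mkQ_map_sub_one (i : Fin (4 + t)) :
    ((D.F i).sub 1).map V.mkQ = Submodule.span ℂ {V.mkQ (bv (D.B i) 0)} := by
  rw [F, sub_one_eq, Submodule.map_span, Set.image_singleton]

/-- The inserted line lies in W but not in ker φ, so it restores W from its hyperplane section. -/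
theorem chainQ_eq {i : Fin (4 + t)} (hi : i ≠ Fin.castAdd t 2) {c n : ℕ} (hn : c < n)
    {W : Submodule ℂ (X ⧸ V)} (hW : V.mkQ (bv (D.B i) 0) ∈ W)
    (h : (D.C ⊓ (D.F i).sub (n - 1)).map V.mkQ = W ⊓ LinearMap.ker D.φ) :
    chainQ V D.C c (D.F i) n = W := by
  rw [chainQ, if_neg (by omega), Submodule.map_sup, h, mkQ_map_sub_one]
  exact inf_ker_sup_span hW (D.side.ψ_line i hi)

theorem chainQ_zero (i : Fin (4 + t)) : chainQ V D.C 0 (D.F i) 0 = ⊥ := by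
  rw [chainQ, if_pos le_rfl, CompleteFlag.sub_zero, inf_bot_eq, Submodule.map_bot]

theorem instG_first : instG q V D.C D.F (Fin.castAdd t 0) =
    CompleteFlag.ofBasis (D.w (Fin.castAdd t 0)) := by
  have hq := D.two_le
  have hX := D.finrank_X
  have hQ := D.finrank_quot
  rw [instG_one]
  refine flagOfChain_eq (chainQ_mono _ _ _ _) _ fun j hj => ?_
  have h2 := mkQ_bv_B₀ (D := D) (m := 2) (by omega)
  change V.mkQ (bv _ 0) = _ at h2
  rcases Nat.lt_or_ge 2 j with h | h
  · refine ⟨j + 4, (D.chainQ_eq (by simp [Fin.ext_iff]) (by omega) ?_ ?_).symm⟩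
    · rw [h2]
      exact bv_mem _ h
    · exact D.map_C_inf₀ (splits₀ (p := 3) (m := j) hq (by omega))
  · refine ⟨j + 1, ?_⟩
    rw [chainQ, if_pos (by omega)]
    refine Submodule.eq_of_le_of_finrank_le ?_ ?_
    · refine Submodule.span_le.2 ?_
      rintro _ ⟨m, hm, rfl⟩
      have hm' : (m : ℕ) < j := hm
      have h3 : bv (D.w (Fin.castAdd t 0)) m = D.w (Fin.castAdd t 0) m := bv_of_lt _ m.2
      have h4 : D.φ (D.w (Fin.castAdd t 0) m) = 0 := by
        rw [← h3, D.fiber.φ_first m (by omega)]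
        omega
      refine ⟨D.s (D.w (Fin.castAdd t 0) m), ⟨D.s_mem_C h4, ?_⟩, D.hs _⟩
      have h5 := bv_shuffle₂ (D.isShuffle 0) D.hs (D.b 0) (D.w (Fin.castAdd t 0)) m.2
      rw [← h3, ← h5, ← B₀]
      refine bv_mem _ ?_
      simp only [gpos, Matrix.cons_val_zero]
      rw [if_pos (by omega)]
      omega
    -- The image of F_{j+1} has dimension at most j + 1 and contains the image of the first basis
    -- vector, which φ does not kill. So the image of C ∩ F_{j+1} is strictly smaller.
    · have h3 : (D.C ⊓ (D.F (Fin.castAdd t 0)).sub (j + 1)).map V.mkQ <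
          ((D.F (Fin.castAdd t 0)).sub (j + 1)).map V.mkQ := by
        refine lt_of_le_of_ne (Submodule.map_mono inf_le_right) fun h4 => ?_
        have h5 : V.mkQ (bv (D.B (Fin.castAdd t 0)) 0) ∈
            ((D.F (Fin.castAdd t 0)).sub (j + 1)).map V.mkQ :=
          ⟨_, bv_mem _ (by omega), rfl⟩
        rw [← h4] at h5
        exact D.side.ψ_line (Fin.castAdd t 0) (by simp [Fin.ext_iff])
          (D.map_C_le (Submodule.map_mono inf_le_left h5))
      have h4 := Submodule.finrank_lt_finrank_of_lt h3
      have h5 := Submodule.finrank_map_le V.mkQ ((D.F (Fin.castAdd t 0)).sub (j + 1))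
      rw [CompleteFlag.finrank_sub _ _ (by omega)] at h5
      rw [CompleteFlag.finrank_sub _ _ hj]
      omega

theorem instG_third : instG q V D.C D.F (Fin.castAdd t 2) =
    CompleteFlag.ofBasis (D.w (Fin.castAdd t 2)) := by
  have hq := D.two_le
  have hQ := D.finrank_quot
  rw [instG_three]
  refine flagOfChain_eq (chainR_mono _ _ _ _) _ fun j hj => ?_
  rcases Nat.lt_or_ge (q - 2) j with h | h
  · refine ⟨j + 4, ?_⟩
    rw [chainR, if_neg (by omega)]
    exact (D.map_F₂ (splits₂ (p := 4) (m := j) hq (by omega))).symm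
  · refine ⟨j + 1, ?_⟩
    rw [chainR, if_pos (by omega), D.map_C_inf₂ (splits₂ (p := 1) (m := j) hq (by omega)),
      inf_eq_left.2]
    exact fun z hz => D.fiber.φ_third z ((CompleteFlag.ofBasis _).mono h hz)

theorem instG_rest {i : Fin (4 + t)} (h0 : i ≠ Fin.castAdd t 0) (h2 : i ≠ Fin.castAdd t 2)
    (hi : V.mkQ (bv (D.B i) 0) = bv (D.w i) 0)
    (h : ∀ j, 1 ≤ j → j ≤ q + 1 → ∃ n, (D.C ⊓ (D.F i).sub n).map V.mkQ =
      (CompleteFlag.ofBasis (D.w i)).sub j ⊓ LinearMap.ker D.φ) :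
    instG q V D.C D.F i = CompleteFlag.ofBasis (D.w i) := by
  rw [instG_other _ _ _ _ h0 h2]
  refine flagOfChain_eq (chainQ_mono _ _ _ _) _ fun j hj => ?_
  rcases Nat.eq_zero_or_pos j with rfl | hj0
  · exact ⟨0, by rw [chainQ_zero, CompleteFlag.sub_zero]⟩
  · obtain ⟨n, hn⟩ := h j hj0 (hj.trans_eq D.finrank_quot)
    have hW : V.mkQ (bv (D.B i) 0) ∈ (CompleteFlag.ofBasis (D.w i)).sub j := by
      rw [hi]
      exact bv_mem _ hj0
    have hc : chainQ V D.C 0 (D.F i) (n + 1) = (CompleteFlag.ofBasis (D.w i)).sub j :=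
      D.chainQ_eq h2 (Nat.succ_pos n) hW (by rw [Nat.succ_sub_one]; exact hn)
    exact ⟨n + 1, hc.symm⟩

theorem instG_eq (i : Fin (4 + t)) :
    instG q V D.C D.F i = CompleteFlag.ofBasis (D.w i) := by
  have hq := D.two_le
  induction i using Fin.addCases with
  | left k =>
    obtain rfl | rfl | rfl | rfl : k = 0 ∨ k = 1 ∨ k = 2 ∨ k = 3 := by omega
    · exact D.instG_first
    · refine D.instG_rest (by simp [Fin.ext_iff]) (by simp [Fin.ext_iff]) ?_ fun j hj hj' => ?_
      · exact mkQ_bv_B₁ (D := D) (m := 0) (by omega)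
      · rcases Nat.lt_or_ge 3 j with h | h
        · exact ⟨j + 3, D.map_C_inf₁ (splits₁ (p := 3) (m := j) hq (by omega))⟩
        · exact ⟨j, D.map_C_inf₁ (splits₁ (p := 0) (m := j) hq (by omega))⟩
    · exact D.instG_third
    · refine D.instG_rest (by simp [Fin.ext_iff]) (by simp [Fin.ext_iff]) ?_ fun j hj hj' => ?_
      · exact mkQ_bv_B₃ (D := D) (m := 0) (by omega)
      · exact ⟨j + 1, D.map_C_inf₃ (splits₃ (p := 1) (m := j) (by omega))⟩
  | right k =>
    refine D.instG_rest (natAdd_ne_castAdd _ _) (natAdd_ne_castAdd _ _) ?_ fun j hj hj' => ?_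
    · exact mkQ_bv_B₄ (D := D) k (m := 0) (by omega)
    · exact ⟨j + 2, D.map_C_inf₄ k (splits₄ (p := 2) (m := j) (by omega))⟩

/-- The constructed instance induces the given data. -/
theorem exists_instData_eq : ∃ G : Submodule ℂ V → Fin (4 + t) → CompleteFlag (X ⧸ V),
    instData q D.F = ⟨V, fun k => CompleteFlag.ofBasis (D.b k), G⟩ ∧
      G (Submodule.span ℂ {D.v 0, D.v 2}) = fun i => CompleteFlag.ofBasis (D.w i) := by
  refine ⟨fun h => instG q V (instC q D.F (h.map V.subtype)) D.F, ?_, ?_⟩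
  · have hV := D.instV_F
    have hE : instE V D.F = fun k => CompleteFlag.ofBasis (D.b k) := funext D.instE_eq
    rw [← hE]
    -- The types of the flags depend on the subspace, so the equality is transported with the
    -- subspace as a variable.
    have key : ∀ W, W = V → (⟨W, instE W D.F, fun h => instG q W (instC q D.F (h.map W.subtype)) D.F⟩ :
        FiberData X (Fin 4) (Fin (4 + t))) =
        ⟨V, instE V D.F, fun h => instG q V (instC q D.F (h.map V.subtype)) D.F⟩ := by
      rintro W rfl
      rfl
    exact key _ hV
  · funext i
    have h : (Submodule.span ℂ {D.v 0, D.v 2}).map V.subtype =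
        Submodule.span ℂ {(D.v 0 : X), (D.v 2 : X)} := by
      rw [Submodule.map_span, Set.image_pair]
      rfl
    change instG q V (instC q D.F ((Submodule.span ℂ {D.v 0, D.v 2}).map V.subtype)) D.F i = _
    rw [h]
    exact D.instG_eq i

end LiftData

end fibration

end SchubertFib

end

noncomputable section
set_option linter.unusedSectionVars false

namespace SchubertFib

open Module

/-! ### General quadruples of flags in a four-dimensional space. -/

section quadruples

variable {Y : Type} [AddCommGroup Y] [Module ℂ Y]

theorem linearIndependent_xy (L : Pencil Y) {a a' : Fin 2 → ℂ}
    (ha : ∀ c d : ℂ, c • a + d • a' = 0 → c = 0 ∧ d = 0) :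
    LinearIndependent ℂ ![L.x a, L.x a', L.y a, L.y a'] := by
  rw [Fintype.linearIndependent_iff]
  intro g hg
  simp only [Fin.sum_univ_four, Matrix.cons_val] at hg
  have h : L.x (g 0 • a + g 1 • a') + L.y (g 2 • a + g 3 • a') = 0 := by
    simp only [map_add, map_smul]
    rw [← hg]
    abel
  obtain ⟨h1, h2⟩ := L.x_add_y_eq_zero h
  obtain ⟨h3, h4⟩ := ha _ _ h1
  obtain ⟨h5, h6⟩ := ha _ _ h2
  exact Fin.forall_fin_succ.2 ⟨h3, Fin.forall_fin_succ.2 ⟨h4, Fin.forall_fin_two.2 ⟨h5, h6⟩⟩⟩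

variable [FiniteDimensional ℂ Y] {e : Basis (Fin (finrank ℂ Y)) ℂ Y}
  {b : Fin 4 → Basis (Fin (finrank ℂ Y)) ℂ Y}

theorem IsGeneralQuad.frameEdge (H : IsGeneralQuad e b) (h4 : 2 + 2 = finrank ℂ Y) {β : ℂ}
    (hβ : IsRoot e 2 2 b β) :
    FrameEdge b ((H.general.pencil h4 le_rfl).x (eigvec e 2 2 b β))
      ((H.general.pencil h4 le_rfl).y (eigvec e 2 2 b β)) (β / (matQ e 2 2 b).det) := by
  have h := H.edge β hβ
  refine ⟨notMem_of_crd h.fst_fst (by omega) le_rfl, notMem_of_crd h.snd_snd (by omega) le_rfl,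
    notMem_of_crd h.fst (by omega) (by omega), notMem_of_crd h.snd (by omega) (by omega),
    notMem_of_crd h.trd (by omega) le_rfl, fun hm => ?_⟩
  refine notMem_of_crd (m := 1) h.fth (by omega) (by omega) ?_
  have h2 := Submodule.smul_mem _ (matQ e 2 2 b).det hm
  rwa [smul_sub, smul_smul, mul_div_cancel₀ _ H.general.Q_ne] at h2

/-- The frame of a general quadruple of flags and a common transversal. -/
theorem IsGeneralQuad.exists_frame (H : IsGeneralQuad e b) (h4 : finrank ℂ Y = 4)
    {h : Submodule ℂ Y}
    (hh : h ∈ Solutions 2 (fun _ => box) fun k => CompleteFlag.ofBasis (b k)) :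
    ∃ (v : Basis (Fin 4) ℂ Y) (α α' : ℂ), QuadFrame b v α α' ∧ FrameEdge b (v 0) (v 2) α ∧
      FrameEdge b (v 1) (v 3) α' ∧ h = Submodule.span ℂ {v 0, v 2} := by
  have hY : 2 + 2 = finrank ℂ Y := h4.symm
  rw [mem_solutions_box h4] at hh
  obtain ⟨h2, hi⟩ := hh
  have hG := H.general
  have hf₂ : finrank ℂ Y - 2 = 2 := by omega
  set L := hG.pencil hY le_rfl with hL
  have h₄ : L.F₄ = (CompleteFlag.ofBasis (b 3)).sub 2 := by
    rw [← hf₂]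
    rfl
  have hne : ∀ k, h ⊓ (CompleteFlag.ofBasis (b k)).sub 2 ≠ ⊥ := fun k h0 => by
    have := hi k
    rw [h0, finrank_bot] at this
    omega
  have hVt : L.V = ⊤ := Submodule.eq_top_of_finrank_eq (by rw [L.finrank_V, h4])
  obtain ⟨a₀, α₀, ha₀, hα₀, hh⟩ := L.exists_eq_transversal (hVt ▸ le_top) h2 (hne 0) (hne 1) (hne 2)
    (by rw [h₄]; exact hne 3)
  obtain ⟨β, hβ, c, hc, hca⟩ := hG.exists_root hY le_rfl ha₀ hα₀
  -- The other eigenvalue, distinct from β by the discriminant; its transversal supplies the other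
  -- half of the frame.
  set β' := (matA e 2 2 b).trace - β with hβ'
  have hr : IsRoot e 2 2 b β' := by
    rw [IsRoot] at hβ ⊢
    rw [hβ']
    linear_combination hβ
  have hββ : β ≠ β' := fun hb => H.disc (by
    have ht : (matA e 2 2 b).trace = 2 * β := by linear_combination -hb
    rw [IsRoot, ht] at hβ
    rw [ht]
    linear_combination -4 * hβ)
  set a := eigvec e 2 2 b β with ha
  set a' := eigvec e 2 2 b β' with ha'
  have hQ := hG.Q_ne
  have hα := hG.eigen hY le_rfl hβ
  have hα' := hG.eigen hY le_rfl hr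
  rw [← ha, ← hL] at hα
  rw [← ha', ← hL] at hα'
  have hane : a ≠ 0 := hG.eigvec_ne β
  have hane' : a' ≠ 0 := hG.eigvec_ne β'
  have hind : ∀ c d : ℂ, c • a + d • a' = 0 → c = 0 ∧ d = 0 := by
    intro c d hcd
    have e0 := congrFun hcd 0
    have e1 := congrFun hcd 1
    simp only [ha, ha', eigvec, Pi.add_apply, Pi.smul_apply, smul_eq_mul, Pi.zero_apply,
      Matrix.cons_val_zero, Matrix.cons_val_one] at e0 e1
    have hcd' : c + d = 0 := by
      have : (c + d) * matA e 2 2 b 0 1 = 0 := by linear_combination e0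
      exact (mul_eq_zero.1 this).resolve_right hG.A_ne
    have hc0 : c = 0 := by
      have : c * (β - β') = 0 := by
        linear_combination e1 - hcd' * (β' - matA e 2 2 b 0 0)
      exact (mul_eq_zero.1 this).resolve_right (sub_ne_zero.2 hββ)
    exact ⟨hc0, by rwa [hc0, zero_add] at hcd'⟩
  have hli := linearIndependent_xy L hind
  let v : Basis (Fin 4) ℂ Y := basisOfLinearIndependentOfCardEqFinrank hli (by simp [h4])
  have hv : ⇑v = ![L.x a, L.x a', L.y a, L.y a'] :=
    coe_basisOfLinearIndependentOfCardEqFinrank _ _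
  have hu : ∀ u, u = L.x (v.coord 0 u • a + v.coord 1 u • a') +
      L.y (v.coord 2 u • a + v.coord 3 u • a') := by
    intro u
    conv_lhs => rw [← v.sum_repr u, Fin.sum_univ_four, hv]
    simp only [map_add, map_smul, Matrix.cons_val, Basis.coord_apply]
    abel
  have hiff : ∀ c d : ℂ, c • a + d • a' = 0 ↔ c = 0 ∧ d = 0 := fun c d =>
    ⟨hind c d, by rintro ⟨rfl, rfl⟩; simp⟩
  have hzero : ∀ s, L.y s ∈ L.F₁ → s = 0 := by
    intro s hs
    have : L.y s ∈ L.V ⊓ L.F₁ := ⟨hVt ▸ Submodule.mem_top, hs⟩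
    rw [L.V_inf₁] at this
    obtain ⟨r, hr⟩ := this
    exact (L.x_add_y_eq_zero (a := r) (b := -s) (by rw [hr, map_neg, add_neg_cancel])).2
      |> neg_eq_zero.1
  have hzero' : ∀ s, L.x s ∈ L.F₂ → s = 0 := by
    intro s hs
    have : L.x s ∈ L.V ⊓ L.F₂ := ⟨hVt ▸ Submodule.mem_top, hs⟩
    rw [L.V_inf₂] at this
    obtain ⟨r, hr⟩ := this
    exact (L.x_add_y_eq_zero (a := s) (b := -r) (by rw [map_neg, hr, add_neg_cancel])).1
  -- Expand ![0, 1] in the two eigenvectors. Both have the same nonzero first entry, so the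
  -- coefficients have sum zero; if one vanished, so would the other.
  have hlast : ∀ u, u = L.g ![0, 1] → v.coord 0 u + v.coord 2 u = 0 ∨
      v.coord 1 u + v.coord 3 u = 0 → False := by
    intro u hug h0
    have h1 : L.x ![0, 1] = L.δ • L.x ((v.coord 0 u + v.coord 2 u) • a +
        (v.coord 1 u + v.coord 3 u) • a') := by
      change L.π₁ (L.g ![0, 1]) = _
      rw [← hug]
      conv_lhs => rw [hu u]
      rw [map_add, L.π₁_x, L.π₁_y, ← smul_add, ← map_add]
      congr 2
      module
    rw [← map_smul, ← sub_eq_zero, ← map_sub] at h1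
    have h2 := sub_eq_zero.1 (L.x_eq_zero h1)
    have e0 := congrFun h2 0
    have e1 := congrFun h2 1
    simp only [ha, ha', eigvec, Pi.add_apply, Pi.smul_apply, smul_eq_mul,
      Matrix.cons_val_zero, Matrix.cons_val_one] at e0 e1
    have h3 : (v.coord 0 u + v.coord 2 u) + (v.coord 1 u + v.coord 3 u) = 0 := by
      have : (L.δ * matA e 2 2 b 0 1) *
          ((v.coord 0 u + v.coord 2 u) + (v.coord 1 u + v.coord 3 u)) = 0 := by
        linear_combination -e0
      exact (mul_eq_zero.1 this).resolve_left (mul_ne_zero L.δ_ne hG.A_ne)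
    have h5 : v.coord 0 u + v.coord 2 u = 0 ∧ v.coord 1 u + v.coord 3 u = 0 := by
      rcases h0 with h0 | h0
      · exact ⟨h0, by rwa [h0, zero_add] at h3⟩
      · exact ⟨by rwa [h0, add_zero] at h3, h0⟩
    rw [h5.1, h5.2] at e1
    simp at e1
  have hg : bv (b 2) 3 = L.g ![0, 1] := by
    change _ = gv 2 b ![0, 1]
    simp [gv, Fintype.linearCombination_apply]
  have v0 : v 0 = L.x a := by rw [hv]; rfl
  have v1 : v 1 = L.x a' := by rw [hv]; rfl
  have v2 : v 2 = L.y a := by rw [hv]; rfl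
  have v3 : v 3 = L.y a' := by rw [hv]; rfl
  refine ⟨v, β / (matQ e 2 2 b).det, β' / (matQ e 2 2 b).det, ?_, ?_, ?_, ?_⟩
  · refine ⟨L.α_ne_zero hane hα, L.α_ne_one hane hα, L.α_ne_zero hane' hα', L.α_ne_one hane' hα',
      fun h => hββ ((div_left_inj' hQ).1 h), fun u => ?_, fun u => ?_, fun u => ?_, fun u => ?_,
      fun h => hlast _ hg (Or.inl h), fun h => hlast _ hg (Or.inr h)⟩
    · rw [← hiff]
      change u ∈ L.F₁ ↔ _
      conv_lhs => rw [hu u]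
      rw [Submodule.add_mem_iff_right _ (L.x_mem _)]
      exact ⟨hzero _, fun h => by rw [h, map_zero]; exact zero_mem _⟩
    · rw [← hiff]
      change u ∈ L.F₂ ↔ _
      conv_lhs => rw [hu u]
      rw [Submodule.add_mem_iff_left _ (L.y_mem _)]
      exact ⟨hzero' _, fun h => by rw [h, map_zero]; exact zero_mem _⟩
    · rw [← hiff]
      change u ∈ L.F₃ ↔ _
      conv_lhs => rw [hu u]
      rw [L.x_add_y_mem_iff]
      refine Eq.congr_left ?_
      module
    · rw [← hiff, ← h₄, ← L.ξ_eq_zero]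
      conv_lhs => rw [hu u]
      have h1 : L.ξ (L.x (v.coord 0 u • a + v.coord 1 u • a') +
          L.y (v.coord 2 u • a + v.coord 3 u • a')) =
          L.Q ((β / (matQ e 2 2 b).det * v.coord 0 u + v.coord 2 u) • a +
            (β' / (matQ e 2 2 b).det * v.coord 1 u + v.coord 3 u) • a') := by
        rw [map_add, L.ξ_x, L.ξ_y]
        simp only [map_add, map_smul, hα, hα']
        module
      rw [h1]
      exact ⟨fun h => L.Q_eq_zero h, fun h => by rw [h, map_zero]⟩
  · rw [v0, v2]
    exact H.frameEdge hY hβ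
  · rw [v1, v3]
    exact H.frameEdge hY hr
  · rw [hh, v0, v2]
    ext u
    rw [L.mem_transversal, Submodule.mem_span_pair, hca]
    constructor
    · rintro ⟨r, s, rfl⟩
      exact ⟨r * c, s * c, by simp only [map_smul, mul_smul]⟩
    · rintro ⟨r, s, rfl⟩
      exact ⟨r / c, s / c, by simp only [map_smul, smul_smul, div_mul_cancel₀ _ hc]⟩

/-- A basis with given coordinates. -/
theorem exists_basis_of_coords (h4 : finrank ℂ Y = 4) (v : Basis (Fin 4) ℂ Y)
    (T : (Fin 4 → ℂ) ≃ₗ[ℂ] (Fin 4 → ℂ)) : ∃ d : Basis (Fin (finrank ℂ Y)) ℂ Y,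
      (∀ m u, u ∈ (CompleteFlag.ofBasis d).sub m ↔
        ∀ k : Fin 4, m ≤ k → T (fun i => v.coord i u) k = 0) ∧
      (fun i => v.coord i (bv d 3)) = T.symm (Pi.single 3 1) := by
  refine ⟨(Basis.ofEquivFun (v.equivFun ≪≫ₗ T)).reindex (finCongr h4.symm), fun m u => ?_, ?_⟩
  · rw [mem_ofBasis_iff_repr, ← (finCongr h4.symm).forall_congr_right]
    simp only [Basis.repr_reindex_apply, Equiv.symm_apply_apply, Basis.ofEquivFun_repr_apply]
    rfl
  · rw [bv_of_lt _ (show 3 < finrank ℂ Y by omega), Basis.reindex_apply]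
    have h3 : (finCongr h4.symm).symm ⟨3, by omega⟩ = (3 : Fin 4) := rfl
    rw [h3, Basis.coe_ofEquivFun]
    change v.equivFun ((v.equivFun ≪≫ₗ T).symm (Pi.single 3 1)) = _
    rw [LinearEquiv.trans_symm, LinearEquiv.trans_apply, LinearEquiv.apply_symm_apply]

theorem forall_two_le {f : Fin 4 → ℂ} : (∀ k : Fin 4, 2 ≤ (k : ℕ) → f k = 0) ↔ f 2 = 0 ∧ f 3 = 0 := by
  simp [Fin.forall_fin_succ]

/-- A basis whose first two vectors are the sums of vectors of a given basis. -/
theorem exists_diagonal (h4 : finrank ℂ Y = 4) (v : Basis (Fin 4) ℂ Y) :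
    ∃ d : Basis (Fin (finrank ℂ Y)) ℂ Y, ∀ u, u ∈ (CompleteFlag.ofBasis d).sub 2 ↔
      v.coord 0 u = v.coord 1 u ∧ v.coord 2 u = v.coord 3 u := by
  let T : (Fin 4 → ℂ) ≃ₗ[ℂ] (Fin 4 → ℂ) :=
    { toFun := fun c => ![c 1, c 3, c 0 - c 1, c 2 - c 3]
      invFun := fun p => ![p 0 + p 2, p 0, p 1 + p 3, p 1]
      map_add' := fun c d => by
        ext i
        fin_cases i <;> simp <;> ring
      map_smul' := fun r c => by
        ext i
        fin_cases i <;> simp <;> ring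
      left_inv := fun c => by
        ext i
        fin_cases i <;> simp
      right_inv := fun p => by
        ext i
        fin_cases i <;> simp }
  obtain ⟨d, hd, -⟩ := exists_basis_of_coords h4 v T
  refine ⟨d, fun u => ?_⟩
  rw [hd, forall_two_le]
  exact and_congr sub_eq_zero sub_eq_zero

end quadruples

end SchubertFib

end

noncomputable section
set_option linter.unusedSectionVars false

namespace SchubertFib

open Module

/-! ### Existence of a general quadruple. -/

section existence

variable {Y : Type} [AddCommGroup Y] [Module ℂ Y] [FiniteDimensional ℂ Y]
  {b : Fin 4 → Basis (Fin (finrank ℂ Y)) ℂ Y} {v : Basis (Fin 4) ℂ Y} {α α' : ℂ}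

theorem coord_self (v : Basis (Fin 4) ℂ Y) (i j) : v.coord i (v j) = if j = i then 1 else 0 := by
  rw [Basis.coord_apply, Basis.repr_self, Finsupp.single_apply]

theorem QuadFrame.isFramed (H : QuadFrame b v α α') (h4 : finrank ℂ Y = 4) :
    IsFramed 2 2 b v α α' (fun a => v.coord 0 (gv 2 b a) + v.coord 2 (gv 2 b a))
      (fun a => v.coord 1 (gv 2 b a) + v.coord 3 (gv 2 b a)) := by
  have h3 : gv 2 b ![0, 1] = bv (b 2) 3 := by simp [gv, Fintype.linearCombination_apply]
  have hzero : ∀ {u : Y}, (∀ i, v.coord i u = 0) → u = 0 := fun h => v.forall_coord_eq_zero_iff.1 h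
  refine ⟨h4.symm, by omega, H.α_ne_zero, H.α_ne_one, H.α'_ne_zero, H.α'_ne_one,
    H.α_ne, ?_, ?_, ⟨?_, ?_⟩, ⟨?_, ?_⟩, ⟨?_, ?_⟩, fun c₀ c₁ c₂ c₃ => ?_,
    fun a => ?_, fun a h h' => ?_, ?_, ?_⟩
  · rw [eq_bot_iff]
    rintro u ⟨h1, h2⟩
    obtain ⟨h3, h4⟩ := (H.mem₁ u).1 h1
    obtain ⟨h5, h6⟩ := (H.mem₃ u).1 h2
    rw [h3, add_zero] at h5
    rw [h4, add_zero] at h6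
    exact hzero (Fin.forall_fin_succ.2 ⟨h5, Fin.forall_fin_succ.2 ⟨h6,
      Fin.forall_fin_two.2 ⟨h3, h4⟩⟩⟩)
  · rw [eq_bot_iff]
    rintro u ⟨h1, h2⟩
    obtain ⟨h3, h4⟩ := (H.mem₂ u).1 h1
    obtain ⟨h5, h6⟩ := (H.mem₃ u).1 h2
    rw [h3, zero_add] at h5
    rw [h4, zero_add] at h6
    exact hzero (Fin.forall_fin_succ.2 ⟨h3, Fin.forall_fin_succ.2 ⟨h4,
      Fin.forall_fin_two.2 ⟨h5, h6⟩⟩⟩)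
  · simp [-Basis.coord_apply, H.mem₁, coord_self]
  · simp [-Basis.coord_apply, H.mem₁, coord_self]
  · simp [-Basis.coord_apply, H.mem₂, coord_self]
  · simp [-Basis.coord_apply, H.mem₂, coord_self]
  · simp [-Basis.coord_apply, H.mem₃, coord_self]
  · simp [-Basis.coord_apply, H.mem₃, coord_self]
  · rw [show finrank ℂ Y - 2 = 2 by omega, H.mem₄]
    simp [-Basis.coord_apply, coord_self]
  · rw [H.mem₃]
    simp [-Basis.coord_apply, coord_self]
  · have hm := (H.mem₃ _).2 ⟨h, h'⟩
    have hg : gv 2 b a = a 0 • bv (b 2) 2 + a 1 • bv (b 2) 3 := by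
      simp [gv, Fintype.linearCombination_apply]
    rw [hg] at hm
    have h3 : a 1 = 0 := eq_zero_of_smul_bv_add_mem (b 2) (k := 3) (m := 3)
      (by omega) le_rfl
      (Submodule.smul_mem _ (a 0) (bv_mem (b 2) (show 2 < 3 by omega))) (by
        rw [add_comm]
        exact (CompleteFlag.ofBasis (b 2)).mono (show 2 ≤ 3 by omega) hm)
    have h2 : a 0 = 0 := eq_zero_of_smul_bv_add_mem (b 2) (k := 2) (m := 2)
      (by omega) le_rfl (Submodule.zero_mem _) (by rwa [h3, zero_smul] at hm)
    exact funext (Fin.forall_fin_two.2 ⟨h2, h3⟩)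
  · rw [h3]
    exact H.last₁
  · rw [h3]
    exact H.last₂

theorem isRoot_of_mulVec {X : Type} [AddCommGroup X] [Module ℂ X]
    {e : Basis (Fin (finrank ℂ X)) ℂ X} {p q : ℕ} {b : Fin 4 → Basis (Fin (finrank ℂ X)) ℂ X}
    {a : Fin 2 → ℂ} (ha : a ≠ 0) {β : ℂ} (h : (matA e p q b).mulVec a = β • a) :
    IsRoot e p q b β := by
  have h1 : (matA e p q b - β • 1).det = 0 := Matrix.exists_mulVec_eq_zero_iff.1 ⟨a, ha, by
    rw [Matrix.sub_mulVec, h, Matrix.smul_mulVec, Matrix.one_mulVec, sub_self]⟩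
  rw [Matrix.det_fin_two] at h1
  simp at h1
  rw [IsRoot, Matrix.trace_fin_two, Matrix.det_fin_two]
  linear_combination h1

/-- Both α det Q and α' det Q are roots, so the discriminant is the square of (α - α') det Q. -/
theorem QuadFrame.disc_ne (H : QuadFrame b v α α') (h4 : finrank ℂ Y = 4)
    (e : Basis (Fin (finrank ℂ Y)) ℂ Y) :
    (matA e 2 2 b).trace ^ 2 - 4 * (matA e 2 2 b).det ≠ 0 := by
  have hF := H.isFramed h4
  have hG := hF.isGeneral e
  let R : (Fin 2 → ℂ) →ₗ[ℂ] (Fin 2 → ℂ) := LinearMap.pi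
    ![(v.coord 0 + v.coord 2) ∘ₗ gv 2 b, (v.coord 1 + v.coord 3) ∘ₗ gv 2 b]
  have hR : Function.Surjective R := LinearMap.injective_iff_surjective.1
    ((injective_iff_map_eq_zero R).2 fun a ha => hF.inj a (congrFun ha 0) (congrFun ha 1))
  have key : ∀ a : Fin 2 → ℂ, a ≠ 0 → ∀ ε : ℂ, (α - ε) * R a 0 = 0 → (α' - ε) * R a 1 = 0 →
      IsRoot e 2 2 b (ε * (matQ e 2 2 b).det) := by
    intro a ha ε h0 h1
    refine isRoot_of_mulVec ha ?_
    have h2 := (hF.smul_P_add_smul_Q e 1 (-ε) a).2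
      ⟨by rw [mul_one, ← sub_eq_add_neg]; exact h0, by rw [mul_one, ← sub_eq_add_neg]; exact h1⟩
    rw [one_smul, neg_smul, ← sub_eq_add_neg, sub_eq_zero] at h2
    rw [matA, ← Matrix.mulVec_mulVec, h2, Matrix.mulVec_smul, Matrix.mulVec_mulVec,
      Matrix.adjugate_mul, Matrix.smul_mulVec, Matrix.one_mulVec, smul_smul]
  obtain ⟨a, ha⟩ := hR ![1, 0]
  obtain ⟨a', ha'⟩ := hR ![0, 1]
  have h1 := key a (by rintro rfl; simpa using congrFun ha 0) α (by simp) (by simp [ha])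
  have h2 := key a' (by rintro rfl; simpa using congrFun ha' 1) α' (by simp [ha']) (by simp)
  rw [IsRoot] at h1 h2
  have hne : (α - α') * (matQ e 2 2 b).det ≠ 0 := mul_ne_zero (sub_ne_zero.2 H.α_ne) hG.Q_ne
  have ht : (matA e 2 2 b).trace = (α + α') * (matQ e 2 2 b).det := by
    apply mul_left_cancel₀ hne
    linear_combination h2 - h1
  rw [ht] at h1 ⊢
  intro h0
  apply pow_ne_zero 2 hne
  linear_combination h0 + 4 * h1

theorem QuadFrame.isGeneralQuad (H : QuadFrame b v α α') (h4 : finrank ℂ Y = 4)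
    (e : Basis (Fin (finrank ℂ Y)) ℂ Y) (H₁ : FrameEdge b (v 0) (v 2) α)
    (H₂ : FrameEdge b (v 1) (v 3) α') : IsGeneralQuad e b := by
  have hF := H.isFramed h4
  refine ⟨hF.isGeneral e, H.disc_ne h4 e, fun β hβ => ?_⟩
  have e1 : finrank ℂ Y - 1 = 3 := by omega
  have e2 : finrank ℂ Y - 2 = 2 := by omega
  have e3 : finrank ℂ Y - 3 = 1 := by omega
  rcases hF.isSideOf e hβ with S | S
  · refine S.edgeCond e one_le_two one_le_two (by omega) (hF.isGeneral e).Q_ne hF.mem₁.1 H₁.fst_fst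
      hF.mem₂.1 H₁.snd_snd ?_ ?_ hF.mem₃.1 H₁.trd ?_ ?_
    · rw [e1]
      exact H₁.fst
    · rw [e1]
      exact H₁.snd
    · rw [e2, H.mem₄]
      simp [-Basis.coord_apply, coord_self]
    · rw [e3]
      exact H₁.fth
  · refine S.edgeCond e one_le_two one_le_two (by omega) (hF.isGeneral e).Q_ne hF.mem₁.2 H₂.fst_fst
      hF.mem₂.2 H₂.snd_snd ?_ ?_ hF.mem₃.2 H₂.trd ?_ ?_
    · rw [e1]
      exact H₂.fst
    · rw [e1]
      exact H₂.snd
    · rw [e2, H.mem₄]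
      simp [-Basis.coord_apply, coord_self]
    · rw [e3]
      exact H₂.fth

/-- There are flags with a frame. -/
theorem exists_quadFrame (h4 : finrank ℂ Y = 4) :
    ∃ (b : Fin 4 → Basis (Fin (finrank ℂ Y)) ℂ Y) (v : Basis (Fin 4) ℂ Y),
      QuadFrame b v 2 3 ∧ FrameEdge b (v 0) (v 2) 2 ∧ FrameEdge b (v 1) (v 3) 3 := by
  let v : Basis (Fin 4) ℂ Y := (finBasis ℂ Y).reindex (finCongr h4)
  -- For a basis x, x', y, y', the four flags come from the bases x+x', x, y+y', y; then y+y', y,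
  -- x+x', x; then (x-y)+(x'-y'), x-y, x, x+x'; then (x-2y)+(x'-3y'), x-2y, x, x'. Starting with
  -- sums keeps the lines of the flags away from both transversals.
  let T₁ : (Fin 4 → ℂ) ≃ₗ[ℂ] (Fin 4 → ℂ) :=
    { toFun := fun c => ![c 1, c 0 - c 1, c 3, c 2 - c 3]
      invFun := fun p => ![p 0 + p 1, p 0, p 2 + p 3, p 2]
      map_add' := fun c d => by ext i; fin_cases i <;> simp <;> ring
      map_smul' := fun r c => by ext i; fin_cases i <;> simp <;> ring
      left_inv := fun c => by ext i; fin_cases i <;> simp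
      right_inv := fun p => by ext i; fin_cases i <;> simp }
  let T₂ : (Fin 4 → ℂ) ≃ₗ[ℂ] (Fin 4 → ℂ) :=
    { toFun := fun c => ![c 3, c 2 - c 3, c 1, c 0 - c 1]
      invFun := fun p => ![p 2 + p 3, p 2, p 0 + p 1, p 0]
      map_add' := fun c d => by ext i; fin_cases i <;> simp <;> ring
      map_smul' := fun r c => by ext i; fin_cases i <;> simp <;> ring
      left_inv := fun c => by ext i; fin_cases i <;> simp
      right_inv := fun p => by ext i; fin_cases i <;> simp }
  let T₃ : (Fin 4 → ℂ) ≃ₗ[ℂ] (Fin 4 → ℂ) :=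
    { toFun := fun c => ![-c 3, c 3 - c 2, (c 0 + c 2) - (c 1 + c 3), c 1 + c 3]
      invFun := fun p => ![p 0 + p 1 + p 2 + p 3, p 0 + p 3, -p 0 - p 1, -p 0]
      map_add' := fun c d => by ext i; fin_cases i <;> simp <;> ring
      map_smul' := fun r c => by ext i; fin_cases i <;> simp <;> ring
      left_inv := fun c => by ext i; fin_cases i <;> simp <;> ring
      right_inv := fun p => by ext i; fin_cases i <;> simp <;> ring }
  let T₄ : (Fin 4 → ℂ) ≃ₗ[ℂ] (Fin 4 → ℂ) :=
    { toFun := fun c => ![-c 3 / 3, c 3 / 3 - c 2 / 2, c 0 + c 2 / 2, c 1 + c 3 / 3]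
      invFun := fun p => ![p 0 + p 1 + p 2, p 0 + p 3, -2 * p 0 - 2 * p 1, -3 * p 0]
      map_add' := fun c d => by ext i; fin_cases i <;> simp <;> ring
      map_smul' := fun r c => by ext i; fin_cases i <;> simp <;> ring
      left_inv := fun c => by ext i; fin_cases i <;> simp <;> ring
      right_inv := fun p => by ext i; fin_cases i <;> simp <;> ring }
  obtain ⟨b₁, h₁, -⟩ := exists_basis_of_coords h4 v T₁
  obtain ⟨b₂, h₂, -⟩ := exists_basis_of_coords h4 v T₂
  obtain ⟨b₃, h₃, hl⟩ := exists_basis_of_coords h4 v T₃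
  obtain ⟨b₄, h₄, -⟩ := exists_basis_of_coords h4 v T₄
  have hT : T₃.symm (Pi.single 3 1) = ![1, 1, 0, 0] := by
    rw [LinearEquiv.symm_apply_eq]
    ext i
    fin_cases i <;> simp [T₃]
  rw [hT] at hl
  have hl0 : v.coord 0 (bv b₃ 3) = 1 := congrFun hl 0
  have hl1 : v.coord 1 (bv b₃ 3) = 1 := congrFun hl 1
  have hl2 : v.coord 2 (bv b₃ 3) = 0 := congrFun hl 2
  have hl3 : v.coord 3 (bv b₃ 3) = 0 := congrFun hl 3
  refine ⟨![b₁, b₂, b₃, b₄], v, ?_, ?_, ?_⟩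
  · refine ⟨by norm_num, by norm_num, by norm_num, by norm_num, by norm_num, fun u => ?_,
      fun u => ?_, fun u => ?_, fun u => ?_, ?_, ?_⟩
    · change u ∈ (CompleteFlag.ofBasis b₁).sub 2 ↔ _
      rw [h₁, forall_two_le]
      change v.coord 3 u = 0 ∧ v.coord 2 u - v.coord 3 u = 0 ↔ _
      constructor
      · rintro ⟨h, h'⟩
        exact ⟨by linear_combination h + h', h⟩
      · rintro ⟨h, h'⟩
        exact ⟨h', by rw [h, h', sub_zero]⟩
    · change u ∈ (CompleteFlag.ofBasis b₂).sub 2 ↔ _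
      rw [h₂, forall_two_le]
      change v.coord 1 u = 0 ∧ v.coord 0 u - v.coord 1 u = 0 ↔ _
      constructor
      · rintro ⟨h, h'⟩
        exact ⟨by linear_combination h + h', h⟩
      · rintro ⟨h, h'⟩
        exact ⟨h', by rw [h, h', sub_zero]⟩
    · change u ∈ (CompleteFlag.ofBasis b₃).sub 2 ↔ _
      rw [h₃, forall_two_le]
      change (v.coord 0 u + v.coord 2 u) - (v.coord 1 u + v.coord 3 u) = 0 ∧
        v.coord 1 u + v.coord 3 u = 0 ↔ _
      constructor
      · rintro ⟨h, h'⟩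
        exact ⟨by linear_combination h + h', h'⟩
      · rintro ⟨h, h'⟩
        exact ⟨by rw [h, h', sub_zero], h'⟩
    · change u ∈ (CompleteFlag.ofBasis b₄).sub 2 ↔ _
      rw [h₄, forall_two_le]
      change v.coord 0 u + v.coord 2 u / 2 = 0 ∧ v.coord 1 u + v.coord 3 u / 3 = 0 ↔ _
      constructor
      · rintro ⟨h, h'⟩
        exact ⟨by linear_combination 2 * h, by linear_combination 3 * h'⟩
      · rintro ⟨h, h'⟩
        exact ⟨by linear_combination h / 2, by linear_combination h' / 3⟩
    · change v.coord 0 (bv b₃ 3) + v.coord 2 (bv b₃ 3) ≠ 0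
      rw [hl0, hl2]
      norm_num
    · change v.coord 1 (bv b₃ 3) + v.coord 3 (bv b₃ 3) ≠ 0
      rw [hl1, hl3]
      norm_num
  · constructor <;> simp [-Basis.coord_apply, h₁, h₂, h₃, h₄, T₁, T₂, T₃, T₄, coord_self,
      Fin.forall_fin_succ]
  · constructor <;> simp [-Basis.coord_apply, h₁, h₂, h₃, h₄, T₁, T₂, T₃, T₄, coord_self,
      Fin.forall_fin_succ]

end existence

end SchubertFib

end

noncomputable section
set_option linter.unusedSectionVars false

namespace SchubertFib

open Module

/-! ### General flags in the quotient. -/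

section fibers

variable {Y : Type} [AddCommGroup Y] [Module ℂ Y]

theorem ofBasis_le_ker {B : Basis (Fin (finrank ℂ Y)) ℂ Y} {f : Y →ₗ[ℂ] ℂ} {j : ℕ}
    (h : ∀ m < j, f (bv B m) = 0) : ∀ u ∈ (CompleteFlag.ofBasis B).sub j, f u = 0 := by
  have : (CompleteFlag.ofBasis B).sub j ≤ LinearMap.ker f := by
    refine Submodule.span_le.2 ?_
    rintro _ ⟨i, hi, rfl⟩
    rw [SetLike.mem_coe, LinearMap.mem_ker, ← bv_of_lt B i.2]
    exact h _ hi
  exact fun u hu => LinearMap.mem_ker.1 (this hu)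

/-- A basis can be changed, with the same flag, so that a linear form vanishes on all its vectors
but the first one on which it did not vanish. -/
theorem exists_adapted_basis (B : Basis (Fin (finrank ℂ Y)) ℂ Y) (f : Y →ₗ[ℂ] ℂ) {n : ℕ}
    (hn : n < finrank ℂ Y) (h : f (bv B n) ≠ 0) (hlt : ∀ m < n, f (bv B m) = 0) :
    ∃ B' : Basis (Fin (finrank ℂ Y)) ℂ Y, CompleteFlag.ofBasis B' = CompleteFlag.ofBasis B ∧
      bv B' n = bv B n ∧ ∀ m < finrank ℂ Y, f (bv B' m) = 0 ↔ m ≠ n := by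
  let c := bv B n
  -- With this choice f (u + g u • c) is f c times the n-th coordinate of u. As g vanishes on the
  -- first n + 1 vectors, the transvection preserves the flag.
  let g : Module.Dual ℂ Y := B.coord ⟨n, hn⟩ - (f c)⁻¹ • f
  have hg : ∀ u, g u = B.repr u ⟨n, hn⟩ - (f c)⁻¹ * f u := fun u => rfl
  have hc : B.repr c ⟨n, hn⟩ = 1 := by simp [c, bv_of_lt B hn]
  have hgc : g c = 0 := by rw [hg, hc, inv_mul_cancel₀ h, sub_self]
  have hglt : ∀ m < n, g (bv B m) = 0 := by
    intro m hm
    rw [hg, hlt m hm, bv_of_lt B (hm.trans hn)]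
    simp [hm.ne]
  have hmem : ∀ j, ∀ u ∈ (CompleteFlag.ofBasis B).sub j, g u • c ∈ (CompleteFlag.ofBasis B).sub j := by
    intro j u hu
    by_cases hj : n < j
    · exact Submodule.smul_mem _ _ (bv_mem B hj)
    · rw [ofBasis_le_ker (fun m hm => hglt m (by omega)) u hu, zero_smul]
      exact zero_mem _
  have hT : ∀ u, LinearEquiv.transvection hgc u = u + g u • c := fun u => rfl
  have hb : ∀ m < finrank ℂ Y, bv (B.map (LinearEquiv.transvection hgc)) m =
      bv B m + g (bv B m) • c := by
    intro m hm
    rw [bv_of_lt _ hm, bv_of_lt _ hm, Basis.map_apply, hT]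
  refine ⟨B.map (LinearEquiv.transvection hgc), ?_, ?_, fun m hm => ?_⟩
  · ext j u
    rw [ofBasis_map_sub, Submodule.mem_map]
    constructor
    · rintro ⟨u, hu, rfl⟩
      exact add_mem hu (hmem j u hu)
    · intro hu
      refine ⟨u - g u • c, sub_mem hu (hmem j u hu), ?_⟩
      change LinearEquiv.transvection hgc _ = u
      rw [hT, map_sub, map_smul, hgc, smul_zero, sub_zero, sub_add_cancel]
  · rw [hb n hn, hgc, zero_smul, add_zero]
  · rw [hb m hm, hg, map_add, map_smul, smul_eq_mul, sub_mul, mul_right_comm, inv_mul_cancel₀ h,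
      one_mul, add_sub_cancel, bv_of_lt B hm, Basis.repr_self, Finsupp.single_apply]
    simp [c, h, Fin.ext_iff]

variable {t q : ℕ}

/-- The form vanishing on the first two vectors of the first basis and the first vectors of the
third basis. -/
def fiberForm (e : Basis (Fin (finrank ℂ Y)) ℂ Y) (hq : 2 < finrank ℂ Y)
    (w : Fin (4 + t) → Basis (Fin (finrank ℂ Y)) ℂ Y) : Y →ₗ[ℂ] ℂ :=
  cr e (frame 3 (w (Fin.castAdd t 0)) (w (Fin.castAdd t 2))) ⟨2, hq⟩

/-- General tuples of bases of a `(q + 1)`-dimensional space. -/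
structure IsGeneralFiber (e : Basis (Fin (finrank ℂ Y)) ℂ Y) (hq : 2 < finrank ℂ Y) (q : ℕ)
    (w : Fin (4 + t) → Basis (Fin (finrank ℂ Y)) ℂ Y) : Prop where
  det₁ : e.det (frame 3 (w (Fin.castAdd t 0)) (w (Fin.castAdd t 2))) ≠ 0
  det₂ : e.det (frame 3 (w (Fin.castAdd t 1)) (w (Fin.castAdd t 2))) ≠ 0
  third : fiberForm e hq w (bv (w (Fin.castAdd t 2)) (q - 2)) ≠ 0
  other : ∀ i, i ≠ Fin.castAdd t 0 → i ≠ Fin.castAdd t 2 → fiberForm e hq w (bv (w i) 0) ≠ 0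

theorem isBasicOpen_isGeneralFiber (e : Basis (Fin (finrank ℂ Y)) ℂ Y) (hq : 2 < finrank ℂ Y)
    (q : ℕ) : IsBasicOpen e {w : Fin (4 + t) → Basis (Fin (finrank ℂ Y)) ℂ Y |
      IsGeneralFiber e hq q w} := by
  have hb : ∀ i k, HasCoordsIn e (polyFun (ι := Fin (4 + t)) e) (fun w => bv (w i) k) :=
    fun i k => hasCoordsIn_polyFun _ _
  have hd : ∀ i i', IsBasicOpen e {w : Fin (4 + t) → Basis (Fin (finrank ℂ Y)) ℂ Y |
      e.det (frame 3 (w i) (w i')) ≠ 0} := fun i i' =>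
    IsBasicOpen.of_mem (HasCoordsIn.det fun k => HasCoordsIn.frame (hb i) (hb i') k)
  have hf : ∀ i k, IsBasicOpen e {w : Fin (4 + t) → Basis (Fin (finrank ℂ Y)) ℂ Y |
      fiberForm e hq w (bv (w i) k) ≠ 0} := fun i k =>
    IsBasicOpen.of_mem (HasCoordsIn.cr (fun k => HasCoordsIn.frame (hb _) (hb _) k) (hb i k) _)
  have ho : ∀ i : Fin (4 + t), IsBasicOpen e {w | i ≠ Fin.castAdd t 0 → i ≠ Fin.castAdd t 2 →
      fiberForm e hq w (bv (w i) 0) ≠ 0} := by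
    intro i
    by_cases h : i ≠ Fin.castAdd t 0 ∧ i ≠ Fin.castAdd t 2
    · exact (hf i 0).congr fun w => by simp [h.1, h.2]
    · refine ⟨1, one_mem _, fun w => ?_⟩
      simp only [Set.mem_ofPred_eq, Pi.one_apply, ne_eq, one_ne_zero, not_false_eq_true, iff_true]
      exact fun h1 h2 => absurd ⟨h1, h2⟩ h
  obtain ⟨f, hf', hW⟩ := (hd (Fin.castAdd t 0) (Fin.castAdd t 2)).inter
    ((hd (Fin.castAdd t 1) (Fin.castAdd t 2)).inter
      ((hf (Fin.castAdd t 2) (q - 2)).inter (IsBasicOpen.iInter ho)))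
  refine ⟨f, hf', fun w => ?_⟩
  rw [← hW w]
  simp only [Set.mem_inter_iff, Set.mem_iInter, Set.mem_ofPred_eq]
  exact ⟨fun H => ⟨H.det₁, H.det₂, H.third, H.other⟩, fun ⟨h1, h2, h3, h4⟩ => ⟨h1, h2, h3, h4⟩⟩

theorem frame_of_lt {p : ℕ} (B B' : Basis (Fin (finrank ℂ Y)) ℂ Y) {j : Fin (finrank ℂ Y)}
    (h : (j : ℕ) < p) : frame p B B' j = bv B j := if_pos h

theorem frame_of_le {p : ℕ} (B B' : Basis (Fin (finrank ℂ Y)) ℂ Y) {j : Fin (finrank ℂ Y)}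
    (h : p ≤ (j : ℕ)) : frame p B B' j = bv B' (j - p) := if_neg (by omega)

theorem cr_self (e : Basis (Fin (finrank ℂ Y)) ℂ Y) (v : Fin (finrank ℂ Y) → Y) (j) :
    cr e v j (v j) = e.det v := by
  rw [cr_apply, Function.update_eq_self]

theorem cr_ne (e : Basis (Fin (finrank ℂ Y)) ℂ Y) (v : Fin (finrank ℂ Y) → Y) {i j} (h : i ≠ j) :
    cr e v j (v i) = 0 := by
  rw [cr_apply]
  refine e.det.map_eq_zero_of_eq _ ?_ h
  rw [Function.update_self, Function.update_of_ne h]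

variable [FiniteDimensional ℂ Y]

/-- The image of C contains the member of dimension 2 of the first flag and that of dimension q - 2
of the third, which together span a hyperplane. So φ is forced up to a scalar, and the bases are
adapted to it. For the other transversal there is freedom, and the same form serves as θ. -/
theorem IsGeneralFiber.exists_fiberFrame {e : Basis (Fin (finrank ℂ Y)) ℂ Y}
    {hq : 2 < finrank ℂ Y} {w : Fin (4 + t) → Basis (Fin (finrank ℂ Y)) ℂ Y} 
    (hY : finrank ℂ Y = q + 1) (H : IsGeneralFiber e hq q w) :
    ∃ (w' : Fin (4 + t) → Basis (Fin (finrank ℂ Y)) ℂ Y) (φ : Y →ₗ[ℂ] ℂ),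
      (fun i => CompleteFlag.ofBasis (w' i)) = (fun i => CompleteFlag.ofBasis (w i)) ∧
        FiberFrame q w' φ φ := by
  set φ := fiberForm e hq w with hφ
  have h0 : ∀ m < 2, φ (bv (w (Fin.castAdd t 0)) m) = 0 := by
    intro m hm
    have := cr_ne e (frame 3 (w (Fin.castAdd t 0)) (w (Fin.castAdd t 2)))
      (i := ⟨m, by omega⟩) (j := ⟨2, hq⟩) (by simp [Fin.ext_iff]; omega)
    rwa [frame_of_lt _ _ (by simp; omega)] at this
  have h2 : φ (bv (w (Fin.castAdd t 0)) 2) ≠ 0 := by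
    have := cr_self e (frame 3 (w (Fin.castAdd t 0)) (w (Fin.castAdd t 2))) ⟨2, hq⟩
    rw [frame_of_lt _ _ (by simp)] at this
    change cr _ _ _ (bv _ 2) ≠ 0
    rw [this]
    exact H.det₁
  have h3 : ∀ m < q - 2, φ (bv (w (Fin.castAdd t 2)) m) = 0 := by
    intro m hm
    have := cr_ne e (frame 3 (w (Fin.castAdd t 0)) (w (Fin.castAdd t 2)))
      (i := ⟨m + 3, by omega⟩) (j := ⟨2, hq⟩) (by simp [Fin.ext_iff])
    rwa [frame_of_le _ _ (by simp)] at this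
  have key : ∀ i, ∃ B' : Basis (Fin (finrank ℂ Y)) ℂ Y,
      CompleteFlag.ofBasis B' = CompleteFlag.ofBasis (w i) ∧
      (i = Fin.castAdd t 0 → φ (bv B' 2) ≠ 0 ∧ ∀ m < q + 1, φ (bv B' m) = 0 ↔ m ≠ 2) ∧
      (i ≠ Fin.castAdd t 0 → i ≠ Fin.castAdd t 2 →
        φ (bv B' 0) ≠ 0 ∧ ∀ m < q + 1, φ (bv B' m) = 0 ↔ m ≠ 0) ∧
      (i = Fin.castAdd t 2 → B' = w i) := by
    intro i
    have h02 : Fin.castAdd t (0 : Fin 4) ≠ Fin.castAdd t 2 := by simp [Fin.ext_iff]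
    by_cases hi : i = Fin.castAdd t 0
    · subst hi
      obtain ⟨B', h1, h4, h5⟩ := exists_adapted_basis (w (Fin.castAdd t 0)) φ hq h2 h0
      exact ⟨B', h1, fun _ => ⟨by rwa [h4], fun m hm => h5 m (by omega)⟩,
        fun h => absurd rfl h, fun h => absurd h h02⟩
    by_cases hi' : i = Fin.castAdd t 2
    · exact ⟨w i, rfl, fun h => absurd h hi, fun _ h => absurd hi' h, fun _ => rfl⟩
    · obtain ⟨B', h1, h4, h5⟩ := exists_adapted_basis (w i) φ (n := 0) (by omega)
        (H.other i hi hi') fun m hm => absurd hm (Nat.not_lt_zero m)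
      exact ⟨B', h1, fun h => absurd h hi, fun _ _ => ⟨by rw [h4]; exact H.other i hi hi',
        fun m hm => h5 m (by omega)⟩, fun h => absurd h hi'⟩
  choose w' hw' hw₀ hw₁ hw₂ using key
  have hthird : ∀ u ∈ (CompleteFlag.ofBasis (w' (Fin.castAdd t 2))).sub (q - 2), φ u = 0 := by
    rw [hw₂ _ rfl]
    exact ofBasis_le_ker h3
  have hthird' : φ (bv (w' (Fin.castAdd t 2)) (q - 2)) ≠ 0 := by
    rw [hw₂ _ rfl]
    exact H.third
  refine ⟨w', φ, funext hw', (hw₀ _ rfl).2, fun i h h' => (hw₁ i h h').2, hthird, hthird',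
    (hw₀ _ rfl).1, fun i h h' => (hw₁ i h h').1, hthird, hthird', ?_, ?_⟩
  · rw [hw', hw']
    exact inf_eq_bot_of_det (by omega) H.det₁
  · rw [hw', hw']
    exact inf_eq_bot_of_det (by omega) H.det₂

theorem exists_isGeneralFiber (e : Basis (Fin (finrank ℂ Y)) ℂ Y) (hq : 2 < finrank ℂ Y)
    (hY : finrank ℂ Y = q + 1) :
    ∃ w : Fin (4 + t) → Basis (Fin (finrank ℂ Y)) ℂ Y, IsGeneralFiber e hq q w := by
  -- The first flag is that of e, the third is the opposite one, and the others start with e 2, on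
  -- which the form does not vanish. The swap leaves the span of the first three vectors unchanged.
  let σ : Equiv.Perm (Fin (finrank ℂ Y)) := Equiv.swap ⟨0, by omega⟩ ⟨2, hq⟩
  let w : Fin (4 + t) → Basis (Fin (finrank ℂ Y)) ℂ Y := fun i =>
    if i = Fin.castAdd t 0 then e else if i = Fin.castAdd t 2 then e.reindex Fin.revPerm
    else e.reindex σ
  have w0 : w (Fin.castAdd t 0) = e := if_pos rfl
  have w2 : w (Fin.castAdd t 2) = e.reindex Fin.revPerm :=
    (if_neg (by simp [Fin.ext_iff])).trans (if_pos rfl)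
  have w1 : ∀ i, i ≠ Fin.castAdd t 0 → i ≠ Fin.castAdd t 2 → w i = e.reindex σ :=
    fun i h h' => (if_neg h).trans (if_neg h')
  have hσ : ∀ k : Fin (finrank ℂ Y), 3 ≤ (k : ℕ) → σ k = k := fun k hk =>
    Equiv.swap_apply_of_ne_of_ne (by rintro rfl; simp at hk) (by rintro rfl; simp at hk)
  have hrev : ∀ (u : Y), u ∈ (CompleteFlag.ofBasis (e.reindex Fin.revPerm)).sub (q - 2) →
      ∀ k : Fin (finrank ℂ Y), (k : ℕ) < 3 → e.repr u k = 0 := by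
    intro u hu k hk
    rw [mem_ofBasis_iff_repr] at hu
    have := hu k.rev (by rw [Fin.val_rev]; omega)
    simpa using this
  have hrepr : ∀ u, (∀ k : Fin (finrank ℂ Y), 3 ≤ (k : ℕ) → e.repr u k = 0) →
      u ∈ (CompleteFlag.ofBasis (e.reindex Fin.revPerm)).sub (q - 2) → u = 0 := by
    intro u h1 h2
    refine e.forall_coord_eq_zero_iff.1 fun k => ?_
    rcases lt_or_ge (k : ℕ) 3 with h | h
    · exact hrev u h2 k h
    · exact h1 k h
  have d1 : e.det (frame 3 (w (Fin.castAdd t 0)) (w (Fin.castAdd t 2))) ≠ 0 := by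
    refine det_frame_ne_zero (q := q - 2) (by omega) ?_
    rw [w0, w2, eq_bot_iff]
    rintro u ⟨h1, h2⟩
    exact hrepr u ((mem_ofBasis_iff_repr _ _ _).1 h1) h2
  have d2 : e.det (frame 3 (w (Fin.castAdd t 1)) (w (Fin.castAdd t 2))) ≠ 0 := by
    refine det_frame_ne_zero (q := q - 2) (by omega) ?_
    rw [w1 _ (by simp [Fin.ext_iff]) (by simp [Fin.ext_iff]), w2, eq_bot_iff]
    rintro u ⟨h1, h2⟩
    refine hrepr u (fun k hk => ?_) h2
    have := (mem_ofBasis_iff_repr _ _ _).1 h1 k hk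
    rwa [Basis.repr_reindex_apply, (Equiv.symm_apply_eq σ).2 (hσ k hk).symm] at this
  have hform : fiberForm e hq w (bv e 2) ≠ 0 := by
    have := cr_self e (frame 3 (w (Fin.castAdd t 0)) (w (Fin.castAdd t 2))) ⟨2, hq⟩
    rw [frame_of_lt _ _ (by simp), w0] at this
    rw [fiberForm, w0, this]
    rwa [w0] at d1
  refine ⟨w, d1, d2, ?_, fun i h h' => ?_⟩
  · have : bv (w (Fin.castAdd t 2)) (q - 2) = bv e 2 := by
      rw [w2, bv_of_lt _ (show q - 2 < finrank ℂ Y by omega), bv_of_lt _ hq, Basis.reindex_apply]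
      congr 1
      ext
      simp [Fin.revPerm, Fin.val_rev]
      omega
    rwa [this]
  · have : bv (w i) 0 = bv e 2 := by
      rw [w1 i h h', bv_of_lt _ (show 0 < finrank ℂ Y by omega), bv_of_lt _ hq, Basis.reindex_apply]
      congr 1
    rwa [this]

end fibers

end SchubertFib

end

noncomputable section
set_option linter.unusedSectionVars false

namespace SchubertFib

open Module

/-! ### Sizes of the partitions. -/

section arithmetic

theorem rect_eq_rowsThen (r m : ℕ) : rect r m = rowsThen r m 0 := rfl

theorem antitone_rowsThen {r m : ℕ} {p : ℕ → ℕ} (hp : Antitone p) (h : p 0 ≤ r) :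
    Antitone (rowsThen r m p) := by
  intro i j hij
  unfold rowsThen
  split_ifs with h1 h2
  · exact le_rfl
  · omega
  · exact (hp (Nat.zero_le _)).trans h
  · exact hp (by omega)

theorem antitone_rect (r m : ℕ) : Antitone (rect r m) :=
  antitone_rowsThen (p := 0) (fun _ _ _ => le_rfl) (Nat.zero_le r)

theorem sum_rowsThen (r m n : ℕ) (p : ℕ → ℕ) :
    ∑ j ∈ Finset.range (m + n), rowsThen r m p j = m * r + ∑ j ∈ Finset.range n, p j := by
  rw [Finset.sum_range_add]
  congr 1
  · refine (Finset.sum_congr (g := fun _ => r) rfl fun j hj =>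
      if_pos (Finset.mem_range.1 hj)).trans ?_
    rw [Finset.sum_const, Finset.card_range, smul_eq_mul]
  · refine Finset.sum_congr rfl fun j _ => ?_
    rw [rowsThen, if_neg (by omega), Nat.add_sub_cancel_left]

theorem sum_rect (r m n : ℕ) : ∑ j ∈ Finset.range (m + n), rect r m j = m * r := by
  rw [rect_eq_rowsThen, sum_rowsThen]
  simp

theorem sum_range_add_of_zero {p : ℕ → ℕ} {m : ℕ} (n : ℕ) (h : ∀ j, m ≤ j → p j = 0) :
    ∑ j ∈ Finset.range (m + n), p j = ∑ j ∈ Finset.range m, p j := by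
  rw [Finset.sum_range_add, Finset.sum_eq_zero (s := Finset.range n) fun j _ => h _ (by omega),
    add_zero]

theorem IsPartition.eq_zero {m : ℕ} {p : ℕ → ℕ} (h : IsPartition m p) {j : ℕ} (hj : m ≤ j) :
    p j = 0 :=
  Nat.le_zero.1 (h.2 ▸ h.1 hj)

variable {a b t : ℕ} {κ ρ σ ν₄ : ℕ → ℕ} {ν' : Fin t → ℕ → ℕ}

theorem numFacts_of_isSchubertProblem (ha : 0 < a) (hab : a + 2 ≤ b)
    (hκ : IsPartition (a - 1) κ) (hρ : IsPartition (a - 1) ρ) (hσ : IsPartition (a - 1) σ)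
    (hν : IsSchubertProblem a b (fiberProblem a b κ ρ σ ν₄ ν')) :
    NumFacts a b κ ρ σ ν₄ ν' := by
  have h0 := hν.1 (Fin.castAdd t 0)
  have h1 := hν.1 (Fin.castAdd t 1)
  have h2 := hν.1 (Fin.castAdd t 2)
  have h3 := hν.1 (Fin.castAdd t 3)
  have h4 := fun i => hν.1 (Fin.natAdd 4 i)
  simp only [fiberProblem, Fin.append_left, Fin.append_right, Matrix.cons_val] at h0 h1 h2 h3 h4
  refine ⟨ha, hab, fun j => ?_, fun j => hκ.eq_zero, fun j => ?_, fun j => hρ.eq_zero,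
    fun j hj => ?_, fun j => hσ.eq_zero, fun j => (h3.1.1 (Nat.zero_le j)).trans h3.2,
    fun j => h3.1.eq_zero, fun i j => ((h4 i).1.1 (Nat.zero_le j)).trans (h4 i).2,
    fun i j => (h4 i).1.eq_zero⟩
  · simpa [rowsThen] using h0.1.1 (Nat.zero_le (j + 1))
  · simpa [rowsThen] using h1.1.1 (Nat.zero_le (j + 1))
  · have := (h2.1.1 (Nat.zero_le j)).trans h2.2
    simpa [rect, hj] using this

/-- The first four partitions grow by b - a - 1, b - a, a + 4 and a + 1, in total 2b + 4, which is
the difference of (a + 2)(b - a + 2) and a (b - a). -/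
theorem isSchubertProblem_bigProblem (ha : 0 < a) (hab : a + 2 ≤ b)
    (hκ : IsPartition (a - 1) κ) (hρ : IsPartition (a - 1) ρ) (hσ : IsPartition (a - 1) σ)
    (hν : IsSchubertProblem a b (fiberProblem a b κ ρ σ ν₄ ν')) :
    IsSchubertProblem (2 + a) (4 + b) (bigProblem a b κ ρ σ ν₄ ν') := by
  have hN := numFacts_of_isSchubertProblem ha hab hκ hρ hσ hν
  have h3 := hν.1 (Fin.castAdd t 3)
  have h4 := fun i => hν.1 (Fin.natAdd 4 i)
  simp only [fiberProblem, Fin.append_left, Fin.append_right, Matrix.cons_val] at h3 h4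
  refine ⟨fun i => ?_, ?_⟩
  · induction i using Fin.addCases with
    | left i =>
      rw [bigProblem, Fin.append_left]
      obtain rfl | rfl | rfl | rfl : i = 0 ∨ i = 1 ∨ i = 2 ∨ i = 3 := by omega
      · refine ⟨⟨antitone_rowsThen hκ.1 (hN.κ_le 0), ?_⟩, ?_⟩
        · simp [rowsThen, hN.κ_zero a (by omega)]
          omega
        · simp [rowsThen]
          omega
      · refine ⟨⟨antitone_rowsThen hρ.1 ((hN.ρ_le 0).trans (by omega)), ?_⟩, ?_⟩
        · simp [rowsThen, hN.ρ_zero a (by omega)]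
          omega
        · simp [rowsThen]
          omega
      · refine ⟨⟨(antitone_rowsThen (antitone_rect 2 1) (by simp [rect])).add hσ.1, ?_⟩, ?_⟩
        · simp [rowsThen, rect, hN.σ_zero (2 + a) (by omega)]
        · have : σ 0 + 1 ≤ b - a := by
            by_cases h : 0 < a - 1
            · have := hN.σ_le 0 h
              omega
            · rw [hN.σ_zero 0 (by omega)]
              omega
          simp [rowsThen, ha]
          omega
      · refine ⟨⟨(antitone_rect 1 (a + 1)).add h3.1.1, ?_⟩, ?_⟩
        · simp [rect, hN.ν₄_zero (2 + a) (by omega)]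
        · have := hN.ν₄_le 0
          simp [rect]
          omega
    | right i =>
      rw [bigProblem, Fin.append_right]
      exact ⟨⟨(h4 i).1.1, hN.ν'_zero i _ (by omega)⟩, (h4 i).2.trans (by omega)⟩
  · obtain ⟨a, rfl⟩ : ∃ k, a = k + 1 := ⟨a - 1, by omega⟩
    obtain ⟨c, rfl⟩ : ∃ k, b = a + 1 + 2 + k := ⟨b - (a + 1 + 2), by omega⟩
    have hs := hν.2
    have e1 : c + 2 - 1 = c + 1 := by omega
    have e2 : c + 2 - 2 = c := by omega
    have e3 : a + 1 + 2 + c - (a + 1) = c + 2 := by omega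
    have e4 : 4 + (a + 1 + 2 + c) - (2 + (a + 1)) = c + 4 := by omega
    have e5 : a + 1 - 1 = a := by omega
    have hκ' := sum_range_add_of_zero 1 fun j hj => hN.κ_zero j hj
    have hρ' := sum_range_add_of_zero 1 fun j hj => hN.ρ_zero j hj
    have hσ' := sum_range_add_of_zero 1 fun j hj => hN.σ_zero j hj
    have hσ'' := sum_range_add_of_zero 3 fun j hj => hN.σ_zero j hj
    have hν₄' := sum_range_add_of_zero 2 fun j hj => hN.ν₄_zero j hj
    have hν'' := fun i => sum_range_add_of_zero 2 fun j hj => hN.ν'_zero i j hj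
    rw [e5] at hκ' hρ' hσ' hσ''
    have s1 := sum_rowsThen (c + 1) 1 a κ
    have s2 := sum_rowsThen c 1 a ρ
    have s3 := sum_rect 2 a 1
    have t1 := sum_rowsThen (c + 1) 2 (a + 1) κ
    have t2 := sum_rowsThen (c + 1) 2 (a + 1) ρ
    have t3 := sum_rowsThen 3 (a + 1) 2 (rect 2 1)
    have t3' := sum_rect 2 1 1
    have t4 := sum_rect 1 (a + 1 + 1) 1
    rw [Fin.sum_univ_add, Fin.sum_univ_four] at hs ⊢
    simp only [fiberProblem, bigProblem, Fin.append_left, Fin.append_right, Matrix.cons_val,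
      Pi.add_apply, Finset.sum_add_distrib, e1, e2, e3, e4, e5] at hs ⊢
    rw [add_comm 1 a] at s1 s2
    rw [add_comm 2 (a + 1)] at t1 t2 ⊢
    simp only [add_assoc, Nat.reduceAdd] at *
    simp only [s1, s2, s3, t1, t2, t3, t3', t4, hκ', hρ', hσ', hσ'', hν₄', hν''] at hs ⊢
    linarith

theorem isSchubertProblem_box : IsSchubertProblem 2 4 (fun _ : Fin 4 => box) :=
  ⟨fun _ => ⟨⟨antitone_rect 1 1, rfl⟩, by simp [box, rect]⟩, by
    simp [box, rect]⟩

end arithmetic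

end SchubertFib

end

noncomputable section
set_option linter.unusedSectionVars false

namespace SchubertFib

open Module

/-! ### Assembly of the fibration. -/

section solutions

variable {Y : Type} [AddCommGroup Y] [Module ℂ Y] [FiniteDimensional ℂ Y]
  {e : Basis (Fin (finrank ℂ Y)) ℂ Y}

theorem exists_isRoot {X : Type} [AddCommGroup X] [Module ℂ X]
    (e : Basis (Fin (finrank ℂ X)) ℂ X) (p q : ℕ) (b : Fin 4 → Basis (Fin (finrank ℂ X)) ℂ X) :
    ∃ β, IsRoot e p q b β := by
  obtain ⟨r, hr⟩ := IsAlgClosed.exists_pow_nat_eq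
    ((matA e p q b).trace ^ 2 - 4 * (matA e p q b).det) two_pos
  refine ⟨((matA e p q b).trace + r) / 2, ?_⟩
  rw [IsRoot]
  linear_combination hr / 4

theorem one_le_finrank_inf {h A : Submodule ℂ Y} {u : Y} (hu : u ∈ h) (hA : u ∈ A) (h0 : u ≠ 0) :
    1 ≤ finrank ℂ ↥(h ⊓ A) := by
  rw [Nat.one_le_iff_ne_zero, Ne, Submodule.finrank_eq_zero]
  intro hb
  exact h0 ((Submodule.mem_bot ℂ).1 (hb ▸ ⟨hu, hA⟩))

/-- An eigenvalue exists over ℂ and its eigenvector gives a transversal. This is needed because the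
construction of an instance starts from a chosen solution h. -/
theorem IsGeneralQuad.nonempty_solutions {b : Fin 4 → Basis (Fin (finrank ℂ Y)) ℂ Y}
    (H : IsGeneralQuad e b) (h4 : finrank ℂ Y = 4) :
    (Solutions 2 (fun _ => box) fun k => CompleteFlag.ofBasis (b k)).Nonempty := by
  obtain ⟨β, hβ⟩ := exists_isRoot e 2 2 b
  have hY : 2 + 2 = finrank ℂ Y := h4.symm
  have hG := H.general
  set L := hG.pencil hY le_rfl with hL
  set a := eigvec e 2 2 b β
  have ha : a ≠ 0 := hG.eigvec_ne β
  have hα := hG.eigen hY le_rfl hβ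
  rw [← hL] at hα
  have h₄ : L.F₄ = (CompleteFlag.ofBasis (b 3)).sub 2 := by
    rw [← show finrank ℂ Y - 2 = 2 by omega]
    rfl
  have hne : ∀ r s : ℂ, r ≠ 0 ∨ s ≠ 0 → r • L.x a + s • L.y a ≠ 0 := by
    intro r s hrs h0
    rw [← map_smul, ← map_smul] at h0
    obtain ⟨h1, h2⟩ := L.x_add_y_eq_zero h0
    exact hrs.elim (fun h => h ((smul_eq_zero.1 h1).resolve_right ha))
      fun h => h ((smul_eq_zero.1 h2).resolve_right ha)
  have hmem : ∀ r s : ℂ, r • L.x a + s • L.y a ∈ L.transversal a := fun r s =>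
    Submodule.mem_span_pair.2 ⟨r, s, rfl⟩
  refine ⟨L.transversal a, (mem_solutions_box h4 _ _).2 ⟨L.finrank_transversal ha, fun k => ?_⟩⟩
  obtain rfl | rfl | rfl | rfl : k = 0 ∨ k = 1 ∨ k = 2 ∨ k = 3 := by omega
  · refine one_le_finrank_inf (hmem 1 0) ?_ (hne 1 0 (by simp))
    rw [one_smul, zero_smul, add_zero]
    exact L.x_mem a
  · refine one_le_finrank_inf (hmem 0 1) ?_ (hne 0 1 (by simp))
    rw [one_smul, zero_smul, zero_add]
    exact L.y_mem a
  · refine one_le_finrank_inf (hmem 1 (-1)) ?_ (hne 1 (-1) (by simp))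
    rw [one_smul, neg_smul, one_smul, ← sub_eq_add_neg]
    exact L.x_sub_y_mem a
  · refine one_le_finrank_inf (hmem 1 (-(β / (matQ e 2 2 b).det))) ?_ (hne _ _ (by simp))
    rw [← h₄, ← L.ξ_eq_zero, map_add, map_smul, map_smul, L.ξ_x, L.ξ_y, hα]
    module

end solutions

section instances

variable {X : Type} [AddCommGroup X] [Module ℂ X] [FiniteDimensional ℂ X]

/-- The instances to which the construction is applied. -/
def generalInstances (e : Basis (Fin (finrank ℂ X)) ℂ X) (t q : ℕ) :
    Set (Fin (4 + t) → CompleteFlag X) :=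
  {F | ∃ B ∈ {B : Fin (4 + t) → Basis (Fin (finrank ℂ X)) ℂ X | IsGeneral e 5 q (quad B) ∧
    ∀ β, IsRoot e 5 q (quad B) β → RootCond e 5 q B β},
    F = fun i => CompleteFlag.ofBasis (B i)}

theorem isZariskiOpen_generalInstances (e : Basis (Fin (finrank ℂ X)) ℂ X) (t q : ℕ) :
    IsZariskiOpen (generalInstances e t q) :=
  isZariskiOpen_image (isBasicOpen_rootCond e 5 q)

theorem goodInst_of_mem {e : Basis (Fin (finrank ℂ X)) ℂ X} {t q : ℕ} (hX : 5 + q = finrank ℂ X)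
    (hq : 2 ≤ q) {F : Fin (4 + t) → CompleteFlag X} (hF : F ∈ generalInstances e t q) :
    GoodInst q F := by
  obtain ⟨B, ⟨h1, h2⟩, rfl⟩ := hF
  exact goodInst_of_rootCond h1 hX hq h2

variable {V : Submodule ℂ X} {t q : ℕ}

/-- General flags are induced from an instance. -/
theorem exists_generalInstance (e : Basis (Fin (finrank ℂ X)) ℂ X) (hq : 2 ≤ q)
    (hV : finrank ℂ V = 4) (hXV : finrank ℂ (X ⧸ V) = q + 1)
    {e₁ : Basis (Fin (finrank ℂ V)) ℂ V} {b : Fin 4 → Basis (Fin (finrank ℂ V)) ℂ V}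
    (hb : IsGeneralQuad e₁ b) {h : Submodule ℂ V}
    (hh : h ∈ Solutions 2 (fun _ => box) fun k => CompleteFlag.ofBasis (b k))
    {e₂ : Basis (Fin (finrank ℂ (X ⧸ V))) ℂ (X ⧸ V)} {hd : 2 < finrank ℂ (X ⧸ V)}
    {w : Fin (4 + t) → Basis (Fin (finrank ℂ (X ⧸ V))) ℂ (X ⧸ V)}
    (hw : IsGeneralFiber e₂ hd q w) :
    ∃ F ∈ generalInstances e t q, ∃ G,
      instData q F = ⟨V, fun k => CompleteFlag.ofBasis (b k), G⟩ ∧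
        G h = fun i => CompleteFlag.ofBasis (w i) := by
  obtain ⟨v, α, α', hv, h1, h2, rfl⟩ := hb.exists_frame hV hh
  obtain ⟨d, hd⟩ := exists_diagonal hV v
  obtain ⟨s, hs⟩ := exists_section V
  obtain ⟨w', φ, hw', hφ⟩ := hw.exists_fiberFrame hXV
  let D : LiftData V t q :=
    { two_le := hq, finrank_V := hV, finrank_quot := hXV, s, hs, b, d, v, α, α', frame := hv,
      edge := h1, edge' := h2, mem_d := hd, w := w', φ, θ := φ, fiber := hφ }
  obtain ⟨G, hG, hGh⟩ := D.exists_instData_eq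
  exact ⟨D.F, ⟨D.B, ⟨D.isGeneral e, fun β hβ => D.rootCond e hβ⟩, rfl⟩, G, hG, hGh.trans hw'⟩

/-- All general instances arise from the construction. -/
theorem forGeneral_instData (e : Basis (Fin (finrank ℂ X)) ℂ X) (hq : 2 ≤ q)
    (hX : 5 + q = finrank ℂ X) (hV : finrank ℂ V = 4) :
    ForGeneral (fun E : Fin 4 → CompleteFlag V =>
      ∃ F ∈ generalInstances e t q, ∃ G, instData q F = ⟨V, E, G⟩) ∧
    ForGeneral (fun E : Fin 4 → CompleteFlag V => ∀ h ∈ Solutions 2 (fun _ => box) E,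
      ForGeneral (fun G' : Fin (4 + t) → CompleteFlag (X ⧸ V) =>
        ∃ F ∈ generalInstances e t q, ∃ G, instData q F = ⟨V, E, G⟩ ∧ G h = G')) := by
  have hXV : finrank ℂ (X ⧸ V) = q + 1 := by
    have := finrank_add_quotient V
    omega
  have hd : 2 < finrank ℂ (X ⧸ V) := by omega
  let e₁ := finBasis ℂ V
  let e₂ := finBasis ℂ (X ⧸ V)
  obtain ⟨w, hw⟩ := exists_isGeneralFiber (t := t) e₂ hd hXV
  obtain ⟨b₀, v, hv, h1, h2⟩ := exists_quadFrame hV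
  have hb₀ := hv.isGeneralQuad hV e₁ h1 h2
  have hopen := isZariskiOpen_image (isBasicOpen_isGeneralQuad e₁)
  refine ⟨⟨_, hopen, ⟨_, b₀, hb₀, rfl⟩, ?_⟩, ⟨_, hopen, ⟨_, b₀, hb₀, rfl⟩, ?_⟩⟩
  · rintro _ ⟨b, hb, rfl⟩
    -- Here only E is prescribed; h and the general flags w in the quotient are auxiliary choices.
    obtain ⟨h, hh⟩ := IsGeneralQuad.nonempty_solutions hb hV
    obtain ⟨F, hF, G, hG, -⟩ := exists_generalInstance e hq hV hXV hb hh hw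
    exact ⟨F, hF, G, hG⟩
  · rintro _ ⟨b, hb, rfl⟩ h hh
    refine ⟨_, isZariskiOpen_image (isBasicOpen_isGeneralFiber e₂ hd q), ⟨_, w, hw, rfl⟩, ?_⟩
    rintro _ ⟨w, hw, rfl⟩
    exact exists_generalInstance e hq hV hXV hb hh hw

/-- Apply the construction to any four-dimensional V: it produces a member of the open set. -/
theorem nonempty_generalInstances (e : Basis (Fin (finrank ℂ X)) ℂ X) (t : ℕ) (hq : 2 ≤ q)
    (hX : 5 + q = finrank ℂ X) : (generalInstances e t q).Nonempty := by
  obtain ⟨V, hV⟩ : ∃ V : Submodule ℂ X, finrank ℂ V = 4 :=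
    ⟨_, (CompleteFlag.ofBasis e).finrank_sub 4 (by omega)⟩
  obtain ⟨_, _, ⟨E, hE⟩, h⟩ := (forGeneral_instData (t := t) e hq hX hV).1
  obtain ⟨F, hF, -⟩ := h E hE
  exact ⟨F, hF⟩

end instances

theorem isFiberedOver_bigProblem {a b t : ℕ} {κ ρ σ ν₄ : ℕ → ℕ} {ν' : Fin t → ℕ → ℕ}
    (ha : 0 < a) (hab : a + 2 ≤ b)
    (hκ : IsPartition (a - 1) κ) (hρ : IsPartition (a - 1) ρ) (hσ : IsPartition (a - 1) σ)
    (hν : IsSchubertProblem a b (fiberProblem a b κ ρ σ ν₄ ν')) :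
    IsFiberedOver 2 4 a b (bigProblem a b κ ρ σ ν₄ ν') (fun _ : Fin 4 => box)
      (fiberProblem a b κ ρ σ ν₄ ν') := by
  refine ⟨isSchubertProblem_bigProblem ha hab hκ hρ hσ hν, isSchubertProblem_box, hν, ?_⟩
  have hN := numFacts_of_isSchubertProblem ha hab hκ hρ hσ hν
  obtain ⟨q, rfl⟩ : ∃ q, b = q + 1 := ⟨b - 1, by omega⟩
  have hq : 2 ≤ q := by omega
  have hX : 5 + q = finrank ℂ (Fin (4 + (q + 1)) → ℂ) := by
    rw [finrank_fin_fun]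
    omega
  let e := finBasis ℂ (Fin (4 + (q + 1)) → ℂ)
  refine ⟨generalInstances e t q, instData q, isZariskiOpen_generalInstances e t q,
    nonempty_generalInstances e t hq hX, fun F hF => ?_, fun V hV =>
    forGeneral_instData e hq hX hV⟩
  have hF' := goodInst_of_mem hX hq hF
  refine ⟨hF'.quad.finrank_V, fun H hH => (hF'.solution_facts hN hH).1, ?_, hF'.bijOn hN⟩
  rintro _ - H hH rfl
  exact hF'.quot_mem hN hH

end SchubertFib

end

open SchubertFib in
theorem theorem3p11 (a b t : ℕ) (ha : 0 < a) (hab : a + 2 ≤ b)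
    (κ ρ σ : ℕ → ℕ)
    (hκ : IsPartition (a - 1) κ) (hρ : IsPartition (a - 1) ρ) (hσ : IsPartition (a - 1) σ)
    (ν₄ : ℕ → ℕ) (ν' : Fin t → ℕ → ℕ)
    (hν : IsSchubertProblem a b (Fin.append
      ![rowsThen (b - a - 1) 1 κ, rowsThen (b - a - 2) 1 ρ, rect 2 (a - 1) + σ, ν₄] ν')) :
    IsSchubertProblem (2 + a) (4 + b) (Fin.append
      ![rowsThen (b - a - 1) 2 κ, rowsThen (b - a - 1) 2 ρ,
        rowsThen 3 a (rect 2 1) + σ, rect 1 (a + 1) + ν₄] ν') ∧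
    IsFiberedOver 2 4 a b
      (Fin.append
        ![rowsThen (b - a - 1) 2 κ, rowsThen (b - a - 1) 2 ρ,
          rowsThen 3 a (rect 2 1) + σ, rect 1 (a + 1) + ν₄] ν')
      (fun _ : Fin 4 => box)
      (Fin.append
        ![rowsThen (b - a - 1) 1 κ, rowsThen (b - a - 2) 1 ρ, rect 2 (a - 1) + σ, ν₄] ν') :=
  ⟨isSchubertProblem_bigProblem ha hab hκ hρ hσ hν, isFiberedOver_bigProblem ha hab hκ hρ hσ hν⟩
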